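/- **Self-attention.** For $Q\in\mathbb R^{n\times d_q}$ and $V\in\mathbb R^{n\times d_v}$ let $S_{ij}=e^{\langle Q_i,Q_j\rangle}$ for $i,j\in[n]$, where $Q_i$ is the $i$-th row of $Q$; for $M\in\mathbb R^{n\times n}$ let $h(M)_{ij}=M_{ij}/\sum_{k=1}^n M_{ik}$; and let $Y=h(S)\cdot V\in\mathbb R^{n\times d_v}$. **Machine model.** Fix one of the following random access machines, with finite programs, integer program constants and indirect addressing; it is used both in the hypothesis and in the conclusion. (a) The real RAM: memory cells hold real numbers, and each of $+,-,\times,/$, comparison, and application of a function from a fixed set $F$ of functions $\mathbb R\to\mathbb R$ (arbitrary, e.g. $F=\{\exp\}$) takes one unit of time. Attention inputs are arbitrary real matrices. (b) The logarithmic-cost RAM: cells hold rational numbers, the operations are $+,-,\times,/$ and comparison, and each instruction costs one plus the bit lengths of the numbers it handles. Attention inputs have all entries of $Q$ and $V$ in $\{0,1,\dots,d_q\}$. **SETH** (in the fixed model). For every $\delta>0$ there is a $k$ such that no program decides $k$-SAT on $N$ variables and $m$ clauses in time $O(2^{(1-\delta)N}\,\mathrm{poly}(m))$. **Theorem.** Assume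 SETH. Let $d_q=d_q(n)$ satisfy $d_q=\omega(\log n)$, let $d_v=d_v(n)\ge 1$, and suppose that each of these two functions can be computed from $n$ in time $O(n^{1-\gamma})$ for some $\gamma>0$. Then for every $\epsilon>0$ there is no program that, given $n\ge1$, $d_q$, $d_v$, $Q\in\mathbb R^{n\times d_q}$ and $V\in\mathbb R^{n\times d_v}$, always computes in time $O(n^{2-\epsilon})$ a matrix $\hat Y\in\mathbb R^{n\times d_v}$ with 1. $\hat Y=Y$ (exact computation); nor, for any fixed $\mu$ with $0\le\mu<1$, one with 2. $|\hat Y_{ij}-Y_{ij}|\le\mu|Y_{ij}|$ for all $i\in[n]$, $j\in[d_v]$ (entrywise multiplicative approximation). -/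

import Mathlib

/-! ### Random access machines -/

/-- The two machine models.
`realRAM F` is the real RAM: cells hold real numbers, every instruction has unit cost, and besides
`+, -, *, /` and comparison the functions in `F` (for instance `exp`) are available.
`logRAM` is the logarithmic-cost RAM: only `+, -, *, /` and comparison (so that on rational inputs
all cells hold rational numbers), and an instruction is charged for the bit lengths of all
numbers that it handles. -/
inductive Model where
  | realRAM (F : Set (ℝ → ℝ))
  | logRAM

/-- The unary functions available in addition to the arithmetic operations. -/
def Model.ops : Model → Set (ℝ → ℝ)
  | .realRAM F => F
  | .logRAM => ∅

/-- Bit length of a rational number (numerator and denominator in lowest terms). -/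
def ratBits (q : ℚ) : ℕ := Nat.size q.num.natAbs + Nat.size q.den

open Classical in
/-- What handling the number `x` costs, in addition to the one unit for the instruction.
In `logRAM` irrational numbers never arise from rational ones, so their value is irrelevant. -/
noncomputable def Model.size : Model → ℝ → ℕ
  | .realRAM _, _ => 0
  | .logRAM, x => if h : ∃ q : ℚ, (q : ℝ) = x then ratBits h.choose else 0

inductive Arith where
  | plus
  | minus
  | times
  | divide

noncomputable def Arith.eval : Arith → ℝ → ℝ → ℝ
  | .plus, x, y => x + y
  | .minus, x, y => x - y
  | .times, x, y => x * y
  | .divide, x, y => x / y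

/-- Programs. `r`, `s`, `t` are numbers of registers and `b` is the number of a memory bank. -/
inductive Prog (F : Set (ℝ → ℝ)) where
  | skip
  /-- `reg r := z` -/
  | const (r : ℕ) (z : ℤ)
  /-- `reg r := reg s o reg t` -/
  | arith (o : Arith) (r s t : ℕ)
  /-- `reg r := f (reg s)` -/
  | app (f : F) (r s : ℕ)
  /-- `reg r := bank b [reg s]` -/
  | load (b r s : ℕ)
  /-- `bank b [reg s] := reg r` -/
  | store (b s r : ℕ)
  | seq (p q : Prog F)
  /-- `if reg r < reg s then p else q` -/
  | branch (r s : ℕ) (p q : Prog F)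
  /-- `while reg r < reg s do p` -/
  | loop (r s : ℕ) (p : Prog F)

/-- Registers and memory banks; every bank is an infinite array of cells. A program refers to
finitely many registers and banks only. -/
@[ext] structure State where
  reg : ℕ → ℝ
  bank : ℕ → ℕ → ℝ

def State.setReg (σ : State) (r : ℕ) (x : ℝ) : State :=
  { σ with reg := Function.update σ.reg r x }

def State.setCell (σ : State) (b i : ℕ) (x : ℝ) : State :=
  { σ with bank := Function.update σ.bank b (Function.update (σ.bank b) i x) }

/-- `Exec M p σ τ c`: started in `σ`, the program `p` halts in state `τ` at total cost `c`.
A division by zero or an address that is not a natural number blocks the machine for ever. -/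
inductive Exec (M : Model) : Prog M.ops → State → State → ℕ → Prop where
  | skip (σ : State) : Exec M .skip σ σ 1
  | const (σ : State) (r : ℕ) (z : ℤ) :
      Exec M (.const r z) σ (σ.setReg r z) (1 + M.size z)
  | arith (σ : State) (o : Arith) (r s t : ℕ) (x : ℝ)
      (hdiv : o = .divide → σ.reg t ≠ 0) (hx : x = o.eval (σ.reg s) (σ.reg t)) :
      Exec M (.arith o r s t) σ (σ.setReg r x)
        (1 + M.size (σ.reg s) + M.size (σ.reg t) + M.size x)
  | app (σ : State) (f : M.ops) (r s : ℕ) (x : ℝ) (hx : x = f.1 (σ.reg s)) :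
      Exec M (.app f r s) σ (σ.setReg r x) (1 + M.size (σ.reg s) + M.size x)
  | load (σ : State) (b r s i : ℕ) (hi : σ.reg s = i) :
      Exec M (.load b r s) σ (σ.setReg r (σ.bank b i))
        (1 + M.size (σ.reg s) + M.size (σ.bank b i))
  | store (σ : State) (b s r i : ℕ) (hi : σ.reg s = i) :
      Exec M (.store b s r) σ (σ.setCell b i (σ.reg r))
        (1 + M.size (σ.reg s) + M.size (σ.reg r))
  | seq {p q : Prog M.ops} {σ τ υ : State} {c c' : ℕ} (hp : Exec M p σ τ c)
      (hq : Exec M q τ υ c') : Exec M (.seq p q) σ υ (c + c')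
  | branchTrue {r s : ℕ} {p q : Prog M.ops} {σ τ : State} {c : ℕ} (h : σ.reg r < σ.reg s)
      (hp : Exec M p σ τ c) :
      Exec M (.branch r s p q) σ τ (1 + M.size (σ.reg r) + M.size (σ.reg s) + c)
  | branchFalse {r s : ℕ} {p q : Prog M.ops} {σ τ : State} {c : ℕ} (h : ¬ σ.reg r < σ.reg s)
      (hq : Exec M q σ τ c) :
      Exec M (.branch r s p q) σ τ (1 + M.size (σ.reg r) + M.size (σ.reg s) + c)
  | loopTrue {r s : ℕ} {p : Prog M.ops} {σ τ υ : State} {c c' : ℕ} (h : σ.reg r < σ.reg s)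
      (hp : Exec M p σ τ c) (hl : Exec M (.loop r s p) τ υ c') :
      Exec M (.loop r s p) σ υ (1 + M.size (σ.reg r) + M.size (σ.reg s) + c + c')
  | loopFalse {r s : ℕ} {p : Prog M.ops} {σ : State} (h : ¬ σ.reg r < σ.reg s) :
      Exec M (.loop r s p) σ σ (1 + M.size (σ.reg r) + M.size (σ.reg s))

/-- `p`, started in `σ`, halts at cost at most `T` in a state satisfying `post`. -/
def RunsWithin (M : Model) (p : Prog M.ops) (σ : State) (T : ℝ) (post : State → Prop) : Prop :=
  ∃ (τ : State) (c : ℕ), Exec M p σ τ c ∧ (c : ℝ) ≤ T ∧ post τ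

/-- The cells of an `n × d` matrix in row-major order: entry `(i, j)` is in cell `i * d + j`, and
all further cells are `0`. -/
noncomputable def flatten {n d : ℕ} (A : Matrix (Fin n) (Fin d) ℝ) (a : ℕ) : ℝ :=
  if h : a < n * d then
    A (finProdFinEquiv.symm ⟨a, h⟩).1 (finProdFinEquiv.symm ⟨a, h⟩).2
  else 0

/-! ### The Strong Exponential Time Hypothesis -/

/-- A CNF formula with `n` variables and `m` clauses of at most `k` literals each. The literal
`(v, b)` is true if the variable `v` has the value `b`; unused positions hold `none`. -/
abbrev KCNF (k n m : ℕ) := Fin m → Fin k → Option (Fin n × Bool)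

def KCNF.Satisfiable {k n m : ℕ} (φ : KCNF k n m) : Prop :=
  ∃ a : Fin n → Bool, ∀ i, ∃ j l, φ i j = some l ∧ a l.1 = l.2

/-- The number that encodes a literal: `v + 1` or `-(v + 1)`, and `0` for an unused position. -/
def litCode {n : ℕ} : Option (Fin n × Bool) → ℝ
  | none => 0
  | some (v, true) => (v : ℕ) + 1
  | some (v, false) => -((v : ℕ) + 1)

/-- Input: `n` and `m` in registers `0`, `1`, and the clauses in bank `0`. -/
noncomputable def satInput {k n m : ℕ} (φ : KCNF k n m) : State where
  reg := fun
    | 0 => n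
    | 1 => m
    | _ => 0
  bank := fun
    | 0 => flatten (Matrix.of fun i j => litCode (φ i j))
    | _ => fun _ => 0

/-- `p` decides `k`-SAT in time `T n m` (`n` variables, `m` clauses): register `0` holds the
answer, `1` for satisfiable and `0` for unsatisfiable. -/
def DecidesSAT (M : Model) (k : ℕ) (p : Prog M.ops) (T : ℕ → ℕ → ℝ) : Prop :=
  ∀ (n m : ℕ) (φ : KCNF k n m), RunsWithin M p (satInput φ) (T n m) fun τ =>
    (φ.Satisfiable → τ.reg 0 = 1) ∧ (¬ φ.Satisfiable → τ.reg 0 = 0)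

/-- SETH: for every `ε > 0` there is a `k` such that no program decides `k`-SAT in time
`O(2 ^ ((1 - ε) n))`, up to factors polynomial in the number of clauses. -/
def SETH (M : Model) : Prop :=
  ∀ ε : ℝ, 0 < ε → ∃ k : ℕ, ¬ ∃ (p : Prog M.ops) (K : ℝ) (a : ℕ),
    DecidesSAT M k p fun n m => K * (2 : ℝ) ^ ((1 - ε) * (n : ℝ)) * ((m : ℝ) + 1) ^ a

/-! ### Self-attention -/

/-- `S i j = exp (⟨Q i, Q j⟩)`. -/
noncomputable def expScore {n d : ℕ} (Q : Matrix (Fin n) (Fin d) ℝ) :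
    Matrix (Fin n) (Fin n) ℝ :=
  Matrix.of fun i j => Real.exp (Q i ⬝ᵥ Q j)

/-- Every entry is divided by the sum of its row. -/
noncomputable def rowNormalize {n : ℕ} (A : Matrix (Fin n) (Fin n) ℝ) :
    Matrix (Fin n) (Fin n) ℝ :=
  Matrix.of fun i j => A i j / ∑ k, A i k

/-- Softmax dot-product self-attention. -/
noncomputable def selfAttention {n d e : ℕ} (Q : Matrix (Fin n) (Fin d) ℝ)
    (V : Matrix (Fin n) (Fin e) ℝ) : Matrix (Fin n) (Fin e) ℝ :=
  rowNormalize (expScore Q) * V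

/-- Input: `n`, `d`, `e` in registers `0`, `1`, `2`, and `Q`, `V` in banks `0`, `1`. -/
noncomputable def attnInput {n d e : ℕ} (Q : Matrix (Fin n) (Fin d) ℝ)
    (V : Matrix (Fin n) (Fin e) ℝ) : State where
  reg := fun
    | 0 => n
    | 1 => d
    | 2 => e
    | _ => 0
  bank := fun
    | 0 => flatten Q
    | 1 => flatten V
    | _ => fun _ => 0

/-- The output matrix, read from bank `2` in row-major order. -/
def attnOutput (n e : ℕ) (τ : State) : Matrix (Fin n) (Fin e) ℝ :=
  Matrix.of fun i j => τ.bank 2 (i * e + j)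

/-- The numbers that may occur as entries of `Q` and `V`: all real numbers on the real RAM, and the
natural numbers up to the dimension `d` on the logarithmic-cost RAM (numbers of unbounded length
would make it run for an unbounded time). -/
def Model.Entry : Model → ℕ → ℝ → Prop
  | .realRAM _, _, _ => True
  | .logRAM, d, x => ∃ z : ℕ, z ≤ d ∧ x = z

/-- `p` computes self-attention for `Q` of size `n × d n` and `V` of size `n × e n` in time `T n`,
where `ok Y' Y` says that the output `Y'` is acceptable if `Y` is the true value. -/
def ComputesAttention (M : Model) (d e : ℕ → ℕ)
    (ok : ∀ n e : ℕ, Matrix (Fin n) (Fin e) ℝ → Matrix (Fin n) (Fin e) ℝ → Prop)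
    (p : Prog M.ops) (T : ℕ → ℝ) : Prop :=
  ∀ n : ℕ, 1 ≤ n → ∀ (Q : Matrix (Fin n) (Fin (d n)) ℝ) (V : Matrix (Fin n) (Fin (e n)) ℝ),
    (∀ i j, M.Entry (d n) (Q i j)) → (∀ i j, M.Entry (d n) (V i j)) →
      RunsWithin M p (attnInput Q V) (T n) fun τ =>
        ok n (e n) (attnOutput n (e n) τ) (selfAttention Q V)

/-- Exact computation. -/
def Exact (n e : ℕ) (Y' Y : Matrix (Fin n) (Fin e) ℝ) : Prop := Y' = Y

/-- Entrywise multiplicative error at most `μ`. -/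
def MulApprox (μ : ℝ) (n e : ℕ) (Y' Y : Matrix (Fin n) (Fin e) ℝ) : Prop :=
  ∀ i j, |Y' i j - Y i j| ≤ μ * |Y i j|

/-- Input: `n` in register `0`. -/
def numInput (n : ℕ) : State where
  reg := fun
    | 0 => n
    | _ => 0
  bank := fun _ _ => 0

/-- `f` is computable in time `O(n ^ (1 - γ))` for some `γ > 0`, where the number `n` is given in
register `0` and `f n` is returned there. -/
def SublinearTime (M : Model) (f : ℕ → ℕ) : Prop :=
  ∃ (p : Prog M.ops) (γ K : ℝ), 0 < γ ∧ ∀ n : ℕ, 1 ≤ n →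
    RunsWithin M p (numInput n) (K * (n : ℝ) ^ (1 - γ)) fun τ => τ.reg 0 = f n

/-!
A subquadratic program for attention would decide `k`-SAT too fast, for every `k`. The reduction
splits the variables into two halves and lists the half-assignments, so that attention on
`n ≈ 2 ^ (N / 2)` rows has to find a matching pair, as in the reduction to orthogonal vectors. The
dimension `d n = ω(log n)` is too small for a column per clause unless there are `O(N)` clauses
only, and therefore the formula is sparsified first (Impagliazzo, Paturi and Zane).

Sparsification treats the clauses as a family of sets of literals. As long as some large subfamily
of sets of equal size `c` shares a nonempty part `H` (a sunflower with heart `H`), one branches: a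
satisfying assignment satisfies `H`, or else all the petals `D \ H`. Smallest sets and smallest
petals come first, and this keeps the number of sets ever added linear (`Sparsify.Inv.added_le`).
A family without large sunflowers is of linear size (`Sparsify.card_le_of_noSun`; it is enough to
look for hearts that are intersections of two members). Most branches take the heart, because a
petal branch adds many sets at once; so a path is encoded by few digits in a large base
`G = 2 ^ b`, where a digit counts the heart branches before the next petal branch (`FP.Progress.pos_lt`).
With `e` digits, `e ≈ N / (2 * q * b)`, there are `2 ^ (b * e) ≈ 2 ^ (N / (2 * q))` leaves. Every
satisfying assignment survives at some leaf (`FP.exists_leaf`), and none is added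
(`FP.eval_leafP`).

All leaves are handled by a single call of the attention program. The rows of `Q` are multiples of
indicators of sets. For each leaf and each half-assignment there is a row of the first kind and
one of the second kind: both contain a one-hot encoding of the digits of the leaf, so that
containment is possible within a leaf only, and two columns for each clause, so that containment
means that every clause is satisfied by one of the two half-assignments (`FP.exists_subset_iff`).
If the nonzero entries of `Q` are of size `B ≈ log n`, then the softmax weights in a row of the
first kind concentrate on the rows whose set contains its own; with `V` the indicator of the rows
of the second kind, the output is at least `1 / n` or at most `n * exp (-B ^ 2)`, and any
multiplicative approximation tells which (`le_approx_iff`).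

The reduction is carried out on the machine. Programs are written in a language `FP` of bounded
loops over natural numbers, in which the number of steps and the growth of numbers can be read off
the program text (`FP.steps`, `FP.bddBy_eval`), and they are compiled (`FP.exec_compile`). The
given programs for attention and for the dimensions are relocated to registers and banks of their
own (`Exec.rename`). `exec_solver` assembles everything, and `not_computesAttention_mulApprox`
chooses the parameters. Exact computation is the case `μ = 0`.

Memory layout of the programs in `FP`. Banks: `0` and `1` are the matrices `Q` and `V`, `2` holds
the sets of the family as rows of bits, `3` the flags of the rows in use, `4` a set to be
inserted, `5` a heart, `6` the digits of a leaf, `7` a half-assignment. Constants: `1` length of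
the rows of bank `2`, `2` their number, `3` number of branching steps, `4` number of clauses, `5`
literals per clause, `6` number of variables after padding, `7` number of digits, `8` half the
number of variables, `9` number of half-assignments, `10` number of leaves, `11` the base `G`,
`12` and `13` the dimensions, `14` the nonzero entries of `Q`, `15` half the number of rows of
`Q`, `16` all of it. Registers: `9` first free row of bank `2`, `17` position of the current
digit, `18` its part that has been used up.
-/

/-! ### Sizes of numbers -/

lemma Model.size_ratCast (q : ℚ) : Model.logRAM.size (q : ℝ) = ratBits q := by
  have h : ∃ q' : ℚ, (q' : ℝ) = (q : ℝ) := ⟨q, rfl⟩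
  have h2 : h.choose = q := by exact_mod_cast h.choose_spec
  simp only [Model.size, dif_pos h, h2]

/-- The size that a machine charges for a natural number. -/
noncomputable def Model.bits (M : Model) (x : ℕ) : ℕ := M.size (x : ℝ)

lemma Model.bits_logRAM (x : ℕ) : Model.logRAM.bits x = Nat.size x + 1 := by
  have := Model.size_ratCast (x : ℚ)
  rw [Rat.cast_natCast] at this
  rw [Model.bits, this]
  simp [ratBits]

lemma Model.size_natCast (M : Model) (x : ℕ) : M.size (x : ℝ) = M.bits x := rfl

lemma Model.size_intCast (M : Model) (z : ℤ) : M.size (z : ℝ) = M.bits z.natAbs := by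
  cases M with
  | realRAM F => rfl
  | logRAM =>
    have := Model.size_ratCast (z : ℚ)
    rw [Rat.cast_intCast] at this
    rw [this, Model.bits_logRAM]
    simp [ratBits]

lemma Model.bits_mono (M : Model) {x y : ℕ} (h : x ≤ y) : M.bits x ≤ M.bits y := by
  cases M with
  | realRAM F => exact le_rfl
  | logRAM => simpa [Model.bits_logRAM] using Nat.size_le_size h

lemma Model.bits_mul (M : Model) (x y : ℕ) : M.bits (x * y) ≤ M.bits x + M.bits y := by
  cases M with
  | realRAM F => exact le_rfl
  | logRAM =>
    simp only [Model.bits_logRAM]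
    have : Nat.size (x * y) ≤ Nat.size x + Nat.size y := by
      rw [Nat.size_le, pow_add]
      exact Nat.mul_lt_mul'' (Nat.lt_size_self x) (Nat.lt_size_self y)
    omega

lemma Model.bits_add (M : Model) (x y : ℕ) : M.bits (x + y) ≤ M.bits x + M.bits y := by
  cases M with
  | realRAM F => exact le_rfl
  | logRAM =>
    simp only [Model.bits_logRAM]
    have : Nat.size (x + y) ≤ Nat.size x + Nat.size y + 1 := by
      rw [Nat.size_le]
      have h1 := Nat.lt_size_self x
      have h2 := Nat.lt_size_self y
      have h3 : 2 ^ Nat.size x ≤ 2 ^ (Nat.size x + Nat.size y) :=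
        Nat.pow_le_pow_right (by norm_num) (by omega)
      have h4 : 2 ^ Nat.size y ≤ 2 ^ (Nat.size x + Nat.size y) :=
        Nat.pow_le_pow_right (by norm_num) (by omega)
      rw [pow_succ]
      omega
    omega

lemma Model.bits_two_pow (M : Model) (t : ℕ) : M.bits (2 ^ t) ≤ t + 2 := by
  cases M with
  | realRAM F => exact Nat.zero_le _
  | logRAM => simp [Model.bits_logRAM, Nat.size_pow]

lemma Model.bits_le (M : Model) (x : ℕ) : M.bits x ≤ x + 2 :=
  (M.bits_mono Nat.lt_two_pow_self.le).trans (M.bits_two_pow x)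

lemma Model.size_one_div (M : Model) (x : ℕ) (hx : 1 ≤ x) : M.size (1 / (x : ℝ)) = M.bits x := by
  cases M with
  | realRAM F => rfl
  | logRAM =>
    have := Model.size_ratCast (1 / (x : ℚ))
    push_cast at this
    rw [this, Model.bits_logRAM]
    have h1 : (1 / (x : ℚ)).num = 1 := by
      rw [one_div, Rat.inv_natCast_num_of_pos (by omega)]
    have h2 : (1 / (x : ℚ)).den = x := by
      rw [one_div, Rat.inv_natCast_den_of_pos (by omega)]
    rw [ratBits, h1, h2]
    simp
    omega

/-! ### Sizes of results -/

@[simp] lemma State.setReg_reg (σ : State) (r : ℕ) (x : ℝ) (r' : ℕ) :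
    (σ.setReg r x).reg r' = if r' = r then x else σ.reg r' := by
  simp [State.setReg, Function.update_apply]

@[simp] lemma State.setReg_bank (σ : State) (r : ℕ) (x : ℝ) :
    (σ.setReg r x).bank = σ.bank := rfl

@[simp] lemma State.setCell_reg (σ : State) (b i : ℕ) (x : ℝ) :
    (σ.setCell b i x).reg = σ.reg := rfl

@[simp] lemma State.setCell_bank (σ : State) (b i : ℕ) (x : ℝ) (b' i' : ℕ) :
    (σ.setCell b i x).bank b' i' = if b' = b ∧ i' = i then x else σ.bank b' i' := by
  by_cases h : b' = b
  · subst h; simp [State.setCell, Function.update_apply]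
  · simp [State.setCell, h]

/-- A register that has been written holds a number whose size was charged for. -/
lemma Exec.size_reg_le {M : Model} {p : Prog M.ops} {σ τ : State} {c : ℕ} (h : Exec M p σ τ c)
    (r : ℕ) : M.size (τ.reg r) ≤ M.size (σ.reg r) + c := by
  induction h with
  | skip | store | loopFalse => simp
  | const σ r' z | arith σ _ r' | app σ _ r' | load σ _ r' =>
    simp only [State.setReg_reg]
    split_ifs <;> omega
  | _ => omega

/-- The numbers in distinct cells that have been written were charged for separately. -/
lemma Exec.sum_size_bank_le {M : Model} {p : Prog M.ops} {σ τ : State} {c : ℕ}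
    (h : Exec M p σ τ c) (b : ℕ) (I : Finset ℕ) :
    ∑ i ∈ I, M.size (τ.bank b i) ≤ ∑ i ∈ I, M.size (σ.bank b i) + c := by
  induction h with
  | skip | const | arith | app | load | loopFalse => simp
  | store σ b' s r i hi =>
    have : ∀ i' ∈ I, M.size ((σ.setCell b' i (σ.reg r)).bank b i') ≤
        M.size (σ.bank b i') + if i' = i then M.size (σ.reg r) else 0 := by
      intro i' _
      simp only [State.setCell_bank]
      split_ifs <;> omega
    refine (Finset.sum_le_sum this).trans ?_
    rw [Finset.sum_add_distrib, Finset.sum_ite_eq']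
    split_ifs <;> omega
  | _ => omega

/-! ### Relocation of programs -/

/-- The program with registers renamed by `f` and memory banks renamed by `g`. -/
def Prog.rename {F : Set (ℝ → ℝ)} (f g : ℕ → ℕ) : Prog F → Prog F
  | .skip => .skip
  | .const r z => .const (f r) z
  | .arith o r s t => .arith o (f r) (f s) (f t)
  | .app φ r s => .app φ (f r) (f s)
  | .load b r s => .load (g b) (f r) (f s)
  | .store b s r => .store (g b) (f s) (f r)
  | .seq p q => .seq (p.rename f g) (q.rename f g)
  | .branch r s p q => .branch (f r) (f s) (p.rename f g) (q.rename f g)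
  | .loop r s p => .loop (f r) (f s) (p.rename f g)

/-- `σ'` contains `σ` as seen through the renaming `f` of registers and `g` of banks. -/
def Embeds (f g : ℕ → ℕ) (σ σ' : State) : Prop :=
  (∀ r, σ'.reg (f r) = σ.reg r) ∧ ∀ b, σ'.bank (g b) = σ.bank b

/-- `σ` and `τ` agree on the registers and banks outside the ranges of `f` and `g`. -/
def AgreeOff (f g : ℕ → ℕ) (σ τ : State) : Prop :=
  (∀ r, r ∉ Set.range f → τ.reg r = σ.reg r) ∧ ∀ b, b ∉ Set.range g → τ.bank b = σ.bank b

lemma AgreeOff.refl (f g : ℕ → ℕ) (σ : State) : AgreeOff f g σ σ :=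
  ⟨fun _ _ => rfl, fun _ _ => rfl⟩

lemma AgreeOff.trans {f g : ℕ → ℕ} {σ τ υ : State} (h : AgreeOff f g σ τ)
    (h' : AgreeOff f g τ υ) : AgreeOff f g σ υ :=
  ⟨fun r hr => (h'.1 r hr).trans (h.1 r hr), fun b hb => (h'.2 b hb).trans (h.2 b hb)⟩

lemma Embeds.setReg {f g : ℕ → ℕ} (hf : f.Injective) {σ σ' : State} (h : Embeds f g σ σ')
    (r : ℕ) (x : ℝ) : Embeds f g (σ.setReg r x) (σ'.setReg (f r) x) := by
  refine ⟨fun r' => ?_, h.2⟩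
  simp [hf.eq_iff, h.1 r']

lemma AgreeOff.setReg {f g : ℕ → ℕ} (σ : State) (r : ℕ) (x : ℝ) :
    AgreeOff f g σ (σ.setReg (f r) x) := by
  refine ⟨fun r' hr' => ?_, fun _ _ => rfl⟩
  have : r' ≠ f r := fun h => hr' ⟨r, h.symm⟩
  simp [this]

/-- A relocated program runs as the original one, at the same cost, and touches nothing else. -/
lemma Exec.rename {M : Model} {f g : ℕ → ℕ} (hf : f.Injective) (hg : g.Injective)
    {p : Prog M.ops} {σ τ : State} {c : ℕ} (h : Exec M p σ τ c) {σ' : State}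
    (hσ : Embeds f g σ σ') :
    ∃ τ', Exec M (p.rename f g) σ' τ' c ∧ Embeds f g τ τ' ∧ AgreeOff f g σ' τ' := by
  induction h generalizing σ' with
  | skip => exact ⟨σ', .skip σ', hσ, .refl _ _ _⟩
  | const σ r z => exact ⟨_, .const σ' (f r) z, hσ.setReg hf r z, .setReg _ _ _⟩
  | arith σ o r s t x hdiv hx =>
    refine ⟨_, ?_, hσ.setReg hf r x, .setReg _ _ _⟩
    have := Exec.arith (M := M) σ' o (f r) (f s) (f t) x (by rwa [hσ.1]) (by rwa [hσ.1, hσ.1])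
    rwa [hσ.1, hσ.1] at this
  | app σ φ r s x hx =>
    refine ⟨_, ?_, hσ.setReg hf r x, .setReg _ _ _⟩
    have := Exec.app (M := M) σ' φ (f r) (f s) x (by rwa [hσ.1])
    rwa [hσ.1] at this
  | load σ b r s i hi =>
    refine ⟨_, ?_, hσ.setReg hf r _, .setReg _ _ _⟩
    have := Exec.load (M := M) σ' (g b) (f r) (f s) i (by rwa [hσ.1])
    rwa [hσ.1, hσ.2] at this
  | store σ b s r i hi =>
    have := Exec.store (M := M) σ' (g b) (f s) (f r) i (by rwa [hσ.1])
    rw [hσ.1, hσ.1] at this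
    refine ⟨_, this, ⟨hσ.1, fun b' => ?_⟩, fun _ _ => rfl, fun b' hb' => ?_⟩
    · funext i'
      simp [hg.eq_iff, hσ.2]
    · have : b' ≠ g b := fun h => hb' ⟨b, h.symm⟩
      funext i'
      simp [this]
  | seq _ _ ih1 ih2 =>
    obtain ⟨τ', e1, m1, a1⟩ := ih1 hσ
    obtain ⟨υ', e2, m2, a2⟩ := ih2 m1
    exact ⟨υ', .seq e1 e2, m2, a1.trans a2⟩
  | @branchTrue r s p q _ _ _ h _ ih =>
    obtain ⟨τ', e1, m1, a1⟩ := ih hσ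
    rw [← hσ.1, ← hσ.1] at h
    have := Exec.branchTrue (q := q.rename f g) h e1
    rw [hσ.1, hσ.1] at this
    exact ⟨τ', this, m1, a1⟩
  | @branchFalse r s p q _ _ _ h _ ih =>
    obtain ⟨τ', e1, m1, a1⟩ := ih hσ
    rw [← hσ.1, ← hσ.1] at h
    have := Exec.branchFalse (p := p.rename f g) h e1
    rw [hσ.1, hσ.1] at this
    exact ⟨τ', this, m1, a1⟩
  | loopTrue h _ _ ih1 ih2 =>
    obtain ⟨τ', e1, m1, a1⟩ := ih1 hσ
    obtain ⟨υ', e2, m2, a2⟩ := ih2 m1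
    rw [← hσ.1, ← hσ.1] at h
    have := Exec.loopTrue h e1 e2
    rw [hσ.1, hσ.1] at this
    exact ⟨υ', this, m2, a1.trans a2⟩
  | @loopFalse r s p _ h =>
    rw [← hσ.1, ← hσ.1] at h
    have := Exec.loopFalse (M := M) (p := p.rename f g) h
    rw [hσ.1, hσ.1] at this
    exact ⟨σ', this, hσ, .refl _ _ _⟩

/-! ### A language of bounded loops over natural numbers -/

/-- States of a machine whose registers and cells hold natural numbers. -/
@[ext] structure NState where
  reg : ℕ → ℕ
  bank : ℕ → ℕ → ℕ

namespace NState

/-- Overwrite a register. -/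
def setReg (s : NState) (r x : ℕ) : NState :=
  { s with reg := Function.update s.reg r x }

/-- Overwrite a cell. -/
def setCell (s : NState) (b i x : ℕ) : NState :=
  { s with bank := Function.update s.bank b (Function.update (s.bank b) i x) }

@[simp] lemma setReg_reg (s : NState) (r x r' : ℕ) :
    (s.setReg r x).reg r' = if r' = r then x else s.reg r' := by
  simp [setReg, Function.update_apply]

@[simp] lemma setReg_bank (s : NState) (r x : ℕ) : (s.setReg r x).bank = s.bank := rfl

@[simp] lemma setCell_reg (s : NState) (b i x : ℕ) : (s.setCell b i x).reg = s.reg := rfl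

@[simp] lemma setCell_bank (s : NState) (b i x b' i' : ℕ) :
    (s.setCell b i x).bank b' i' = if b' = b ∧ i' = i then x else s.bank b' i' := by
  by_cases h : b' = b
  · subst h; simp [setCell, Function.update_apply]
  · simp [setCell, h]

/-- All registers and cells hold numbers at most `X`. -/
def BddBy (s : NState) (X : ℕ) : Prop := (∀ r, s.reg r ≤ X) ∧ ∀ b i, s.bank b i ≤ X

lemma BddBy.mono {s : NState} {X Y : ℕ} (h : s.BddBy X) (hXY : X ≤ Y) : s.BddBy Y :=
  ⟨fun r => (h.1 r).trans hXY, fun b i => (h.2 b i).trans hXY⟩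

lemma BddBy.setReg {s : NState} {X r x : ℕ} (h : s.BddBy X) (hx : x ≤ X) :
    (s.setReg r x).BddBy X := by
  refine ⟨fun r' => ?_, h.2⟩
  rw [setReg_reg]
  split_ifs
  exacts [hx, h.1 r']

lemma BddBy.setCell {s : NState} {X b i x : ℕ} (h : s.BddBy X) (hx : x ≤ X) :
    (s.setCell b i x).BddBy X := by
  refine ⟨h.1, fun b' i' => ?_⟩
  rw [setCell_bank]
  split_ifs
  exacts [hx, h.2 b' i']

end NState

/-- What a bounded-loop program can read but not change: the constants `κ j`, which are its loop
bounds, array widths and increments, and the input cells `ι i`. -/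
structure Env where
  κ : ℕ → ℕ
  ι : ℕ → ℤ

/-- Programs with bounded loops over natural numbers. Loop bounds are constants of the
environment, so that the running time is bounded by a function of these constants only. -/
inductive FP where
  | skip
  /-- `r := z` -/
  | const (r z : ℕ)
  /-- `r := κ j` -/
  | setc (r j : ℕ)
  /-- `r := s + z` -/
  | addl (r s z : ℕ)
  /-- `r := s + κ j` -/
  | addc (r s j : ℕ)
  /-- `r := s + t` -/
  | addv (r s t : ℕ)
  /-- `r :=` the positive (or negative) part of the input cell `s * κ j + t` -/
  | inp (pos : Bool) (r s j t : ℕ)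
  /-- `r := bank b [s]` -/
  | load1 (b r s : ℕ)
  /-- `bank b [s] := r` -/
  | store1 (b s r : ℕ)
  /-- `r := bank b [s * κ j + t]` -/
  | load (b r s j t : ℕ)
  /-- `bank b [s * κ j + t] := r` -/
  | store (b s j t r : ℕ)
  | seq (p q : FP)
  /-- `if r < s then p else q` -/
  | ite (r s : ℕ) (p q : FP)
  /-- `if 0 < r then p else q` -/
  | ifPos (r : ℕ) (p q : FP)
  /-- `for i = 0, …, κ j - 1 do p` -/
  | loop (i j : ℕ) (p : FP)

namespace FP

/-- The effect of a program. -/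
def eval (E : Env) : FP → NState → NState
  | skip, s => s
  | const r z, s => s.setReg r z
  | setc r j, s => s.setReg r (E.κ j)
  | addl r t z, s => s.setReg r (s.reg t + z)
  | addc r t j, s => s.setReg r (s.reg t + E.κ j)
  | addv r t u, s => s.setReg r (s.reg t + s.reg u)
  | inp pos r t j u, s =>
    s.setReg r (if pos then (E.ι (s.reg t * E.κ j + s.reg u)).toNat
      else (-E.ι (s.reg t * E.κ j + s.reg u)).toNat)
  | load1 b r t, s => s.setReg r (s.bank b (s.reg t))
  | store1 b t r, s => s.setCell b (s.reg t) (s.reg r)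
  | load b r t j u, s => s.setReg r (s.bank b (s.reg t * E.κ j + s.reg u))
  | store b t j u r, s => s.setCell b (s.reg t * E.κ j + s.reg u) (s.reg r)
  | seq p q, s => q.eval E (p.eval E s)
  | ite r t p q, s => if s.reg r < s.reg t then p.eval E s else q.eval E s
  | ifPos r p q, s => if 0 < s.reg r then p.eval E s else q.eval E s
  | loop i j p, s => Nat.rec s (fun a s' => p.eval E (s'.setReg i a)) (E.κ j)

/-- A bound on the number of steps. -/
def steps (E : Env) : FP → ℕ
  | seq p q => p.steps E + q.steps E
  | ite _ _ p q => 1 + p.steps E + q.steps E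
  | ifPos _ p q => 1 + p.steps E + q.steps E
  | loop _ j p => 1 + E.κ j * (1 + p.steps E)
  | _ => 1

/-- A bound on the number of additions of two variables. -/
def adds (E : Env) : FP → ℕ
  | addv _ _ _ => 1
  | seq p q => p.adds E + q.adds E
  | ite _ _ p q => p.adds E + q.adds E
  | ifPos _ p q => p.adds E + q.adds E
  | loop _ j p => E.κ j * p.adds E
  | _ => 0

/-- All numbers in the program text are at most `Δ`. -/
def LitLe (Δ : ℕ) : FP → Prop
  | const _ z => z ≤ Δ
  | addl _ _ z => z ≤ Δ
  | seq p q => p.LitLe Δ ∧ q.LitLe Δ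
  | ite _ _ p q => p.LitLe Δ ∧ q.LitLe Δ
  | ifPos _ p q => p.LitLe Δ ∧ q.LitLe Δ
  | loop _ _ p => p.LitLe Δ
  | _ => True

/-- The largest number in the program text. -/
def maxLit : FP → ℕ
  | const _ z => z
  | addl _ _ z => z
  | seq p q => max p.maxLit q.maxLit
  | ite _ _ p q => max p.maxLit q.maxLit
  | ifPos _ p q => max p.maxLit q.maxLit
  | loop _ _ p => p.maxLit
  | _ => 0

lemma litLe_of_maxLit_le {Δ : ℕ} {p : FP} (h : p.maxLit ≤ Δ) : p.LitLe Δ := by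
  induction p with
  | seq p q ihp ihq => exact ⟨ihp ((le_max_left _ _).trans h), ihq ((le_max_right _ _).trans h)⟩
  | ite _ _ p q ihp ihq | ifPos _ p q ihp ihq =>
    exact ⟨ihp ((le_max_left _ _).trans h), ihq ((le_max_right _ _).trans h)⟩
  | loop _ _ p ih => exact ih h
  | _ => first | exact h | trivial

end FP

/-- All constants and all input cells are at most `Δ` in absolute value. -/
def Env.BddBy (E : Env) (Δ : ℕ) : Prop := (∀ j, E.κ j ≤ Δ) ∧ ∀ i, (E.ι i).natAbs ≤ Δ

namespace FP

/-- Induction over the rounds of a loop. -/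
lemma eval_loop {E : Env} {i j : ℕ} {p : FP} {s : NState} (P : ℕ → NState → Prop) (h0 : P 0 s)
    (hs : ∀ a < E.κ j, ∀ s', P a s' → P (a + 1) (p.eval E (s'.setReg i a))) :
    P (E.κ j) ((loop i j p).eval E s) := by
  have : ∀ N ≤ E.κ j, P N (Nat.rec s (fun a s' => p.eval E (s'.setReg i a)) N) := by
    intro N
    induction N with
    | zero => exact fun _ => h0
    | succ N ih => exact fun h => hs N (by omega) _ (ih (by omega))
  exact this _ le_rfl

/-- Only additions of two variables can make numbers grow exponentially. -/
lemma bddBy_eval {E : Env} {Δ : ℕ} (hE : E.BddBy Δ) {p : FP} (hp : p.LitLe Δ) {s : NState} {X : ℕ}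
    (hs : s.BddBy X) : (p.eval E s).BddBy (2 ^ p.adds E * (X + Δ * p.steps E)) := by
  induction p generalizing s X with
  | skip => exact hs.mono (by simp [adds])
  | seq p q ihp ihq =>
    refine (ihq hp.2 (ihp hp.1 hs)).mono ?_
    simp only [adds, steps, pow_add]
    have h1 : 1 ≤ 2 ^ p.adds E := Nat.one_le_two_pow
    calc 2 ^ q.adds E * (2 ^ p.adds E * (X + Δ * p.steps E) + Δ * q.steps E)
        ≤ 2 ^ q.adds E * (2 ^ p.adds E * (X + Δ * p.steps E) +
          2 ^ p.adds E * (Δ * q.steps E)) := by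
          refine Nat.mul_le_mul_left _ (Nat.add_le_add_left ?_ _)
          exact Nat.le_mul_of_pos_left _ h1
      _ = _ := by ring
  | ite r t p q ihp ihq | ifPos r p q ihp ihq =>
    simp only [eval, adds, steps]
    split_ifs
    · exact (ihp hp.1 hs).mono (by gcongr <;> omega)
    · exact (ihq hp.2 hs).mono (by gcongr <;> omega)
  | loop i j p ih =>
    have key := eval_loop (E := E) (i := i) (j := j) (p := p) (s := s)
      (fun a s' => s'.BddBy (2 ^ (a * p.adds E) * (X + Δ * (1 + a * (1 + p.steps E)))))
      (hs.mono (by simp)) (by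
        intro a ha s' hs'
        have h0 : (s'.setReg i a).BddBy
            (2 ^ (a * p.adds E) * (X + Δ * (1 + a * (1 + p.steps E)))) := by
          refine hs'.setReg ?_
          have h2 := hE.1 j
          have h3 : Δ ≤ Δ * (1 + a * (1 + p.steps E)) := Nat.le_mul_of_pos_right _ (by omega)
          have h4 : 1 ≤ 2 ^ (a * p.adds E) := Nat.one_le_two_pow
          calc a ≤ X + Δ * (1 + a * (1 + p.steps E)) := by omega
            _ ≤ _ := Nat.le_mul_of_pos_left _ h4
        refine (ih hp h0).mono ?_
        have h1 : 1 ≤ 2 ^ (a * p.adds E) := Nat.one_le_two_pow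
        calc 2 ^ p.adds E * (2 ^ (a * p.adds E) * (X + Δ * (1 + a * (1 + p.steps E))) +
              Δ * p.steps E)
            ≤ 2 ^ p.adds E * (2 ^ (a * p.adds E) * (X + Δ * (1 + a * (1 + p.steps E))) +
              2 ^ (a * p.adds E) * (Δ * (1 + p.steps E))) := by
              refine Nat.mul_le_mul_left _ (Nat.add_le_add_left ?_ _)
              calc Δ * p.steps E ≤ Δ * (1 + p.steps E) := by gcongr; omega
                _ ≤ _ := Nat.le_mul_of_pos_left _ h1
          _ = _ := by ring)
    exact key.mono (by simp [adds, steps])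
  | const r z =>
    have h : z ≤ Δ := hp
    exact (hs.mono (by simp [adds])).setReg (by simp [adds, steps]; omega)
  | setc r j =>
    have := hE.1 j
    exact (hs.mono (by simp [adds])).setReg (by simp [adds, steps]; omega)
  | addl r t z =>
    have := hs.1 t
    have h : z ≤ Δ := hp
    exact (hs.mono (by simp [adds])).setReg (by simp [adds, steps]; omega)
  | addc r t j =>
    have := hs.1 t
    have := hE.1 j
    exact (hs.mono (by simp [adds])).setReg (by simp [adds, steps]; omega)
  | addv r t u =>
    have := hs.1 t
    have := hs.1 u
    exact (hs.mono (by simp [adds, steps]; omega)).setReg (by simp [adds, steps]; omega)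
  | inp pos r t j u =>
    have := hE.2 (s.reg t * E.κ j + s.reg u)
    refine (hs.mono (by simp [adds])).setReg ?_
    simp only [adds, steps]
    split_ifs <;> omega
  | load1 b r t =>
    exact (hs.setReg (hs.2 _ _)).mono (by simp [adds])
  | store1 b t r =>
    exact (hs.setCell (hs.1 _)).mono (by simp [adds])
  | load b r t j u =>
    exact (hs.setReg (hs.2 _ _)).mono (by simp [adds])
  | store b t j u r =>
    exact (hs.setCell (hs.1 _)).mono (by simp [adds])

/-- The registers that a program may change. -/
def wr : FP → List ℕ
  | const r _ | setc r _ | addl r _ _ | addc r _ _ | addv r _ _ | inp _ r _ _ _ | load1 _ r _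
  | load _ r _ _ _ => [r]
  | seq p q | ite _ _ p q | ifPos _ p q => p.wr ++ q.wr
  | loop i _ p => i :: p.wr
  | _ => []

/-- The banks that a program may change. -/
def wb : FP → List ℕ
  | store1 b _ _ | store b _ _ _ _ => [b]
  | seq p q | ite _ _ p q | ifPos _ p q => p.wb ++ q.wb
  | loop _ _ p => p.wb
  | _ => []

lemma eval_reg {E : Env} {p : FP} {r : ℕ} (hr : r ∉ p.wr) (s : NState) :
    (p.eval E s).reg r = s.reg r := by
  induction p generalizing s with
  | seq p q ihp ihq =>
    simp only [wr, List.mem_append, not_or] at hr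
    rw [eval, ihq hr.2, ihp hr.1]
  | ite a b p q ihp ihq | ifPos a p q ihp ihq =>
    simp only [wr, List.mem_append, not_or] at hr
    rw [eval]
    split_ifs
    exacts [ihp hr.1 s, ihq hr.2 s]
  | loop i j p ih =>
    simp only [wr, List.mem_cons, not_or] at hr
    refine eval_loop (fun _ s' => s'.reg r = s.reg r) rfl fun a _ s' h => ?_
    rw [ih hr.2, NState.setReg_reg, if_neg hr.1, h]
  | _ => simp_all [wr, eval]

lemma eval_bank {E : Env} {p : FP} {b : ℕ} (hb : b ∉ p.wb) (s : NState) :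
    (p.eval E s).bank b = s.bank b := by
  induction p generalizing s with
  | seq p q ihp ihq =>
    simp only [wb, List.mem_append, not_or] at hb
    rw [eval, ihq hb.2, ihp hb.1]
  | ite a c p q ihp ihq | ifPos a p q ihp ihq =>
    simp only [wb, List.mem_append, not_or] at hb
    rw [eval]
    split_ifs
    exacts [ihp hb.1 s, ihq hb.2 s]
  | loop i j p ih =>
    refine eval_loop (fun _ s' => s'.bank b = s.bank b) rfl fun a _ s' h => ?_
    rw [ih hb, NState.setReg_bank, h]
  | store1 b' t r =>
    funext i
    simp_all [wb, eval]
  | store b' t j u r =>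
    funext i
    simp_all [wb, eval]
  | _ => simp_all [wb, eval]

/-- Induction over the rounds of a loop, with what is outside the reach of the body left alone. -/
lemma eval_loop_frame {E : Env} {i j : ℕ} {p : FP} {s : NState} (P : ℕ → NState → Prop)
    (h0 : P 0 s) (hs : ∀ a < E.κ j, ∀ s' : NState, (∀ r, r ∉ i :: p.wr → s'.reg r = s.reg r) →
      (∀ b, b ∉ p.wb → s'.bank b = s.bank b) → P a s' → P (a + 1) (p.eval E (s'.setReg i a))) :
    P (E.κ j) ((loop i j p).eval E s) := by
  refine (eval_loop (fun a s' => (∀ r, r ∉ i :: p.wr → s'.reg r = s.reg r) ∧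
    (∀ b, b ∉ p.wb → s'.bank b = s.bank b) ∧ P a s') ⟨fun _ _ => rfl, fun _ _ => rfl, h0⟩ ?_).2.2
  rintro a ha s' ⟨h1, h2, h3⟩
  refine ⟨fun r hr => ?_, fun b hb => ?_, hs a ha s' h1 h2 h3⟩
  · rw [List.mem_cons, not_or] at hr
    rw [eval_reg hr.2, NState.setReg_reg, if_neg hr.1]
    exact h1 r (by simp [hr])
  · rw [eval_bank hb]
    exact h2 b hb

end FP

/-! ### Compilation of bounded-loop programs -/

/-- The machine register of a variable. Machine registers and banks are divided into classes
modulo 16, so that the parts of a composed program do not interfere. -/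
def varReg (v : ℕ) : ℕ := 16 * v + 2

/-- The machine register of the counter of a loop at nesting depth `δ`. -/
def ctrReg (δ : ℕ) : ℕ := 16 * δ + 3

/-- The machine register of a constant of the environment. -/
def cstReg (j : ℕ) : ℕ := 16 * j + 4

/-- A scratch register. -/
def tmpReg : ℕ := 5

/-- A second scratch register. -/
def tmpReg' : ℕ := 21

/-- The machine bank of a bank of a bounded-loop program. The banks `0` and `1` are shared with
the program relocated to class `8`. -/
def bankOf (b : ℕ) : ℕ := if b < 2 then 16 * b + 8 else 16 * b + 2

lemma bankOf_injective : bankOf.Injective := by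
  intro a b h
  unfold bankOf at h
  split_ifs at h <;> omega

namespace FP

/-- The machine program for a bounded-loop program at nesting depth `δ`. -/
def compile {F : Set (ℝ → ℝ)} : ℕ → FP → Prog F
  | _, skip => .skip
  | _, const r z => .const (varReg r) z
  | _, setc r j => .seq (.const tmpReg 0) (.arith .plus (varReg r) (cstReg j) tmpReg)
  | _, addl r s z => .seq (.const tmpReg z) (.arith .plus (varReg r) (varReg s) tmpReg)
  | _, addc r s j => .arith .plus (varReg r) (varReg s) (cstReg j)
  | _, addv r s t => .arith .plus (varReg r) (varReg s) (varReg t)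
  | _, inp pos r s j t =>
    .seq (.arith .times tmpReg (varReg s) (cstReg j)) <|
    .seq (.arith .plus tmpReg tmpReg (varReg t)) <|
    .seq (.load 0 tmpReg' tmpReg) <|
    .seq (.const tmpReg 0) <|
      if pos then
        .branch tmpReg tmpReg' (.arith .plus (varReg r) tmpReg' tmpReg) (.const (varReg r) 0)
      else
        .branch tmpReg' tmpReg (.arith .minus (varReg r) tmpReg tmpReg') (.const (varReg r) 0)
  | _, load1 b r s => .load (bankOf b) (varReg r) (varReg s)
  | _, store1 b s r => .store (bankOf b) (varReg s) (varReg r)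
  | _, load b r s j t =>
    .seq (.arith .times tmpReg (varReg s) (cstReg j)) <|
    .seq (.arith .plus tmpReg tmpReg (varReg t)) (.load (bankOf b) (varReg r) tmpReg)
  | _, store b s j t r =>
    .seq (.arith .times tmpReg (varReg s) (cstReg j)) <|
    .seq (.arith .plus tmpReg tmpReg (varReg t)) (.store (bankOf b) tmpReg (varReg r))
  | δ, seq p q => .seq (compile δ p) (compile δ q)
  | δ, ite r s p q => .branch (varReg r) (varReg s) (compile δ p) (compile δ q)
  | δ, ifPos r p q =>
    .seq (.const tmpReg 0) (.branch tmpReg (varReg r) (compile δ p) (compile δ q))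
  | δ, loop i j p =>
    .seq (.const (ctrReg δ) 0) <|
    .loop (ctrReg δ) (cstReg j) <|
      .seq (.const tmpReg 0) <|
      .seq (.arith .plus (varReg i) (ctrReg δ) tmpReg) <|
      .seq (compile (δ + 1) p) <|
      .seq (.const tmpReg 1) (.arith .plus (ctrReg δ) (ctrReg δ) tmpReg)

end FP

/-- The machine state `σ` represents the environment `E` and the state `s`. -/
structure Represents (E : Env) (σ : State) (s : NState) : Prop where
  var : ∀ v, σ.reg (varReg v) = s.reg v
  cst : ∀ j, σ.reg (cstReg j) = E.κ j
  bank : ∀ b i, σ.bank (bankOf b) i = s.bank b i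
  inp : ∀ i, σ.bank 0 i = E.ι i

/-- The registers that a program compiled at depth `δ` does not use. -/
def FreeReg (δ r : ℕ) : Prop :=
  (∀ v, r ≠ varReg v) ∧ (∀ δ', δ ≤ δ' → r ≠ ctrReg δ') ∧ r ≠ tmpReg ∧ r ≠ tmpReg'

/-- `σ` and `τ` differ at most in what a program compiled at depth `δ` uses. -/
def Keeps (δ : ℕ) (σ τ : State) : Prop :=
  (∀ r, FreeReg δ r → τ.reg r = σ.reg r) ∧ ∀ b, (∀ b', b ≠ bankOf b') → τ.bank b = σ.bank b

lemma Keeps.refl (δ : ℕ) (σ : State) : Keeps δ σ σ := ⟨fun _ _ => rfl, fun _ _ => rfl⟩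

lemma Keeps.trans {δ : ℕ} {σ τ υ : State} (h : Keeps δ σ τ) (h' : Keeps δ τ υ) : Keeps δ σ υ :=
  ⟨fun r hr => (h'.1 r hr).trans (h.1 r hr), fun b hb => (h'.2 b hb).trans (h.2 b hb)⟩

lemma Keeps.mono {δ δ' : ℕ} (hδ : δ ≤ δ') {σ τ : State} (h : Keeps δ' σ τ) : Keeps δ σ τ :=
  ⟨fun r hr => h.1 r ⟨hr.1, fun d hd => hr.2.1 d (hδ.trans hd), hr.2.2⟩, h.2⟩

lemma Keeps.setReg {δ : ℕ} (σ : State) {r : ℕ} (x : ℝ) (hr : ¬ FreeReg δ r) :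
    Keeps δ σ (σ.setReg r x) := by
  refine ⟨fun r' hr' => ?_, fun _ _ => rfl⟩
  have : r' ≠ r := fun h => hr (h ▸ hr')
  simp [this]

lemma Keeps.setCell {δ : ℕ} (σ : State) (b i : ℕ) (x : ℝ) :
    Keeps δ σ (σ.setCell (bankOf b) i x) := by
  refine ⟨fun _ _ => rfl, fun b' hb' => ?_⟩
  funext i'
  simp [hb' b]

lemma not_freeReg_varReg (δ v : ℕ) : ¬ FreeReg δ (varReg v) := fun h => h.1 v rfl
lemma not_freeReg_ctrReg (δ : ℕ) : ¬ FreeReg δ (ctrReg δ) := fun h => h.2.1 δ le_rfl rfl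
lemma not_freeReg_tmpReg (δ : ℕ) : ¬ FreeReg δ tmpReg := fun h => h.2.2.1 rfl
lemma not_freeReg_tmpReg' (δ : ℕ) : ¬ FreeReg δ tmpReg' := fun h => h.2.2.2 rfl

lemma Represents.setVar {E : Env} {σ : State} {s : NState} (h : Represents E σ s) (v x : ℕ) :
    Represents E (σ.setReg (varReg v) x) (s.setReg v x) where
  var v' := by
    have : varReg v' = varReg v ↔ v' = v := by unfold varReg; omega
    simp [this, h.var]
  cst j := by
    have : cstReg j ≠ varReg v := by unfold varReg cstReg; omega
    simp [this, h.cst]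
  bank := h.bank
  inp := h.inp

lemma Represents.setOther {E : Env} {σ : State} {s : NState} (h : Represents E σ s) (r : ℕ)
    (x : ℝ) (h1 : ∀ v, varReg v ≠ r) (h2 : ∀ j, cstReg j ≠ r) :
    Represents E (σ.setReg r x) s where
  var v := by simp [h1, h.var]
  cst j := by simp [h2, h.cst]
  bank := h.bank
  inp := h.inp

lemma Represents.setTmp {E : Env} {σ : State} {s : NState} (h : Represents E σ s) (x : ℝ) :
    Represents E (σ.setReg tmpReg x) s :=
  h.setOther _ _ (fun v => by unfold varReg tmpReg; omega) fun v => by unfold cstReg tmpReg; omega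

lemma Represents.setTmp' {E : Env} {σ : State} {s : NState} (h : Represents E σ s) (x : ℝ) :
    Represents E (σ.setReg tmpReg' x) s :=
  h.setOther _ _ (fun v => by unfold varReg tmpReg'; omega) fun v => by
    unfold cstReg tmpReg'; omega

lemma Represents.setCtr {E : Env} {σ : State} {s : NState} (h : Represents E σ s) (δ : ℕ) (x : ℝ) :
    Represents E (σ.setReg (ctrReg δ) x) s :=
  h.setOther _ _ (fun v => by unfold varReg ctrReg; omega) fun v => by unfold cstReg ctrReg; omega

lemma Represents.setCell {E : Env} {σ : State} {s : NState} (h : Represents E σ s) (b i x : ℕ) :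
    Represents E (σ.setCell (bankOf b) i x) (s.setCell b i x) where
  var := h.var
  cst := h.cst
  bank b' i' := by
    simp only [State.setCell_bank, NState.setCell_bank, bankOf_injective.eq_iff, h.bank]
    split_ifs <;> simp
  inp i := by
    have : (0 : ℕ) ≠ bankOf b := by unfold bankOf; split_ifs <;> omega
    simp [this, h.inp]

/-- An execution that takes `n` instructions on numbers of size at most that of `W`. -/
def ExecN (M : Model) (W : ℕ) (p : Prog M.ops) (σ τ : State) (n : ℕ) : Prop :=
  ∃ c, Exec M p σ τ c ∧ c ≤ n * (1 + 3 * M.bits W)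

namespace ExecN

variable {M : Model} {W : ℕ} {p q : Prog M.ops} {σ τ υ : State} {n n' : ℕ}

lemma mono (h : ExecN M W p σ τ n) (hn : n ≤ n') : ExecN M W p σ τ n' := by
  obtain ⟨c, hc, hle⟩ := h
  exact ⟨c, hc, hle.trans (Nat.mul_le_mul_right _ hn)⟩

lemma seq (h : ExecN M W p σ τ n) (h' : ExecN M W q τ υ n') :
    ExecN M W (.seq p q) σ υ (n + n') := by
  obtain ⟨c, hc, hle⟩ := h
  obtain ⟨c', hc', hle'⟩ := h'
  exact ⟨_, .seq hc hc', by rw [add_mul]; omega⟩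

lemma skip : ExecN M W .skip σ σ 1 := ⟨_, .skip σ, by omega⟩

lemma const (r z : ℕ) (hz : z ≤ W) : ExecN M W (.const r z) σ (σ.setReg r z) 1 := by
  refine ⟨_, .const σ r z, ?_⟩
  have := M.bits_mono hz
  rw [Model.size_intCast, Int.natAbs_natCast]
  omega

lemma plus (r s t : ℕ) {x y : ℕ} (hs : σ.reg s = x) (ht : σ.reg t = y) (h : x + y ≤ W) :
    ExecN M W (.arith .plus r s t) σ (σ.setReg r (x + y : ℕ)) 1 := by
  refine ⟨_, .arith σ .plus r s t _ (by simp) (by simp [Arith.eval, hs, ht]), ?_⟩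
  have h1 := M.bits_mono h
  have h2 := M.bits_mono (show x ≤ W by omega)
  have h3 := M.bits_mono (show y ≤ W by omega)
  rw [hs, ht]
  simp only [Model.size_natCast]
  omega

lemma times (r s t : ℕ) {x y : ℕ} (hs : σ.reg s = x) (ht : σ.reg t = y) (hx : x ≤ W) (hy : y ≤ W)
    (h : x * y ≤ W) : ExecN M W (.arith .times r s t) σ (σ.setReg r (x * y : ℕ)) 1 := by
  refine ⟨_, .arith σ .times r s t _ (by simp) (by simp [Arith.eval, hs, ht]), ?_⟩
  have h1 := M.bits_mono h
  have h2 := M.bits_mono hx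
  have h3 := M.bits_mono hy
  rw [hs, ht]
  simp only [Model.size_natCast]
  omega

/-- Moving the positive part of an integer, given that it is positive. -/
lemma plusInt (r s t : ℕ) {z : ℤ} (hs : σ.reg s = z) (ht : σ.reg t = (0 : ℕ)) (hz : 0 < z)
    (h : z.natAbs ≤ W) :
    ExecN M W (.arith .plus r s t) σ (σ.setReg r (z.toNat : ℕ)) 1 := by
  lift z to ℕ using hz.le
  have := plus (M := M) (W := W) (x := z) r s t (by simpa using hs) ht (by simpa using h)
  simpa using this

lemma minusInt (r s t : ℕ) {z : ℤ} (hs : σ.reg s = (0 : ℕ)) (ht : σ.reg t = z) (hz : z < 0)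
    (h : z.natAbs ≤ W) :
    ExecN M W (.arith .minus r s t) σ (σ.setReg r ((-z).toNat : ℕ)) 1 := by
  have hx : (((-z).toNat : ℕ) : ℝ) = -(z : ℝ) := by
    have : (((-z).toNat : ℕ) : ℤ) = -z := Int.toNat_of_nonneg (by omega)
    exact_mod_cast congrArg (Int.cast (R := ℝ)) this
  refine ⟨_, .arith σ .minus r s t _ (by simp) (by simp [Arith.eval, hs, ht, hx]), ?_⟩
  have h1 := M.bits_mono h
  have h2 := M.bits_mono (Nat.zero_le W)
  have h3 : (-z).toNat = z.natAbs := by omega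
  rw [hs, ht, h3]
  simp only [Model.size_natCast, Model.size_intCast]
  omega

lemma load (b r s : ℕ) {i : ℕ} {z : ℤ} (hs : σ.reg s = i) (hz : σ.bank b i = z) (hi : i ≤ W)
    (h : z.natAbs ≤ W) : ExecN M W (.load b r s) σ (σ.setReg r z) 1 := by
  have := Exec.load (M := M) σ b r s i hs
  rw [hz, hs] at this
  refine ⟨_, this, ?_⟩
  have h1 := M.bits_mono h
  have h2 := M.bits_mono hi
  simp only [Model.size_natCast, Model.size_intCast]
  omega

lemma store (b s r : ℕ) {i x : ℕ} (hs : σ.reg s = i) (hx : σ.reg r = x) (hi : i ≤ W)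
    (h : x ≤ W) : ExecN M W (.store b s r) σ (σ.setCell b i x) 1 := by
  have := Exec.store (M := M) σ b s r i hs
  rw [hx, hs] at this
  refine ⟨_, this, ?_⟩
  have h1 := M.bits_mono h
  have h2 := M.bits_mono hi
  simp only [Model.size_natCast]
  omega

lemma branch (r s : ℕ) {x y : ℤ} (hr : σ.reg r = x) (hs : σ.reg s = y) (hx : x.natAbs ≤ W)
    (hy : y.natAbs ≤ W) (h1 : x < y → ExecN M W p σ τ n) (h2 : ¬ x < y → ExecN M W q σ τ n) :
    ExecN M W (.branch r s p q) σ τ (1 + n) := by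
  have hb1 := M.bits_mono hx
  have hb2 := M.bits_mono hy
  rw [← Model.size_intCast] at hb1 hb2
  rw [← hr] at hb1
  rw [← hs] at hb2
  by_cases h : x < y
  · obtain ⟨c, hc, hle⟩ := h1 h
    exact ⟨_, .branchTrue (by rw [hr, hs]; exact_mod_cast h) hc, by rw [add_mul]; omega⟩
  · obtain ⟨c, hc, hle⟩ := h2 h
    exact ⟨_, .branchFalse (by rw [hr, hs]; exact_mod_cast h) hc, by rw [add_mul]; omega⟩

/-- A counting loop: `P a` holds before round `a`. -/
lemma loop (r s : ℕ) {N : ℕ} (P : ℕ → State → Prop) (hN : N ≤ W)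
    (hP : ∀ a σ, P a σ → σ.reg r = a ∧ σ.reg s = N)
    (hs : ∀ a < N, ∀ σ, P a σ → ∃ τ, ExecN M W p σ τ n ∧ P (a + 1) τ) (h0 : P 0 σ) :
    ∃ τ, ExecN M W (.loop r s p) σ τ (1 + N * (1 + n)) ∧ P N τ := by
  have hbN := M.bits_mono hN
  have key : ∀ m a σ, a + m = N → P a σ →
      ∃ τ, ExecN M W (.loop r s p) σ τ (1 + m * (1 + n)) ∧ P N τ := by
    intro m
    induction m with
    | zero =>
      intro a σ ha hσ
      obtain ⟨hr, hs'⟩ := hP a σ hσ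
      have haN : a = N := by omega
      subst haN
      refine ⟨σ, ⟨_, .loopFalse (by rw [hr, hs']; simp), ?_⟩, hσ⟩
      rw [hr, hs', Model.size_natCast]
      omega
    | succ m ih =>
      intro a σ ha hσ
      obtain ⟨hr, hs'⟩ := hP a σ hσ
      obtain ⟨τ, ⟨c, hc, hle⟩, hτ⟩ := hs a (by omega) σ hσ
      obtain ⟨υ, ⟨c', hc', hle'⟩, hυ⟩ := ih (a + 1) τ (by omega) hτ
      refine ⟨υ, ⟨_, .loopTrue (by rw [hr, hs']; exact_mod_cast (by omega : a < N)) hc hc', ?_⟩, hυ⟩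
      have hba := M.bits_mono (show a ≤ W by omega)
      rw [hr, hs', Model.size_natCast, Model.size_natCast]
      have : (1 + (m + 1) * (1 + n)) * (1 + 3 * M.bits W) =
          (1 + m * (1 + n)) * (1 + 3 * M.bits W) + n * (1 + 3 * M.bits W) +
          (1 + 3 * M.bits W) := by ring
      omega
  exact key N 0 σ (by omega) h0

end ExecN

namespace FP

/-- The compiled program computes `eval`, with a constant number of instructions per step. -/
theorem exec_compile {M : Model} {E : Env} {Δ Z : ℕ} (hE : E.BddBy Δ) (hZ : 1 ≤ Z) (hΔ : Δ ≤ Z)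
    {p : FP} (hp : p.LitLe Δ) (δ : ℕ) {s : NState} {X : ℕ} (hs : s.BddBy X)
    (hX : 2 ^ p.adds E * (X + Δ * p.steps E) ≤ Z) {σ : State} (hσ : Represents E σ s) :
    ∃ τ, ExecN M (Z * Z + Z) (p.compile δ) σ τ (6 * p.steps E) ∧ Represents E τ (p.eval E s) ∧
      Keeps δ σ τ := by
  have hZW : Z ≤ Z * Z + Z := by omega
  induction p generalizing δ s X σ with
  | skip => exact ⟨σ, ExecN.skip.mono (by simp [steps]), hσ, .refl _ _⟩
  | const r z =>
    have hz : z ≤ Δ := hp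
    exact ⟨_, (ExecN.const (varReg r) z (by omega)).mono (by simp [steps]), hσ.setVar r z,
      .setReg _ _ (not_freeReg_varReg _ _)⟩
  | setc r j =>
    have hj := hE.1 j
    have h1 := ExecN.const (M := M) (W := Z * Z + Z) (σ := σ) tmpReg 0 (by omega)
    have r1 := hσ.setTmp ((0 : ℕ) : ℝ)
    have h2 := ExecN.plus (M := M) (W := Z * Z + Z) (varReg r) (cstReg j) tmpReg (r1.cst j)
      (y := 0) (by simp) (by omega)
    exact ⟨_, (h1.seq h2).mono (by simp [steps]), r1.setVar r _,
      (Keeps.setReg _ _ (not_freeReg_tmpReg _)).trans (.setReg _ _ (not_freeReg_varReg _ _))⟩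
  | addl r t z =>
    have hz : z ≤ Δ := hp
    have ht := hs.1 t
    simp only [adds, steps, pow_zero, one_mul, mul_one] at hX
    have h1 := ExecN.const (M := M) (W := Z * Z + Z) (σ := σ) tmpReg z (by omega)
    have r1 := hσ.setTmp (z : ℝ)
    have h2 := ExecN.plus (M := M) (W := Z * Z + Z) (varReg r) (varReg t) tmpReg (r1.var t)
      (y := z) (by simp) (by omega)
    exact ⟨_, (h1.seq h2).mono (by simp [steps]), r1.setVar r _,
      (Keeps.setReg _ _ (not_freeReg_tmpReg _)).trans (.setReg _ _ (not_freeReg_varReg _ _))⟩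
  | addc r t j =>
    have hj := hE.1 j
    have ht := hs.1 t
    simp only [adds, steps, pow_zero, one_mul, mul_one] at hX
    have h2 := ExecN.plus (M := M) (W := Z * Z + Z) (varReg r) (varReg t) (cstReg j) (hσ.var t)
      (hσ.cst j) (by omega)
    exact ⟨_, h2.mono (by simp [steps]), hσ.setVar r _, .setReg _ _ (not_freeReg_varReg _ _)⟩
  | addv r t u =>
    have ht := hs.1 t
    have hu := hs.1 u
    simp only [adds, steps, pow_one, mul_one] at hX
    have h2 := ExecN.plus (M := M) (W := Z * Z + Z) (varReg r) (varReg t) (varReg u) (hσ.var t)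
      (hσ.var u) (by omega)
    exact ⟨_, h2.mono (by simp [steps]), hσ.setVar r _, .setReg _ _ (not_freeReg_varReg _ _)⟩
  | inp pos r t j u =>
    have ht := hs.1 t
    have hu := hs.1 u
    have hj := hE.1 j
    simp only [adds, steps, pow_zero, one_mul, mul_one] at hX
    have hm : s.reg t * E.κ j ≤ Z * Z := Nat.mul_le_mul (by omega) (by omega)
    set a := s.reg t * E.κ j with ha
    have h1 := ExecN.times (M := M) (W := Z * Z + Z) tmpReg (varReg t) (cstReg j) (hσ.var t)
      (hσ.cst j) (by omega) (by omega) (by omega)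
    have r1 := hσ.setTmp ((a : ℕ) : ℝ)
    have h2 := ExecN.plus (M := M) (W := Z * Z + Z) tmpReg tmpReg (varReg u)
      (σ := σ.setReg tmpReg (a : ℕ)) (x := a) (by simp) (r1.var u) (by omega)
    have r2 := r1.setTmp ((a + s.reg u : ℕ) : ℝ)
    have hz := hE.2 (a + s.reg u)
    have h3 := ExecN.load (M := M) (W := Z * Z + Z) 0 tmpReg' tmpReg
      (σ := (σ.setReg tmpReg (a : ℕ)).setReg tmpReg (a + s.reg u : ℕ)) (i := a + s.reg u) (by simp)
      (r2.inp _) (by omega) (by omega)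
    have r3 := r2.setTmp' ((E.ι (a + s.reg u) : ℤ) : ℝ)
    have h4 := ExecN.const (M := M) (W := Z * Z + Z) tmpReg 0
      (σ := ((σ.setReg tmpReg (a : ℕ)).setReg tmpReg (a + s.reg u : ℕ)).setReg tmpReg'
        (E.ι (a + s.reg u) : ℤ)) (by omega)
    have r4 := r3.setTmp ((0 : ℕ) : ℝ)
    set z := E.ι (a + s.reg u) with hzdef
    have keep : Keeps δ σ ((((σ.setReg tmpReg (a : ℕ)).setReg tmpReg (a + s.reg u : ℕ)).setReg
        tmpReg' (z : ℝ)).setReg tmpReg ((0 : ℕ) : ℝ)) :=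
      (((Keeps.setReg _ _ (not_freeReg_tmpReg _)).trans (.setReg _ _ (not_freeReg_tmpReg _))).trans
        (.setReg _ _ (not_freeReg_tmpReg' _))).trans (.setReg _ _ (not_freeReg_tmpReg _))
    set σ4 := ((((σ.setReg tmpReg (a : ℕ)).setReg tmpReg (a + s.reg u : ℕ)).setReg
        tmpReg' (z : ℝ)).setReg tmpReg ((0 : ℕ) : ℝ)) with hσ4
    have e1 : σ4.reg tmpReg = ((0 : ℕ) : ℝ) := by simp [hσ4]
    have e1' : σ4.reg tmpReg = ((0 : ℤ) : ℝ) := by simp [hσ4]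
    have e2 : σ4.reg tmpReg' = (z : ℝ) := by simp [hσ4, tmpReg, tmpReg']
    have h0 : (0 : ℤ).natAbs ≤ Z * Z + Z := by simp
    have hzW : z.natAbs ≤ Z * Z + Z := by omega
    have pre {P : Prog M.ops} {τ : State} (hP : ExecN M (Z * Z + Z) P σ4 τ 2) :=
      (h1.seq (h2.seq (h3.seq (h4.seq hP))))
    cases pos with
    | true =>
      refine ⟨σ4.setReg (varReg r) (z.toNat : ℕ), (pre ?_).mono (by simp [steps]),
        r4.setVar r _, keep.trans (.setReg _ _ (not_freeReg_varReg _ _))⟩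
      refine ExecN.branch (n := 1) _ _ e1' e2 h0 hzW (fun h => ?_) fun h => ?_
      · exact ExecN.plusInt _ _ _ e2 e1 h hzW
      · have : z.toNat = 0 := by omega
        rw [this]
        exact ExecN.const _ 0 (by omega)
    | false =>
      refine ⟨σ4.setReg (varReg r) ((-z).toNat : ℕ), (pre ?_).mono (by simp [steps]),
        r4.setVar r _, keep.trans (.setReg _ _ (not_freeReg_varReg _ _))⟩
      refine ExecN.branch (n := 1) _ _ e2 e1' hzW h0 (fun h => ?_) fun h => ?_
      · exact ExecN.minusInt _ _ _ e1 e2 h hzW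
      · have : (-z).toNat = 0 := by omega
        rw [this]
        exact ExecN.const _ 0 (by omega)
  | load1 b r t =>
    have ht := hs.1 t
    have hb := hs.2 b (s.reg t)
    simp only [adds, steps, pow_zero, one_mul, mul_one] at hX
    have h1 := ExecN.load (M := M) (W := Z * Z + Z) (bankOf b) (varReg r) (varReg t)
      (z := (s.bank b (s.reg t) : ℕ)) (hσ.var t) (by simp [hσ.bank]) (by omega) (by simp; omega)
    rw [Int.cast_natCast] at h1
    exact ⟨_, h1.mono (by simp [steps]), hσ.setVar r _, .setReg _ _ (not_freeReg_varReg _ _)⟩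
  | store1 b t r =>
    have ht := hs.1 t
    have hr := hs.1 r
    simp only [adds, steps, pow_zero, one_mul, mul_one] at hX
    exact ⟨_, (ExecN.store (bankOf b) (varReg t) (varReg r) (hσ.var t) (hσ.var r) (by omega)
      (by omega)).mono (by simp [steps]), hσ.setCell b _ _, .setCell _ _ _ _⟩
  | load b r t j u =>
    have ht := hs.1 t
    have hu := hs.1 u
    have hj := hE.1 j
    simp only [adds, steps, pow_zero, one_mul, mul_one] at hX
    have hm : s.reg t * E.κ j ≤ Z * Z := Nat.mul_le_mul (by omega) (by omega)
    have h1 := ExecN.times (M := M) (W := Z * Z + Z) tmpReg (varReg t) (cstReg j) (hσ.var t)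
      (hσ.cst j) (by omega) (by omega) (by omega)
    have r1 := hσ.setTmp ((s.reg t * E.κ j : ℕ) : ℝ)
    have h2 := ExecN.plus (M := M) (W := Z * Z + Z) tmpReg tmpReg (varReg u)
      (σ := σ.setReg tmpReg (s.reg t * E.κ j : ℕ)) (x := s.reg t * E.κ j) (by simp) (r1.var u)
      (by omega)
    have r2 := r1.setTmp ((s.reg t * E.κ j + s.reg u : ℕ) : ℝ)
    have hb := hs.2 b (s.reg t * E.κ j + s.reg u)
    have h3 := ExecN.load (M := M) (W := Z * Z + Z) (bankOf b) (varReg r) tmpReg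
      (σ := (σ.setReg tmpReg (s.reg t * E.κ j : ℕ)).setReg tmpReg (s.reg t * E.κ j + s.reg u : ℕ))
      (z := (s.bank b (s.reg t * E.κ j + s.reg u) : ℕ)) (i := s.reg t * E.κ j + s.reg u) (by simp)
      (by simp only [r2.bank, Int.cast_natCast]) (by omega) (by simp; omega)
    rw [Int.cast_natCast] at h3
    exact ⟨_, (h1.seq (h2.seq h3)).mono (by simp [steps]), r2.setVar r _,
      ((Keeps.setReg _ _ (not_freeReg_tmpReg _)).trans (.setReg _ _ (not_freeReg_tmpReg _))).trans
        (.setReg _ _ (not_freeReg_varReg _ _))⟩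
  | store b t j u r =>
    have ht := hs.1 t
    have hu := hs.1 u
    have hj := hE.1 j
    have hr := hs.1 r
    simp only [adds, steps, pow_zero, one_mul, mul_one] at hX
    have hm : s.reg t * E.κ j ≤ Z * Z := Nat.mul_le_mul (by omega) (by omega)
    have h1 := ExecN.times (M := M) (W := Z * Z + Z) tmpReg (varReg t) (cstReg j) (hσ.var t)
      (hσ.cst j) (by omega) (by omega) (by omega)
    have r1 := hσ.setTmp ((s.reg t * E.κ j : ℕ) : ℝ)
    have h2 := ExecN.plus (M := M) (W := Z * Z + Z) tmpReg tmpReg (varReg u)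
      (σ := σ.setReg tmpReg (s.reg t * E.κ j : ℕ)) (x := s.reg t * E.κ j) (by simp) (r1.var u)
      (by omega)
    have r2 := r1.setTmp ((s.reg t * E.κ j + s.reg u : ℕ) : ℝ)
    have h3 := ExecN.store (M := M) (W := Z * Z + Z) (bankOf b) tmpReg (varReg r)
      (σ := (σ.setReg tmpReg (s.reg t * E.κ j : ℕ)).setReg tmpReg (s.reg t * E.κ j + s.reg u : ℕ))
      (i := s.reg t * E.κ j + s.reg u) (by simp) (r2.var r) (by omega) (by omega)
    exact ⟨_, (h1.seq (h2.seq h3)).mono (by simp [steps]), r2.setCell b _ _,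
      ((Keeps.setReg _ _ (not_freeReg_tmpReg _)).trans (.setReg _ _ (not_freeReg_tmpReg _))).trans
        (.setCell _ _ _ _)⟩
  | seq p q ihp ihq =>
    simp only [adds, steps] at hX
    have hX2 : 2 ^ q.adds E * (2 ^ p.adds E * (X + Δ * p.steps E) + Δ * q.steps E) ≤ Z := by
      refine le_trans ?_ hX
      have h1 : 1 ≤ 2 ^ p.adds E := Nat.one_le_two_pow
      calc 2 ^ q.adds E * (2 ^ p.adds E * (X + Δ * p.steps E) + Δ * q.steps E)
          ≤ 2 ^ q.adds E * (2 ^ p.adds E * (X + Δ * p.steps E) +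
            2 ^ p.adds E * (Δ * q.steps E)) := by
            refine Nat.mul_le_mul_left _ (Nat.add_le_add_left ?_ _)
            exact Nat.le_mul_of_pos_left _ h1
        _ = _ := by rw [pow_add]; ring
    have hX1 : 2 ^ p.adds E * (X + Δ * p.steps E) ≤ Z :=
      ((Nat.le_add_right _ _).trans (Nat.le_mul_of_pos_left _ (by positivity))).trans hX2
    obtain ⟨τ, e1, r1, k1⟩ := ihp hp.1 δ hs hX1 hσ
    obtain ⟨υ, e2, r2, k2⟩ := ihq hp.2 δ (bddBy_eval hE hp.1 hs) hX2 r1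
    exact ⟨υ, (e1.seq e2).mono (by simp [steps]; omega), r2, k1.trans k2⟩
  | ite r t p q ihp ihq =>
    simp only [adds, steps] at hX
    have hX1 : 2 ^ p.adds E * (X + Δ * p.steps E) ≤ Z := by
      refine le_trans ?_ hX
      gcongr <;> omega
    have hX2 : 2 ^ q.adds E * (X + Δ * q.steps E) ≤ Z := by
      refine le_trans ?_ hX
      gcongr <;> omega
    have hXZ : X ≤ Z :=
      ((Nat.le_add_right _ _).trans (Nat.le_mul_of_pos_left _ (by positivity))).trans hX1
    have hr := hs.1 r
    have ht := hs.1 t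
    have er : σ.reg (varReg r) = ((s.reg r : ℤ) : ℝ) := by simp [hσ.var]
    have et : σ.reg (varReg t) = ((s.reg t : ℤ) : ℝ) := by simp [hσ.var]
    by_cases h : s.reg r < s.reg t
    · obtain ⟨τ, e1, r1, k1⟩ := ihp hp.1 δ hs hX1 hσ
      refine ⟨τ, (ExecN.branch _ _ er et (by simp; omega) (by simp; omega) (fun _ => e1)
        fun h' => absurd (by exact_mod_cast h) h').mono ?_, by simpa [eval, h] using r1, k1⟩
      simp only [steps]
      omega
    · obtain ⟨τ, e1, r1, k1⟩ := ihq hp.2 δ hs hX2 hσ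
      refine ⟨τ, (ExecN.branch _ _ er et (by simp; omega) (by simp; omega)
        (fun h' => absurd (by exact_mod_cast h') h) fun _ => e1).mono ?_,
        by simpa [eval, h] using r1, k1⟩
      simp only [steps]
      omega
  | ifPos r p q ihp ihq =>
    simp only [adds, steps] at hX
    have hX1 : 2 ^ p.adds E * (X + Δ * p.steps E) ≤ Z := by
      refine le_trans ?_ hX
      gcongr <;> omega
    have hX2 : 2 ^ q.adds E * (X + Δ * q.steps E) ≤ Z := by
      refine le_trans ?_ hX
      gcongr <;> omega
    have hXZ : X ≤ Z :=
      ((Nat.le_add_right _ _).trans (Nat.le_mul_of_pos_left _ (by positivity))).trans hX1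
    have hr := hs.1 r
    have h0 := ExecN.const (M := M) (W := Z * Z + Z) (σ := σ) tmpReg 0 (by omega)
    have r0 := hσ.setTmp ((0 : ℕ) : ℝ)
    have k0 : Keeps δ σ _ := Keeps.setReg σ ((0 : ℕ) : ℝ) (not_freeReg_tmpReg δ)
    have er : (σ.setReg tmpReg ((0 : ℕ) : ℝ)).reg tmpReg = ((0 : ℤ) : ℝ) := by simp
    have et : (σ.setReg tmpReg ((0 : ℕ) : ℝ)).reg (varReg r) = ((s.reg r : ℤ) : ℝ) := by
      rw [r0.var]; simp
    by_cases h : 0 < s.reg r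
    · obtain ⟨τ, e1, r1, k1⟩ := ihp hp.1 δ hs hX1 r0
      refine ⟨τ, (h0.seq (ExecN.branch _ _ er et (by simp) (by simp; omega) (fun _ => e1)
        fun h' => absurd (by exact_mod_cast h) h')).mono ?_, by simpa [eval, h] using r1,
            k0.trans k1⟩
      simp only [steps]
      omega
    · obtain ⟨τ, e1, r1, k1⟩ := ihq hp.2 δ hs hX2 r0
      refine ⟨τ, (h0.seq (ExecN.branch _ _ er et (by simp) (by simp; omega)
        (fun h' => absurd (by exact_mod_cast h') h) fun _ => e1)).mono ?_,
        by simpa [eval, h] using r1, k0.trans k1⟩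
      simp only [steps]
      omega
  | loop i j p ih =>
    have hj := hE.1 j
    have h0 := ExecN.const (M := M) (W := Z * Z + Z) (σ := σ) (ctrReg δ) 0 (by omega)
    have hcv : ∀ v, ctrReg δ ≠ varReg v := fun v => by unfold ctrReg varReg; omega
    have hct : ctrReg δ ≠ tmpReg := by unfold ctrReg tmpReg; omega
    have hct' : ctrReg δ ≠ tmpReg' := by unfold ctrReg tmpReg'; omega
    have hfree : FreeReg (δ + 1) (ctrReg δ) :=
      ⟨hcv, fun δ' h => by unfold ctrReg; omega, hct, hct'⟩
    -- the state before round `a` of the loop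
    let S : ℕ → NState := fun a => Nat.rec s (fun a s' => p.eval E (s'.setReg i a)) a
    have hS : ∀ a, S (a + 1) = p.eval E ((S a).setReg i a) := fun a => rfl
    have hbd : ∀ a ≤ E.κ j,
        (S a).BddBy (2 ^ (a * p.adds E) * (X + Δ * (1 + a * (1 + p.steps E)))) ∧
        ((S a).setReg i a).BddBy (2 ^ (a * p.adds E) * (X + Δ * (1 + a * (1 + p.steps E)))) := by
      have aux : ∀ a ≤ E.κ j, a ≤ 2 ^ (a * p.adds E) * (X + Δ * (1 + a * (1 + p.steps E))) := by
        intro a ha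
        have h3 : Δ ≤ Δ * (1 + a * (1 + p.steps E)) := Nat.le_mul_of_pos_right _ (by omega)
        calc a ≤ X + Δ * (1 + a * (1 + p.steps E)) := by omega
          _ ≤ _ := Nat.le_mul_of_pos_left _ (by positivity)
      intro a
      induction a with
      | zero =>
        intro h
        have : (S 0).BddBy (2 ^ (0 * p.adds E) * (X + Δ * (1 + 0 * (1 + p.steps E)))) :=
          hs.mono (by simp)
        exact ⟨this, this.setReg (by simp)⟩
      | succ a iha =>
        intro h
        have := bddBy_eval (p := p) hE hp (iha (by omega)).2
        rw [← hS] at this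
        have h4 : (S (a + 1)).BddBy
            (2 ^ ((a + 1) * p.adds E) * (X + Δ * (1 + (a + 1) * (1 + p.steps E)))) := by
          refine this.mono ?_
          calc 2 ^ p.adds E * (2 ^ (a * p.adds E) * (X + Δ * (1 + a * (1 + p.steps E))) +
                Δ * p.steps E)
              ≤ 2 ^ p.adds E * (2 ^ (a * p.adds E) * (X + Δ * (1 + a * (1 + p.steps E))) +
                2 ^ (a * p.adds E) * (Δ * (1 + p.steps E))) := by
                refine Nat.mul_le_mul_left _ (Nat.add_le_add_left ?_ _)
                calc Δ * p.steps E ≤ Δ * (1 + p.steps E) := by gcongr; omega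
                  _ ≤ _ := Nat.le_mul_of_pos_left _ (by positivity)
            _ = _ := by rw [add_mul, pow_add]; ring
        exact ⟨h4, h4.setReg (aux _ h)⟩
    have hlt : ∀ a < E.κ j, 2 ^ p.adds E * (2 ^ (a * p.adds E) *
        (X + Δ * (1 + a * (1 + p.steps E))) + Δ * p.steps E) ≤ Z := by
      intro a ha
      refine le_trans ?_ hX
      simp only [adds, steps]
      calc 2 ^ p.adds E * (2 ^ (a * p.adds E) * (X + Δ * (1 + a * (1 + p.steps E))) +
            Δ * p.steps E)
          ≤ 2 ^ p.adds E * (2 ^ (a * p.adds E) * (X + Δ * (1 + a * (1 + p.steps E))) +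
            2 ^ (a * p.adds E) * (Δ * (1 + p.steps E))) := by
            refine Nat.mul_le_mul_left _ (Nat.add_le_add_left ?_ _)
            calc Δ * p.steps E ≤ Δ * (1 + p.steps E) := by gcongr; omega
              _ ≤ _ := Nat.le_mul_of_pos_left _ (by positivity)
        _ = 2 ^ ((a + 1) * p.adds E) * (X + Δ * (1 + (a + 1) * (1 + p.steps E))) := by
            rw [add_mul, pow_add]; ring
        _ ≤ _ := by gcongr <;> omega
    obtain ⟨τ, e1, hτ1, hτ2, hτ3⟩ := ExecN.loop (M := M) (W := Z * Z + Z) (n := 4 + 6 * p.steps E)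
      (p := .seq (.const tmpReg 0) <|
        .seq (.arith .plus (varReg i) (ctrReg δ) tmpReg) <|
        .seq (compile (δ + 1) p) <|
        .seq (.const tmpReg 1) (.arith .plus (ctrReg δ) (ctrReg δ) tmpReg))
      (σ := σ.setReg (ctrReg δ) ((0 : ℕ) : ℝ)) (ctrReg δ) (cstReg j) (N := E.κ j)
      (fun a σ' => σ'.reg (ctrReg δ) = a ∧ Represents E σ' (S a) ∧ Keeps δ σ σ') (by omega)
      (fun a σ' h => ⟨h.1, h.2.1.cst j⟩) (by
        rintro a ha σ' ⟨hc, hr, hk⟩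
        have g1 := ExecN.const (M := M) (W := Z * Z + Z) (σ := σ') tmpReg 0 (by omega)
        have r1 := hr.setTmp ((0 : ℕ) : ℝ)
        have g2 := ExecN.plus (M := M) (W := Z * Z + Z) (σ := σ'.setReg tmpReg ((0 : ℕ) : ℝ))
          (varReg i) (ctrReg δ) tmpReg (x := a) (y := 0) (by simp [hct, hc]) (by simp) (by omega)
        have r2 := r1.setVar i (a + 0)
        have k2 := (hk.trans (Keeps.setReg _ ((0 : ℕ) : ℝ) (not_freeReg_tmpReg δ))).trans
          (Keeps.setReg _ ((a + 0 : ℕ) : ℝ) (not_freeReg_varReg δ i))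
        obtain ⟨τ, g3, r3, k3⟩ := ih hp (δ + 1) (hbd a ha.le).2 (hlt a ha) r2
        have c3 : τ.reg (ctrReg δ) = a := by
          rw [k3.1 _ hfree]
          simp [hct, hcv, hc]
        have g4 := ExecN.const (M := M) (W := Z * Z + Z) (σ := τ) tmpReg 1 (by omega)
        have r4 := r3.setTmp ((1 : ℕ) : ℝ)
        have g5 := ExecN.plus (M := M) (W := Z * Z + Z) (σ := τ.setReg tmpReg ((1 : ℕ) : ℝ))
          (ctrReg δ) (ctrReg δ) tmpReg (x := a) (y := 1) (by simp [hct, c3]) (by simp) (by omega)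
        refine ⟨_, (g1.seq (g2.seq (g3.seq (g4.seq g5)))).mono (by omega), by simp, ?_, ?_⟩
        · rw [hS]
          exact r4.setCtr δ _
        · exact ((k2.trans (k3.mono (by omega))).trans
            (Keeps.setReg _ _ (not_freeReg_tmpReg _))).trans
            (Keeps.setReg _ _ (not_freeReg_ctrReg _)))
      ⟨by simp, hσ.setCtr δ _, Keeps.setReg _ _ (not_freeReg_ctrReg _)⟩
    refine ⟨τ, (h0.seq e1).mono ?_, hτ2, hτ3⟩
    simp only [steps]
    calc 1 + (1 + E.κ j * (1 + (4 + 6 * p.steps E))) = 2 + E.κ j * (5 + 6 * p.steps E) := by ring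
      _ ≤ 6 + E.κ j * (6 + 6 * p.steps E) := by gcongr <;> omega
      _ = _ := by ring

end FP

/-! ### Sparsification of set families -/

namespace Sparsify

/-- The members of size `i` that contain `G`. -/
def above (F : Finset (Finset ℕ)) (i : ℕ) (G : Finset ℕ) : Finset (Finset ℕ) :=
  F.filter fun D => D.card = i ∧ G ⊆ D

/-- The number of members of size `i` that contain `G`. -/
def deg (F : Finset (Finset ℕ)) (i : ℕ) (G : Finset ℕ) : ℕ := (above F i G).card

/-- The members of size `i`. -/
def slice (F : Finset (Finset ℕ)) (i : ℕ) : Finset (Finset ℕ) := F.filter fun D => D.card = i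

/-- The number of petals of size `i` from which on a sunflower counts as large. -/
def thr (α i : ℕ) : ℕ := α ^ (3 * i - 1)

/-- Add the members of `P` and drop all sets that have become redundant. -/
def insS (F P : Finset (Finset ℕ)) : Finset (Finset ℕ) :=
  P ∪ F.filter fun D => ∀ C ∈ P, ¬ C ⊆ D

/-- The petals of the sunflower that consists of the members of size `c` containing `H`. -/
def petals (F : Finset (Finset ℕ)) (c : ℕ) (H : Finset ℕ) : Finset (Finset ℕ) :=
  (above F c H).image fun D => D \ H

/-- The intersection of `t` and `t'` is the heart of a large sunflower of sets of size `c` with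
petals of size `i`. Only hearts of this form are considered; this is enough for sparsification
since the thresholds grow quickly. -/
structure IsSun (α : ℕ) (F : Finset (Finset ℕ)) (c i : ℕ) (t t' : Finset ℕ) : Prop where
  left : t ∈ F
  right : t' ∈ F
  card_left : t.card = c
  card_right : t'.card = c
  card_inter : (t ∩ t').card + i = c
  large : thr α i ≤ deg F c (t ∩ t')

/-- No pair of sets of size `c` spans a large sunflower with petals of size `i`. -/
def NoSun (α : ℕ) (F : Finset (Finset ℕ)) (c i : ℕ) : Prop := ∀ t t', ¬ IsSun α F c i t t'

variable {α k Λ : ℕ} {F P : Finset (Finset ℕ)} {A : ℕ → ℕ} {c i p : ℕ} {G H : Finset ℕ}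

lemma mem_above {D : Finset ℕ} : D ∈ above F i G ↔ D ∈ F ∧ D.card = i ∧ G ⊆ D := by
  simp [above]

lemma mem_insS {D : Finset ℕ} : D ∈ insS F P ↔ D ∈ P ∨ D ∈ F ∧ ∀ C ∈ P, ¬ C ⊆ D := by
  simp [insS]

lemma thr_pos (hα : 0 < α) (i : ℕ) : 0 < thr α i := Nat.pow_pos hα

lemma thr_mono (hα : 0 < α) {i j : ℕ} (h : i ≤ j) : thr α i ≤ thr α j :=
  Nat.pow_le_pow_right hα (by omega)

/-- Without large sunflowers, every set is contained in few members. Either some two members meet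
exactly in `G`, or all members above `G` contain one of the larger sets `S ⊆ C₀`, for a fixed
member `C₀`. -/
lemma deg_lt_of_noSun (hα : 2 ^ k + 2 ≤ α) (hck : c ≤ k) (i : ℕ)
    (hno : ∀ i', 1 ≤ i' → i' ≤ i → NoSun α F c i') (hG : G.card + i = c) (hi : 1 ≤ i) :
    deg F c G < thr α i := by
  have hα0 : 0 < α := lt_of_lt_of_le (by positivity) hα
  have hthr1 : α ≤ thr α i := by
    have := Nat.pow_le_pow_right hα0 (show 1 ≤ 3 * i - 1 by omega)
    simpa [thr] using this
  rcases (above F c G).eq_empty_or_nonempty with h0 | ⟨C₀, hC₀⟩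
  · simp [deg, h0, thr_pos hα0]
  by_cases hpair : ∃ t ∈ above F c G, ∃ t' ∈ above F c G, t ∩ t' = G
  · obtain ⟨t, ht, t', ht', rfl⟩ := hpair
    by_contra hlt
    rw [mem_above] at ht ht'
    exact hno i hi le_rfl t t' ⟨ht.1, ht'.1, ht.2.1, ht'.2.1, hG, by omega⟩
  · push Not at hpair
    have hC₀' := mem_above.1 hC₀
    -- the possible intersections of `C₀` with other members
    let 𝒮 := C₀.powerset.filter fun S => 1 ≤ c - S.card ∧ c - S.card + 1 ≤ i ∧
      ∃ C ∈ above F c G, C ∩ C₀ = S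
    have hcover : above F c G ⊆ {C₀} ∪ 𝒮.biUnion fun S => above F c S := by
      intro C hC
      rw [Finset.mem_union, Finset.mem_singleton, Finset.mem_biUnion]
      by_cases hCC : C = C₀
      · exact Or.inl hCC
      right
      have hC' := mem_above.1 hC
      have h1 : G ⊆ C ∩ C₀ := Finset.subset_inter hC'.2.2 hC₀'.2.2
      have h2 : G.card < (C ∩ C₀).card :=
        Finset.card_lt_card (h1.ssubset_of_ne (hpair C hC C₀ hC₀).symm)
      have h3 : (C ∩ C₀).card < c := by
        rw [← hC₀'.2.1]
        refine Finset.card_lt_card (Finset.inter_subset_right.ssubset_of_ne fun h => hCC ?_)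
        have : C₀ ⊆ C := h ▸ Finset.inter_subset_left
        exact (Finset.eq_of_subset_of_card_le this (by rw [hC'.2.1, hC₀'.2.1])).symm
      refine ⟨C ∩ C₀, ?_, mem_above.2 ⟨hC'.1, hC'.2.1, Finset.inter_subset_left⟩⟩
      rw [Finset.mem_filter, Finset.mem_powerset]
      exact ⟨Finset.inter_subset_right, by omega, by omega, C, hC, rfl⟩
    have hS : ∀ S ∈ 𝒮, (above F c S).card ≤ thr α (i - 1) := by
      intro S hS
      rw [Finset.mem_filter] at hS
      obtain ⟨-, h1, h2, C, hC, rfl⟩ := hS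
      have hC' := mem_above.1 hC
      by_contra hlt
      have hle : thr α (c - (C ∩ C₀).card) ≤ thr α (i - 1) := thr_mono hα0 (by omega)
      refine hno (c - (C ∩ C₀).card) h1 (by omega) C C₀
        ⟨hC'.1, hC₀'.1, hC'.2.1, hC₀'.2.1, by omega, ?_⟩
      rw [deg]
      omega
    have hcard : 𝒮.card ≤ 2 ^ k := by
      refine (Finset.card_filter_le _ _).trans ?_
      rw [Finset.card_powerset, hC₀'.2.1]
      exact Nat.pow_le_pow_right (by norm_num) hck
    have hmain : deg F c G ≤ 1 + 𝒮.card * thr α (i - 1) := by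
      refine (Finset.card_le_card hcover).trans ((Finset.card_union_le _ _).trans ?_)
      rw [Finset.card_singleton]
      exact Nat.add_le_add_left (Finset.card_biUnion_le_card_mul _ _ _ hS) _
    by_cases hi1 : i = 1
    · have : 𝒮 = ∅ := by
        refine Finset.filter_eq_empty_iff.2 fun S _ h => ?_
        omega
      rw [this, Finset.card_empty] at hmain
      omega
    · have e1 : thr α i = thr α (i - 1) * α ^ 3 := by
        rw [thr, thr, ← pow_add]
        congr 1
        omega
      have e2 := thr_pos hα0 (i - 1)
      calc deg F c G ≤ 1 + 2 ^ k * thr α (i - 1) := hmain.trans (by gcongr)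
        _ < 2 * thr α (i - 1) + 2 ^ k * thr α (i - 1) := by omega
        _ ≤ thr α (i - 1) * α := by rw [← add_mul, mul_comm]; gcongr; omega
        _ ≤ thr α i := by rw [e1]; gcongr; exact Nat.le_self_pow (by norm_num) α

/-- The invariant of sparsification; `A i` is the number of sets of size `i` added so far. Sets of
size `i` are added only when no large sunflower of sets of size `i` is left (`dense`), and so the
addition of a smaller set removes few sets of size `i` (`amort`). -/
structure Inv (α k Λ : ℕ) (F : Finset (Finset ℕ)) (A : ℕ → ℕ) : Prop where
  anti : ∀ C ∈ F, ∀ D ∈ F, C ⊆ D → C = D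
  size : ∀ C ∈ F, C.card ≤ k
  sub : ∀ C ∈ F, C ⊆ Finset.range Λ
  dense : ∀ i, A i = 0 ∨ ∀ G : Finset ℕ, 1 ≤ G.card → G.card < i →
      deg F i G ≤ 2 * thr α (i - G.card)
  amort : ∀ i, A i ≤ (slice F i).card + ∑ j ∈ Finset.Ico 1 i, 2 * thr α (i - j) * A j
  zero : ∀ i, (i = 0 ∨ k ≤ i) → A i = 0

/-- The invariant is preserved by the addition of sets of size `p`, each a proper subset of some
member, if the sets of size `p` remain spread out. -/
lemma Inv.insS (h : Inv α k Λ F A) (hP : ∀ C ∈ P, C.card = p) (hp1 : 1 ≤ p) (hpk : p < k)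
    (hsub : ∀ C ∈ P, ∃ D ∈ F, C ⊂ D)
    (hdeg : ∀ G : Finset ℕ, 1 ≤ G.card → G.card < p →
      deg F p G + (P.filter fun C => G ⊆ C).card ≤ 2 * thr α (p - G.card)) :
    Inv α k Λ (insS F P) (Function.update A p (A p + P.card)) := by
  have hnot : ∀ C ∈ P, ∀ D ∈ F, ¬ D ⊆ C := by
    intro C hC D hD hDC
    obtain ⟨D', hD', hlt⟩ := hsub C hC
    have := h.anti D hD D' hD' (hDC.trans hlt.1)
    exact hlt.2 (this ▸ hDC)
  refine ⟨?_, ?_, ?_, ?_, ?_, ?_⟩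
  · intro C hC D hD hCD
    rcases mem_insS.1 hC with hC | hC <;> rcases mem_insS.1 hD with hD | hD
    · exact Finset.eq_of_subset_of_card_le hCD (by rw [hP C hC, hP D hD])
    · exact absurd hCD (hD.2 C hC)
    · exact absurd hCD (hnot D hD C hC.1)
    · exact h.anti C hC.1 D hD.1 hCD
  · intro C hC
    rcases mem_insS.1 hC with hC | hC
    · rw [hP C hC]; omega
    · exact h.size C hC.1
  · intro C hC
    rcases mem_insS.1 hC with hC | hC
    · obtain ⟨D, hD, hlt⟩ := hsub C hC
      exact hlt.1.trans (h.sub D hD)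
    · exact h.sub C hC.1
  · intro i
    by_cases hip : i = p
    · subst hip
      right
      intro G h1 h2
      refine le_trans ?_ (hdeg G h1 h2)
      refine le_trans (Finset.card_le_card (t := above F i G ∪ P.filter fun C => G ⊆ C) ?_)
        (Finset.card_union_le _ _)
      intro D hD
      rw [mem_above, mem_insS] at hD
      rw [Finset.mem_union, mem_above, Finset.mem_filter]
      tauto
    · rw [Function.update_of_ne hip]
      refine (h.dense i).imp id fun hd G h1 h2 => le_trans (Finset.card_le_card ?_) (hd G h1 h2)
      intro D hD
      rw [mem_above, mem_insS] at hD
      rw [mem_above]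
      obtain ⟨hD | hD, h3, h4⟩ := hD
      · exact absurd ((hP D hD).symm.trans h3).symm hip
      · exact ⟨hD.1, h3, h4⟩
  · intro i
    have hsum : ∑ j ∈ Finset.Ico 1 i, 2 * thr α (i - j) * Function.update A p (A p + P.card) j =
        ∑ j ∈ Finset.Ico 1 i, 2 * thr α (i - j) * A j +
          if p < i then 2 * thr α (i - p) * P.card else 0 := by
      have : ∀ j ∈ Finset.Ico 1 i, 2 * thr α (i - j) * Function.update A p (A p + P.card) j =
          2 * thr α (i - j) * A j + if j = p then 2 * thr α (i - p) * P.card else 0 := by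
        intro j _
        by_cases hj : j = p
        · subst hj; simp; ring
        · simp [hj]
      rw [Finset.sum_congr rfl this, Finset.sum_add_distrib, Finset.sum_ite_eq']
      simp [hp1]
    rw [hsum]
    rcases lt_trichotomy i p with hip | rfl | hip
    · rw [Function.update_of_ne hip.ne, if_neg (by omega), add_zero]
      refine (h.amort i).trans (Nat.add_le_add_right (Finset.card_le_card ?_) _)
      intro D hD
      rw [slice, Finset.mem_filter] at hD ⊢
      refine ⟨mem_insS.2 (Or.inr ⟨hD.1, fun C hC hCD => ?_⟩), hD.2⟩
      have := Finset.card_le_card hCD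
      rw [hP C hC] at this
      omega
    · rw [Function.update_self, if_neg (by omega), add_zero]
      have hle : (slice F i).card + P.card ≤ (slice (Sparsify.insS F P) i).card := by
        rw [← Finset.card_union_of_disjoint]
        · refine Finset.card_le_card fun D hD => ?_
          rw [slice, Finset.mem_filter, mem_insS]
          rw [Finset.mem_union, slice, Finset.mem_filter] at hD
          rcases hD with hD | hD
          · refine ⟨Or.inr ⟨hD.1, fun C hC hCD => ?_⟩, hD.2⟩
            have := Finset.eq_of_subset_of_card_le hCD (by rw [hP C hC, hD.2])
            exact hnot C hC D hD.1 this.ge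
          · exact ⟨Or.inl hD, hP D hD⟩
        · rw [Finset.disjoint_left]
          intro D hD hDP
          exact hnot D hDP D (Finset.mem_filter.1 hD).1 le_rfl
      have := h.amort i
      omega
    · rw [Function.update_of_ne hip.ne', if_pos hip]
      rcases h.dense i with h0 | hd
      · omega
      have hle : (slice F i).card ≤ (slice (Sparsify.insS F P) i).card +
          P.card * (2 * thr α (i - p)) := by
        refine (Finset.card_le_card (t := slice (Sparsify.insS F P) i ∪
          P.biUnion fun C => above F i C) ?_).trans ((Finset.card_union_le _ _).trans
            (Nat.add_le_add_left (Finset.card_biUnion_le_card_mul _ _ _ fun C hC => ?_) _))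
        · intro D hD
          rw [slice, Finset.mem_filter] at hD
          rw [Finset.mem_union, Finset.mem_biUnion, slice, Finset.mem_filter, mem_insS]
          by_cases hC : ∃ C ∈ P, C ⊆ D
          · obtain ⟨C, hC, hCD⟩ := hC
            exact Or.inr ⟨C, hC, mem_above.2 ⟨hD.1, hD.2, hCD⟩⟩
          · push Not at hC
            exact Or.inl ⟨Or.inr ⟨hD.1, hC⟩, hD.2⟩
        · have := hd C (by rw [hP C hC]; exact hp1) (by rw [hP C hC]; exact hip)
          rwa [hP C hC] at this
      have := h.amort i
      have e : P.card * (2 * thr α (i - p)) = 2 * thr α (i - p) * P.card := by ring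
      omega
  · intro i hi
    rw [Function.update_of_ne (by omega)]
    exact h.zero i hi

/-- The sunflowers with smaller members, or with members of the same size and smaller petals, are
all small. -/
def Best (α k : ℕ) (F : Finset (Finset ℕ)) (c i : ℕ) (H : Finset ℕ) : Prop :=
  1 ≤ i ∧ i < c ∧ c ≤ k ∧ (∃ t t', IsSun α F c i t t' ∧ H = t ∩ t') ∧
    ∀ c' i', (c' < c ∨ c' = c ∧ i' < i) → 1 ≤ i' → i' < c' → NoSun α F c' i'

lemma Best.card_heart (h : Best α k F c i H) : H.card + i = c := by
  obtain ⟨-, -, -, ⟨t, t', hs, rfl⟩, -⟩ := h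
  exact hs.card_inter

lemma card_petals (F : Finset (Finset ℕ)) (c : ℕ) (H : Finset ℕ) :
    (petals F c H).card = deg F c H := by
  refine Finset.card_image_of_injOn fun C hC D hD hCD => ?_
  have h1 := (mem_above.1 hC).2.2
  have h2 := (mem_above.1 hD).2.2
  rw [← Finset.sdiff_union_of_subset h1, ← Finset.sdiff_union_of_subset h2]
  exact congrArg (· ∪ H) hCD

lemma Best.le_card_petals (h : Best α k F c i H) : thr α i ≤ (petals F c H).card := by
  obtain ⟨-, -, -, ⟨t, t', hs, rfl⟩, -⟩ := h
  rw [card_petals]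
  exact hs.large

lemma Best.deg_lt (h : Best α k F c i H) (hα : 2 ^ k + 2 ≤ α) {c' : ℕ} (hc : c' < c)
    (h1 : 1 ≤ G.card) (h2 : G.card < c') : deg F c' G < thr α (c' - G.card) := by
  obtain ⟨-, -, hck, -, hno⟩ := h
  exact deg_lt_of_noSun hα (by omega) _ (fun i' h3 h4 => hno c' i' (Or.inl hc) h3 (by omega))
    (by omega) (by omega)

lemma Inv.heart (h : Inv α k Λ F A) (hα : 2 ^ k + 2 ≤ α) (hb : Best α k F c i H) :
    Inv α k Λ (Sparsify.insS F {H}) (Function.update A (c - i) (A (c - i) + 1)) := by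
  have hH := hb.card_heart
  have hα0 : 0 < α := lt_of_lt_of_le (by positivity) hα
  obtain ⟨hi1, hic, hck, ⟨t, t', hs, rfl⟩, -⟩ := id hb
  have := Inv.insS (P := {t ∩ t'}) (p := c - i) h (by simp; omega) (by omega) (by omega) ?_ ?_
  · simpa using this
  · intro C hC
    rw [Finset.mem_singleton] at hC
    subst hC
    refine ⟨t, hs.left, Finset.inter_subset_left.ssubset_of_ne fun h => ?_⟩
    have h2 := hs.card_left
    rw [h] at hH
    omega
  · intro G h1 h2
    have h3 := hb.deg_lt hα (c' := c - i) (by omega) h1 h2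
    have h4 := Finset.card_filter_le {t ∩ t'} fun C => G ⊆ C
    rw [Finset.card_singleton] at h4
    omega

lemma Inv.petals (h : Inv α k Λ F A) (hα : 2 ^ k + 2 ≤ α) (hb : Best α k F c i H) :
    Inv α k Λ (Sparsify.insS F (Sparsify.petals F c H))
      (Function.update A i (A i + (Sparsify.petals F c H).card)) := by
  have hH := hb.card_heart
  obtain ⟨hi1, hic, hck, -, hno⟩ := id hb
  refine Inv.insS (p := i) h ?_ hi1 (by omega) ?_ ?_
  · intro C hC
    obtain ⟨D, hD, rfl⟩ := Finset.mem_image.1 hC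
    rw [mem_above] at hD
    rw [Finset.card_sdiff_of_subset hD.2.2]
    omega
  · intro C hC
    obtain ⟨D, hD, rfl⟩ := Finset.mem_image.1 hC
    rw [mem_above] at hD
    refine ⟨D, hD.1, Finset.sdiff_subset.ssubset_of_ne fun h => ?_⟩
    have h2 := Finset.card_sdiff_of_subset hD.2.2
    rw [h] at h2
    omega
  · intro G h1 h2
    have h3 := hb.deg_lt hα (c' := i) hic h1 h2
    have h4 : ((Sparsify.petals F c H).filter fun C => G ⊆ C).card ≤ thr α (i - G.card) := by
      by_cases hGH : Disjoint G H
      · have h5 : deg F c (H ∪ G) < thr α (i - G.card) := by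
          have hu : (H ∪ G).card = H.card + G.card := Finset.card_union_of_disjoint hGH.symm
          refine deg_lt_of_noSun hα hck _ (fun i' h6 h7 => hno c i' (Or.inr ⟨rfl, by omega⟩) h6
            (by omega)) (by omega) (by omega)
        refine le_trans ?_ h5.le
        rw [deg]
        refine le_trans (Finset.card_le_card (t := (above F c (H ∪ G)).image fun D => D \ H) ?_)
          Finset.card_image_le
        intro C hC
        rw [Finset.mem_filter, Sparsify.petals, Finset.mem_image] at hC
        obtain ⟨⟨D, hD, rfl⟩, hG⟩ := hC
        rw [mem_above] at hD
        exact Finset.mem_image.2 ⟨D, mem_above.2 ⟨hD.1, hD.2.1,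
          Finset.union_subset hD.2.2 (hG.trans Finset.sdiff_subset)⟩, rfl⟩
      · have : ((Sparsify.petals F c H).filter fun C => G ⊆ C) = ∅ := by
          refine Finset.filter_eq_empty_iff.2 fun C hC hG => hGH ?_
          obtain ⟨D, hD, rfl⟩ := Finset.mem_image.1 hC
          exact Finset.disjoint_of_subset_left hG Finset.sdiff_disjoint
        simp [this]
    omega

/-- A family with few members of size `i` above each point has few members of size `i`. -/
lemma card_slice_le (hsub : ∀ C ∈ F, C ⊆ Finset.range Λ) (hi : 1 ≤ i) {N : ℕ}
    (h : ∀ l, deg F i {l} ≤ N) : (slice F i).card ≤ Λ * N := by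
  refine (Finset.card_le_card (t := (Finset.range Λ).biUnion fun l => above F i {l}) ?_).trans
    ((Finset.card_biUnion_le_card_mul _ _ N fun l _ => h l).trans (by simp))
  intro C hC
  rw [slice, Finset.mem_filter] at hC
  obtain ⟨l, hl⟩ : C.Nonempty := Finset.card_pos.1 (by omega)
  rw [Finset.mem_biUnion]
  exact ⟨l, hsub C hC.1 hl, mem_above.2 ⟨hC.1, hC.2, by simpa using hl⟩⟩

/-- There is only one set of size `1` above a point. -/
lemma deg_one_le (F : Finset (Finset ℕ)) (l : ℕ) : deg F 1 {l} ≤ 1 := by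
  refine Finset.card_le_one.2 fun C hC D hD => ?_
  rw [mem_above] at hC hD
  rw [← Finset.eq_of_subset_of_card_le hC.2.2 (by simp [hC.2.1]),
    ← Finset.eq_of_subset_of_card_le hD.2.2 (by simp [hD.2.1])]

/-- By `amort`, the numbers of added sets satisfy a recursion; the exponents of the thresholds `thr`
are chosen such that it has a bound of the same form. -/
lemma Inv.added_le (h : Inv α k Λ F A) (hα : 2 * k ≤ α) (hα2 : 2 ≤ α) (i : ℕ) (hi : 1 ≤ i) :
    A i ≤ Λ * α ^ (3 * i - 2) := by
  induction i using Nat.strong_induction_on with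
  | _ i ih =>
    by_cases h0 : A i = 0
    · omega
    have hik : i < k := by
      by_contra hk
      exact h0 (h.zero i (by omega))
    have hd := (h.dense i).resolve_left h0
    have hs : (slice F i).card ≤ Λ * (2 * thr α (i - 1)) := by
      refine card_slice_le h.sub hi fun l => ?_
      by_cases hi1 : i = 1
      · subst hi1
        have := deg_one_le F l
        have := thr_pos (show 0 < α by omega) (1 - 1)
        omega
      · simpa using hd {l} (by simp) (by simp; omega)
    have hsum : ∑ j ∈ Finset.Ico 1 i, 2 * thr α (i - j) * A j ≤
        (i - 1) * (2 * Λ * α ^ (3 * i - 3)) := by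
      refine (Finset.sum_le_card_nsmul _ _ (2 * Λ * α ^ (3 * i - 3)) fun j hj => ?_).trans
        (by simp)
      rw [Finset.mem_Ico] at hj
      calc 2 * thr α (i - j) * A j ≤ 2 * thr α (i - j) * (Λ * α ^ (3 * j - 2)) := by
            gcongr
            exact ih j hj.2 hj.1
        _ = 2 * Λ * (α ^ (3 * (i - j) - 1) * α ^ (3 * j - 2)) := by rw [thr]; ring
        _ = 2 * Λ * α ^ (3 * i - 3) := by
            rw [← pow_add]
            congr 2
            omega
    have h1 : thr α (i - 1) ≤ α ^ (3 * i - 3) := Nat.pow_le_pow_right (by omega) (by omega)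
    calc A i ≤ Λ * (2 * α ^ (3 * i - 3)) + (i - 1) * (2 * Λ * α ^ (3 * i - 3)) :=
          (h.amort i).trans (Nat.add_le_add (hs.trans (by gcongr)) hsum)
      _ = Λ * (α ^ (3 * i - 3) * (2 * (1 + (i - 1)))) := by ring
      _ ≤ Λ * (α ^ (3 * i - 3) * α) := by gcongr; omega
      _ = Λ * α ^ (3 * i - 2) := by
          rw [← pow_succ]
          congr 2
          omega

/-- In total, the number of added sets is linear in the number of points. -/
lemma Inv.sum_added_le (h : Inv α k Λ F A) (hα : 2 * k ≤ α) (hα2 : 2 ≤ α) :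
    ∑ i ∈ Finset.range k, A i ≤ Λ * α ^ (3 * k) := by
  have h1 : ∀ i ∈ Finset.range k, A i ≤ Λ * α ^ (3 * k - 1) := by
    intro i hi
    rw [Finset.mem_range] at hi
    by_cases h0 : i = 0
    · rw [h.zero i (Or.inl h0)]
      omega
    · refine (h.added_le hα hα2 i (by omega)).trans ?_
      gcongr <;> omega
  refine (Finset.sum_le_card_nsmul _ _ _ h1).trans ?_
  rw [Finset.card_range, smul_eq_mul]
  rcases Nat.eq_zero_or_pos k with rfl | hk
  · simp
  calc k * (Λ * α ^ (3 * k - 1)) ≤ α * (Λ * α ^ (3 * k - 1)) := by gcongr; omega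
    _ = Λ * α ^ (3 * k - 1 + 1) := by rw [pow_succ]; ring
    _ = Λ * α ^ (3 * k) := by
        congr 2
        omega

/-- A family without large sunflowers has linearly many members. -/
lemma card_le_of_noSun (hα : 2 ^ k + 2 ≤ α) (hsize : ∀ C ∈ F, C.card ≤ k)
    (hsub : ∀ C ∈ F, C ⊆ Finset.range Λ)
    (hno : ∀ c i, 1 ≤ i → i < c → c ≤ k → NoSun α F c i) :
    F.card ≤ 1 + k * (Λ * α ^ (3 * k)) := by
  have hα0 : 0 < α := lt_of_lt_of_le (by positivity) hα
  have h0 : (slice F 0).card ≤ 1 := by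
    refine Finset.card_le_one.2 fun C hC D hD => ?_
    rw [slice, Finset.mem_filter, Finset.card_eq_zero] at hC hD
    rw [hC.2, hD.2]
  have h1 : ∀ c ∈ Finset.Icc 1 k, (slice F c).card ≤ Λ * α ^ (3 * k) := by
    intro c hc
    rw [Finset.mem_Icc] at hc
    refine card_slice_le hsub hc.1 fun l => ?_
    by_cases hc1 : c = 1
    · subst hc1
      exact (deg_one_le F l).trans (Nat.one_le_pow _ _ (by omega))
    · have := deg_lt_of_noSun (F := F) (c := c) (G := {l}) hα hc.2 (c - 1)
        (fun i' h1 h2 => hno c i' h1 (by omega) hc.2) (by simp; omega) (by omega)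
      refine this.le.trans (Nat.pow_le_pow_right (by omega) (by omega))
  have hcover : F ⊆ slice F 0 ∪ (Finset.Icc 1 k).biUnion (slice F) := by
    intro C hC
    rw [Finset.mem_union, Finset.mem_biUnion]
    by_cases hC0 : C.card = 0
    · exact Or.inl (Finset.mem_filter.2 ⟨hC, hC0⟩)
    · exact Or.inr ⟨C.card, Finset.mem_Icc.2 ⟨by omega, hsize C hC⟩, Finset.mem_filter.2 ⟨hC, rfl⟩⟩
  calc F.card ≤ _ := (Finset.card_le_card hcover).trans (Finset.card_union_le _ _)
    _ ≤ 1 + (Finset.Icc 1 k).card * (Λ * α ^ (3 * k)) :=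
        Nat.add_le_add h0 (Finset.card_biUnion_le_card_mul _ _ _ h1)
    _ = _ := by simp

/-- `T` meets every member: the set of true literals satisfies every clause. -/
def Hits (T : Finset ℕ) (F : Finset (Finset ℕ)) : Prop := ∀ C ∈ F, ∃ l ∈ C, l ∈ T

lemma Hits.of_insS {T : Finset ℕ} (h : Hits T (insS F P)) : Hits T F := by
  intro D hD
  by_cases hC : ∃ C ∈ P, C ⊆ D
  · obtain ⟨C, hC, hCD⟩ := hC
    obtain ⟨l, hl, hlT⟩ := h C (mem_insS.2 (Or.inl hC))
    exact ⟨l, hCD hl, hlT⟩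
  · push Not at hC
    exact h D (mem_insS.2 (Or.inr ⟨hD, hC⟩))

lemma Hits.insS {T : Finset ℕ} (h : Hits T F) (hP : Hits T P) : Hits T (insS F P) := by
  intro D hD
  rcases mem_insS.1 hD with hD | hD
  exacts [hP D hD, h D hD.1]

/-- If no point of the heart is hit, then all petals are. -/
lemma Hits.petals {T : Finset ℕ} (h : Hits T F) (hH : ¬ ∃ l ∈ H, l ∈ T) :
    Hits T (petals F c H) := by
  intro C hC
  obtain ⟨D, hD, rfl⟩ := Finset.mem_image.1 hC
  obtain ⟨l, hl, hlT⟩ := h D (mem_above.1 hD).1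
  exact ⟨l, Finset.mem_sdiff.2 ⟨hl, fun hlH => hH ⟨l, hlH, hlT⟩⟩, hlT⟩

end Sparsify

/-! ### Vector routines -/

/-- Sequential composition. -/
infixr:60 " ;; " => FP.seq

namespace FP

/-- `if r = t then p` -/
def ifEq (r t : ℕ) (p : FP) : FP := ite r t skip (ite t r skip p)

lemma eval_ifEq {E : Env} {r t : ℕ} {p : FP} {s : NState} :
    (ifEq r t p).eval E s = if s.reg r = s.reg t then p.eval E s else s := by
  simp only [ifEq, eval]
  split_ifs <;> first | rfl | omega

@[simp] lemma wr_ifEq (r t : ℕ) (p : FP) : (ifEq r t p).wr = p.wr := by simp [ifEq, wr]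
@[simp] lemma wb_ifEq (r t : ℕ) (p : FP) : (ifEq r t p).wb = p.wb := by simp [ifEq, wb]

/-- The set whose characteristic vector (up to the values of the positive entries) is row `t` of
bank `b`. The constant `1` is the row length. -/
def vec (E : Env) (s : NState) (b t : ℕ) : Finset ℕ :=
  (Finset.range (E.κ 1)).filter fun l => 0 < s.bank b (t * E.κ 1 + l)

lemma mem_vec {E : Env} {s : NState} {b t l : ℕ} :
    l ∈ vec E s b t ↔ l < E.κ 1 ∧ 0 < s.bank b (t * E.κ 1 + l) := by simp [vec]

lemma vec_congr {E : Env} {s s' : NState} {b : ℕ} (h : s'.bank b = s.bank b) (t : ℕ) :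
    vec E s' b t = vec E s b t := by simp [vec, h]

/-- Register `5 :=` is row `r₁` of bank `b₁` contained in row `r₂` of bank `b₂`? -/
def subV (b₁ r₁ b₂ r₂ : ℕ) : FP :=
  const 5 1 ;;
  loop 2 1 (load b₁ 3 r₁ 1 2 ;; load b₂ 4 r₂ 1 2 ;; ifPos 3 (ifPos 4 skip (const 5 0)) skip)

@[simp] lemma wr_subV (b₁ r₁ b₂ r₂ : ℕ) : (subV b₁ r₁ b₂ r₂).wr = [5, 2, 3, 4, 5] := by
  simp [subV, wr]
@[simp] lemma wb_subV (b₁ r₁ b₂ r₂ : ℕ) : (subV b₁ r₁ b₂ r₂).wb = [] := by simp [subV, wb]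

lemma eval_subV {E : Env} {s : NState} {b₁ r₁ b₂ r₂ : ℕ} (h₁ : r₁ ∉ [2, 3, 4, 5])
    (h₂ : r₂ ∉ [2, 3, 4, 5]) :
    ((subV b₁ r₁ b₂ r₂).eval E s).reg 5 =
      if vec E s b₁ (s.reg r₁) ⊆ vec E s b₂ (s.reg r₂) then 1 else 0 := by
  simp only [List.mem_cons, List.not_mem_nil, or_false, not_or] at h₁ h₂
  have key : ((subV b₁ r₁ b₂ r₂).eval E s).reg 5 =
      if ∀ l < E.κ 1, 0 < s.bank b₁ (s.reg r₁ * E.κ 1 + l) →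
        0 < s.bank b₂ (s.reg r₂ * E.κ 1 + l) then 1 else 0 := by
    rw [subV, eval]
    refine eval_loop_frame (fun a s' => s'.reg 5 = if ∀ l < a,
      0 < s.bank b₁ (s.reg r₁ * E.κ 1 + l) → 0 < s.bank b₂ (s.reg r₂ * E.κ 1 + l) then 1 else 0)
      (by simp [eval]) fun a ha s' hf hb h5 => ?_
    have hr1 : s'.reg r₁ = s.reg r₁ := by
      rw [hf r₁ (by simp [wr, h₁])]; simp [eval, h₁]
    have hr2 : s'.reg r₂ = s.reg r₂ := by
      rw [hf r₂ (by simp [wr, h₂])]; simp [eval, h₂]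
    have hb' : s'.bank = s.bank := funext fun b => hb b (by simp [wb])
    simp only [Nat.forall_lt_succ_right, eval, NState.setReg_reg, NState.setReg_bank, h₁, h₂, hr1,
      hr2, hb', if_false]
    by_cases hA : ∀ l < a, 0 < s.bank b₁ (s.reg r₁ * E.κ 1 + l) →
      0 < s.bank b₂ (s.reg r₂ * E.κ 1 + l)
    · rw [if_pos hA] at h5
      simp only [and_iff_right hA]
      by_cases hB : 0 < s.bank b₁ (s.reg r₁ * E.κ 1 + a) <;>
      by_cases hC : 0 < s.bank b₂ (s.reg r₂ * E.κ 1 + a) <;>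
      simp [hB, hC, h5]
    · rw [if_neg hA] at h5
      simp only [hA, false_and, if_false]
      by_cases hB : 0 < s.bank b₁ (s.reg r₁ * E.κ 1 + a) <;>
      by_cases hC : 0 < s.bank b₂ (s.reg r₂ * E.κ 1 + a) <;>
      simp [hB, hC, h5]
  rw [key]
  congr 1
  simp only [Finset.subset_iff, mem_vec, eq_iff_iff]
  exact ⟨fun h l hl => ⟨hl.1, h l hl.1 hl.2⟩, fun h l hl hp => (h ⟨hl, hp⟩).2⟩

/-- Register `6 :=` the cardinality of row `r` of bank `b`. -/
def cardV (b r : ℕ) : FP := const 6 0 ;; loop 2 1 (load b 3 r 1 2 ;; ifPos 3 (addl 6 6 1) skip)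

@[simp] lemma wr_cardV (b r : ℕ) : (cardV b r).wr = [6, 2, 3, 6] := by simp [cardV, wr]
@[simp] lemma wb_cardV (b r : ℕ) : (cardV b r).wb = [] := by simp [cardV, wb]

lemma eval_cardV {E : Env} {s : NState} {b r : ℕ} (hr : r ∉ [2, 3, 6]) :
    ((cardV b r).eval E s).reg 6 = (vec E s b (s.reg r)).card := by
  simp only [List.mem_cons, List.not_mem_nil, or_false, not_or] at hr
  rw [cardV, eval]
  refine eval_loop_frame (fun a s' => s'.reg 6 =
    ((Finset.range a).filter fun l => 0 < s.bank b (s.reg r * E.κ 1 + l)).card)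
    (by simp [eval]) fun a ha s' hf hb h6 => ?_
  have hr1 : s'.reg r = s.reg r := by
    rw [hf r (by simp [wr, hr])]; simp [eval, hr]
  have hb' : s'.bank = s.bank := funext fun b => hb b (by simp [wb])
  rw [Finset.range_add_one, Finset.filter_insert]
  by_cases hB : 0 < s.bank b (s.reg r * E.κ 1 + a) <;> simp [eval, hr, hr1, hb', hB, h6]

/-- Row `r` of bank `b :=` the intersection (the difference, if `neg`) of row `r₁` of bank `b₁`
and row `r₂` of bank `b₂`. -/
def interV (neg : Bool) (b₁ r₁ b₂ r₂ b r : ℕ) : FP :=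
  loop 2 1 (load b₁ 3 r₁ 1 2 ;; load b₂ 4 r₂ 1 2 ;; const 6 0 ;;
    ifPos 3 (if neg then ifPos 4 skip (const 6 1) else ifPos 4 (const 6 1) skip) skip ;;
    store b r 1 2 6)

@[simp] lemma wr_interV (neg : Bool) (b₁ r₁ b₂ r₂ b r : ℕ) :
    (interV neg b₁ r₁ b₂ r₂ b r).wr = [2, 3, 4, 6, 6] := by cases neg <;> simp [interV, wr]
@[simp] lemma wb_interV (neg : Bool) (b₁ r₁ b₂ r₂ b r : ℕ) :
    (interV neg b₁ r₁ b₂ r₂ b r).wb = [b] := by cases neg <;> simp [interV, wb]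

/-- An address determines its row. -/
lemma row_unique {w t t' l l' : ℕ} (hl : l < w) (hl' : l' < w) (h : t * w + l = t' * w + l') :
    t = t' := by
  have h1 := congrArg (· / w) h
  simp only [add_comm (_ * w)] at h1
  rwa [Nat.add_mul_div_right _ _ (by omega), Nat.add_mul_div_right _ _ (by omega),
    Nat.div_eq_of_lt hl, Nat.div_eq_of_lt hl', zero_add, zero_add] at h1

lemma eval_interV {E : Env} {s : NState} (neg : Bool) {b₁ r₁ b₂ r₂ b r : ℕ}
    (h₁ : r₁ ∉ [2, 3, 4, 6]) (h₂ : r₂ ∉ [2, 3, 4, 6]) (hr : r ∉ [2, 3, 4, 6]) (hb₁ : b₁ ≠ b)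
    (hb₂ : b₂ ≠ b) :
    vec E ((interV neg b₁ r₁ b₂ r₂ b r).eval E s) b (s.reg r) =
      (if neg then vec E s b₁ (s.reg r₁) \ vec E s b₂ (s.reg r₂)
        else vec E s b₁ (s.reg r₁) ∩ vec E s b₂ (s.reg r₂)) ∧
    ∀ t ≠ s.reg r, vec E ((interV neg b₁ r₁ b₂ r₂ b r).eval E s) b t = vec E s b t := by
  simp only [List.mem_cons, List.not_mem_nil, or_false, not_or] at h₁ h₂ hr
  obtain ⟨hin, hout⟩ : (∀ l < E.κ 1,
      0 < ((interV neg b₁ r₁ b₂ r₂ b r).eval E s).bank b (s.reg r * E.κ 1 + l) ↔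
        0 < s.bank b₁ (s.reg r₁ * E.κ 1 + l) ∧
        (neg = true ↔ s.bank b₂ (s.reg r₂ * E.κ 1 + l) = 0)) ∧
      ∀ i, (∀ l < E.κ 1, i ≠ s.reg r * E.κ 1 + l) →
        ((interV neg b₁ r₁ b₂ r₂ b r).eval E s).bank b i = s.bank b i := by
    rw [interV]
    refine eval_loop_frame (fun a s' => (∀ l < a,
      0 < s'.bank b (s.reg r * E.κ 1 + l) ↔ 0 < s.bank b₁ (s.reg r₁ * E.κ 1 + l) ∧
        (neg = true ↔ s.bank b₂ (s.reg r₂ * E.κ 1 + l) = 0)) ∧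
      ∀ i, (∀ l < a, i ≠ s.reg r * E.κ 1 + l) → s'.bank b i = s.bank b i)
      (by simp) ?_
    rintro a ha s' hf hb ⟨hin, hout⟩
    have hr1 : s'.reg r₁ = s.reg r₁ := hf r₁ (by cases neg <;> simp [wr, h₁])
    have hr2 : s'.reg r₂ = s.reg r₂ := hf r₂ (by cases neg <;> simp [wr, h₂])
    have hr3 : s'.reg r = s.reg r := hf r (by cases neg <;> simp [wr, hr])
    have hb1 : s'.bank b₁ = s.bank b₁ := hb b₁ (by cases neg <;> simp [wb, hb₁])
    have hb2 : s'.bank b₂ = s.bank b₂ := hb b₂ (by cases neg <;> simp [wb, hb₂])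
    have hval : ∃ v, (0 < v ↔ 0 < s.bank b₁ (s.reg r₁ * E.κ 1 + a) ∧
        (neg = true ↔ s.bank b₂ (s.reg r₂ * E.κ 1 + a) = 0)) ∧
        ((load b₁ 3 r₁ 1 2 ;; load b₂ 4 r₂ 1 2 ;; const 6 0 ;;
        ifPos 3 (if neg then ifPos 4 skip (const 6 1) else ifPos 4 (const 6 1) skip) skip ;;
        store b r 1 2 6).eval E (s'.setReg 2 a)).bank b =
          fun i => if i = s.reg r * E.κ 1 + a then v else s'.bank b i := by
      obtain hB | hB := Nat.eq_zero_or_pos (s.bank b₁ (s.reg r₁ * E.κ 1 + a)) <;>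
      obtain hC | hC := Nat.eq_zero_or_pos (s.bank b₂ (s.reg r₂ * E.κ 1 + a)) <;>
      cases neg <;>
      simp [eval, h₁, h₂, hr, hr1, hr2, hr3, hb1, hb2, hB, hC, funext_iff] <;>
      first
      | exact ⟨0, by omega, fun i => rfl⟩
      | exact ⟨1, by omega, fun i => rfl⟩
    obtain ⟨v, hv, hval⟩ := hval
    rw [hval]
    refine ⟨fun l hl => ?_, fun i hi => ?_⟩
    · by_cases hla : l = a
      · subst hla
        simpa using hv
      · simpa [hla] using hin l (by omega)
    · have := hi a (by omega)
      simp only [this, if_false]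
      exact hout i fun l hl => hi l (by omega)
  refine ⟨?_, fun t ht => ?_⟩
  · ext l
    by_cases hl : l < E.κ 1
    · have := hin l hl
      cases neg
      · simp [mem_vec, hl] at this ⊢
        rw [this]
        omega
      · simp [mem_vec, hl] at this ⊢
        rw [this]
    · cases neg <;> simp [mem_vec, hl]
  · ext l
    rw [mem_vec, mem_vec]
    refine and_congr_right fun hl => ?_
    rw [hout]
    exact fun l' hl' h => ht (row_unique hl hl' h)

/-- Row `r` of bank `b :=` the empty set. -/
def clearV (b r z : ℕ) : FP := loop 2 1 (store b r 1 2 z)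

@[simp] lemma wr_clearV (b r z : ℕ) : (clearV b r z).wr = [2] := by simp [clearV, wr]
@[simp] lemma wb_clearV (b r z : ℕ) : (clearV b r z).wb = [b] := by simp [clearV, wb]

end FP

/-! ### Families of sets in memory -/

namespace FP

/-- The rows of bank `2` that are in use. Bank `3` holds the flags, and the constant `2` is the
number of rows. -/
def live (E : Env) (s : NState) : Finset ℕ := (Finset.range (E.κ 2)).filter fun t => 0 < s.bank 3 t

lemma mem_live {E : Env} {s : NState} {t : ℕ} : t ∈ live E s ↔ t < E.κ 2 ∧ 0 < s.bank 3 t := by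
  simp [live]

/-- The family of sets in memory. -/
def fam (E : Env) (s : NState) : Finset (Finset ℕ) := (live E s).image (vec E s 2)

/-- Rows from the number in register `9` on are free, and the rows in use are distinct. -/
structure Good (E : Env) (s : NState) : Prop where
  zero : s.reg 0 = 0
  free : ∀ t, s.reg 9 ≤ t → s.bank 3 t = 0
  inj : Set.InjOn (vec E s 2) (live E s)

lemma live_congr {E : Env} {s s' : NState} (h : s'.bank 3 = s.bank 3) : live E s' = live E s := by
  simp [live, h]

lemma fam_congr {E : Env} {s s' : NState} (h2 : s'.bank 2 = s.bank 2) (h3 : s'.bank 3 = s.bank 3) :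
    fam E s' = fam E s := by
  rw [fam, fam, live_congr h3]
  congr 1
  exact funext fun t => vec_congr h2 t

lemma Good.congr {E : Env} {s s' : NState} (h : Good E s) (h0 : s'.reg 0 = s.reg 0)
    (h9 : s'.reg 9 = s.reg 9) (h2 : s'.bank 2 = s.bank 2) (h3 : s'.bank 3 = s.bank 3) :
    Good E s' := by
  refine ⟨h0.trans h.zero, by rw [h9, h3]; exact h.free, ?_⟩
  rw [live_congr h3]
  have : vec E s' 2 = vec E s 2 := funext fun t => vec_congr h2 t
  rw [this]
  exact h.inj

/-- Register `8 :=` is some member of the family contained in the set in bank `4`? -/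
def insTest : FP :=
  const 8 0 ;;
  loop 21 2 (load1 3 7 21 ;; ifPos 7 (subV 2 21 4 0 ;; ifPos 5 (const 8 1) skip) skip)

/-- Drop all members of the family that contain the set in bank `4`. -/
def insKill : FP :=
  loop 21 2 (load1 3 7 21 ;; ifPos 7 (subV 4 0 2 21 ;; ifPos 5 (store1 3 21 0) skip) skip)

/-- Insert the set in bank `4` into the family, unless it is redundant, and drop the members that
have become redundant. If there is no free row, nothing happens. -/
def ins : FP :=
  insTest ;; ifPos 8 skip (setc 10 2 ;; ite 9 10
    (insKill ;; interV false 4 0 4 0 2 9 ;; const 10 1 ;; store1 3 9 10 ;; addl 9 9 1) skip)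

lemma wr_insTest : insTest.wr = [8, 21, 7, 5, 2, 3, 4, 5, 8] := by simp [insTest, wr]
lemma wb_insTest : insTest.wb = [] := by simp [insTest, wb]
lemma wr_insKill : insKill.wr = [21, 7, 5, 2, 3, 4, 5] := by simp [insKill, wr]
lemma wb_insKill : insKill.wb = [3] := by simp [insKill, wb]
@[simp] lemma wr_ins : ins.wr =
    [8, 21, 7, 5, 2, 3, 4, 5, 8, 10, 21, 7, 5, 2, 3, 4, 5, 2, 3, 4, 6, 6, 10, 9] := by
  simp [ins, wr, wr_insTest, wr_insKill]
@[simp] lemma wb_ins : ins.wb = [3, 2, 3] := by simp [ins, wb, wb_insTest, wb_insKill]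

lemma eval_insTest {E : Env} {s : NState} (h0 : s.reg 0 = 0) :
    (insTest.eval E s).reg 8 = if ∃ C ∈ fam E s, C ⊆ vec E s 4 0 then 1 else 0 := by
  have key : (insTest.eval E s).reg 8 =
      if ∃ t < E.κ 2, 0 < s.bank 3 t ∧ vec E s 2 t ⊆ vec E s 4 0 then 1 else 0 := by
    rw [insTest, eval]
    refine eval_loop_frame (fun a s' => s'.reg 8 =
      if ∃ t < a, 0 < s.bank 3 t ∧ vec E s 2 t ⊆ vec E s 4 0 then 1 else 0)
      (by simp [eval]) fun a ha s' hf hb h8 => ?_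
    have hb' : s'.bank = s.bank := funext fun b => hb b (by simp [wb])
    have hz : s'.reg 0 = 0 := by
      rw [hf 0 (by simp [wr])]; simpa [eval] using h0
    have hex : (∃ t < a + 1, 0 < s.bank 3 t ∧ vec E s 2 t ⊆ vec E s 4 0) ↔
        (∃ t < a, 0 < s.bank 3 t ∧ vec E s 2 t ⊆ vec E s 4 0) ∨
        (0 < s.bank 3 a ∧ vec E s 2 a ⊆ vec E s 4 0) := by
      simp only [Nat.lt_succ_iff_lt_or_eq, or_and_right, exists_or, exists_eq_left]
    simp only [hex]
    simp only [eval, NState.setReg_reg, NState.setReg_bank, if_true, hb']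
    by_cases hl : 0 < s.bank 3 a
    · have h5 := eval_subV (E := E) (s := (s'.setReg 21 a).setReg 7 (s.bank 3 a)) (b₁ := 2)
        (r₁ := 21) (b₂ := 4) (r₂ := 0) (by simp) (by simp)
      have h8' := eval_reg (E := E) (p := subV 2 21 4 0) (r := 8) (by simp)
        ((s'.setReg 21 a).setReg 7 (s.bank 3 a))
      have e1 : ∀ b t, vec E ((s'.setReg 21 a).setReg 7 (s.bank 3 a)) b t = vec E s b t :=
        fun b t => vec_congr (by simp [hb']) t
      simp only [e1, NState.setReg_reg] at h5 h8'
      by_cases hs : vec E s 2 a ⊆ vec E s 4 0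
      · simp [hl, hs, hz] at h5 ⊢
        simp [h5]
      · simp [hl, hs, hz] at h5 h8' ⊢
        simp [h5, h8', h8]
    · simp [hl, h8]
  rw [key]
  congr 1
  simp only [fam, Finset.mem_image, mem_live, eq_iff_iff]
  exact ⟨fun ⟨t, h1, h2, h3⟩ => ⟨_, ⟨t, ⟨h1, h2⟩, rfl⟩, h3⟩,
    fun ⟨_, ⟨t, ⟨h1, h2⟩, rfl⟩, h3⟩ => ⟨t, h1, h2, h3⟩⟩

lemma eval_insKill {E : Env} {s : NState} (h0 : s.reg 0 = 0) (t : ℕ) :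
    (insKill.eval E s).bank 3 t =
      if t < E.κ 2 ∧ vec E s 4 0 ⊆ vec E s 2 t then 0 else s.bank 3 t := by
  refine eval_loop_frame (fun a s' => s'.bank 3 t =
    if t < a ∧ vec E s 4 0 ⊆ vec E s 2 t then 0 else s.bank 3 t)
    (by simp) fun a ha s' hf hb h3 => ?_
  have hb' : ∀ b ≠ 3, s'.bank b = s.bank b := fun b hb3 => hb b (by simp [wb, hb3])
  have hz : s'.reg 0 = 0 := (hf 0 (by simp [wr])).trans h0
  simp only [eval, NState.setReg_reg, NState.setReg_bank, if_true]
  set s1 := (s'.setReg 21 a).setReg 7 (s'.bank 3 a) with hs1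
  have h5 := eval_subV (E := E) (s := s1) (b₁ := 4) (r₁ := 0) (b₂ := 2) (r₂ := 21) (by simp)
    (by simp)
  have hr21 := eval_reg (E := E) (p := subV 4 0 2 21) (r := 21) (by simp) s1
  have hr0 := eval_reg (E := E) (p := subV 4 0 2 21) (r := 0) (by simp) s1
  have hb3 := eval_bank (E := E) (p := subV 4 0 2 21) (b := 3) (by simp) s1
  have e1 : ∀ b ≠ 3, ∀ t, vec E s1 b t = vec E s b t :=
    fun b hb t => vec_congr (by simp [hs1, hb' b hb]) t
  rw [e1 4 (by simp), e1 2 (by simp)] at h5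
  simp only [hs1, NState.setReg_reg, NState.setReg_bank] at hr21 hr0 h5 hb3 ⊢
  simp [hz] at hr21 hr0 h5 hb3 ⊢
  by_cases hl : 0 < s'.bank 3 a
  · by_cases hs : vec E s 4 0 ⊆ vec E s 2 a
    · simp only [hl, hs, if_true] at h5 ⊢
      simp only [h5, hr21, hr0, hb3, NState.setCell_bank, zero_lt_one, if_true, true_and]
      by_cases hta : t = a
      · subst hta; simp [hs]
      · have : t ≤ a ↔ t < a := by omega
        simp only [hta, if_false, h3, this]
    · simp only [hl, hs, if_true, if_false] at h5 ⊢
      simp only [h5, hb3, lt_irrefl, if_false, h3]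
      by_cases hta : t = a
      · subst hta; simp [hs]
      · have : t ≤ a ↔ t < a := by omega
        simp only [this]
  · simp only [hl, if_false]
    by_cases hta : t = a
    · subst hta
      have : s'.bank 3 t = 0 := by omega
      simp at h3
      rw [h3] at this
      simp [h3, this]
    · have : t ≤ a ↔ t < a := by omega
      simp only [this]
      exact h3

/-- The effect of an insertion on the individual rows. -/
lemma eval_ins {E : Env} {s : NState} (hs : Good E s) (hg : s.reg 9 < E.κ 2) :
    ((∃ C ∈ fam E s, C ⊆ vec E s 4 0) ∧ (ins.eval E s).bank = s.bank ∧
      (ins.eval E s).reg 9 = s.reg 9) ∨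
    ((¬ ∃ C ∈ fam E s, C ⊆ vec E s 4 0) ∧ (ins.eval E s).reg 9 = s.reg 9 + 1 ∧
      vec E (ins.eval E s) 2 (s.reg 9) = vec E s 4 0 ∧
      (∀ t ≠ s.reg 9, vec E (ins.eval E s) 2 t = vec E s 2 t) ∧
      ∀ t, (ins.eval E s).bank 3 t = if t = s.reg 9 then 1 else
        if t < E.κ 2 ∧ vec E s 4 0 ⊆ vec E s 2 t then 0 else s.bank 3 t) := by
  have h8 := eval_insTest (E := E) hs.zero
  have hb1 : (insTest.eval E s).bank = s.bank :=
    funext fun b => eval_bank (by simp [wb_insTest]) s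
  have h91 : (insTest.eval E s).reg 9 = s.reg 9 := eval_reg (by simp [wr_insTest]) s
  have h01 : (insTest.eval E s).reg 0 = 0 := (eval_reg (by simp [wr_insTest]) s).trans hs.zero
  by_cases hex : ∃ C ∈ fam E s, C ⊆ vec E s 4 0
  · left
    rw [if_pos hex] at h8
    refine ⟨hex, ?_⟩
    rw [ins]
    simp [eval, h8, hb1, h91]
  · right
    rw [if_neg hex] at h8
    refine ⟨hex, ?_⟩
    obtain ⟨s1, hs1⟩ : ∃ s1, s1 = (insTest.eval E s).setReg 10 (E.κ 2) := ⟨_, rfl⟩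
    have e : ins.eval E s = (interV false 4 0 4 0 2 9 ;; const 10 1 ;; store1 3 9 10 ;;
        addl 9 9 1).eval E (insKill.eval E s1) := by
      rw [ins, hs1]
      simp [eval, h8, h91, hg]
    replace hb1 : s1.bank = s.bank := by rw [hs1]; exact hb1
    replace h91 : s1.reg 9 = s.reg 9 := by rw [hs1]; simpa using h91
    replace h01 : s1.reg 0 = 0 := by rw [hs1]; simpa using h01
    have hk := eval_insKill (E := E) h01
    have h92 : (insKill.eval E s1).reg 9 = s.reg 9 :=
      (eval_reg (by simp [wr_insKill]) s1).trans h91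
    have h02 : (insKill.eval E s1).reg 0 = 0 := (eval_reg (by simp [wr_insKill]) s1).trans h01
    have hb2 : ∀ b ≠ 3, (insKill.eval E s1).bank b = s.bank b := fun b hb =>
      (eval_bank (by simp [wb_insKill, hb]) s1).trans (by rw [hb1])
    set s2 := insKill.eval E s1 with hs2
    obtain ⟨hi1, hi2⟩ := eval_interV (E := E) (s := s2) false (b₁ := 4) (r₁ := 0) (b₂ := 4)
      (r₂ := 0) (b := 2) (r := 9) (by simp) (by simp) (by simp) (by simp) (by simp)
    have h93 : ((interV false 4 0 4 0 2 9).eval E s2).reg 9 = s.reg 9 :=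
      (eval_reg (by simp) s2).trans h92
    have hb3 : ((interV false 4 0 4 0 2 9).eval E s2).bank 3 = s2.bank 3 :=
      eval_bank (by simp) s2
    set s3 := (interV false 4 0 4 0 2 9).eval E s2 with hs3
    have e2 : ∀ t, vec E (ins.eval E s) 2 t = vec E s3 2 t := fun t => by
      rw [e]
      refine vec_congr ?_ t
      funext i
      simp [eval, hs3]
    refine ⟨?_, ?_, ?_, ?_⟩
    · rw [e]
      simp [eval, ← hs3, h93]
    · rw [e2, ← h92, hi1, h02]
      simp [vec_congr (hb2 4 (by simp))]
    · intro t ht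
      rw [e2, hi2 t (by rwa [h92]), vec_congr (hb2 2 (by simp))]
    · intro t
      rw [e]
      simp only [eval, ← hs3]
      simp [h93, hb3, hk, vec_congr (congrFun hb1 _)]
      rw [hb1]

/-- Insertion as an operation on families. -/
lemma fam_ins {E : Env} {s : NState} (hs : Good E s) (hg : s.reg 9 < E.κ 2) :
    Good E (ins.eval E s) ∧ s.reg 9 ≤ (ins.eval E s).reg 9 ∧ (ins.eval E s).reg 9 ≤ s.reg 9 + 1 ∧
    fam E (ins.eval E s) = if ∃ C ∈ fam E s, C ⊆ vec E s 4 0 then fam E s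
      else Sparsify.insS (fam E s) {vec E s 4 0} := by
  have h0 : (ins.eval E s).reg 0 = s.reg 0 := eval_reg (by simp) s
  rcases eval_ins hs hg with ⟨hex, hb, h9⟩ | ⟨hex, h9, hv, hv', hl⟩
  · rw [if_pos hex]
    exact ⟨hs.congr h0 h9 (congrFun hb 2) (congrFun hb 3), by omega, by omega,
      fam_congr (congrFun hb 2) (congrFun hb 3)⟩
  · rw [if_neg hex]
    have hml : ∀ t, t ∈ live E (ins.eval E s) ↔
        t = s.reg 9 ∨ t ≠ s.reg 9 ∧ t ∈ live E s ∧ ¬ vec E s 4 0 ⊆ vec E s 2 t := by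
      intro t
      rw [mem_live, mem_live, hl]
      by_cases ht : t = s.reg 9
      · simp [ht, hg]
      · simp only [ht, if_false, false_or, not_false_eq_true, ne_eq, true_and]
        by_cases h1 : t < E.κ 2 <;> by_cases h2 : vec E s 4 0 ⊆ vec E s 2 t <;> simp [h1, h2]
    have hnot : ∀ t ∈ live E s, vec E s 2 t ≠ vec E s 4 0 := fun t ht h =>
      hex ⟨_, Finset.mem_image_of_mem _ ht, h.le⟩
    refine ⟨⟨h0.trans hs.zero, ?_, ?_⟩, by omega, by omega, ?_⟩
    · intro t ht
      rw [hl, if_neg (by omega)]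
      split_ifs
      · rfl
      · exact hs.free t (by omega)
    · intro t ht t' ht' h
      rw [Finset.mem_coe, hml] at ht ht'
      rcases ht with rfl | ⟨h1, h2, -⟩ <;> rcases ht' with rfl | ⟨h3, h4, -⟩
      · rfl
      · rw [hv, hv' _ h3] at h
        exact absurd h.symm (hnot _ h4)
      · rw [hv, hv' _ h1] at h
        exact absurd h (hnot _ h2)
      · rw [hv' _ h1, hv' _ h3] at h
        exact hs.inj h2 h4 h
    · ext C
      simp only [fam, Finset.mem_image, Sparsify.mem_insS, Finset.mem_singleton, hml]
      have hg9 : s.reg 9 ∉ live E s := fun h => by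
        have := (mem_live.1 h).2
        rw [hs.free _ le_rfl] at this
        omega
      constructor
      · rintro ⟨t, rfl | ⟨h1, h2, h3⟩, rfl⟩
        · exact Or.inl hv
        · rw [hv' _ h1]
          exact Or.inr ⟨⟨t, h2, rfl⟩, fun C hC => hC ▸ h3⟩
      · rintro (rfl | ⟨⟨t, ht, rfl⟩, h3⟩)
        · exact ⟨_, Or.inl rfl, hv⟩
        · have h1 : t ≠ s.reg 9 := fun h => hg9 (h ▸ ht)
          exact ⟨t, Or.inr ⟨h1, ht, h3 _ rfl⟩, hv' _ h1⟩

/-- Register `38 :=` is row `t` in use, and of the size in register `16`? -/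
def isLive (t : ℕ) : FP :=
  const 38 0 ;; load1 3 7 t ;; ifPos 7 (cardV 2 t ;; ifEq 6 16 (const 38 1)) skip

@[simp] lemma wr_isLive (t : ℕ) : (isLive t).wr = [38, 7, 6, 2, 3, 6, 38] := by simp [isLive, wr]
@[simp] lemma wb_isLive (t : ℕ) : (isLive t).wb = [] := by simp [isLive, wb]

lemma eval_isLive {E : Env} {s : NState} {t : ℕ} (ht : t ∉ [38, 7, 6, 2, 3, 6, 38]) :
    ((isLive t).eval E s).reg 38 =
      if 0 < s.bank 3 (s.reg t) ∧ (vec E s 2 (s.reg t)).card = s.reg 16 then 1 else 0 := by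
  simp only [List.mem_cons, List.not_mem_nil, or_false, not_or] at ht
  rw [isLive]
  simp only [eval, eval_ifEq, NState.setReg_reg, NState.setReg_bank, ht, if_false, if_true]
  by_cases hl : 0 < s.bank 3 (s.reg t)
  · have h6 := eval_cardV (E := E) (s := (s.setReg 38 0).setReg 7 (s.bank 3 (s.reg t))) (b := 2)
      (r := t) (by simp [ht])
    have h16 := eval_reg (E := E) (p := cardV 2 t) (r := 16) (by simp)
      ((s.setReg 38 0).setReg 7 (s.bank 3 (s.reg t)))
    have h38 := eval_reg (E := E) (p := cardV 2 t) (r := 38) (by simp)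
      ((s.setReg 38 0).setReg 7 (s.bank 3 (s.reg t)))
    have e : vec E ((s.setReg 38 0).setReg 7 (s.bank 3 (s.reg t))) 2 (s.reg t) =
      vec E s 2 (s.reg t) := vec_congr rfl _
    simp [ht, e] at h6 h16 h38
    simp only [hl, if_true, true_and, h6, h16]
    split_ifs <;> simp [h38]
  · simp [hl]

end FP

/-! ### Search for sunflowers -/

namespace FP

open Sparsify in
lemma deg_fam {E : Env} {s : NState} (hs : Good E s) (c : ℕ) (H : Finset ℕ) :
    deg (fam E s) c H =
      ((live E s).filter fun t => (vec E s 2 t).card = c ∧ H ⊆ vec E s 2 t).card := by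
  rw [deg, above, fam, Finset.filter_image, Finset.card_image_of_injOn]
  exact hs.inj.mono fun t ht => (Finset.mem_filter.1 ht).1

/-- Register `13 :=` the number of members of the size in register `16` that contain the set in
bank `5`. -/
def countV : FP :=
  const 13 0 ;;
  loop 15 2 (isLive 15 ;; ifPos 38 (subV 5 0 2 15 ;; ifPos 5 (addl 13 13 1) skip) skip)

@[simp] lemma wr_countV : countV.wr = [13, 15, 38, 7, 6, 2, 3, 6, 38, 5, 2, 3, 4, 5, 13] := by
  simp [countV, wr]
@[simp] lemma wb_countV : countV.wb = [] := by simp [countV, wb]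

lemma eval_countV {E : Env} {s : NState} (hs : Good E s) :
    (countV.eval E s).reg 13 = Sparsify.deg (fam E s) (s.reg 16) (vec E s 5 0) := by
  rw [deg_fam hs, live, Finset.filter_filter]
  rw [countV, eval]
  refine eval_loop_frame (fun a s' => s'.reg 13 = ((Finset.range a).filter fun t =>
    0 < s.bank 3 t ∧ (vec E s 2 t).card = s.reg 16 ∧ vec E s 5 0 ⊆ vec E s 2 t).card)
    (by simp [eval]) fun a ha s' hf hb h13 => ?_
  have hb' : s'.bank = s.bank := funext fun b => hb b (by simp [wb])
  have hz : s'.reg 0 = 0 := by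
    rw [hf 0 (by simp [wr])]; simpa [eval] using hs.zero
  have h16 : s'.reg 16 = s.reg 16 := by
    rw [hf 16 (by simp [wr])]; simp [eval]
  have e1 : ∀ s'' : NState, s''.bank = s.bank → ∀ b t, vec E s'' b t = vec E s b t :=
    fun s'' hs'' b t => vec_congr (by rw [hs'']) t
  rw [eval, Finset.range_add_one, Finset.filter_insert]
  have h38 := eval_isLive (E := E) (s := s'.setReg 15 a) (t := 15) (by simp)
  have hr : ∀ r, r ∉ [38, 7, 6, 2, 3, 6, 38] →
      ((isLive 15).eval E (s'.setReg 15 a)).reg r = (s'.setReg 15 a).reg r :=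
    fun r hr => eval_reg (by simpa using hr) _
  have hbb : ((isLive 15).eval E (s'.setReg 15 a)).bank = s.bank := by
    rw [← hb']
    exact funext fun b => eval_bank (by simp) _
  rw [e1 (s'.setReg 15 a) hb'] at h38
  simp only [NState.setReg_reg, NState.setReg_bank, if_true, hb'] at h38
  have hr15 := hr 15 (by simp)
  have hr13 := hr 13 (by simp)
  have hr0 := hr 0 (by simp)
  set s1 := (isLive 15).eval E (s'.setReg 15 a) with hs1
  simp [h16, hz, h13] at h38 hr15 hr13 hr0
  by_cases hl : 0 < s.bank 3 a ∧ (vec E s 2 a).card = s.reg 16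
  · have h5 := eval_subV (E := E) (s := s1) (b₁ := 5) (r₁ := 0) (b₂ := 2) (r₂ := 15) (by simp)
      (by simp)
    have h13' := eval_reg (E := E) (p := subV 5 0 2 15) (r := 13) (by simp) s1
    rw [e1 _ hbb, e1 _ hbb, hr15, hr0] at h5
    rw [if_pos hl] at h38
    rw [eval, h38]
    simp only [hl, true_and, zero_lt_one, if_true, eval, h5]
    by_cases hsub : vec E s 5 0 ⊆ vec E s 2 a
    · simp [hsub, h13', hr13]
    · simp [hsub, h13', hr13]
  · rw [if_neg hl] at h38
    have : ¬ (0 < s.bank 3 a ∧ (vec E s 2 a).card = s.reg 16 ∧ vec E s 5 0 ⊆ vec E s 2 a) := by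
      tauto
    rw [eval, h38, if_neg this]
    simp [eval, hr13]

/-- Test whether the intersection of the rows in registers `1` and `14` is the heart of a
sunflower of sets of the size in register `16`, with at least `a` petals of size `i`. If so, set
registers `11` and `12`; the heart is in bank `5`. -/
def tryV (i a : ℕ) : FP :=
  interV false 2 1 2 14 5 0 ;; cardV 5 0 ;; addl 3 6 i ;;
  ifEq 3 16 (countV ;; const 3 a ;; ite 13 3 skip (const 11 1 ;; addl 12 16 0))

@[simp] lemma wr_tryV (i a : ℕ) : (tryV i a).wr = [2, 3, 4, 6, 6, 6, 2, 3, 6, 3, 13, 15, 38, 7, 6,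
    2, 3, 6, 38, 5, 2, 3, 4, 5, 13, 3, 11, 12] := by simp [tryV, wr]
@[simp] lemma wb_tryV (i a : ℕ) : (tryV i a).wb = [5] := by simp [tryV, wb]

lemma eval_tryV {E : Env} {s : NState} (hs : Good E s) (i a : ℕ) :
    vec E ((tryV i a).eval E s) 5 0 = vec E s 2 (s.reg 1) ∩ vec E s 2 (s.reg 14) ∧
    if (vec E s 2 (s.reg 1) ∩ vec E s 2 (s.reg 14)).card + i = s.reg 16 ∧
      a ≤ Sparsify.deg (fam E s) (s.reg 16) (vec E s 2 (s.reg 1) ∩ vec E s 2 (s.reg 14))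
    then ((tryV i a).eval E s).reg 11 = 1 ∧ ((tryV i a).eval E s).reg 12 = s.reg 16
    else ((tryV i a).eval E s).reg 11 = s.reg 11 := by
  obtain ⟨h1, -⟩ := eval_interV (E := E) (s := s) false (b₁ := 2) (r₁ := 1) (b₂ := 2)
      (r₂ := 14) (b := 5) (r := 0) (by simp) (by simp) (by simp) (by simp) (by simp)
  have hf1 : ∀ r, r ∉ [2, 3, 4, 6, 6] →
      ((interV false 2 1 2 14 5 0).eval E s).reg r = s.reg r :=
          fun r hr => eval_reg (by simpa using hr) _
  have hb1 : ∀ b ≠ 5, ((interV false 2 1 2 14 5 0).eval E s).bank b = s.bank b :=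
    fun b hb => eval_bank (by simpa using hb) _
  rw [tryV, eval]
  set s1 := (interV false 2 1 2 14 5 0).eval E s with hs1
  simp only [hs.zero, Bool.false_eq_true, if_false] at h1
  have h6 := eval_cardV (E := E) (s := s1) (b := 5) (r := 0) (by simp)
  rw [hf1 0 (by simp), hs.zero, h1] at h6
  have hf2 : ∀ r, r ∉ [6, 2, 3, 6] → ((cardV 5 0).eval E s1).reg r = s1.reg r :=
    fun r hr => eval_reg (by simpa using hr) _
  have hb2 : ((cardV 5 0).eval E s1).bank = s1.bank := funext fun b => eval_bank (by simp) _
  rw [eval]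
  set s2 := (cardV 5 0).eval E s1 with hs2
  set H := vec E s 2 (s.reg 1) ∩ vec E s 2 (s.reg 14) with hH
  have hv2 : ∀ s' : NState, s'.bank = s2.bank → vec E s' 5 0 = H := fun s' hs' => by
    rw [← h1]
    exact vec_congr (by rw [hs', hb2]) 0
  have e16 : s2.reg 16 = s.reg 16 := (hf2 16 (by simp)).trans (hf1 16 (by simp))
  have e11 : s2.reg 11 = s.reg 11 := (hf2 11 (by simp)).trans (hf1 11 (by simp))
  rw [eval, eval_ifEq]
  simp only [eval, NState.setReg_reg, if_true, h6, e16, if_false, Nat.reduceEqDiff]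
  by_cases hc : H.card + i = s.reg 16
  · have hg : Good E (s2.setReg 3 (H.card + i)) := hs.congr
      (by simp [hf2 0, hf1 0]) (by simp [hf2 9, hf1 9]) (by simp [hb2, hb1 2])
      (by simp [hb2, hb1 3])
    have h13 := eval_countV hg
    have hfam : fam E (s2.setReg 3 (H.card + i)) = fam E s :=
      fam_congr (by simp [hb2, hb1 2]) (by simp [hb2, hb1 3])
    rw [hfam, hv2 (s2.setReg 3 (H.card + i)) rfl] at h13
    have hf3 : ∀ r, r ∉ [13, 15, 38, 7, 6, 2, 3, 6, 38, 5, 2, 3, 4, 5, 13] →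
        (countV.eval E (s2.setReg 3 (H.card + i))).reg r = (s2.setReg 3 (H.card + i)).reg r :=
      fun r hr => eval_reg (by simpa using hr) _
    have hb3 : (countV.eval E (s2.setReg 3 (H.card + i))).bank = s2.bank :=
      funext fun b => eval_bank (by simp) _
    have g16 := hf3 16 (by simp)
    have g11 := hf3 11 (by simp)
    simp only [hc, true_and, if_true]
    rw [hc] at h13 g16 g11 hb3
    set s3 := countV.eval E (s2.setReg 3 (s.reg 16)) with hs3
    simp [e16, e11] at h13 g16 g11
    by_cases ha : a ≤ Sparsify.deg (fam E s) (s.reg 16) H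
    · have : ¬ Sparsify.deg (fam E s) (s.reg 16) H < a := by omega
      rw [h13, if_neg this, if_pos ha]
      exact ⟨hv2 _ (by simpa using hb3), by simp, by simp [g16]⟩
    · have : Sparsify.deg (fam E s) (s.reg 16) H < a := by omega
      rw [h13, if_pos this, if_neg ha]
      exact ⟨hv2 _ (by simpa using hb3), by simp [g11]⟩
  · simp only [hc, false_and, if_false]
    exact ⟨hv2 _ (by simp), by simp [e11]⟩

/-- Search for a large sunflower of sets of size `c` with at least `a` petals of size `i`. -/
def findV (c i a : ℕ) : FP :=
  const 16 c ;;
  loop 1 2 (isLive 1 ;; ifPos 38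
    (loop 14 2 (isLive 14 ;; ifPos 38 (ifPos 11 skip (tryV i a)) skip)) skip)

@[simp] lemma wr_findV (c i a : ℕ) : (findV c i a).wr = [16, 1, 38, 7, 6, 2, 3, 6, 38, 14, 38, 7, 6,
    2, 3, 6, 38, 2, 3, 4, 6, 6, 6, 2, 3, 6, 3, 13, 15, 38, 7, 6, 2, 3, 6, 38, 5, 2, 3, 4, 5, 13, 3,
    11, 12] := by simp [findV, wr]
@[simp] lemma wb_findV (c i a : ℕ) : (findV c i a).wb = [5] := by simp [findV, wb]

/-- Registers `11`, `12` and bank `5` describe a large sunflower of the family `F`. -/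
def Found (E : Env) (α : ℕ) (F : Finset (Finset ℕ)) (c i : ℕ) (s : NState) : Prop :=
  s.reg 11 = 1 ∧ s.reg 12 = c ∧ ∃ t t', Sparsify.IsSun α F c i t t' ∧ vec E s 5 0 = t ∩ t'

lemma Found.congr {E : Env} {α : ℕ} {F : Finset (Finset ℕ)} {c i : ℕ} {s s' : NState}
    (h : Found E α F c i s) (h11 : s'.reg 11 = s.reg 11) (h12 : s'.reg 12 = s.reg 12)
    (h5 : s'.bank 5 = s.bank 5) : Found E α F c i s' := by
  obtain ⟨h1, h2, t, t', h3, h4⟩ := h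
  exact ⟨h11.trans h1, h12.trans h2, t, t', h3, (vec_congr h5 0).trans h4⟩

/-- One pair of rows. -/
lemma eval_findV_body {E : Env} {s : NState} (hs : Good E s) {α c i : ℕ} (h16 : s.reg 16 = c)
    (h1 : s.reg 1 ∈ live E s) (hc1 : (vec E s 2 (s.reg 1)).card = c) (h14 : s.reg 14 < E.κ 2)
    {s' : NState} (hs' : s' = (isLive 14 ;; ifPos 38 (ifPos 11 skip (tryV i (Sparsify.thr α i)))
      skip).eval E s) :
    (s.reg 11 = 0 → (s'.reg 11 = 0 ∧ ¬ (s.reg 14 ∈ live E s ∧ Sparsify.IsSun α (fam E s) c i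
      (vec E s 2 (s.reg 1)) (vec E s 2 (s.reg 14)))) ∨ Found E α (fam E s) c i s') ∧
    (Found E α (fam E s) c i s → Found E α (fam E s) c i s') := by
  have h38 := eval_isLive (E := E) (s := s) (t := 14) (by simp)
  have hf : ∀ r, r ∉ [38, 7, 6, 2, 3, 6, 38] → ((isLive 14).eval E s).reg r = s.reg r :=
    fun r hr => eval_reg (by simpa using hr) _
  have hb : ((isLive 14).eval E s).bank = s.bank := funext fun b => eval_bank (by simp) _
  rw [eval] at hs'
  set s1 := (isLive 14).eval E s with hs1
  have hg : Good E s1 := hs.congr (hf 0 (by simp)) (hf 9 (by simp)) (by rw [hb]) (by rw [hb])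
  have hfam : fam E s1 = fam E s := fam_congr (by rw [hb]) (by rw [hb])
  have hv : ∀ b t, vec E s1 b t = vec E s b t := fun b t => vec_congr (by rw [hb]) t
  rw [h16] at h38
  by_cases hl : 0 < s.bank 3 (s.reg 14) ∧ (vec E s 2 (s.reg 14)).card = c
  · rw [if_pos hl] at h38
    simp only [eval, h38, zero_lt_one, if_true, hf 11 (by simp)] at hs'
    by_cases h11 : 0 < s.reg 11
    · simp only [h11, if_true] at hs'
      subst hs'
      refine ⟨fun h => by omega, fun h => h.congr (hf 11 (by simp)) (hf 12 (by simp)) (by rw [hb])⟩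
    · rw [if_neg h11] at hs'
      refine ⟨fun h => ?_, fun h => absurd h.1 (by omega)⟩
      obtain ⟨h2, h3⟩ := eval_tryV hg i (Sparsify.thr α i)
      rw [← hs', hv, hv, hf 1 (by simp), hf 14 (by simp)] at h2
      rw [← hs', hv, hv, hf 1 (by simp), hf 14 (by simp), hf 16 (by simp), hf 11 (by simp), hfam,
        h16] at h3
      by_cases hcond : (vec E s 2 (s.reg 1) ∩ vec E s 2 (s.reg 14)).card + i = c ∧
          Sparsify.thr α i ≤ Sparsify.deg (fam E s) c
            (vec E s 2 (s.reg 1) ∩ vec E s 2 (s.reg 14))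
      · rw [if_pos hcond] at h3
        right
        refine ⟨h3.1, h3.2, _, _, ⟨Finset.mem_image_of_mem _ h1, Finset.mem_image_of_mem _
          (mem_live.2 ⟨h14, hl.1⟩), hc1, hl.2, hcond.1, hcond.2⟩, h2⟩
      · rw [if_neg hcond] at h3
        left
        exact ⟨h3.trans h, fun h => hcond ⟨h.2.card_inter, h.2.large⟩⟩
  · rw [if_neg hl] at h38
    simp only [eval, h38, lt_irrefl, if_false] at hs'
    subst hs'
    refine ⟨fun h => Or.inl ⟨(hf 11 (by simp)).trans h, fun h => hl ⟨(mem_live.1 h.1).2,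
      h.2.card_right⟩⟩, fun h => h.congr (hf 11 (by simp)) (hf 12 (by simp)) (by rw [hb])⟩

lemma eval_findV {E : Env} {s : NState} (hs : Good E s) (α c i : ℕ) (h11 : s.reg 11 = 0)
    {s' : NState} (hs' : s' = (findV c i (Sparsify.thr α i)).eval E s) :
    (s'.reg 11 = 0 ∧ Sparsify.NoSun α (fam E s) c i) ∨ Found E α (fam E s) c i s' := by
  have key : (s'.reg 11 = 0 ∧ ∀ t < E.κ 2, t ∈ live E s → ∀ t' < E.κ 2, t' ∈ live E s →
      ¬ Sparsify.IsSun α (fam E s) c i (vec E s 2 t) (vec E s 2 t')) ∨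
      Found E α (fam E s) c i s' := by
    rw [hs', findV, eval]
    refine eval_loop_frame (fun a s' => (s'.reg 11 = 0 ∧ ∀ t < a, t ∈ live E s →
      ∀ t' < E.κ 2, t' ∈ live E s →
      ¬ Sparsify.IsSun α (fam E s) c i (vec E s 2 t) (vec E s 2 t')) ∨
      Found E α (fam E s) c i s') (by simp [eval, h11]) fun a ha s' hf hb hP => ?_
    have hb2 : s'.bank 2 = s.bank 2 := hb 2 (by simp [wb])
    have hb3 : s'.bank 3 = s.bank 3 := hb 3 (by simp [wb])
    have hr0 : s'.reg 0 = s.reg 0 := (hf 0 (by simp [wr])).trans (by simp [eval])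
    have hr9 : s'.reg 9 = s.reg 9 := (hf 9 (by simp [wr])).trans (by simp [eval])
    have hr16 : s'.reg 16 = c := (hf 16 (by simp [wr])).trans (by simp [eval])
    have h38 := eval_isLive (E := E) (s := s'.setReg 1 a) (t := 1) (by simp)
    have hf1 : ∀ r, r ∉ [38, 7, 6, 2, 3, 6, 38] →
        ((isLive 1).eval E (s'.setReg 1 a)).reg r = (s'.setReg 1 a).reg r :=
      fun r hr => eval_reg (by simpa using hr) _
    have hb1 : ((isLive 1).eval E (s'.setReg 1 a)).bank = s'.bank :=
      funext fun b => eval_bank (by simp) _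
    rw [eval]
    set s1 := (isLive 1).eval E (s'.setReg 1 a) with hs1
    have e1 : vec E (s'.setReg 1 a) 2 a = vec E s 2 a := vec_congr (by simp [hb2]) a
    simp [hb3, e1, hr16] at h38
    have g0 := hf1 0 (by simp)
    have g1 := hf1 1 (by simp)
    have g9 := hf1 9 (by simp)
    have g11 := hf1 11 (by simp)
    have g12 := hf1 12 (by simp)
    have g16 := hf1 16 (by simp)
    simp [hr0, hr9, hr16] at g0 g1 g9 g11 g12 g16
    by_cases hl : 0 < s.bank 3 a ∧ (vec E s 2 a).card = c
    · rw [if_pos hl] at h38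
      rw [eval, h38, if_pos zero_lt_one]
      have inner := eval_loop_frame (E := E) (i := 14) (j := 2)
        (p := isLive 14 ;; ifPos 38 (ifPos 11 skip (tryV i (Sparsify.thr α i))) skip) (s := s1)
        (fun a' s'' => (s''.reg 11 = 0 ∧ (∀ t < a, t ∈ live E s → ∀ t' < E.κ 2, t' ∈ live E s →
          ¬ Sparsify.IsSun α (fam E s) c i (vec E s 2 t) (vec E s 2 t')) ∧
          ∀ t' < a', t' ∈ live E s →
          ¬ Sparsify.IsSun α (fam E s) c i (vec E s 2 a) (vec E s 2 t')) ∨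
          Found E α (fam E s) c i s'')
        (hP.imp (fun h => ⟨g11.trans h.1, h.2, by simp⟩)
          fun h => h.congr g11 g12 (by rw [hb1]))
        (by
          intro a' ha' s'' hf2 hb2' hP2
          have k0 : s''.reg 0 = s.reg 0 := (hf2 0 (by simp [wr])).trans g0
          have k9 : s''.reg 9 = s.reg 9 := (hf2 9 (by simp [wr])).trans g9
          have k1 : s''.reg 1 = a := (hf2 1 (by simp [wr])).trans g1
          have k16 : s''.reg 16 = c := (hf2 16 (by simp [wr])).trans g16
          have kb2 : s''.bank 2 = s.bank 2 := (hb2' 2 (by simp [wb])).trans (by rw [hb1, hb2])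
          have kb3 : s''.bank 3 = s.bank 3 := (hb2' 3 (by simp [wb])).trans (by rw [hb1, hb3])
          have hg : Good E (s''.setReg 14 a') := hs.congr (by simp [k0]) (by simp [k9])
            (by simp [kb2]) (by simp [kb3])
          have hfam : fam E (s''.setReg 14 a') = fam E s :=
              fam_congr (by simp [kb2]) (by simp [kb3])
          have hlive : live E (s''.setReg 14 a') = live E s := live_congr (by simp [kb3])
          have hv : ∀ t, vec E (s''.setReg 14 a') 2 t = vec E s 2 t :=
            fun t => vec_congr (by simp [kb2]) t
          have := eval_findV_body (α := α) (c := c) (i := i) hg (by simp [k16])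
            (by rw [hlive]; simpa [k1] using mem_live.2 ⟨ha, hl.1⟩)
            (by rw [hv]; simpa [k1] using hl.2) (by simpa using ha') rfl
          rw [hfam, hlive, hv, hv] at this
          simp [k1] at this
          rcases hP2 with ⟨h1, h2, h3⟩ | hF
          · rcases this.1 h1 with ⟨h4, h5⟩ | h4
            · refine Or.inl ⟨h4, h2, fun t' ht' => ?_⟩
              rcases Nat.lt_succ_iff_lt_or_eq.1 ht' with h | rfl
              · exact h3 t' h
              · exact fun hx hy => h5 hx hy
            · exact Or.inr h4
          · exact Or.inr (this.2 (hF.congr (by simp) (by simp) (by simp))))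
      refine inner.imp (fun h => ⟨h.1, fun t ht => ?_⟩) id
      rcases Nat.lt_succ_iff_lt_or_eq.1 ht with h' | rfl
      · exact h.2.1 t h'
      · exact fun _ => h.2.2
    · rw [if_neg hl] at h38
      simp only [eval, h38, lt_irrefl, if_false]
      refine hP.imp (fun h => ⟨g11.trans h.1, fun t ht => ?_⟩) fun h =>
        h.congr g11 g12 (by rw [hb1])
      rcases Nat.lt_succ_iff_lt_or_eq.1 ht with h' | rfl
      · exact h.2 t h'
      · exact fun h3 t' _ _ hx => hl ⟨(mem_live.1 h3).2, hx.card_left⟩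
  refine key.imp (fun h => ⟨h.1, fun t t' hst => ?_⟩) id
  obtain ⟨r, hr, rfl⟩ := Finset.mem_image.1 hst.left
  obtain ⟨r', hr', rfl⟩ := Finset.mem_image.1 hst.right
  exact h.2 r (mem_live.1 hr).1 hr r' (mem_live.1 hr').1 hr' hst

/-- `p 0 ;; … ;; p (n - 1)` -/
def seqs (p : ℕ → FP) : ℕ → FP
  | 0 => skip
  | n + 1 => seqs p n ;; p n

lemma eval_seqs {E : Env} {p : ℕ → FP} {s : NState} (P : ℕ → NState → Prop) (h0 : P 0 s) (n : ℕ)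
    (hs : ∀ a < n, ∀ s', P a s' → P (a + 1) ((p a).eval E s')) : P n ((seqs p n).eval E s) := by
  induction n with
  | zero => exact h0
  | succ n ih => exact hs n (by omega) _ (ih fun a ha => hs a (by omega))

/-- Search for the first large sunflower: smallest members first, then smallest petals. -/
def find (α k : ℕ) : FP :=
  const 11 0 ;;
  seqs (fun c => seqs (fun i => ifPos 11 skip (findV c (i + 1) (Sparsify.thr α (i + 1)))) (c - 1))
    (k + 1)

lemma wr_seqs {p : ℕ → FP} {L : List ℕ} {n : ℕ} (h : ∀ a, (p a).wr ⊆ L) : (seqs p n).wr ⊆ L := by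
  induction n with
  | zero => simp [seqs, wr]
  | succ n ih => simp [seqs, wr, ih, h n]

lemma wb_seqs {p : ℕ → FP} {L : List ℕ} {n : ℕ} (h : ∀ a, (p a).wb ⊆ L) : (seqs p n).wb ⊆ L := by
  induction n with
  | zero => simp [seqs, wb]
  | succ n ih => simp [seqs, wb, ih, h n]

lemma wr_find (α k : ℕ) :
    (find α k).wr ⊆ [16, 1, 38, 7, 6, 2, 3, 14, 4, 13, 15, 5, 11, 12] := by
  rw [find, wr, List.append_subset]
  refine ⟨by simp [wr], wr_seqs fun c => wr_seqs fun i => ?_⟩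
  simp [wr]

lemma wb_find (α k : ℕ) : (find α k).wb ⊆ [5] := by
  rw [find, wb, List.append_subset]
  refine ⟨by simp [wb], wb_seqs fun c => wb_seqs fun i => ?_⟩
  simp [wb]

lemma eval_find {E : Env} {s : NState} (hs : Good E s) (α k : ℕ) {s' : NState}
    (hs' : s' = (find α k).eval E s) :
    (s'.reg 11 = 0 ∧ ∀ c i, 1 ≤ i → i < c → c ≤ k → Sparsify.NoSun α (fam E s) c i) ∨
    (s'.reg 11 = 1 ∧ ∃ c i, s'.reg 12 = c ∧
      Sparsify.Best α k (fam E s) c i (vec E s' 5 0)) := by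
  -- the state while the pairs `(c, i)` are searched in lexicographic order
  let B : ℕ → ℕ → NState → Prop := fun c i s' =>
    s'.reg 0 = s.reg 0 ∧ s'.reg 9 = s.reg 9 ∧ s'.bank 2 = s.bank 2 ∧ s'.bank 3 = s.bank 3 ∧
    ((s'.reg 11 = 0 ∧ ∀ c' i', (c' < c ∨ c' = c ∧ i' < i + 1) → 1 ≤ i' → i' < c' →
      Sparsify.NoSun α (fam E s) c' i') ∨
    (s'.reg 11 = 1 ∧ ∃ c i, s'.reg 12 = c ∧ Sparsify.Best α k (fam E s) c i (vec E s' 5 0)))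
  have hB : ∀ c i s', B c i s' → ((s'.reg 11 = 0 ∧ ∀ c' i', (c' < c ∨ c' = c ∧ i' < i + 1) →
      1 ≤ i' → i' < c' → Sparsify.NoSun α (fam E s) c' i') ∨
    (s'.reg 11 = 1 ∧ ∃ c i, s'.reg 12 = c ∧
      Sparsify.Best α k (fam E s) c i (vec E s' 5 0))) := fun c i s' h => h.2.2.2.2
  have key : B (k + 1) 0 s' := by
    rw [hs', find, eval]
    refine eval_seqs (fun c s' => B c 0 s') ?_ _ fun c hc s1 h1 => ?_
    · refine ⟨by simp [eval], by simp [eval], by simp [eval], by simp [eval],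
        Or.inl ⟨by simp [eval], fun c' i' h => ?_⟩⟩
      omega
    · have h2 : B c (c - 1) ((seqs (fun i => ifPos 11 skip
          (findV c (i + 1) (Sparsify.thr α (i + 1)))) (c - 1)).eval E s1) := by
        refine eval_seqs (fun i s' => B c i s') h1 _ fun i hi s2 h2 => ?_
        obtain ⟨g0, g9, gb2, gb3, h3⟩ := h2
        rw [eval]
        rcases h3 with ⟨h3, h4⟩ | ⟨h3, h4⟩
        · rw [if_neg (by omega)]
          have hg : Good E s2 := hs.congr g0 g9 gb2 gb3
          have hfam : fam E s2 = fam E s := fam_congr gb2 gb3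
          refine ⟨(eval_reg (by simp) _).trans g0, (eval_reg (by simp) _).trans g9,
            (eval_bank (by simp) _).trans gb2, (eval_bank (by simp) _).trans gb3, ?_⟩
          have := eval_findV hg α c (i + 1) h3 rfl
          rw [hfam] at this
          refine this.imp (fun h => ⟨h.1, fun c' i' h5 h6 h7 => ?_⟩)
            fun ⟨h5, h6, t, t', h7, h8⟩ => ⟨h5, c, i + 1, h6, by omega, by omega, by omega,
              ⟨t, t', h7, h8⟩, fun c' i' h9 => h4 c' i' h9⟩
          by_cases hnew : c' = c ∧ i' = i + 1
          · rw [hnew.1, hnew.2]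
            exact h.2
          · exact h4 c' i' (by omega) h6 h7
        · rw [if_pos (by omega)]
          exact ⟨g0, g9, gb2, gb3, Or.inr ⟨h3, h4⟩⟩
      obtain ⟨g0, g9, gb2, gb3, h3⟩ := h2
      exact ⟨g0, g9, gb2, gb3, h3.imp (fun h => ⟨h.1, fun c' i' h5 h6 h7 =>
        h.2 c' i' (by omega) h6 h7⟩) id⟩
  exact (hB _ _ _ key).imp (fun h => ⟨h.1, fun c i h1 h2 h3 => h.2 c i (by omega) h1 h2⟩) id

end FP

/-! ### Branching -/

namespace FP

open Sparsify

/-- Record a decision for the heart (in base-`G` notation) and insert the heart. -/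
def heartP (G : ℕ) : FP :=
  const 19 0 ;; addl 18 18 1 ;; const 3 (G - 1) ;; ifEq 18 3 (addl 17 17 1 ;; const 18 0) ;;
  interV false 5 0 5 0 4 0 ;; ins

/-- Record a decision for the petals and insert them. -/
def petalP : FP :=
  const 19 0 ;; addl 17 17 1 ;; const 18 0 ;; addl 16 12 0 ;;
  loop 1 2 (isLive 1 ;; ifPos 38
    (subV 5 0 2 1 ;; ifPos 5 (interV true 2 1 5 0 4 0 ;; ins) skip) skip)

@[simp] lemma wb_heartP (G : ℕ) : (heartP G).wb = [4, 3, 2, 3] := by simp [heartP, wb]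
@[simp] lemma wb_petalP : petalP.wb = [4, 3, 2, 3] := by simp [petalP, wb]

lemma eval_heartP {E : Env} {s : NState} (hs : Good E s) (hg : s.reg 9 < E.κ 2) (G : ℕ)
    (hH : ¬ ∃ C ∈ fam E s, C ⊆ vec E s 5 0) {s' : NState} (hs' : s' = (heartP G).eval E s) :
    Good E s' ∧ s'.reg 9 ≤ s.reg 9 + 1 ∧ fam E s' = insS (fam E s) {vec E s 5 0} ∧
    (s'.reg 17, s'.reg 18) =
      if s.reg 18 + 1 = G - 1 then (s.reg 17 + 1, 0) else (s.reg 17, s.reg 18 + 1) := by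
  obtain ⟨s1, hs1⟩ : ∃ s1, s1 = (const 19 0 ;; addl 18 18 1 ;; const 3 (G - 1) ;;
      ifEq 18 3 (addl 17 17 1 ;; const 18 0)).eval E s := ⟨_, rfl⟩
  have e : s' = ins.eval E ((interV false 5 0 5 0 4 0).eval E s1) := by
    rw [hs', hs1, heartP]
    simp only [eval]
  have hb1 : s1.bank = s.bank := by
    rw [hs1]
    exact funext fun b => eval_bank (by simp [wb]) _
  have hr1 : ∀ r, r ∉ [19, 18, 3, 17] → s1.reg r = s.reg r := fun r hr => by
    rw [hs1]
    exact eval_reg (by simp at hr; simp [wr, hr]) _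
  have hpc : (s1.reg 17, s1.reg 18) =
      if s.reg 18 + 1 = G - 1 then (s.reg 17 + 1, 0) else (s.reg 17, s.reg 18 + 1) := by
    rw [hs1]
    simp only [eval, eval_ifEq]
    by_cases h : s.reg 18 + 1 = G - 1 <;> simp [h]
  obtain ⟨h2, -⟩ := eval_interV (E := E) (s := s1) false (b₁ := 5) (r₁ := 0) (b₂ := 5)
    (r₂ := 0) (b := 4) (r := 0) (by simp) (by simp) (by simp) (by simp) (by simp)
  have hb2 : ∀ b ≠ 4, ((interV false 5 0 5 0 4 0).eval E s1).bank b = s.bank b := fun b hb => by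
    rw [eval_bank (by simpa using hb), hb1]
  have hr2 : ∀ r, r ∉ [2, 3, 4, 6] → ((interV false 5 0 5 0 4 0).eval E s1).reg r = s1.reg r :=
    fun r hr => eval_reg (by simpa using hr) _
  set s2 := (interV false 5 0 5 0 4 0).eval E s1 with hs2
  have h0 : s1.reg 0 = 0 := (hr1 0 (by simp)).trans hs.zero
  rw [h0, vec_congr (s := s) (s' := s1) (b := 5) (by rw [hb1]) 0] at h2
  simp only [Bool.false_eq_true, if_false, Finset.inter_self] at h2
  have h9 : s2.reg 9 = s.reg 9 := (hr2 9 (by simp)).trans (hr1 9 (by simp))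
  have hg2 : Good E s2 := hs.congr ((hr2 0 (by simp)).trans (hr1 0 (by simp))) h9
    (hb2 2 (by simp)) (hb2 3 (by simp))
  have hf2 : fam E s2 = fam E s := fam_congr (hb2 2 (by simp)) (hb2 3 (by simp))
  obtain ⟨k1, -, k2, k3⟩ := fam_ins hg2 (by rw [h9]; exact hg)
  rw [h2, hf2, if_neg hH] at k3
  rw [e]
  refine ⟨k1, by omega, k3, ?_⟩
  rw [eval_reg (r := 17) (by simp), eval_reg (r := 18) (by simp), hr2 17 (by simp),
    hr2 18 (by simp), hpc]

lemma petal_unique {F : Finset (Finset ℕ)} (hF : ∀ C ∈ F, ∀ D ∈ F, C ⊆ D → C = D)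
    {C D H : Finset ℕ} (hC : C ∈ F) (hD : D ∈ F) (hHD : H ⊆ D) (h : C \ H ⊆ D) : C = D :=
  hF C hC D hD fun x hx => by
    by_cases hxH : x ∈ H
    · exact hHD hxH
    · exact h (Finset.mem_sdiff.2 ⟨hx, hxH⟩)

lemma insS_insS {F P : Finset (Finset ℕ)} {x : Finset ℕ} (h : ∀ C ∈ P, ¬ x ⊆ C) :
    insS (insS F P) {x} = insS F (insert x P) := by
  ext D
  simp only [mem_insS, Finset.mem_singleton, Finset.mem_insert, forall_eq, forall_eq_or_imp]
  constructor
  · rintro (h1 | ⟨h1 | ⟨h1, h2⟩, h3⟩) <;> tauto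
  · rintro ((h1 | h1) | ⟨h1, h2, h3⟩)
    · tauto
    · exact Or.inr ⟨Or.inl h1, h D h1⟩
    · tauto

/-- Insertion of all petals. -/
lemma eval_petals {E : Env} {s : NState} (hs : Good E s) {c : ℕ} (h16 : s.reg 16 = c)
    {F : Finset (Finset ℕ)} (hF : fam E s = F) {H : Finset ℕ} (hH : vec E s 5 0 = H)
    (hanti : ∀ C ∈ F, ∀ D ∈ F, C ⊆ D → C = D) (hne : H.Nonempty)
    (hg : s.reg 9 + (petals F c H).card ≤ E.κ 2) {s' : NState}
    (hs' : s' = (loop 1 2 (isLive 1 ;; ifPos 38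
    (subV 5 0 2 1 ;; ifPos 5 (interV true 2 1 5 0 4 0 ;; ins) skip) skip)).eval E s) :
    Good E s' ∧ s'.reg 9 ≤ s.reg 9 + (petals F c H).card ∧
      fam E s' = insS F (petals F c H) := by
  -- the rows that are to be processed, and the petals from the rows below `a`
  let W : ℕ → Prop := fun t => t ∈ live E s ∧ (vec E s 2 t).card = c ∧ H ⊆ vec E s 2 t
  let P : ℕ → Finset (Finset ℕ) := fun a =>
    ((live E s).filter fun t => t < a ∧ (vec E s 2 t).card = c ∧ H ⊆ vec E s 2 t).image
      fun t => vec E s 2 t \ H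
  have hWF : ∀ t, W t → vec E s 2 t ∈ F := fun t ht => hF ▸ Finset.mem_image_of_mem _ ht.1
  have hPmem : ∀ a C, C ∈ P a ↔ ∃ t, W t ∧ t < a ∧ vec E s 2 t \ H = C := fun a C => by
    simp only [P, W, Finset.mem_image, Finset.mem_filter]
    constructor
    · rintro ⟨t, ⟨h1, h2, h3, h4⟩, h5⟩
      exact ⟨t, ⟨h1, h3, h4⟩, h2, h5⟩
    · rintro ⟨t, ⟨h1, h3, h4⟩, h2, h5⟩
      exact ⟨t, ⟨h1, h2, h3, h4⟩, h5⟩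
  have hPsub : ∀ a, P a ⊆ petals F c H := fun a C hC => by
    obtain ⟨t, ht, -, rfl⟩ := (hPmem a C).1 hC
    exact Finset.mem_image_of_mem _ (mem_above.2 ⟨hWF t ht, ht.2⟩)
  have hPall : P (E.κ 2) = petals F c H := by
    refine (hPsub _).antisymm fun C hC => ?_
    obtain ⟨D, hD, rfl⟩ := Finset.mem_image.1 hC
    obtain ⟨hD1, hD2, hD3⟩ := mem_above.1 hD
    rw [← hF] at hD1
    obtain ⟨t, ht, rfl⟩ := Finset.mem_image.1 hD1
    exact (hPmem _ _).2 ⟨t, ⟨ht, hD2, hD3⟩, (mem_live.1 ht).1, rfl⟩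
  have hcard : ∀ t, W t → (vec E s 2 t \ H).card < c := fun t ht => by
    rw [Finset.card_sdiff_of_subset ht.2.2, ht.2.1]
    have := Finset.card_le_card ht.2.2
    have := hne.card_pos
    rw [ht.2.1] at *
    omega
  rw [← hPall, hs']
  refine eval_loop_frame (fun a s' => Good E s' ∧ s'.reg 9 ≤ s.reg 9 + (P a).card ∧
      fam E s' = insS F (P a) ∧ ∀ t, a ≤ t →
        ((t ∈ live E s' ∧ (vec E s' 2 t).card = c ∧ H ⊆ vec E s' 2 t) ↔ W t) ∧
        (W t → vec E s' 2 t = vec E s 2 t)) ⟨hs, by omega, ?_, fun t _ => ⟨Iff.rfl, fun _ => rfl⟩⟩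
      (fun a ha s' hf hb hP => ?_) |> fun h => ⟨h.1, h.2.1, h.2.2.1⟩
  · have : P 0 = ∅ := by
      ext C
      simp [hPmem]
    rw [this, hF]
    ext D
    simp [mem_insS]
  obtain ⟨hP1, hP2, hP3, hP4⟩ := hP
  have k16 : s'.reg 16 = c := (hf 16 (by simp [wr])).trans h16
  have k5 : s'.bank 5 = s.bank 5 := hb 5 (by simp [wb])
  have h38 := eval_isLive (E := E) (s := s'.setReg 1 a) (t := 1) (by simp)
  have hf1 : ∀ r, r ∉ [38, 7, 6, 2, 3, 6, 38] →
      ((isLive 1).eval E (s'.setReg 1 a)).reg r = (s'.setReg 1 a).reg r :=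
    fun r hr => eval_reg (by simpa using hr) _
  have hb1 : ((isLive 1).eval E (s'.setReg 1 a)).bank = s'.bank :=
    funext fun b => eval_bank (by simp) _
  rw [eval]
  set s1 := (isLive 1).eval E (s'.setReg 1 a) with hs1
  have e1 : vec E (s'.setReg 1 a) 2 a = vec E s' 2 a := vec_congr rfl a
  simp [k16, e1] at h38
  have g0 := hf1 0 (by simp)
  have g1 := hf1 1 (by simp)
  have g9 := hf1 9 (by simp)
  simp at g0 g1 g9
  have z1 : s1.reg 0 = 0 := g0.trans hP1.zero
  have hv1 : ∀ b t, vec E s1 b t = vec E s' b t := fun b t => vec_congr (by rw [hb1]) t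
  have hH1 : vec E s1 5 0 = H := (hv1 5 0).trans ((vec_congr k5 0).trans hH)
  have hlive : (a ∈ live E s' ∧ (vec E s' 2 a).card = c) ↔
      (0 < s'.bank 3 a ∧ (vec E s' 2 a).card = c) := by
    rw [mem_live, and_iff_right ha]
  have hPnot : ¬ W a → P (a + 1) = P a := fun hW => by
    ext C
    rw [hPmem, hPmem]
    refine exists_congr fun t => and_congr_right fun ht => and_congr_left fun _ => ?_
    rw [Nat.lt_succ_iff_lt_or_eq, or_iff_left]
    rintro rfl
    exact hW ht
  -- a row that is not of the required form changes nothing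
  have hskip : ∀ s2 : NState, ¬ W a → (∀ b, s2.bank b = s'.bank b) → s2.reg 0 = s'.reg 0 →
      s2.reg 9 = s'.reg 9 → (Good E s2 ∧ s2.reg 9 ≤ s.reg 9 + (P (a + 1)).card ∧
      fam E s2 = insS F (P (a + 1)) ∧ ∀ t, a + 1 ≤ t →
        ((t ∈ live E s2 ∧ (vec E s2 2 t).card = c ∧ H ⊆ vec E s2 2 t) ↔ W t) ∧
        (W t → vec E s2 2 t = vec E s 2 t)) := fun s2 hW hb2 h0 h9 => by
    rw [hPnot hW, h9, fam_congr (hb2 2) (hb2 3), live_congr (hb2 3)]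
    refine ⟨hP1.congr h0 h9 (hb2 2) (hb2 3), hP2, hP3, fun t ht => ?_⟩
    rw [vec_congr (hb2 2) t]
    exact hP4 t (by omega)
  by_cases hl : 0 < s'.bank 3 a ∧ (vec E s' 2 a).card = c
  swap
  · rw [if_neg hl] at h38
    simp only [eval, h38, lt_irrefl, if_false]
    refine hskip s1 (fun hW => hl (hlive.1 ?_)) (fun b => by rw [hb1]) g0 g9
    have := ((hP4 a le_rfl).1.2 hW)
    exact ⟨this.1, this.2.1⟩
  rw [if_pos hl] at h38
  rw [eval, h38, if_pos zero_lt_one, eval]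
  have h5 := eval_subV (E := E) (s := s1) (b₁ := 5) (r₁ := 0) (b₂ := 2) (r₂ := 1) (by simp)
    (by simp)
  rw [z1, hH1, g1, hv1] at h5
  have hf2 : ∀ r, r ∉ [5, 2, 3, 4, 5] → ((subV 5 0 2 1).eval E s1).reg r = s1.reg r :=
    fun r hr => eval_reg (by simpa using hr) _
  have hb2 : ((subV 5 0 2 1).eval E s1).bank = s1.bank := funext fun b => eval_bank (by simp) _
  set s2 := (subV 5 0 2 1).eval E s1 with hs2
  have hW : W a ↔ H ⊆ vec E s' 2 a := by
    rw [← (hP4 a le_rfl).1]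
    exact ⟨fun h => h.2.2, fun h => ⟨(hlive.2 hl).1, hl.2, h⟩⟩
  by_cases hsub : H ⊆ vec E s' 2 a
  swap
  · rw [if_neg hsub] at h5
    simp only [eval, h5, lt_irrefl, if_false]
    exact hskip s2 (fun h => hsub (hW.1 h)) (fun b => by rw [hb2, hb1])
      ((hf2 0 (by simp)).trans g0) ((hf2 9 (by simp)).trans g9)
  rw [if_pos hsub] at h5
  rw [eval, h5, if_pos zero_lt_one, eval]
  replace hW := hW.2 hsub
  have hva := (hP4 a le_rfl).2 hW
  obtain ⟨h4, -⟩ := eval_interV (E := E) (s := s2) true (b₁ := 2) (r₁ := 1) (b₂ := 5)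
    (r₂ := 0) (b := 4) (r := 0) (by simp) (by simp) (by simp) (by simp) (by simp)
  have hv2 : ∀ b t, vec E s2 b t = vec E s' b t := fun b t => vec_congr (by rw [hb2, hb1]) t
  rw [hf2 0 (by simp), hf2 1 (by simp), z1, g1, hv2, hv2, vec_congr k5, hH, hva] at h4
  simp only [if_true] at h4
  have hf3 : ∀ r, r ∉ [2, 3, 4, 6, 6] → ((interV true 2 1 5 0 4 0).eval E s2).reg r = s2.reg r :=
    fun r hr => eval_reg (by simpa using hr) _
  have hb3 : ∀ b ≠ 4, ((interV true 2 1 5 0 4 0).eval E s2).bank b = s'.bank b := fun b hb => by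
    rw [eval_bank (by simpa using hb), hb2, hb1]
  set s3 := (interV true 2 1 5 0 4 0).eval E s2 with hs3
  have h93 : s3.reg 9 = s'.reg 9 := (hf3 9 (by simp)).trans ((hf2 9 (by simp)).trans g9)
  have hg3 : Good E s3 := hP1.congr ((hf3 0 (by simp)).trans ((hf2 0 (by simp)).trans g0)) h93
    (hb3 2 (by simp)) (hb3 3 (by simp))
  have hfam3 : fam E s3 = insS F (P a) := (fam_congr (hb3 2 (by simp)) (hb3 3 (by simp))).trans hP3
  set x := vec E s 2 a \ H with hx
  have haF := hWF a hW
  -- the new petal is incomparable to the earlier ones and contains no member of the family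
  have hinj : ∀ t, W t → t ≠ a → vec E s 2 t ≠ vec E s 2 a := fun t ht hta h =>
    hta (hs.inj ht.1 hW.1 h)
  have hxP : ∀ C ∈ P a, ¬ x ⊆ C := fun C hC hxC => by
    obtain ⟨t, ht, hta, rfl⟩ := (hPmem a C).1 hC
    exact hinj t ht hta.ne (petal_unique hanti haF (hWF t ht) ht.2.2
      (hxC.trans Finset.sdiff_subset)).symm
  have hPx : ∀ C ∈ P a, ¬ C ⊆ x := fun C hC hxC => by
    obtain ⟨t, ht, hta, rfl⟩ := (hPmem a C).1 hC
    exact hinj t ht hta.ne (petal_unique hanti (hWF t ht) haF hW.2.2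
      (hxC.trans Finset.sdiff_subset))
  have hxnot : ¬ ∃ C ∈ fam E s3, C ⊆ vec E s3 4 0 := by
    rw [hfam3, h4]
    rintro ⟨C, hC, hCx⟩
    rcases mem_insS.1 hC with hC | ⟨hC, -⟩
    · exact hPx C hC hCx
    · have := hanti C hC _ haF (hCx.trans Finset.sdiff_subset)
      have h2 := hcard a hW
      have h3 := Finset.card_le_card hCx
      have h5 := hW.2.1
      rw [← this] at h5
      rw [← hx] at h2
      omega
  have hPs : P (a + 1) = insert x (P a) := by
    ext C
    rw [Finset.mem_insert, hPmem, hPmem]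
    constructor
    · rintro ⟨t, ht, hta, rfl⟩
      rcases Nat.lt_succ_iff_lt_or_eq.1 hta with h | rfl
      · exact Or.inr ⟨t, ht, h, rfl⟩
      · exact Or.inl rfl
    · rintro (rfl | ⟨t, ht, hta, rfl⟩)
      · exact ⟨a, hW, by omega, rfl⟩
      · exact ⟨t, ht, by omega, rfl⟩
  have hxmem : x ∉ P a := fun h => hxP x h le_rfl
  have hPcard : (P (a + 1)).card = (P a).card + 1 := by
    rw [hPs, Finset.card_insert_of_notMem hxmem]
  have hroom : s3.reg 9 < E.κ 2 := by
    have := Finset.card_le_card (hPsub (a + 1))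
    omega
  obtain ⟨k1, -, k2, k3⟩ := fam_ins hg3 hroom
  rw [if_neg hxnot, h4, hfam3, insS_insS hxP, ← hPs] at k3
  refine ⟨k1, by omega, k3, fun t hat => ?_⟩
  rcases eval_ins hg3 hroom with ⟨hex, -⟩ | ⟨-, r9, rv, rv', rl⟩
  · exact absurd hex hxnot
  have hP4t := hP4 t (by omega)
  by_cases ht9 : t = s3.reg 9
  · have hnW : ¬ W t := fun h => by
      have := (hP4t.1.2 h).1
      rw [mem_live, hP1.free t (by omega)] at this
      omega
    refine ⟨⟨fun h => ?_, fun h => absurd h hnW⟩, fun h => absurd h hnW⟩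
    rw [ht9, rv, h4] at h
    exact absurd h.2.1 (hcard a hW).ne
  have e3 : vec E s3 2 t = vec E s' 2 t := vec_congr (hb3 2 (by simp)) t
  have hvt : vec E (ins.eval E s3) 2 t = vec E s' 2 t := (rv' t ht9).trans e3
  have hlt : t ∈ live E (ins.eval E s3) ↔ t ∈ live E s' ∧ ¬ x ⊆ vec E s' 2 t := by
    rw [mem_live, mem_live, rl, if_neg ht9, h4, e3, hb3 3 (by simp)]
    by_cases h1 : t < E.κ 2 <;> by_cases h2 : x ⊆ vec E s' 2 t <;> simp [h1, h2]
  rw [hvt, hlt]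
  refine ⟨?_, hP4t.2⟩
  rw [← hP4t.1]
  refine ⟨fun h => ⟨h.1.1, h.2⟩, fun h => ⟨⟨h.1, fun hxt => ?_⟩, h.2⟩⟩
  have hWt := hP4t.1.1 h
  rw [hP4t.2 hWt] at hxt
  exact hinj t hWt (by omega) (petal_unique hanti haF (hWF t hWt) hWt.2.2 hxt).symm

lemma eval_petalP {E : Env} {s : NState} (hs : Good E s) {c : ℕ} (h12 : s.reg 12 = c)
    (hanti : ∀ C ∈ fam E s, ∀ D ∈ fam E s, C ⊆ D → C = D) (hne : (vec E s 5 0).Nonempty)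
    (hg : s.reg 9 + (petals (fam E s) c (vec E s 5 0)).card ≤ E.κ 2) {s' : NState}
    (hs' : s' = petalP.eval E s) :
    Good E s' ∧ s'.reg 9 ≤ s.reg 9 + (petals (fam E s) c (vec E s 5 0)).card ∧
    fam E s' = insS (fam E s) (petals (fam E s) c (vec E s 5 0)) ∧
    s'.reg 17 = s.reg 17 + 1 ∧ s'.reg 18 = 0 := by
  obtain ⟨s1, hs1⟩ : ∃ s1, s1 =
      (const 19 0 ;; addl 17 17 1 ;; const 18 0 ;; addl 16 12 0).eval E s :=
    ⟨_, rfl⟩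
  have e : s' = (loop 1 2 (isLive 1 ;; ifPos 38
    (subV 5 0 2 1 ;; ifPos 5 (interV true 2 1 5 0 4 0 ;; ins) skip) skip)).eval E s1 := by
    rw [hs', hs1, petalP]
    simp only [eval]
  have hb : s1.bank = s.bank := by
    rw [hs1]
    simp [eval]
  have hr : s1.reg 0 = s.reg 0 ∧ s1.reg 9 = s.reg 9 ∧ s1.reg 16 = c ∧
      s1.reg 17 = s.reg 17 + 1 ∧ s1.reg 18 = 0 := by
    rw [hs1]
    simp [eval, h12]
  have hg1 : Good E s1 := hs.congr hr.1 hr.2.1 (by rw [hb]) (by rw [hb])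
  have hf1 : fam E s1 = fam E s := fam_congr (by rw [hb]) (by rw [hb])
  have hv1 : vec E s1 5 0 = vec E s 5 0 := vec_congr (by rw [hb]) 0
  obtain ⟨k1, k2, k3⟩ := eval_petals hg1 hr.2.2.1 hf1 hv1 hanti hne (by rw [hr.2.1]; exact hg) e
  refine ⟨k1, by omega, k3, ?_⟩
  rw [e, eval_reg (by simp [wr]), eval_reg (by simp [wr])]
  exact hr.2.2.2

end FP

/-! ### The branching process -/

/-- Replace a whole bank. -/
def NState.setBank (s : NState) (b : ℕ) (f : ℕ → ℕ) : NState :=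
  { s with bank := Function.update s.bank b f }

@[simp] lemma NState.setBank_reg (s : NState) (b : ℕ) (f : ℕ → ℕ) : (s.setBank b f).reg = s.reg :=
  rfl

lemma NState.setBank_bank (s : NState) (b : ℕ) (f : ℕ → ℕ) (b' : ℕ) :
    (s.setBank b f).bank b' = if b' = b then f else s.bank b' := by
  simp [setBank, Function.update_apply]

lemma NState.setBank_self (s : NState) (b : ℕ) : s.setBank b (s.bank b) = s := by
  simp [setBank]

lemma NState.setBank_setReg (s : NState) (b : ℕ) (f : ℕ → ℕ) (r x : ℕ) :
    (s.setBank b f).setReg r x = (s.setReg r x).setBank b f := rfl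

lemma NState.setBank_setCell (s : NState) {b b' : ℕ} (h : b' ≠ b) (f : ℕ → ℕ) (i x : ℕ) :
    (s.setBank b f).setCell b' i x = (s.setCell b' i x).setBank b f := by
  simp only [setBank, setCell, Function.update_of_ne h]
  rw [Function.update_comm h]

lemma NState.setReg_setReg (s : NState) (r x y : ℕ) : (s.setReg r x).setReg r y = s.setReg r y := by
  simp [setReg]

namespace FP

open Sparsify

/-- The banks that a program may read. -/
def rb : FP → List ℕ
  | load1 b _ _ | load b _ _ _ _ => [b]
  | seq p q | ite _ _ p q | ifPos _ p q => p.rb ++ q.rb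
  | loop _ _ p => p.rb
  | _ => []

/-- A program does not depend on the banks that it does not access. -/
lemma eval_setBank {E : Env} {p : FP} {b : ℕ} (hr : b ∉ p.rb) (hw : b ∉ p.wb) (f : ℕ → ℕ)
    (s : NState) : p.eval E (s.setBank b f) = (p.eval E s).setBank b f := by
  induction p generalizing s with
  | seq p q ihp ihq =>
    simp only [wb, rb, List.mem_append, not_or] at hr hw
    rw [eval, eval, ihp hr.1 hw.1, ihq hr.2 hw.2]
  | ite a c p q ihp ihq =>
    simp only [wb, rb, List.mem_append, not_or] at hr hw
    by_cases h : s.reg a < s.reg c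
    · simpa [eval, h] using ihp hr.1 hw.1 s
    · simpa [eval, h] using ihq hr.2 hw.2 s
  | ifPos a p q ihp ihq =>
    simp only [wb, rb, List.mem_append, not_or] at hr hw
    by_cases h : 0 < s.reg a
    · simpa [eval, h] using ihp hr.1 hw.1 s
    · simpa [eval, h] using ihq hr.2 hw.2 s
  | loop i j p ih =>
    simp only [eval]
    generalize E.κ j = N
    induction N with
    | zero => rfl
    | succ N ihN =>
      simp only [ihN]
      rw [NState.setBank_setReg, ih hr hw]
  | store1 b' t r | store b' t j u r =>
    simp only [wb, List.mem_singleton] at hw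
    simp only [eval, NState.setBank_reg]
    exact NState.setBank_setCell _ (fun h => hw h.symm) _ _ _
  | load1 b' r t | load b' r t j u =>
    simp only [rb, List.mem_singleton] at hr
    simp only [eval, NState.setBank_reg, NState.setBank_bank, if_neg (fun h => hr (Eq.symm h)),
      NState.setBank_setReg]
  | _ => rfl

lemma rb_ifEq (r t : ℕ) (p : FP) : (ifEq r t p).rb = p.rb := by simp [ifEq, rb]
lemma rb_subV (b₁ r₁ b₂ r₂ : ℕ) : (subV b₁ r₁ b₂ r₂).rb = [b₁, b₂] := by simp [subV, rb]
lemma rb_cardV (b r : ℕ) : (cardV b r).rb = [b] := by simp [cardV, rb]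
lemma rb_interV (neg : Bool) (b₁ r₁ b₂ r₂ b r : ℕ) :
    (interV neg b₁ r₁ b₂ r₂ b r).rb = [b₁, b₂] := by cases neg <;> simp [interV, rb]
lemma rb_ins : ins.rb = [3, 2, 4, 3, 4, 2, 4, 4] := by
  simp [ins, insTest, insKill, rb, rb_subV, rb_interV]
lemma rb_isLive (t : ℕ) : (isLive t).rb = [3, 2] := by simp [isLive, rb, rb_cardV, rb_ifEq]

lemma rb_seqs {p : ℕ → FP} {L : List ℕ} {n : ℕ} (h : ∀ a, (p a).rb ⊆ L) : (seqs p n).rb ⊆ L := by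
  induction n with
  | zero => simp [seqs, rb]
  | succ n ih => simp [seqs, rb, ih, h n]

lemma rb_find (α k : ℕ) : (find α k).rb ⊆ [2, 3, 5] := by
  rw [find, rb, List.append_subset]
  refine ⟨by simp [rb], rb_seqs fun c => rb_seqs fun i => ?_⟩
  simp [rb, findV, tryV, countV, rb_isLive, rb_interV, rb_cardV, rb_ifEq, rb_subV]

lemma heartP_setReg (E : Env) (G x : ℕ) (s : NState) :
    (heartP G).eval E (s.setReg 19 x) = (heartP G).eval E s := by
  simp only [heartP, eval, NState.setReg_setReg]

lemma petalP_setReg (E : Env) (x : ℕ) (s : NState) :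
    petalP.eval E (s.setReg 19 x) = petalP.eval E s := by
  simp only [petalP, eval, NState.setReg_setReg]

/-- One branching step, as prescribed by the digits in bank `6`: on the digit `a`, the branches
with the heart are taken `a` times, and then, if `a < G - 1`, one with the petals. -/
def stepP (α k G : ℕ) : FP :=
  const 19 0 ;; find α k ;; ifPos 11 (load1 6 19 17 ;; ite 18 19 (heartP G) petalP) skip

/-- One branching step with a given decision (`true` for the heart). -/
def next (E : Env) (α k G : ℕ) (s : NState) (d : Bool) : NState :=
  let s' := (find α k).eval E (s.setReg 19 0)
  if 0 < s'.reg 11 then (if d then (heartP G).eval E s' else petalP.eval E s') else s'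

/-- One branching step with the decision that the digits prescribe. -/
def nextJ (E : Env) (α k G : ℕ) (J : ℕ → ℕ) (s : NState) : NState :=
  next E α k G s (decide (s.reg 18 < J (s.reg 17)))

lemma eval_stepP (E : Env) (α k G : ℕ) (J : ℕ → ℕ) (s : NState) (x : ℕ) :
    (stepP α k G).eval E ((s.setBank 6 J).setReg 19 x) = (nextJ E α k G J s).setBank 6 J := by
  have h17 : ((find α k).eval E (s.setReg 19 0)).reg 17 = s.reg 17 := by
    rw [eval_reg fun h => by simpa using wr_find α k h]
    simp
  have h18 : ((find α k).eval E (s.setReg 19 0)).reg 18 = s.reg 18 := by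
    rw [eval_reg fun h => by simpa using wr_find α k h]
    simp
  have e : (find α k).eval E ((const 19 0).eval E ((s.setBank 6 J).setReg 19 x)) =
      ((find α k).eval E (s.setReg 19 0)).setBank 6 J := by
    rw [eval, NState.setReg_setReg, NState.setBank_setReg]
    exact eval_setBank (fun h => by simpa using rb_find α k h)
      (fun h => by simpa using wb_find α k h) _ _
  change (ifPos 11 (load1 6 19 17 ;; ite 18 19 (heartP G) petalP) skip).eval E
    ((find α k).eval E ((const 19 0).eval E ((s.setBank 6 J).setReg 19 x))) = _
  rw [e]
  simp only [nextJ, next]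
  set s' := (find α k).eval E (s.setReg 19 0) with hs'
  simp only [eval, NState.setBank_reg]
  by_cases h11 : 0 < s'.reg 11
  · simp only [h11, if_true, NState.setBank_setReg,
      NState.setReg_reg, NState.setBank_reg, h17, h18, NState.setBank_bank, decide_eq_true_eq]
    simp only [Nat.reduceEqDiff, if_false]
    split_ifs
    · rw [← NState.setBank_setReg, heartP_setReg]
      exact eval_setBank (by simp [heartP, rb, rb_ifEq, rb_interV, rb_ins]) (by simp) _ _
    · rw [← NState.setBank_setReg, petalP_setReg]
      exact eval_setBank (by simp [petalP, rb, rb_isLive, rb_subV, rb_interV, rb_ins]) (by simp) _ _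
  · simp only [h11, if_false]

/-- The branching process with the digits `J`. -/
lemma eval_loop_stepP (E : Env) (α k G : ℕ) (J : ℕ → ℕ) (s : NState) :
    (loop 19 3 (stepP α k G)).eval E (s.setBank 6 J) =
      ((nextJ E α k G J)^[E.κ 3] s).setBank 6 J := by
  rw [eval]
  generalize E.κ 3 = N
  induction N with
  | zero => rfl
  | succ N ih => simp only [ih, eval_stepP, Function.iterate_succ_apply']

/-- The sizes for which the sparsification works: `k` bounds the size of the sets, `α` determines
which sunflowers are large, `m` is the number of sets at the start, and `e` is the number of digits
in base `G`. -/
structure Params (E : Env) (α k G m e : ℕ) : Prop where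
  hα : 2 ^ k + 2 ≤ α
  hk : 2 * k ≤ α
  hG : 2 ≤ G
  room : m + E.κ 1 * α ^ (3 * k) ≤ E.κ 2
  digits : E.κ 1 * α ^ (3 * k) * α + (G - 1) * (k * E.κ 1) < e * ((G - 1) * α)

/-- The invariant of the branching process. `A i` is the number of sets of size `i` inserted so
far, `B i` is the number of branches with petals of size `i`, and `h` is the number of branches
with a heart. -/
structure Progress (E : Env) (α k G m : ℕ) (s : NState) (A B : ℕ → ℕ) (h : ℕ) : Prop where
  good : Good E s
  inv : Inv α k (E.κ 1) (fam E s) A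
  rows : s.reg 9 ≤ m + ∑ i ∈ Finset.range k, A i
  pos : s.reg 17 * (G - 1) + s.reg 18 ≤ h + (G - 1) * ∑ i ∈ Finset.range k, B i
  ctr : s.reg 18 < G - 1
  hearts : h ≤ ∑ i ∈ Finset.range k, A i
  petals : ∀ i, B i * thr α i ≤ A i

lemma Params.two_le {E : Env} {α k G m e : ℕ} (hp : Params E α k G m e) : 2 ≤ α :=
  le_trans (Nat.le_add_left 2 _) hp.hα

/-- The number of digits suffices. -/
lemma Progress.pos_lt {E : Env} {α k G m e : ℕ} (hp : Params E α k G m e) {s : NState}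
    {A B : ℕ → ℕ} {h : ℕ} (hs : Progress E α k G m s A B h) : s.reg 17 < e := by
  have hα2 := hp.two_le
  have hB : ∀ i, B i * α ≤ E.κ 1 := fun i => by
    by_cases hi : i = 0 ∨ k ≤ i
    · have h1 := hs.petals i
      rw [hs.inv.zero i hi, Nat.le_zero, Nat.mul_eq_zero] at h1
      have := thr_pos (α := α) (by omega) i
      rcases h1 with h1 | h1
      · simp [h1]
      · omega
    · have h1 := (hs.petals i).trans (hs.inv.added_le hp.hk hα2 i (by omega))
      have h2 : thr α i = α ^ (3 * i - 2) * α := by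
        rw [thr, ← pow_succ]
        congr 1
        omega
      rw [h2, mul_comm (α ^ _), ← mul_assoc] at h1
      exact Nat.le_of_mul_le_mul_right h1 (Nat.pow_pos (by omega))
  have hsum : (∑ i ∈ Finset.range k, B i) * α ≤ k * E.κ 1 := by
    rw [Finset.sum_mul]
    simpa using Finset.sum_le_card_nsmul (Finset.range k) (fun i => B i * α) _ fun i _ => hB i
  have hh := hs.hearts.trans (hs.inv.sum_added_le hp.hk hα2)
  by_contra hle
  push Not at hle
  have h1 : e * (G - 1) ≤ h + (G - 1) * ∑ i ∈ Finset.range k, B i :=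
    (Nat.mul_le_mul_right _ hle).trans ((Nat.le_add_right _ _).trans hs.pos)
  have h2 := Nat.mul_le_mul_right α h1
  have h3 := hp.digits
  have h4 : (h + (G - 1) * ∑ i ∈ Finset.range k, B i) * α ≤
      E.κ 1 * α ^ (3 * k) * α + (G - 1) * (k * E.κ 1) := by
    rw [add_mul, mul_assoc (G - 1)]
    gcongr
  rw [show e * ((G - 1) * α) = e * (G - 1) * α by ring] at h3
  omega

lemma sum_update {A : ℕ → ℕ} {k j x : ℕ} (hj : j < k) :
    ∑ i ∈ Finset.range k, Function.update A j (A j + x) i = ∑ i ∈ Finset.range k, A i + x := by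
  have hj' : j ∈ Finset.range k := Finset.mem_range.2 hj
  rw [Finset.sum_update_of_mem hj', ← Finset.add_sum_erase _ _ hj', Finset.sdiff_singleton_eq_erase]
  omega

/-- A branching step. Either no large sunflower is left and nothing changes, or the two decisions
lead to the insertion of a heart and of the corresponding petals. -/
lemma next_spec {E : Env} {α k G m e : ℕ} (hp : Params E α k G m e) {s : NState}
    {A B : ℕ → ℕ} {h : ℕ} (hs : Progress E α k G m s A B h) :
    (∃ s', (∀ d, next E α k G s d = s') ∧ Progress E α k G m s' A B h ∧ fam E s' = fam E s ∧
      s'.reg 17 = s.reg 17 ∧ s'.reg 18 = s.reg 18 ∧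
      ∀ c i, 1 ≤ i → i < c → c ≤ k → NoSun α (fam E s) c i) ∨
    ((¬ ∀ c i, 1 ≤ i → i < c → c ≤ k → NoSun α (fam E s) c i) ∧
      ∃ c H, (∀ d, ∃ A' B' h', Progress E α k G m (next E α k G s d) A' B' h' ∧
        ∑ i ∈ Finset.range k, A i < ∑ i ∈ Finset.range k, A' i) ∧
      (fam E (next E α k G s true) = insS (fam E s) {H} ∧
        ((next E α k G s true).reg 17, (next E α k G s true).reg 18) =
          if s.reg 18 + 1 = G - 1 then (s.reg 17 + 1, 0) else (s.reg 17, s.reg 18 + 1)) ∧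
      (fam E (next E α k G s false) = insS (fam E s) (Sparsify.petals (fam E s) c H) ∧
        (next E α k G s false).reg 17 = s.reg 17 + 1 ∧ (next E α k G s false).reg 18 = 0)) := by
  have hα2 := hp.two_le
  have hg0 : Good E (s.setReg 19 0) := hs.good.congr (by simp) (by simp) rfl rfl
  have hf0 : fam E (s.setReg 19 0) = fam E s := fam_congr rfl rfl
  have hfind := eval_find hg0 α k rfl
  rw [hf0] at hfind
  have hr : ∀ r, r ∉ [19, 16, 1, 38, 7, 6, 2, 3, 14, 4, 13, 15, 5, 11, 12] →
      ((find α k).eval E (s.setReg 19 0)).reg r = s.reg r := fun r hr => by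
    rw [List.mem_cons, not_or] at hr
    rw [eval_reg fun h => hr.2 (wr_find α k h), NState.setReg_reg, if_neg hr.1]
  have hb : ∀ b ≠ 5, ((find α k).eval E (s.setReg 19 0)).bank b = s.bank b := fun b hb =>
    eval_bank (fun h => by simpa [hb] using wb_find α k h) _
  simp only [next]
  set s1 := (find α k).eval E (s.setReg 19 0) with hs1
  have hg1 : Good E s1 := hs.good.congr (hr 0 (by simp)) (hr 9 (by simp)) (hb 2 (by simp))
    (hb 3 (by simp))
  have hf1 : fam E s1 = fam E s := fam_congr (hb 2 (by simp)) (hb 3 (by simp))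
  have h9 := hr 9 (by simp)
  have h17 := hr 17 (by simp)
  have h18 := hr 18 (by simp)
  rcases hfind with ⟨h11, hno⟩ | ⟨h11, c, i, h12, hbest⟩
  · left
    refine ⟨s1, fun d => by rw [h11]; simp, ⟨hg1, by rw [hf1]; exact hs.inv, ?_, ?_, ?_,
      hs.hearts, hs.petals⟩, hf1, h17, h18, hno⟩
    · rw [h9]; exact hs.rows
    · rw [h17, h18]; exact hs.pos
    · rw [h18]; exact hs.ctr
  · right
    have hci := hbest.card_heart
    set H := vec E s1 5 0 with hH
    obtain ⟨hi1, hic, hck, ⟨t, t', hsun, hHt⟩, -⟩ := id hbest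
    have hHne : H.Nonempty := by
      rw [← Finset.card_pos]
      omega
    have htF : t ∈ fam E s := hsun.left
    have hHnot : ¬ ∃ C ∈ fam E s1, C ⊆ H := by
      rw [hf1]
      rintro ⟨C, hC, hCH⟩
      have := hs.inv.anti C hC t htF (hCH.trans (hHt ▸ Finset.inter_subset_left))
      rw [this] at hCH
      have := Finset.card_le_card hCH
      have := hsun.card_left
      omega
    have invH := hs.inv.heart hp.hα hbest
    have invP := hs.inv.petals hp.hα hbest
    have sumH := invH.sum_added_le hp.hk hα2
    have sumP := invP.sum_added_le hp.hk hα2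
    rw [sum_update (by omega)] at sumH sumP
    have hrows := hs.rows
    have hroom := hp.room
    have hle := hbest.le_card_petals
    have hthr := thr_pos (α := α) (by omega) i
    obtain ⟨a1, a2, a3, a4⟩ := eval_heartP hg1 (by omega) G hHnot rfl
    obtain ⟨b1, b2, b3, b4, b5⟩ := eval_petalP hg1 h12 (by rw [hf1]; exact hs.inv.anti) hHne
      (by rw [hf1, ← hH]; omega) rfl
    rw [← hH, hf1] at a3 b3 b2
    rw [h17, h18] at a4
    have hpos := hs.pos
    have hctr := hs.ctr
    have hG := hp.hG
    refine ⟨fun hno => hno c i hi1 hic hck t t' hsun, c, H, ?_, ?_, ?_⟩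
    · rintro (_ | _)
      · refine ⟨Function.update A i (A i + (Sparsify.petals (fam E s) c H).card),
          Function.update B i (B i + 1), h, ⟨?_, ?_, ?_, ?_, ?_, ?_, ?_⟩, ?_⟩
        · simpa [h11] using b1
        · simp only [h11, zero_lt_one, if_true, Bool.false_eq_true, if_false]
          rw [b3]
          exact invP
        · rw [sum_update (by omega)]
          simp [h11]
          omega
        · rw [sum_update (by omega)]
          simp only [h11, zero_lt_one, if_true, Bool.false_eq_true, if_false, b4, b5, h17]
          rw [add_mul, mul_add]
          omega
        · simp only [h11, zero_lt_one, if_true, Bool.false_eq_true, if_false, b5]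
          omega
        · rw [sum_update (by omega)]
          have := hs.hearts
          omega
        · intro j
          have := hs.petals j
          by_cases hj : j = i
          · subst hj
            simp only [Function.update_self, add_mul]
            omega
          · simpa [hj] using this
        · rw [sum_update (by omega)]
          omega
      · refine ⟨Function.update A (c - i) (A (c - i) + 1), B,
          h + 1, ⟨?_, ?_, ?_, ?_, ?_, ?_, ?_⟩, ?_⟩
        · simpa [h11] using a1
        · simp only [h11, zero_lt_one, if_true]
          rw [a3]
          exact invH
        · rw [sum_update (by omega)]
          simp [h11]
          omega
        · simp only [h11, zero_lt_one, if_true]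
          split_ifs at a4 with hc <;> rw [Prod.mk.injEq] at a4 <;> rw [a4.1, a4.2]
          · rw [add_mul]
            omega
          · omega
        · simp only [h11, zero_lt_one, if_true]
          split_ifs at a4 with hc <;> rw [Prod.mk.injEq] at a4 <;> rw [a4.2]
          · omega
          · omega
        · rw [sum_update (by omega)]
          have := hs.hearts
          omega
        · intro j
          have := hs.petals j
          by_cases hj : j = c - i
          · subst hj
            simp only [Function.update_self]
            omega
          · simpa [hj] using this
        · rw [sum_update (by omega)]
          omega
    · simp only [h11, zero_lt_one, if_true]
      exact ⟨a3, a4⟩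
    · simp only [h11, zero_lt_one, if_true, Bool.false_eq_true, if_false]
      exact ⟨b3, by rw [b4, h17], b5⟩

end FP

/-! ### Existence of a good branch -/

namespace FP

open Sparsify

lemma nextJ_spec {E : Env} {α k G m e : ℕ} (hp : Params E α k G m e) {s : NState}
    {A B : ℕ → ℕ} {h : ℕ} (hs : Progress E α k G m s A B h) (J : ℕ → ℕ) :
    ∃ A' B' h', Progress E α k G m (nextJ E α k G J s) A' B' h' ∧
      (fam E (nextJ E α k G J s) = fam E s ∧
          (∀ c i, 1 ≤ i → i < c → c ≤ k → NoSun α (fam E s) c i) ∨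
        (¬ ∀ c i, 1 ≤ i → i < c → c ≤ k → NoSun α (fam E s) c i) ∧
          ∑ i ∈ Finset.range k, A i < ∑ i ∈ Finset.range k, A' i) ∧
      (∀ T, Hits T (fam E (nextJ E α k G J s)) → Hits T (fam E s)) ∧
      s.reg 17 ≤ (nextJ E α k G J s).reg 17 := by
  rcases next_spec hp hs with ⟨s', h1, h2, h3, h4, h5, h6⟩ | ⟨h0, c, H, h1, ⟨h2, h3⟩, h4, h5, -⟩
  · rw [nextJ, h1]
    exact ⟨A, B, h, h2, Or.inl ⟨h3, h6⟩, fun T => by rw [h3]; exact id, h4.ge⟩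
  · obtain ⟨A', B', h', h6, h7⟩ := h1 (decide (s.reg 18 < J (s.reg 17)))
    refine ⟨A', B', h', h6, Or.inr ⟨h0, h7⟩, fun T => ?_, ?_⟩ <;> rw [nextJ] <;>
      generalize decide (s.reg 18 < J (s.reg 17)) = d <;> cases d
    · rw [h4]; exact Hits.of_insS
    · rw [h2]; exact Hits.of_insS
    · omega
    · split_ifs at h3 <;> rw [Prod.mk.injEq] at h3 <;> omega

/-- What holds after `t` steps of the branching process, for all digits. -/
lemma iterate_spec {E : Env} {α k G m e : ℕ} (hp : Params E α k G m e) {s : NState}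
    {A B : ℕ → ℕ} {h : ℕ} (hs : Progress E α k G m s A B h) (J : ℕ → ℕ) (t : ℕ) :
    ∃ A' B' h', Progress E α k G m ((nextJ E α k G J)^[t] s) A' B' h' ∧
      ((∀ c i, 1 ≤ i → i < c → c ≤ k →
          NoSun α (fam E ((nextJ E α k G J)^[t] s)) c i) ∨
        t ≤ ∑ i ∈ Finset.range k, A' i) ∧
      (∀ T, Hits T (fam E ((nextJ E α k G J)^[t] s)) → Hits T (fam E s)) := by
  induction t with
  | zero => exact ⟨A, B, h, hs, Or.inr (Nat.zero_le _), fun T => id⟩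
  | succ t ih =>
    obtain ⟨A', B', h', h1, h2, h3⟩ := ih
    rw [Function.iterate_succ_apply']
    obtain ⟨A'', B'', h'', h4, h5, h6, -⟩ := nextJ_spec hp h1 J
    refine ⟨A'', B'', h'', h4, ?_, fun T hT => h3 T (h6 T hT)⟩
    rcases h5 with ⟨h5, h7⟩ | ⟨h5, h7⟩
    · left
      rw [h5]
      exact h7
    · right
      have := h2.resolve_left h5
      omega

/-- Only the digits from the current position on matter, and only the first `e` digits. -/
lemma iterate_congr {E : Env} {α k G m e : ℕ} (hp : Params E α k G m e) {J J' : ℕ → ℕ} (t : ℕ)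
    {s : NState} {A B : ℕ → ℕ} {h : ℕ} (hs : Progress E α k G m s A B h)
    (hJ : ∀ p, s.reg 17 ≤ p → p < e → J p = J' p) :
    (nextJ E α k G J)^[t] s = (nextJ E α k G J')^[t] s := by
  induction t generalizing s A B h with
  | zero => rfl
  | succ t ih =>
    have e1 : nextJ E α k G J s = nextJ E α k G J' s := by
      rw [nextJ, nextJ, hJ _ le_rfl (hs.pos_lt hp)]
    rw [Function.iterate_succ_apply, Function.iterate_succ_apply, ← e1]
    obtain ⟨A', B', h', h1, -, -, h2⟩ := nextJ_spec hp hs J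
    exact ih h1 fun p hp => hJ p (h2.trans hp)

/-- The digits can be chosen such that a given solution survives: the decisions are made from the
first to the last step, and the digits are found from the last to the first. -/
lemma exists_digits_aux {E : Env} {α k G m e : ℕ} (hp : Params E α k G m e) {T : Finset ℕ} (t : ℕ)
    {s : NState} {A B : ℕ → ℕ} {h : ℕ} (hs : Progress E α k G m s A B h)
    (hT : Hits T (fam E s)) : ∃ J : ℕ → ℕ, (∀ p, J p < G) ∧ s.reg 18 ≤ J (s.reg 17) ∧
      Hits T (fam E ((nextJ E α k G J)^[t] s)) := by
  have hctr := hs.ctr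
  induction t generalizing s A B h with
  | zero => exact ⟨fun _ => s.reg 18, fun _ => lt_of_lt_of_le hctr (Nat.sub_le _ _), le_rfl, hT⟩
  | succ t ih =>
    simp only [Function.iterate_succ_apply]
    rcases next_spec hp hs with ⟨s', h1, h2, h3, h4, h5, -⟩ |
      ⟨-, c, H, h1, ⟨h2, h3⟩, h4, h5, h6⟩
    · obtain ⟨J, k1, k2, k3⟩ := ih h2 (by rwa [h3]) h2.ctr
      rw [h4, h5] at k2
      refine ⟨J, k1, k2, ?_⟩
      rwa [nextJ, h1]
    · by_cases hH : ∃ l ∈ H, l ∈ T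
      · -- take the heart
        obtain ⟨A', B', h', k0, -⟩ := h1 true
        obtain ⟨J, k1, k2, k3⟩ := ih k0 (by
          rw [h2]
          exact hT.insS fun C hC => by rw [Finset.mem_singleton.1 hC]; exact hH) k0.ctr
        split_ifs at h3 with hc <;> rw [Prod.mk.injEq] at h3 <;> rw [h3.1, h3.2] at k2
        · refine ⟨Function.update J (s.reg 17) (G - 1), fun p => ?_, ?_, ?_⟩
          · by_cases hps : p = s.reg 17
            · simp [hps]; omega
            · simpa [hps] using k1 p
          · simp; omega
          · have e1 : nextJ E α k G (Function.update J (s.reg 17) (G - 1)) s =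
                next E α k G s true := by
              simp [nextJ, hctr]
            rw [e1, iterate_congr hp (J' := J) t k0]
            · exact k3
            · intro p h7 _
              rw [h3.1] at h7
              exact Function.update_of_ne (by omega) _ _
        · refine ⟨J, k1, by omega, ?_⟩
          have e1 : nextJ E α k G J s = next E α k G s true := by
            have : s.reg 18 < J (s.reg 17) := by omega
            simp [nextJ, this]
          rwa [e1]
      · -- take the petals
        obtain ⟨A', B', h', k0, -⟩ := h1 false
        obtain ⟨J, k1, k2, k3⟩ := ih k0 (by
          rw [h4]
          exact hT.insS (hT.petals hH)) k0.ctr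
        refine ⟨Function.update J (s.reg 17) (s.reg 18), fun p => ?_, by simp, ?_⟩
        · by_cases hps : p = s.reg 17
          · simp [hps]; omega
          · simpa [hps] using k1 p
        · have e1 : nextJ E α k G (Function.update J (s.reg 17) (s.reg 18)) s =
              next E α k G s false := by
            simp [nextJ]
          rw [e1, iterate_congr hp (J' := J) t k0]
          · exact k3
          · intro p h7 _
            rw [h5] at h7
            exact Function.update_of_ne (by omega) _ _

lemma exists_digits {E : Env} {α k G m e : ℕ} (hp : Params E α k G m e) {T : Finset ℕ} (t : ℕ)
    {s : NState} {A B : ℕ → ℕ} {h : ℕ} (hs : Progress E α k G m s A B h)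
    (hT : Hits T (fam E s)) : ∃ J : ℕ → ℕ, (∀ p, J p < G) ∧ (∀ p, e ≤ p → J p = 0) ∧
      Hits T (fam E ((nextJ E α k G J)^[t] s)) := by
  obtain ⟨J, h1, -, h2⟩ := exists_digits_aux hp t hs hT
  have hG := hp.hG
  refine ⟨fun p => if p < e then J p else 0, fun p => ?_, fun p hp => if_neg (by omega), ?_⟩
  · dsimp only
    split_ifs
    exacts [h1 p, by omega]
  · rw [iterate_congr hp (J' := J) t hs fun p _ h => if_pos h]
    exact h2

end FP

/-! ### Leaves of the branching process -/

namespace FP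

open Sparsify

/-- The registers that occur in a program. -/
def regs : FP → List ℕ
  | skip => []
  | const r _ | setc r _ => [r]
  | addl r s _ | addc r s _ => [r, s]
  | addv r s t => [r, s, t]
  | inp _ r s _ t | load _ r s _ t | store _ s _ t r => [r, s, t]
  | load1 _ r s | store1 _ s r => [r, s]
  | seq p q => p.regs ++ q.regs
  | ite r s p q => r :: s :: (p.regs ++ q.regs)
  | ifPos r p q => r :: (p.regs ++ q.regs)
  | loop i _ p => i :: p.regs

/-- The states agree on the registers below `39` and on the banks in `L`. -/
def Agree (L : List ℕ) (s s' : NState) : Prop :=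
  (∀ r < 39, s.reg r = s'.reg r) ∧ ∀ b ∈ L, s.bank b = s'.bank b

lemma Agree.setReg {L : List ℕ} {s s' : NState} (h : Agree L s s') (r x : ℕ) :
    Agree L (s.setReg r x) (s'.setReg r x) := by
  refine ⟨fun r' hr' => ?_, h.2⟩
  rw [NState.setReg_reg, NState.setReg_reg, h.1 r' hr']

lemma Agree.setCell {L : List ℕ} {s s' : NState} (h : Agree L s s') (b i x : ℕ) :
    Agree L (s.setCell b i x) (s'.setCell b i x) := by
  refine ⟨h.1, fun b' hb' => funext fun i' => ?_⟩
  rw [NState.setCell_bank, NState.setCell_bank, h.2 b' hb']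

lemma Agree.eval {L : List ℕ} {E : Env} {p : FP} {s s' : NState} (h : Agree L s s')
    (hr : ∀ r ∈ p.regs, r < 39) (hb : p.rb ⊆ L) : Agree L (p.eval E s) (p.eval E s') := by
  induction p generalizing s s' with
  | seq p q ihp ihq =>
    simp only [regs, rb, List.mem_append, List.append_subset] at hr hb
    exact ihq (ihp h (fun r h => hr r (Or.inl h)) hb.1) (fun r h => hr r (Or.inr h)) hb.2
  | ite a c p q ihp ihq =>
    simp only [regs, rb, List.mem_cons, List.mem_append, List.append_subset] at hr hb
    simp only [FP.eval, h.1 a (hr a (by simp)), h.1 c (hr c (by simp))]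
    split_ifs
    · exact ihp h (fun r h => hr r (by tauto)) hb.1
    · exact ihq h (fun r h => hr r (by tauto)) hb.2
  | ifPos a p q ihp ihq =>
    simp only [regs, rb, List.mem_cons, List.mem_append, List.append_subset] at hr hb
    simp only [FP.eval, h.1 a (hr a (by simp))]
    split_ifs
    · exact ihp h (fun r h => hr r (by tauto)) hb.1
    · exact ihq h (fun r h => hr r (by tauto)) hb.2
  | loop i j p ih =>
    simp only [regs, rb, List.mem_cons] at hr hb
    simp only [FP.eval]
    generalize E.κ j = N
    induction N with
    | zero => exact h
    | succ N ihN => exact ih (ihN.setReg _ _) (fun r h => hr r (Or.inr h)) hb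
  | skip => exact h
  | store1 b t r =>
    simp only [regs, List.mem_cons, List.not_mem_nil, or_false] at hr
    simp only [FP.eval, h.1 t (hr t (by simp)), h.1 r (hr r (by simp))]
    exact h.setCell _ _ _
  | store b t j u r =>
    simp only [regs, List.mem_cons, List.not_mem_nil, or_false] at hr
    simp only [FP.eval, h.1 t (hr t (by simp)), h.1 r (hr r (by simp)), h.1 u (hr u (by simp))]
    exact h.setCell _ _ _
  | load1 b r t =>
    simp only [regs, rb, List.mem_cons, List.not_mem_nil, or_false] at hr hb
    simp only [FP.eval, h.1 t (hr t (by simp)), h.2 b (hb (by simp))]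
    exact h.setReg _ _
  | load b r t j u =>
    simp only [regs, rb, List.mem_cons, List.not_mem_nil, or_false] at hr hb
    simp only [FP.eval, h.1 t (hr t (by simp)), h.1 u (hr u (by simp)), h.2 b (hb (by simp))]
    exact h.setReg _ _
  | const r z | setc r j => exact h.setReg _ _
  | addl r t z | addc r t j =>
    simp only [regs, List.mem_cons, List.not_mem_nil, or_false] at hr
    simp only [FP.eval, h.1 t (hr t (by simp))]
    exact h.setReg _ _
  | addv r t u | inp pos r t j u =>
    simp only [regs, List.mem_cons, List.not_mem_nil, or_false] at hr
    simp only [FP.eval, h.1 t (hr t (by simp)), h.1 u (hr u (by simp))]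
    exact h.setReg _ _

lemma regs_ifEq (r t : ℕ) (p : FP) : (ifEq r t p).regs = r :: t :: t :: r :: p.regs := by
  simp [ifEq, regs]
lemma regs_subV (b₁ r₁ b₂ r₂ : ℕ) :
    (subV b₁ r₁ b₂ r₂).regs = [5, 2, 3, r₁, 2, 4, r₂, 2, 3, 4, 5] := by
  simp [subV, regs]
lemma regs_cardV (b r : ℕ) : (cardV b r).regs = [6, 2, 3, r, 2, 3, 6, 6] := by simp [cardV, regs]
lemma regs_interV (neg : Bool) (b₁ r₁ b₂ r₂ b r : ℕ) :
    (interV neg b₁ r₁ b₂ r₂ b r).regs = [2, 3, r₁, 2, 4, r₂, 2, 6, 3, 4, 6, 6, r, 2] := by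
  cases neg <;> simp [interV, regs]
lemma regs_clearV (b r z : ℕ) : (clearV b r z).regs = [2, z, r, 2] := by simp [clearV, regs]
lemma rb_clearV (b r z : ℕ) : (clearV b r z).rb = [] := by simp [clearV, rb]
lemma regs_ins : ∀ r ∈ ins.regs, r < 39 := by
  simp [ins, insTest, insKill, regs, regs_subV, regs_interV]

lemma regs_seqs {p : ℕ → FP} {N n : ℕ} (h : ∀ a, ∀ r ∈ (p a).regs, r < N) :
    ∀ r ∈ (seqs p n).regs, r < N := by
  induction n with
  | zero => simp [seqs, regs]
  | succ n ih =>
    intro r hr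
    rw [seqs, regs, List.mem_append] at hr
    exact hr.elim (ih r) (h n r)

lemma regs_find (α k : ℕ) : ∀ r ∈ (find α k).regs, r < 39 := by
  intro r hr
  simp only [find, regs, List.mem_append, List.mem_singleton] at hr
  rcases hr with rfl | hr
  · simp
  · refine regs_seqs (fun c => regs_seqs fun i => ?_) r hr
    simp [regs, findV, tryV, countV, isLive, regs_interV, regs_cardV, regs_ifEq, regs_subV]

lemma regs_stepP (α k G : ℕ) : ∀ r ∈ (stepP α k G).regs, r < 39 := by
  have h1 := regs_find α k
  have h2 := regs_ins
  simp only [stepP, heartP, petalP, isLive, regs, regs_interV, regs_cardV, regs_ifEq, regs_subV,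
    List.mem_append, List.mem_cons, List.not_mem_nil, or_false]
  intro r hr
  by_contra hlt
  have a1 : r ∉ (find α k).regs := fun h => hlt (h1 r h)
  have a2 : r ∉ ins.regs := fun h => hlt (h2 r h)
  simp only [a1, a2, or_false, false_or] at hr
  omega

lemma eval_seq (E : Env) (p q : FP) (s : NState) : (p ;; q).eval E s = q.eval E (p.eval E s) := rfl

/-- Clear the registers in a list. -/
def zeroR : List ℕ → FP
  | [] => skip
  | r :: L => const r 0 ;; zeroR L

lemma eval_zeroR (E : Env) (L : List ℕ) (s : NState) :
    ((zeroR L).eval E s).bank = s.bank ∧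
      ∀ r, ((zeroR L).eval E s).reg r = if r ∈ L then 0 else s.reg r := by
  induction L generalizing s with
  | nil => simp [zeroR, eval]
  | cons a L ih =>
    rw [zeroR, eval]
    obtain ⟨h1, h2⟩ := ih ((const a 0).eval E s)
    refine ⟨h1, fun r => ?_⟩
    rw [h2]
    by_cases hr : r ∈ L <;> by_cases hra : r = a <;> simp [hr, hra, eval]

/-- Clear the working memory. -/
def clearP : FP :=
  zeroR (List.range 39) ;; loop 1 2 (clearV 2 1 0 ;; store1 3 1 0) ;; clearV 4 0 0 ;; clearV 5 0 0

/-- All cells outside the working memory are `0`. -/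
structure Clean (E : Env) (s : NState) : Prop where
  bank2 : ∀ i, E.κ 2 * E.κ 1 ≤ i → s.bank 2 i = 0
  bank3 : ∀ i, E.κ 2 ≤ i → s.bank 3 i = 0
  bank4 : ∀ i, E.κ 1 ≤ i → s.bank 4 i = 0
  bank5 : ∀ i, E.κ 1 ≤ i → s.bank 5 i = 0

lemma Clean.congr {E : Env} {s s' : NState} (h : Clean E s)
    (hb : ∀ b ∈ [2, 3, 4, 5], s'.bank b = s.bank b) : Clean E s' := by
  constructor
  · rw [hb 2 (by simp)]; exact h.bank2
  · rw [hb 3 (by simp)]; exact h.bank3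
  · rw [hb 4 (by simp)]; exact h.bank4
  · rw [hb 5 (by simp)]; exact h.bank5

/-- Writing a row changes only the cells of this row. -/
lemma bank_clearV {E : Env} {s : NState} {b r z : ℕ} (hr : r ≠ 2) (hz : z ≠ 2) (h0 : s.reg z = 0)
    (i : ℕ) : ((clearV b r z).eval E s).bank b i =
      if ∃ l < E.κ 1, i = s.reg r * E.κ 1 + l then 0 else s.bank b i := by
  rw [clearV]
  refine eval_loop_frame (fun a s' => s'.bank b i =
    if ∃ l < a, i = s.reg r * E.κ 1 + l then 0 else s.bank b i) (by simp) ?_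
  intro a ha s' hf hb h
  have hr1 : s'.reg r = s.reg r := hf r (by simp [wr, hr])
  have hz1 : s'.reg z = 0 := (hf z (by simp [wr, hz])).trans h0
  have hex : (∃ l < a + 1, i = s.reg r * E.κ 1 + l) ↔
      (∃ l < a, i = s.reg r * E.κ 1 + l) ∨ i = s.reg r * E.κ 1 + a := by
    simp only [Nat.lt_succ_iff_lt_or_eq, or_and_right, exists_or, exists_eq_left]
  simp only [hex]
  by_cases hla : i = s.reg r * E.κ 1 + a
  · simp [eval, hr, hr1, hz, hz1, hla]
  · simp only [hla, or_false]
    rw [← h]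
    simp [eval, hr, hr1, hz, hz1, hla]

lemma eval_clearP {E : Env} {s : NState} (hs : Clean E s) :
    ∀ b ∈ [2, 3, 4, 5], (clearP.eval E s).bank b = fun _ => 0 := by
  rw [clearP]
  simp only [eval_seq]
  obtain ⟨hb1, hr1⟩ := eval_zeroR E (List.range 39) s
  set s1 := (zeroR (List.range 39)).eval E s with hs1
  have h0 : s1.reg 0 = 0 := by rw [hr1, if_pos (by simp)]
  have key := eval_loop_frame (E := E) (i := 1) (j := 2) (p := clearV 2 1 0 ;; store1 3 1 0)
    (s := s1) (fun a s' => (∀ i, a * E.κ 1 ≤ i ∨ s'.bank 2 i = 0) ∧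
      (∀ i, E.κ 2 * E.κ 1 ≤ i → s'.bank 2 i = 0) ∧ (∀ i < a, s'.bank 3 i = 0) ∧
      ∀ i, E.κ 2 ≤ i → s'.bank 3 i = 0)
    ⟨by simp, by rw [hb1]; exact hs.bank2, by simp, by rw [hb1]; exact hs.bank3⟩ (by
      rintro a ha s' hf hb ⟨h1, h2, h3, h4⟩
      have z : s'.reg 0 = 0 := (hf 0 (by simp [wr])).trans h0
      have k2 := bank_clearV (E := E) (s := s'.setReg 1 a) (b := 2) (r := 1) (z := 0) (by simp)
        (by simp) (by simpa using z)
      have k3 : ((clearV 2 1 0).eval E (s'.setReg 1 a)).bank 3 = s'.bank 3 := eval_bank (by simp) _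
      have k1 : ((clearV 2 1 0).eval E (s'.setReg 1 a)).reg 1 = a :=
        (eval_reg (by simp) _).trans (by simp)
      have k0 : ((clearV 2 1 0).eval E (s'.setReg 1 a)).reg 0 = 0 :=
        (eval_reg (by simp) _).trans (by simpa using z)
      simp at k2
      simp only [eval, NState.setCell_bank, k1, k0, k2, k3]
      simp only [Nat.reduceEqDiff, false_and, true_and, if_false]
      refine ⟨fun i => ?_, fun i hi => ?_, fun i hi => ?_, fun i hi => ?_⟩
      · rcases h1 i with h | h
        · by_cases hi : (a + 1) * E.κ 1 ≤ i
          · exact Or.inl hi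
          · right
            rw [add_mul] at hi
            exact if_pos ⟨i - a * E.κ 1, by omega, by omega⟩
        · right
          rw [h]
          simp
      · rw [h2 i hi]
        simp
      · by_cases hia : i = a
        · simp [hia]
        · rw [if_neg hia]
          exact h3 i (by omega)
      · rw [h4 i hi]
        simp)
  set s2 := (loop 1 2 (clearV 2 1 0 ;; store1 3 1 0)).eval E s1 with hs2
  have hb2 : ∀ b, b ∉ [2, 3] → s2.bank b = s.bank b := fun b hb => by
    rw [hs2, eval_bank (by simpa [wb] using hb), hb1]
  have h02 : s2.reg 0 = 0 := (eval_reg (by simp [wr]) _).trans h0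
  have k4 := bank_clearV (E := E) (s := s2) (b := 4) (r := 0) (z := 0) (by simp) (by simp) h02
  have k45 : ∀ b ≠ 4, ((clearV 4 0 0).eval E s2).bank b = s2.bank b := fun b hb =>
    eval_bank (by simpa using hb) _
  have h03 : ((clearV 4 0 0).eval E s2).reg 0 = 0 := (eval_reg (by simp) _).trans h02
  set s3 := (clearV 4 0 0).eval E s2 with hs3
  have k5 := bank_clearV (E := E) (s := s3) (b := 5) (r := 0) (z := 0) (by simp) (by simp) h03
  have k55 : ∀ b ≠ 5, ((clearV 5 0 0).eval E s3).bank b = s3.bank b := fun b hb =>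
    eval_bank (by simpa using hb) _
  intro b hb
  funext i
  simp only [List.mem_cons, List.not_mem_nil, or_false] at hb
  rcases hb with rfl | rfl | rfl | rfl
  · rw [k55 2 (by simp), k45 2 (by simp)]
    rcases key.1 i with h | h
    · exact key.2.1 i h
    · exact h
  · rw [k55 3 (by simp), k45 3 (by simp)]
    by_cases h : i < E.κ 2
    · exact key.2.2.1 i h
    · exact key.2.2.2 i (by omega)
  · rw [k55 4 (by simp), k4, h02, hb2 4 (by simp)]
    split_ifs with h
    · rfl
    · refine hs.bank4 i ?_
      by_contra hi
      exact h ⟨i, by omega, by omega⟩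
  · rw [k5, h03, k45 5 (by simp), hb2 5 (by simp)]
    split_ifs with h
    · rfl
    · refine hs.bank5 i ?_
      by_contra hi
      exact h ⟨i, by omega, by omega⟩

lemma reg_clearP (E : Env) (s : NState) {r : ℕ} (hr : r ∉ [1, 2]) (hr' : r < 39) :
    (clearP.eval E s).reg r = 0 := by
  rw [clearP, eval]
  rw [eval_reg (by simpa [wr] using hr), (eval_zeroR E _ s).2, if_pos (by simpa using hr')]

end FP

/-! ### The family at a leaf -/

namespace FP

open Sparsify

/-- `p` preserves the emptiness of the memory outside the working memory. -/
def KeepsClean (E : Env) (p : FP) : Prop :=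
  ∀ s : NState, s.reg 0 = 0 → Clean E s → (p.eval E s).reg 0 = 0 ∧ Clean E (p.eval E s)

section

variable {E : Env} {p q : FP}

lemma KeepsClean.seq (hp : KeepsClean E p) (hq : KeepsClean E q) : KeepsClean E (p ;; q) :=
  fun s h0 hs => hq _ (hp s h0 hs).1 (hp s h0 hs).2

lemma KeepsClean.ite (r t : ℕ) (hp : KeepsClean E p) (hq : KeepsClean E q) :
    KeepsClean E (ite r t p q) := fun s h0 hs => by
  rw [eval]
  split_ifs
  exacts [hp s h0 hs, hq s h0 hs]

lemma KeepsClean.ifPos (r : ℕ) (hp : KeepsClean E p) (hq : KeepsClean E q) :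
    KeepsClean E (ifPos r p q) := fun s h0 hs => by
  rw [eval]
  split_ifs
  exacts [hp s h0 hs, hq s h0 hs]

lemma KeepsClean.loop {i : ℕ} (hi : i ≠ 0) (j : ℕ) (hp : KeepsClean E p) :
    KeepsClean E (loop i j p) := fun s h0 hs => by
  refine eval_loop (fun _ s' => s'.reg 0 = 0 ∧ Clean E s') ⟨h0, hs⟩ fun a _ s' h => ?_
  exact hp _ (by simpa [hi.symm] using h.1) (h.2.congr fun _ _ => rfl)

lemma KeepsClean.of_wb (h0 : 0 ∉ p.wr) (hb : ∀ b ∈ [2, 3, 4, 5], b ∉ p.wb) : KeepsClean E p :=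
  fun s h hs => ⟨(eval_reg h0 s).trans h, hs.congr fun b hb' => eval_bank (hb b hb') s⟩

lemma KeepsClean.seqs {p : ℕ → FP} (hp : ∀ a, KeepsClean E (p a)) (n : ℕ) :
    KeepsClean E (seqs p n) := by
  induction n with
  | zero => exact fun s h0 hs => ⟨h0, hs⟩
  | succ n ih => exact ih.seq (hp n)

/-- Writing a row changes no cells outside this row. -/
lemma bank_interV {s : NState} (neg : Bool) {b₁ r₁ b₂ r₂ b r : ℕ} (hr : r ∉ [2, 3, 4, 6]) {i : ℕ}
    (hi : ∀ l < E.κ 1, i ≠ s.reg r * E.κ 1 + l) :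
    ((interV neg b₁ r₁ b₂ r₂ b r).eval E s).bank b i = s.bank b i := by
  simp only [List.mem_cons, List.not_mem_nil, or_false, not_or] at hr
  rw [interV]
  refine eval_loop_frame (fun a s' => s'.bank b i = s.bank b i) rfl fun a ha s' hf hb h => ?_
  have hr3 : s'.reg r = s.reg r := hf r (by cases neg <;> simp [wr, hr])
  have := hi a ha
  rw [eval_seq, eval_seq, eval_seq, eval_seq]
  generalize hs1 : (load b₁ 3 r₁ 1 2).eval E (s'.setReg 2 a) = s1
  generalize hs2 : (load b₂ 4 r₂ 1 2).eval E s1 = s2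
  generalize hs3 : (const 6 0).eval E s2 = s3
  generalize hs4 : (FP.ifPos 3
      (if neg then FP.ifPos 4 skip (const 6 1) else FP.ifPos 4 (const 6 1) skip)
    skip).eval E s3 = s4
  have h4 : s4.bank b i = s.bank b i := by
    rw [← hs4, eval_bank (by cases neg <;> simp [wb]), ← hs3, ← hs2, ← hs1]
    simpa [eval] using h
  have h4r : s4.reg r = s.reg r := by
    rw [← hs4, eval_reg (by cases neg <;> simp [wr, hr]), ← hs3, ← hs2, ← hs1]
    simp [eval, hr, hr3]
  have h42 : s4.reg 2 = a := by
    rw [← hs4, eval_reg (by cases neg <;> simp [wr]), ← hs3, ← hs2, ← hs1]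
    simp [eval]
  simp [eval, h4r, h42, this, h4]

lemma keepsClean_interV (neg : Bool) {b₁ r₁ b₂ r₂ b : ℕ} (hb : b = 4 ∨ b = 5) :
    KeepsClean E (interV neg b₁ r₁ b₂ r₂ b 0) := fun s h0 hs => by
  have hout : ∀ i, E.κ 1 ≤ i →
      ((interV neg b₁ r₁ b₂ r₂ b 0).eval E s).bank b i = s.bank b i := fun i hi =>
    bank_interV neg (by simp) fun l hl => by rw [h0]; omega
  have hoth : ∀ b' ≠ b, ((interV neg b₁ r₁ b₂ r₂ b 0).eval E s).bank b' = s.bank b' :=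
    fun b' hb' => eval_bank (by simpa using hb') s
  refine ⟨(eval_reg (by simp) s).trans h0, ⟨?_, ?_, fun i hi => ?_, fun i hi => ?_⟩⟩
  · rw [hoth 2 (by omega)]; exact hs.bank2
  · rw [hoth 3 (by omega)]; exact hs.bank3
  · by_cases h : b = 4
    · subst h; rw [hout i hi]; exact hs.bank4 i hi
    · rw [hoth 4 (by omega)]; exact hs.bank4 i hi
  · by_cases h : b = 5
    · subst h; rw [hout i hi]; exact hs.bank5 i hi
    · rw [hoth 5 (by omega)]; exact hs.bank5 i hi

lemma keepsClean_clearV : KeepsClean E (clearV 4 0 0) := fun s h0 hs => by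
  have hoth : ∀ b' ≠ 4, ((clearV 4 0 0).eval E s).bank b' = s.bank b' :=
    fun b' hb' => eval_bank (by simpa using hb') s
  refine ⟨(eval_reg (by simp) s).trans h0, ⟨?_, ?_, fun i hi => ?_, ?_⟩⟩
  · rw [hoth 2 (by omega)]; exact hs.bank2
  · rw [hoth 3 (by omega)]; exact hs.bank3
  · rw [bank_clearV (by simp) (by simp) h0]
    split_ifs
    exacts [rfl, hs.bank4 i hi]
  · rw [hoth 5 (by omega)]; exact hs.bank5

lemma keepsClean_insKill : KeepsClean E insKill := fun s h0 hs => by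
  have hoth : ∀ b' ≠ 3, (insKill.eval E s).bank b' = s.bank b' :=
    fun b' hb' => eval_bank (by simpa [wb_insKill] using hb') s
  refine ⟨(eval_reg (by simp [wr_insKill]) s).trans h0, ⟨?_, fun i hi => ?_, ?_, ?_⟩⟩
  · rw [hoth 2 (by omega)]; exact hs.bank2
  · rw [eval_insKill h0]
    split_ifs
    exacts [rfl, hs.bank3 i hi]
  · rw [hoth 4 (by omega)]; exact hs.bank4
  · rw [hoth 5 (by omega)]; exact hs.bank5

lemma keepsClean_ins : KeepsClean E ins := by
  refine KeepsClean.seq (.of_wb (by simp [wr_insTest]) (by simp [wb_insTest]))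
    (.ifPos _ (.of_wb (by simp [wr]) (by simp [wb])) fun s h0 hs => ?_)
  rw [eval_seq]
  have h0' : ((setc 10 2).eval E s).reg 0 = 0 := by simpa [eval] using h0
  have hs' : Clean E ((setc 10 2).eval E s) := hs.congr fun _ _ => rfl
  have r9 : ((setc 10 2).eval E s).reg 9 = s.reg 9 := by simp [eval]
  have r10 : ((setc 10 2).eval E s).reg 10 = E.κ 2 := by simp [eval]
  generalize (setc 10 2).eval E s = s' at *
  rw [eval, r9, r10]
  split_ifs with h9'
  swap
  · exact ⟨h0', hs'⟩
  rw [eval_seq]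
  obtain ⟨k0, ks⟩ := keepsClean_insKill _ h0' hs'
  have k9 : (insKill.eval E s').reg 9 = s.reg 9 := (eval_reg (by simp [wr_insKill]) _).trans r9
  set s1 := insKill.eval E s' with hs1
  refine ⟨(eval_reg (by simp [wr]) _).trans k0, ⟨fun i hi => ?_, fun i hi => ?_, ?_, ?_⟩⟩
  · have e : ((interV false 4 0 4 0 2 9 ;; const 10 1 ;; store1 3 9 10 ;; addl 9 9 1).eval
      E s1).bank 2
        i = ((interV false 4 0 4 0 2 9).eval E s1).bank 2 i := by simp [eval]
    rw [e, bank_interV _ (by simp), ks.bank2 i hi]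
    intro l hl h
    rw [k9] at h
    have := Nat.mul_le_mul_right (E.κ 1) (Nat.succ_le_of_lt h9')
    rw [Nat.succ_mul] at this
    omega
  · have e3 : ((interV false 4 0 4 0 2 9).eval E s1).bank 3 = s1.bank 3 := eval_bank (by simp) _
    have e9 : ((interV false 4 0 4 0 2 9).eval E s1).reg 9 = s.reg 9 :=
      (eval_reg (by simp) _).trans k9
    have : i ≠ s.reg 9 := by omega
    simp [eval, e3, e9, ks.bank3 i hi, this]
  · rw [eval_bank (by simp [wb])]; exact ks.bank4
  · rw [eval_bank (by simp [wb])]; exact ks.bank5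

lemma keepsClean_find (α k : ℕ) : KeepsClean E (find α k) := by
  refine .seq (.of_wb (by simp [wr]) (by simp [wb])) (.seqs (fun c => .seqs (fun i => ?_) _) _)
  refine .ifPos _ (.of_wb (by simp [wr]) (by simp [wb])) ?_
  refine .seq (.of_wb (by simp [wr]) (by simp [wb])) (.loop (by simp) _ ?_)
  refine .seq (.of_wb (by simp) (by simp)) (.ifPos _ ?_ (.of_wb (by simp [wr]) (by simp [wb])))
  refine .loop (by simp) _ (.seq (.of_wb (by simp) (by simp)) (.ifPos _ (.ifPos _
    (.of_wb (by simp [wr]) (by simp [wb])) ?_) (.of_wb (by simp [wr]) (by simp [wb]))))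
  exact .seq (keepsClean_interV _ (by simp)) (.of_wb (by simp [wr]) (by simp [wb]))

lemma keepsClean_stepP (α k G : ℕ) : KeepsClean E (stepP α k G) := by
  have hskip : KeepsClean E skip := .of_wb (by simp [wr]) (by simp [wb])
  refine .seq (.of_wb (by simp [wr]) (by simp [wb])) (.seq (keepsClean_find α k) (.ifPos _
    (.seq (.of_wb (by simp [wr]) (by simp [wb])) (.ite _ _ ?_ ?_)) hskip))
  · exact .seq (.of_wb (by simp [wr]) (by simp [wb])) (.seq (.of_wb (by simp [wr]) (by simp [wb]))
      (.seq (.of_wb (by simp [wr]) (by simp [wb])) (.seq (.of_wb (by simp [wr]) (by simp [wb]))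
      (.seq (keepsClean_interV _ (by simp)) keepsClean_ins))))
  · exact .seq (.of_wb (by simp [wr]) (by simp [wb])) (.seq (.of_wb (by simp [wr]) (by simp [wb]))
      (.seq (.of_wb (by simp [wr]) (by simp [wb])) (.seq (.of_wb (by simp [wr]) (by simp [wb]))
      (.loop (by simp) _ (.seq (.of_wb (by simp) (by simp)) (.ifPos _ (.seq
        (.of_wb (by simp) (by simp)) (.ifPos _ (.seq (keepsClean_interV _ (by simp))
        keepsClean_ins) hskip)) hskip))))))

end

/-- Put the number in register `37` into the set in bank `4`. -/
def markV : FP := setc 10 1 ;; ite 37 10 (const 10 1 ;; store1 4 37 10) skip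

/-- Bank `4 :=` the set of literals of the clause in register `22`. -/
def readClause : FP :=
  clearV 4 0 0 ;; loop 23 5 (inp true 37 22 5 23 ;; ifPos 37 markV skip ;;
    inp false 37 22 5 23 ;; ifPos 37 (addc 37 37 6 ;; markV) skip)

/-- The set of literals of the `i`-th clause of the input. The literal that the code `z > 0`
denotes is the point `z`, and the literal with the code `-z` is the point `z + κ 6`. -/
def clauseSet (E : Env) (i : ℕ) : Finset ℕ :=
  (Finset.range (E.κ 1)).filter fun l => ∃ j < E.κ 5,
    (0 < E.ι (i * E.κ 5 + j) ∧ l = (E.ι (i * E.κ 5 + j)).toNat) ∨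
    (E.ι (i * E.κ 5 + j) < 0 ∧ l = (-E.ι (i * E.κ 5 + j)).toNat + E.κ 6)

lemma card_clauseSet (E : Env) (i : ℕ) : (clauseSet E i).card ≤ E.κ 5 := by
  have : clauseSet E i ⊆ (Finset.range (E.κ 5)).image fun j => if 0 < E.ι (i * E.κ 5 + j)
      then (E.ι (i * E.κ 5 + j)).toNat else (-E.ι (i * E.κ 5 + j)).toNat + E.κ 6 := by
    intro l hl
    obtain ⟨-, j, hj, h⟩ := Finset.mem_filter.1 hl
    refine Finset.mem_image.2 ⟨j, Finset.mem_range.2 hj, ?_⟩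
    rcases h with ⟨h1, rfl⟩ | ⟨h1, rfl⟩
    · rw [if_pos h1]
    · rw [if_neg (by omega)]
  exact (Finset.card_le_card this).trans (Finset.card_image_le.trans (by simp))

lemma wr_readClause : readClause.wr = [2, 23, 37, 10, 10, 37, 37, 10, 10] := by
  simp [readClause, markV, wr]
lemma wb_readClause : readClause.wb = [4, 4, 4] := by simp [readClause, markV, wb]

lemma eval_markV (E : Env) (s : NState) (l : ℕ) :
    l < E.κ 1 → (0 < (markV.eval E s).bank 4 l ↔ 0 < s.bank 4 l ∨ l = s.reg 37) := by
  intro hl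
  by_cases h : s.reg 37 < E.κ 1
  · by_cases hls : l = s.reg 37 <;> simp [markV, eval, h, hls]
  · have : l ≠ s.reg 37 := by omega
    simp [markV, eval, h, this]

lemma eval_readClause {E : Env} {s : NState} (h0 : s.reg 0 = 0) :
    vec E (readClause.eval E s) 4 0 = clauseSet E (s.reg 22) := by
  have key : ∀ l < E.κ 1, 0 < (readClause.eval E s).bank 4 l ↔ ∃ j < E.κ 5,
      (0 < E.ι (s.reg 22 * E.κ 5 + j) ∧ l = (E.ι (s.reg 22 * E.κ 5 + j)).toNat) ∨
      (E.ι (s.reg 22 * E.κ 5 + j) < 0 ∧ l = (-E.ι (s.reg 22 * E.κ 5 + j)).toNat + E.κ 6) := by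
    rw [readClause, eval_seq]
    have h22 : ((clearV 4 0 0).eval E s).reg 22 = s.reg 22 := eval_reg (by simp) s
    have hcl := fun l => bank_clearV (E := E) (s := s) (b := 4) (r := 0) (z := 0) (by simp)
      (by simp) h0 l
    set s1 := (clearV 4 0 0).eval E s with hs1
    refine eval_loop_frame (fun a s' => ∀ l < E.κ 1, 0 < s'.bank 4 l ↔ ∃ j < a,
      (0 < E.ι (s.reg 22 * E.κ 5 + j) ∧ l = (E.ι (s.reg 22 * E.κ 5 + j)).toNat) ∨
      (E.ι (s.reg 22 * E.κ 5 + j) < 0 ∧ l = (-E.ι (s.reg 22 * E.κ 5 + j)).toNat + E.κ 6))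
      (fun l hl => ?_) fun a ha s' hf hb h l hl => ?_
    · rw [hcl, h0, if_pos ⟨l, hl, by omega⟩]
      simp
    · have hr : s'.reg 22 = s.reg 22 := (hf 22 (by simp [wr, markV])).trans h22
      have hex : ∀ P : ℕ → Prop, (∃ j < a + 1, P j) ↔ (∃ j < a, P j) ∨ P a := fun P => by
        simp only [Nat.lt_succ_iff_lt_or_eq, or_and_right, exists_or, exists_eq_left]
      rw [hex, ← h l hl]
      simp only [eval_seq]
      set z := E.ι (s.reg 22 * E.κ 5 + a) with hz
      have e1 : (inp true 37 22 5 23).eval E (s'.setReg 23 a) =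
          (s'.setReg 23 a).setReg 37 z.toNat := by simp [eval, hr, hz]
      rw [e1]
      set s2 := (ifPos 37 markV skip).eval E ((s'.setReg 23 a).setReg 37 z.toNat) with hs2
      have r2 : s2.reg 22 = s.reg 22 ∧ s2.reg 23 = a := by
        rw [hs2, eval_reg (by simp [markV, wr]), eval_reg (by simp [markV, wr])]
        simp [hr]
      have b2 : 0 < s2.bank 4 l ↔ 0 < s'.bank 4 l ∨ 0 < z ∧ l = z.toNat := by
        rw [hs2, eval]
        by_cases hz0 : 0 < z
        · rw [if_pos (by simp; omega), eval_markV E _ l hl]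
          simp [hz0]
        · rw [if_neg (by simp; omega)]
          simp [hz0, eval]
      have e3 : (inp false 37 22 5 23).eval E s2 = s2.setReg 37 (-z).toNat := by
        simp [eval, r2, hz]
      rw [e3, eval]
      by_cases hz0 : z < 0
      · rw [if_pos (by simp; omega), eval_seq, eval_markV E _ l hl]
        simp only [eval, NState.setReg_reg, NState.setReg_bank, if_true, b2, hz0, true_and]
        tauto
      · rw [if_neg (by simp; omega)]
        simp only [eval, NState.setReg_bank, b2, hz0, false_and]
        tauto
  ext l
  rw [mem_vec, clauseSet, Finset.mem_filter, Finset.mem_range]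
  refine and_congr_right fun hl => ?_
  rw [zero_mul, zero_add]
  exact key l hl

/-- Read the clauses. -/
def readP : FP := loop 22 4 (readClause ;; ins)

lemma wr_readP : readP.wr = [22, 2, 23, 37, 10, 10, 37, 37, 10, 10,
    8, 21, 7, 5, 2, 3, 4, 5, 8, 10, 21, 7, 5, 2, 3, 4, 5, 2, 3, 4, 6, 6, 10, 9] := by
  simp [readP, wr, wr_readClause]
lemma wb_readP : readP.wb = [4, 4, 4, 3, 2, 3] := by simp [readP, wb, wb_readClause]

/-- The family of all clauses, without the redundant ones. -/
lemma eval_readP {E : Env} {s : NState} (h0 : s.reg 0 = 0) (h9 : s.reg 9 = 0)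
    (h3 : ∀ t, s.bank 3 t = 0) (hm : E.κ 4 ≤ E.κ 2) :
    Good E (readP.eval E s) ∧ (readP.eval E s).reg 9 ≤ E.κ 4 ∧
    (∀ C ∈ fam E (readP.eval E s), ∀ D ∈ fam E (readP.eval E s), C ⊆ D → C = D) ∧
    (∀ C ∈ fam E (readP.eval E s), ∃ i < E.κ 4, C = clauseSet E i) ∧
    ∀ T, Hits T (fam E (readP.eval E s)) ↔ ∀ i < E.κ 4, ∃ l ∈ clauseSet E i, l ∈ T := by
  have hfam : fam E s = ∅ := by
    rw [fam, Finset.image_eq_empty]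
    exact Finset.filter_eq_empty_iff.2 fun t _ => by simp [h3 t]
  refine eval_loop_frame (fun a s' => Good E s' ∧ s'.reg 9 ≤ a ∧
    (∀ C ∈ fam E s', ∀ D ∈ fam E s', C ⊆ D → C = D) ∧
    (∀ C ∈ fam E s', ∃ i < a, C = clauseSet E i) ∧
    ∀ T, Hits T (fam E s') ↔ ∀ i < a, ∃ l ∈ clauseSet E i, l ∈ T)
    ⟨⟨h0, fun t _ => h3 t, ?_⟩, by omega, by simp [hfam], by simp [hfam], ?_⟩ ?_
  · have : live E s = ∅ := Finset.filter_eq_empty_iff.2 fun t _ => by simp [h3 t]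
    simp [this]
  · intro T
    simp [hfam, Hits]
  rintro a ha s' hf hb ⟨h1, h2, h4, h5, h6⟩
  rw [eval_seq]
  have hv := eval_readClause (E := E) (s := s'.setReg 22 a) (by simpa using h1.zero)
  have hr : ∀ r, r ∉ [2, 23, 37, 10] →
      (readClause.eval E (s'.setReg 22 a)).reg r = (s'.setReg 22 a).reg r := fun r hr =>
    eval_reg (by simp at hr; simp [wr_readClause, hr]) _
  have hbb : ∀ b ≠ 4, (readClause.eval E (s'.setReg 22 a)).bank b = s'.bank b := fun b hb =>
    (eval_bank (by simpa [wb_readClause] using hb) _).trans rfl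
  set s1 := readClause.eval E (s'.setReg 22 a) with hs1
  have k0 := hr 0 (by simp)
  have k9 := hr 9 (by simp)
  simp at hv k0 k9
  have g1 : Good E s1 := h1.congr k0 k9 (hbb 2 (by simp)) (hbb 3 (by simp))
  have f1 : fam E s1 = fam E s' := fam_congr (hbb 2 (by simp)) (hbb 3 (by simp))
  obtain ⟨k1, -, k2, k3⟩ := fam_ins g1 (by omega)
  rw [f1, hv] at k3
  have hall : ∀ T : Finset ℕ, (∀ i < a + 1, ∃ l ∈ clauseSet E i, l ∈ T) ↔
      (∀ i < a, ∃ l ∈ clauseSet E i, l ∈ T) ∧ ∃ l ∈ clauseSet E a, l ∈ T := fun T =>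
    Nat.forall_lt_succ_right
  refine ⟨k1, by omega, ?_⟩
  by_cases hex : ∃ C ∈ fam E s', C ⊆ clauseSet E a
  · rw [if_pos hex] at k3
    rw [k3]
    refine ⟨h4, fun C hC => ?_, fun T => ?_⟩
    · obtain ⟨i, hi, rfl⟩ := h5 C hC
      exact ⟨i, by omega, rfl⟩
    · rw [hall, ← h6, iff_self_and]
      intro hT
      obtain ⟨C, hC, hsub⟩ := hex
      obtain ⟨l, hl, hlT⟩ := hT C hC
      exact ⟨l, hsub hl, hlT⟩
  · rw [if_neg hex] at k3
    rw [k3]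
    refine ⟨fun C hC D hD hCD => ?_, fun C hC => ?_, fun T => ?_⟩
    · rw [mem_insS] at hC hD
      simp only [Finset.mem_singleton, forall_eq] at hC hD
      rcases hC with rfl | ⟨hC, hC'⟩ <;> rcases hD with rfl | ⟨hD, hD'⟩
      · rfl
      · exact absurd hCD hD'
      · exact absurd ⟨C, hC, hCD⟩ hex
      · exact h4 C hC D hD hCD
    · rcases mem_insS.1 hC with hC | ⟨hC, -⟩
      · exact ⟨a, by omega, Finset.mem_singleton.1 hC⟩
      · obtain ⟨i, hi, rfl⟩ := h5 C hC
        exact ⟨i, by omega, rfl⟩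
    · rw [hall, ← h6]
      constructor
      · intro hT
        refine ⟨hT.of_insS, ?_⟩
        exact hT _ (mem_insS.2 (Or.inl (Finset.mem_singleton_self _)))
      · rintro ⟨h7, h8⟩
        exact h7.insS fun C hC => by rw [Finset.mem_singleton.1 hC]; exact h8

/-- Compute the family at the leaf given by the digits in bank `6`. -/
def leafP (α k G : ℕ) : FP := clearP ;; readP ;; loop 19 3 (stepP α k G)

lemma keepsClean_readP {E : Env} : KeepsClean E readP := by
  have hskip : KeepsClean E skip := .of_wb (by simp [wr]) (by simp [wb])
  have hmark : KeepsClean E markV := fun s h0 hs => by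
    by_cases h : s.reg 37 < E.κ 1
    · refine ⟨(eval_reg (by simp [markV, wr]) s).trans h0, ⟨?_, ?_, fun i hi => ?_, ?_⟩⟩
      · rw [eval_bank (by simp [markV, wb])]; exact hs.bank2
      · rw [eval_bank (by simp [markV, wb])]; exact hs.bank3
      · have : i ≠ s.reg 37 := by omega
        simpa [markV, eval, h, this] using hs.bank4 i hi
      · rw [eval_bank (by simp [markV, wb])]; exact hs.bank5
    · simp only [markV, eval]
      simp only [NState.setReg_reg, if_true, Nat.reduceEqDiff, if_false, h]
      exact ⟨by simpa using h0, hs.congr fun _ _ => rfl⟩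
  exact .loop (by simp) _ (.seq (.seq keepsClean_clearV (.loop (by simp) _
    (.seq (.of_wb (by simp [wr]) (by simp [wb])) (.seq (.ifPos _ hmark hskip)
    (.seq (.of_wb (by simp [wr]) (by simp [wb])) (.ifPos _
    (.seq (.of_wb (by simp [wr]) (by simp [wb])) hmark) hskip)))))) keepsClean_ins)

lemma keepsClean_leafP {E : Env} {α k G : ℕ} {s : NState} (hs : Clean E s) :
    Clean E ((leafP α k G).eval E s) := by
  have hb := eval_clearP hs
  have h1 : Clean E (clearP.eval E s) := by
    constructor <;> intro i _ <;> rw [hb _ (by simp)]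
  exact ((keepsClean_readP.seq (.loop (by simp) _ (keepsClean_stepP α k G))) _
    (reg_clearP E s (by simp) (by simp)) h1).2

lemma reg_zero_leafP {E : Env} {α k G : ℕ} {s : NState} (hs : Clean E s) :
    ((leafP α k G).eval E s).reg 0 = 0 := by
  have hb := eval_clearP hs
  have h1 : Clean E (clearP.eval E s) := by
    constructor <;> intro i _ <;> rw [hb _ (by simp)]
  exact ((keepsClean_readP.seq (.loop (by simp) _ (keepsClean_stepP α k G))) _
    (reg_clearP E s (by simp) (by simp)) h1).1

/-- The memory that holds the family at a leaf is determined by the digits. -/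
lemma bank_leafP_congr {E : Env} {α k G : ℕ} {s s' : NState} (hs : Clean E s) (hs' : Clean E s')
    (h : s.bank 6 = s'.bank 6) {b : ℕ} (hb : b = 2 ∨ b = 3) :
    ((leafP α k G).eval E s).bank b = ((leafP α k G).eval E s').bank b := by
  have h1 : Agree [6] (clearP.eval E s) (clearP.eval E s') := by
    refine Agree.eval (p := loop 1 2 (clearV 2 1 0 ;; store1 3 1 0) ;; clearV 4 0 0 ;; clearV 5 0 0)
      (s := (zeroR (List.range 39)).eval E s) (s' := (zeroR (List.range 39)).eval E s')
      ⟨fun r hr => ?_, ?_⟩ (by simp [regs, regs_clearV]) (by simp [rb, rb_clearV])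
    · rw [(eval_zeroR E _ s).2, (eval_zeroR E _ s').2]
      simp [hr]
    · intro b hb
      rw [(eval_zeroR E _ s).1, (eval_zeroR E _ s').1, List.mem_singleton.1 hb, h]
  have h2 : Agree [2, 3, 4, 5, 6] (clearP.eval E s) (clearP.eval E s') := by
    refine ⟨h1.1, fun b hb => ?_⟩
    by_cases hb' : b ∈ [2, 3, 4, 5]
    · rw [eval_clearP hs b hb', eval_clearP hs' b hb']
    · exact h1.2 b (by simp at hb hb' ⊢; omega)
  have h3 := regs_ins
  have h4 := regs_stepP α k G
  have h5 := h2.eval (E := E) (p := readP ;; loop 19 3 (stepP α k G)) (by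
      intro r hr
      by_contra hlt
      have a1 : r ∉ (stepP α k G).regs := fun h => hlt (h4 r h)
      have a2 : r ∉ ins.regs := fun h => hlt (h3 r h)
      simp [readP, readClause, markV, regs, regs_clearV, a1, a2] at hr
      omega) (by
      have := rb_find α k
      simp [readP, readClause, markV, stepP, heartP, petalP, rb, rb_clearV, rb_ins, rb_isLive,
        rb_subV, rb_interV, rb_ifEq]
      exact List.Subset.trans this (by simp))
  exact h5.2 b (by simp; omega)

lemma fam_leafP_congr {E : Env} {α k G : ℕ} {s s' : NState} (hs : Clean E s) (hs' : Clean E s')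
    (h : s.bank 6 = s'.bank 6) : fam E ((leafP α k G).eval E s) = fam E ((leafP α k G).eval E s') :=
  fam_congr (bank_leafP_congr hs hs' h (.inl rfl)) (bank_leafP_congr hs hs' h (.inr rfl))

lemma fam_setBank (E : Env) (s : NState) (J : ℕ → ℕ) : fam E (s.setBank 6 J) = fam E s :=
  fam_congr (by simp [NState.setBank_bank]) (by simp [NState.setBank_bank])

lemma progress_readP {E : Env} {α k G m e : ℕ} (hp : Params E α k G m e) (hm : E.κ 4 = m)
    (hk : E.κ 5 = k) {s : NState} (hs : Clean E s) :
    Progress E α k G m (readP.eval E (clearP.eval E s)) (fun _ => 0) (fun _ => 0) 0 ∧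
    ∀ T, Hits T (fam E (readP.eval E (clearP.eval E s))) ↔
      ∀ i < E.κ 4, ∃ l ∈ clauseSet E i, l ∈ T := by
  have hroom := hp.room
  have hG := hp.hG
  obtain ⟨h1, h2, h3, h4, h5⟩ := eval_readP (E := E) (reg_clearP E s (r := 0) (by simp) (by simp))
    (reg_clearP E s (r := 9) (by simp) (by simp))
    (fun t => by rw [eval_clearP hs 3 (by simp)]) (by omega)
  refine ⟨⟨h1, ⟨h3, fun C hC => ?_, fun C hC => ?_, fun i => Or.inl rfl, fun i => by simp,
    fun i _ => rfl⟩, by simp; omega, ?_, ?_, by simp, by simp⟩, h5⟩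
  · obtain ⟨i, -, rfl⟩ := h4 C hC
    rw [← hk]
    exact card_clauseSet E i
  · obtain ⟨i, -, rfl⟩ := h4 C hC
    exact Finset.filter_subset _ _
  · rw [eval_reg (r := 17) (by simp [wr_readP]), eval_reg (r := 18) (by simp [wr_readP]),
      reg_clearP E s (r := 17) (by simp) (by simp), reg_clearP E s (r := 18) (by simp) (by simp)]
    simp
  · rw [eval_reg (r := 18) (by simp [wr_readP]), reg_clearP E s (r := 18) (by simp) (by simp)]
    omega

/-- The family at a leaf has few members, and is at least as hard to satisfy as the input. -/
lemma eval_leafP {E : Env} {α k G m e : ℕ} (hp : Params E α k G m e) (hm : E.κ 4 = m)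
    (hk : E.κ 5 = k) (hL : E.κ 1 * α ^ (3 * k) < E.κ 3) {s : NState} (hs : Clean E s) :
    Good E ((leafP α k G).eval E s) ∧
    (fam E ((leafP α k G).eval E s)).card ≤ 1 + k * (E.κ 1 * α ^ (3 * k)) ∧
    ∀ T, Hits T (fam E ((leafP α k G).eval E s)) → ∀ i < E.κ 4, ∃ l ∈ clauseSet E i, l ∈ T := by
  obtain ⟨h1, h2⟩ := progress_readP hp hm hk hs
  have e : (leafP α k G).eval E s = ((nextJ E α k G (s.bank 6))^[E.κ 3]
      (readP.eval E (clearP.eval E s))).setBank 6 (s.bank 6) := by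
    rw [leafP, eval_seq, eval_seq, ← eval_loop_stepP]
    congr 1
    have : s.bank 6 = (readP.eval E (clearP.eval E s)).bank 6 := by
      rw [eval_bank (by simp [wb_readP]), clearP, eval_seq, eval_bank (by simp [wb]),
        (eval_zeroR E _ s).1]
    rw [this, NState.setBank_self]
  obtain ⟨A', B', h', h3, h4, h5⟩ := iterate_spec hp h1 (s.bank 6) (E.κ 3)
  have hf : fam E ((leafP α k G).eval E s) = fam E ((nextJ E α k G (s.bank 6))^[E.κ 3]
      (readP.eval E (clearP.eval E s))) := by
    rw [e, fam_setBank]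
  refine ⟨?_, ?_, fun T hT => (h2 T).1 (h5 T (by rwa [hf] at hT))⟩
  · rw [e]
    exact h3.good.congr rfl rfl (by simp [NState.setBank_bank]) (by simp [NState.setBank_bank])
  · rw [hf]
    have hsum := h3.inv.sum_added_le hp.hk hp.two_le
    refine card_le_of_noSun hp.hα h3.inv.size h3.inv.sub (h4.resolve_right ?_)
    omega

/-- Every solution of the input survives at some leaf. -/
lemma exists_leaf {E : Env} {α k G m e : ℕ} (hp : Params E α k G m e) (hm : E.κ 4 = m)
    (hk : E.κ 5 = k) {T : Finset ℕ} (hT : ∀ i < E.κ 4, ∃ l ∈ clauseSet E i, l ∈ T) :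
    ∃ J : ℕ → ℕ, (∀ p, J p < G) ∧ (∀ p, e ≤ p → J p = 0) ∧
      ∀ s : NState, Clean E s → s.bank 6 = J → Hits T (fam E ((leafP α k G).eval E s)) := by
  have h0 : Clean E ⟨fun _ => 0, fun _ _ => 0⟩ := by constructor <;> simp
  obtain ⟨h1, h2⟩ := progress_readP hp hm hk h0
  obtain ⟨J, k1, k2, k3⟩ := exists_digits hp (E.κ 3) h1 ((h2 T).2 hT)
  refine ⟨J, k1, k2, fun s hs hJ => ?_⟩
  rw [fam_leafP_congr (s' := NState.setBank ⟨fun _ => 0, fun _ _ => 0⟩ 6 J) hs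
    (h0.congr fun b hb => by
      rw [NState.setBank_bank, if_neg (by simp at hb; omega)])
    (by rw [hJ, NState.setBank_bank, if_pos rfl])]
  rw [leafP, eval_seq, eval_seq, eval_setBank (by simp [clearP, rb, rb_clearV, zeroR, List.range,
    List.range.loop]) (by simp [clearP, wb, zeroR, List.range, List.range.loop]),
    eval_setBank (by simp [readP, readClause, markV, rb, rb_clearV, rb_ins]) (by simp [wb_readP]),
    eval_loop_stepP]
  rwa [fam_setBank]

end FP

/-! ### Odometers -/

namespace FP

/-- The first `n` digits of `j` in base `G`. -/
def digs (G n j p : ℕ) : ℕ := if p < n then j / G ^ p % G else 0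

lemma digs_lt {G n j p : ℕ} (hG : 0 < G) : digs G n j p < G := by
  rw [digs]
  split_ifs
  exacts [Nat.mod_lt _ hG, hG]

lemma digs_pow (G n : ℕ) (hG : 0 < G) : digs G n (G ^ n) = digs G n 0 := by
  funext p
  simp only [digs]
  split_ifs with h
  · rw [Nat.pow_div (by omega) hG, Nat.zero_div, Nat.zero_mod]
    exact Nat.mod_eq_zero_of_dvd (dvd_pow_self G (by omega))
  · rfl

lemma digs_succ_of_dvd {G j a : ℕ} (hG : 0 < G) (h : G ^ a ∣ j + 1) :
    (j + 1) / G ^ a % G = (if j / G ^ a % G + 1 < G then j / G ^ a % G + 1 else 0) ∧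
      (G ^ (a + 1) ∣ j + 1 ↔ ¬ j / G ^ a % G + 1 < G) := by
  have h1 : (j + 1) / G ^ a = j / G ^ a + 1 := by rw [Nat.succ_div, if_pos h]
  have h2 : G ^ (a + 1) ∣ j + 1 ↔ (j / G ^ a + 1) % G = 0 := by
    rw [← h1, ← Nat.dvd_iff_mod_eq_zero, pow_succ, Nat.dvd_div_iff_mul_dvd h]
  have h3 := Nat.mod_lt (j / G ^ a) hG
  have h4 : (j / G ^ a + 1) % G = if j / G ^ a % G + 1 < G then j / G ^ a % G + 1 else 0 := by
    rw [Nat.add_mod]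
    by_cases hlt : j / G ^ a % G + 1 < G
    · rw [if_pos hlt, Nat.mod_eq_of_lt (a := 1) (by omega), Nat.mod_eq_of_lt hlt]
    · rw [if_neg hlt]
      have : j / G ^ a % G + 1 = G := by omega
      by_cases hG1 : G = 1
      · subst hG1; simp [Nat.mod_one]
      · rw [Nat.mod_eq_of_lt (a := 1) (by omega), this, Nat.mod_self]
  refine ⟨by rw [h1, h4], ?_⟩
  rw [h2, h4]
  split_ifs with hlt <;> simp [hlt]

lemma digs_succ_of_not_dvd {G j a : ℕ} (h : ¬ G ^ a ∣ j + 1) :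
    (j + 1) / G ^ a = j / G ^ a ∧ ¬ G ^ (a + 1) ∣ j + 1 :=
  ⟨by rw [Nat.succ_div, if_neg h, add_zero], fun h' => h ((pow_dvd_pow G (by omega)).trans h')⟩

/-- Add `1` to the number with the digits in bank `b`. -/
def odo (b n G : ℕ) : FP :=
  const 53 1 ;; loop 56 n (ifPos 53 (load1 b 3 56 ;; addl 3 3 1 ;; const 4 G ;;
    ite 3 4 (store1 b 56 3 ;; const 53 0) (store1 b 56 0)) skip)

@[simp] lemma wr_odo (b n G : ℕ) : (odo b n G).wr = [53, 56, 3, 3, 4, 53] := by simp [odo, wr]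
@[simp] lemma wb_odo (b n G : ℕ) : (odo b n G).wb = [b, b] := by simp [odo, wb]

lemma eval_odo {E : Env} {s : NState} (h0 : s.reg 0 = 0) {b n G : ℕ} (hG : 0 < G) {j : ℕ}
    (hb : s.bank b = digs G (E.κ n) j) :
    ((odo b n G).eval E s).bank b = digs G (E.κ n) (j + 1) := by
  rw [odo, eval_seq]
  have key := eval_loop_frame (E := E) (i := 56) (j := n) (s := (const 53 1).eval E s)
    (p := ifPos 53 (load1 b 3 56 ;; addl 3 3 1 ;; const 4 G ;;
      ite 3 4 (store1 b 56 3 ;; const 53 0) (store1 b 56 0)) skip)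
    (fun a s' => s'.reg 53 = (if G ^ a ∣ j + 1 then 1 else 0) ∧
      ∀ p, s'.bank b p = if p < a then digs G (E.κ n) (j + 1) p else digs G (E.κ n) j p)
    ⟨by simp [eval], fun p => by simp [eval, hb]⟩ (by
      rintro a ha s' hf hbf ⟨h1, h2⟩
      have z : s'.reg 0 = 0 := by
        rw [hf 0 (by simp [wr])]; simpa [eval] using h0
      have ha2 := h2 a
      rw [if_neg (lt_irrefl _), digs, if_pos ha] at ha2
      by_cases hd : G ^ a ∣ j + 1
      · obtain ⟨k1, k2⟩ := digs_succ_of_dvd hG hd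
        rw [if_pos hd] at h1
        by_cases hlt : j / G ^ a % G + 1 < G
        · rw [if_pos hlt] at k1
          have k3 : ¬ G ^ (a + 1) ∣ j + 1 := by rw [k2]; simpa using hlt
          simp only [k3, if_false]
          refine ⟨by simp [eval, h1, ha2, hlt], fun p => ?_⟩
          by_cases hp : p = a
          · subst hp
            simp [eval, h1, ha2, hlt, digs, ha, k1]
          · have : p ≤ a ↔ p < a := by omega
            simp [eval, h1, ha2, hlt, hp, h2, this]
        · rw [if_neg hlt] at k1
          have k3 : G ^ (a + 1) ∣ j + 1 := by rw [k2]; exact hlt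
          simp only [k3, if_true]
          refine ⟨by simp [eval, h1, ha2, hlt], fun p => ?_⟩
          by_cases hp : p = a
          · subst hp
            simp [eval, h1, ha2, hlt, digs, ha, k1, z]
          · have : p ≤ a ↔ p < a := by omega
            simp [eval, h1, ha2, hlt, hp, h2, this]
      · obtain ⟨k1, k2⟩ := digs_succ_of_not_dvd hd
        rw [if_neg hd] at h1
        simp only [k2, if_false]
        refine ⟨by simp [eval, h1], fun p => ?_⟩
        by_cases hp : p = a
        · subst hp
          simp [eval, h1, ha2, digs, ha, k1]
        · have : p ≤ a ↔ p < a := by omega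
          simp [eval, h1, h2, this])
  funext p
  rw [key.2 p]
  split_ifs with h
  · rfl
  · simp [digs, h]

/-- Every sequence of digits belongs to some number. -/
lemma exists_digs {G n : ℕ} {J : ℕ → ℕ} (h1 : ∀ p, J p < G) (h2 : ∀ p, n ≤ p → J p = 0) :
    ∃ j < G ^ n, digs G n j = J := by
  let f : Fin n → Fin G := fun p => ⟨J p, h1 p⟩
  refine ⟨finFunctionFinEquiv f, (finFunctionFinEquiv f).2, ?_⟩
  funext p
  rw [digs]
  split_ifs with hp
  · have := congrArg Fin.val (congrFun (finFunctionFinEquiv.symm_apply_apply f) ⟨p, hp⟩)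
    rwa [finFunctionFinEquiv_symm_apply_val] at this
  · exact (h2 p (by omega)).symm

/-! ### Writing the matrices -/

/-- Register `48 + side :=` does the half-assignment in bank `7`, taken as one of the first half of
the variables (`side = 0`) or of the second half (`side = 1`), satisfy the clause in row `47`? -/
def satHalf (side : ℕ) : FP :=
  const (48 + side) 0 ;; loop 50 8 (addl 52 50 1 ;; (if side = 0 then skip else addc 52 52 8) ;;
    load 2 3 47 1 52 ;; addc 52 52 6 ;; load 2 4 47 1 52 ;; load1 7 5 50 ;;
    ifPos 5 (ifPos 3 (const (48 + side) 1) skip) (ifPos 4 (const (48 + side) 1) skip))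

/-- The half-assignment in bank `7`, used for the variables from `o` on, satisfies the clause in
row `t`. -/
def HalfSat (E : Env) (s : NState) (o t : ℕ) : Prop :=
  ∃ v < E.κ 8, (0 < s.bank 7 v ∧ 0 < s.bank 2 (t * E.κ 1 + (v + 1 + o))) ∨
    (s.bank 7 v = 0 ∧ 0 < s.bank 2 (t * E.κ 1 + (v + 1 + o + E.κ 6)))

instance (E : Env) (s : NState) (o t : ℕ) : Decidable (HalfSat E s o t) :=
  inferInstanceAs (Decidable (∃ v < E.κ 8, _ ∨ _))

lemma wr_satHalf (side : ℕ) : (satHalf side).wr ⊆ [48 + side, 50, 52, 3, 4, 5] := by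
  rw [satHalf]
  split_ifs <;> simp [wr]
lemma wb_satHalf (side : ℕ) : (satHalf side).wb = [] := by
  rw [satHalf]
  split_ifs <;> simp [wb]

lemma eval_satHalf {E : Env} {s : NState} {side : ℕ} (hside : side < 2) :
    ((satHalf side).eval E s).reg (48 + side) =
      if HalfSat E s (side * E.κ 8) (s.reg 47) then 1 else 0 := by
  rw [satHalf, eval_seq]
  refine eval_loop_frame (s := (const (48 + side) 0).eval E s)
    (fun a s' => s'.reg (48 + side) = if ∃ v < a,
    (0 < s.bank 7 v ∧ 0 < s.bank 2 (s.reg 47 * E.κ 1 + (v + 1 + side * E.κ 8))) ∨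
    (s.bank 7 v = 0 ∧ 0 < s.bank 2 (s.reg 47 * E.κ 1 + (v + 1 + side * E.κ 8 + E.κ 6)))
    then 1 else 0) (by simp [eval]) fun a ha s' hf hb h => ?_
  have hr : s'.reg 47 = s.reg 47 := by
    rw [hf 47 ?_]
    · have : 47 ≠ 48 + side := by omega
      simp [eval, this]
    · split_ifs <;> simp [wr] <;> omega
  have hb' : s'.bank = s.bank := by
    funext b
    rw [hb b ?_]
    · rfl
    · split_ifs <;> simp [wb]
  have hex : ∀ P : ℕ → Prop, (∃ v < a + 1, P v) ↔ (∃ v < a, P v) ∨ P a := fun P => by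
    simp only [Nat.lt_succ_iff_lt_or_eq, or_and_right, exists_or, exists_eq_left]
  simp only [hex]
  have hA : (if side = 0 then skip else addc 52 52 8).eval E ((s'.setReg 50 a).setReg 52 (a + 1)) =
      if side = 0 then (s'.setReg 50 a).setReg 52 (a + 1) else
        ((s'.setReg 50 a).setReg 52 (a + 1)).setReg 52 (a + 1 + E.κ 8) := by
    split_ifs <;> simp [eval]
  have e0 : (addl 52 50 1).eval E (s'.setReg 50 a) = (s'.setReg 50 a).setReg 52 (a + 1) := by
    simp [eval]
  rw [eval_seq, eval_seq, e0, hA]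
  obtain ⟨s1, hs1, r52, r47, r50, r48, b1⟩ : ∃ s1 : NState, s1 = (if side = 0 then
      (s'.setReg 50 a).setReg 52 (a + 1) else
        ((s'.setReg 50 a).setReg 52 (a + 1)).setReg 52 (a + 1 + E.κ 8)) ∧
      s1.reg 52 = a + 1 + side * E.κ 8 ∧ s1.reg 47 = s.reg 47 ∧ s1.reg 50 = a ∧
      s1.reg (48 + side) = s'.reg (48 + side) ∧ s1.bank = s.bank := by
    refine ⟨_, rfl, ?_⟩
    interval_cases side <;> simp [hr, hb']
  rw [← hs1]
  have n1 : ¬ 48 + side = 3 := by omega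
  have n2 : ¬ 48 + side = 4 := by omega
  have n3 : ¬ 48 + side = 5 := by omega
  have n4 : ¬ 48 + side = 52 := by omega
  rw [← r48] at h
  by_cases hp : ∃ v < a,
    (0 < s.bank 7 v ∧ 0 < s.bank 2 (s.reg 47 * E.κ 1 + (v + 1 + side * E.κ 8))) ∨
    (s.bank 7 v = 0 ∧ 0 < s.bank 2 (s.reg 47 * E.κ 1 + (v + 1 + side * E.κ 8 + E.κ 6)))
  all_goals
    simp only [hp, true_or, false_or, if_true, if_false] at h ⊢
    obtain h7 | h7 := Nat.eq_zero_or_pos (s.bank 7 a) <;>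
    obtain h2 | h2 := Nat.eq_zero_or_pos (s.bank 2 (s.reg 47 * E.κ 1 + (a + 1 + side * E.κ 8))) <;>
    obtain h3 | h3 := Nat.eq_zero_or_pos
      (s.bank 2 (s.reg 47 * E.κ 1 + (a + 1 + side * E.κ 8 + E.κ 6))) <;>
    simp [eval, r52, r47, r50, b1, h7, h2, h3, n1, n2, n3, n4, h] <;> omega

end FP

/-! ### A pair of rows -/

namespace FP

/-- In bank `0`, the columns satisfying `SA` of the row in register `40` and those satisfying `SB`
of the row in register `41` have been set to the number in register `51`. -/
def Marked (E : Env) (s s' : NState) (SA SB : ℕ → Prop) : Prop :=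
  ∀ i, ((∃ c, SA c ∧ i = s.reg 40 * E.κ 12 + c) ∨ (∃ c, SB c ∧ i = s.reg 41 * E.κ 12 + c) →
      s'.bank 0 i = s.reg 51) ∧
    (¬ ((∃ c, SA c ∧ i = s.reg 40 * E.κ 12 + c) ∨ ∃ c, SB c ∧ i = s.reg 41 * E.κ 12 + c) →
      s'.bank 0 i = s.bank 0 i)

section

variable {E : Env} {s s' s'' : NState} {SA SB SA' SB' : ℕ → Prop}

lemma Marked.storeA (h : Marked E s s' SA SB) (c : ℕ)
    (hs : ∀ i, s''.bank 0 i = if i = s.reg 40 * E.κ 12 + c then s.reg 51 else s'.bank 0 i) :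
    Marked E s s'' (fun x => SA x ∨ x = c) SB := by
  intro i
  simp only [hs, or_and_right, exists_or, exists_eq_left]
  by_cases hi : i = s.reg 40 * E.κ 12 + c
  · simp [hi]
  · simpa only [hi, if_false, or_false] using h i

lemma Marked.storeB (h : Marked E s s' SA SB) (c : ℕ)
    (hs : ∀ i, s''.bank 0 i = if i = s.reg 41 * E.κ 12 + c then s.reg 51 else s'.bank 0 i) :
    Marked E s s'' SA (fun x => SB x ∨ x = c) := by
  intro i
  simp only [hs, or_and_right, exists_or, exists_eq_left]
  by_cases hi : i = s.reg 41 * E.κ 12 + c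
  · simp [hi]
  · simpa only [hi, if_false, or_false] using h i

lemma Marked.congr (h : Marked E s s' SA SB) (hA : ∀ c, SA' c ↔ SA c) (hB : ∀ c, SB' c ↔ SB c)
    (hs : s''.bank 0 = s'.bank 0) : Marked E s s'' SA' SB' := by
  obtain rfl : SA' = SA := funext fun c => propext (hA c)
  obtain rfl : SB' = SB := funext fun c => propext (hB c)
  intro i
  rw [hs]
  exact h i

end

/-- The one-hot encoding of the digits in bank `6`. -/
def DigCol (E : Env) (s : NState) (c : ℕ) : Prop :=
  ∃ p < E.κ 7, s.bank 6 p < E.κ 11 ∧ c = p * E.κ 11 + s.bank 6 p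

/-- The number of rows in use below row `t`. -/
def rank (s : NState) (t : ℕ) : ℕ := ((Finset.range t).filter fun t' => 0 < s.bank 3 t').card

lemma rank_succ (s : NState) (t : ℕ) :
    rank s (t + 1) = rank s t + if 0 < s.bank 3 t then 1 else 0 := by
  rw [rank, rank, Finset.range_add_one, Finset.filter_insert]
  split_ifs <;> simp

/-- The support of the row of the left half-assignment: the digits, and for each clause one of two
columns, the first one if the half-assignment satisfies the clause. -/
def InA (E : Env) (s : NState) (c : ℕ) : Prop :=
  DigCol E s c ∨ ∃ t < E.κ 2, 0 < s.bank 3 t ∧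
    c = E.κ 7 * E.κ 11 + 2 * rank s t + if HalfSat E s 0 t then 0 else 1

/-- The support of the row of the right half-assignment: the digits, and for each clause the first
of the two columns, and also the second one if the half-assignment satisfies the clause. -/
def InB (E : Env) (s : NState) (c : ℕ) : Prop :=
  DigCol E s c ∨ ∃ t < E.κ 2, 0 < s.bank 3 t ∧ (c = E.κ 7 * E.κ 11 + 2 * rank s t ∨
    HalfSat E s (E.κ 8) t ∧ c = E.κ 7 * E.κ 11 + 2 * rank s t + 1)

/-- Write the digits. -/
def digitsP : FP :=
  const 42 0 ;;
  loop 45 7 (load1 6 3 45 ;; loop 46 11 (ifEq 46 3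
    (store 0 40 12 42 51 ;; store 0 41 12 42 51) ;; addl 42 42 1))

/-- Write the clauses. -/
def clausesP : FP :=
  loop 47 2 (load1 3 7 47 ;; ifPos 7 (satHalf 0 ;; satHalf 1 ;;
    ifPos 48 (store 0 40 12 42 51) skip ;; store 0 41 12 42 51 ;; addl 42 42 1 ;;
    ifPos 48 skip (store 0 40 12 42 51) ;; ifPos 49 (store 0 41 12 42 51) skip ;;
    addl 42 42 1) skip)

/-- Write a row for each half-assignment, and the corresponding entry of the value matrix. -/
def writeP : FP :=
  digitsP ;; clausesP ;; const 52 1 ;; store 1 41 13 0 52 ;; addl 40 40 1 ;; addl 41 41 1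

lemma wr_digitsP : digitsP.wr = [42, 45, 3, 46, 42] := by simp [digitsP, wr]
lemma wb_digitsP : digitsP.wb = [0, 0] := by simp [digitsP, wb]

lemma eval_digitsP (E : Env) (s : NState) :
    (digitsP.eval E s).reg 42 = E.κ 7 * E.κ 11 ∧
      Marked E s (digitsP.eval E s) (DigCol E s) (DigCol E s) := by
  rw [digitsP, eval_seq]
  have key := eval_loop_frame (E := E) (i := 45) (j := 7) (s := (const 42 0).eval E s)
    (p := load1 6 3 45 ;; loop 46 11 (ifEq 46 3
      (store 0 40 12 42 51 ;; store 0 41 12 42 51) ;; addl 42 42 1))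
    (fun a s' => s'.reg 42 = a * E.κ 11 ∧ Marked E s s'
      (fun c => ∃ p < a, s.bank 6 p < E.κ 11 ∧ c = p * E.κ 11 + s.bank 6 p)
      (fun c => ∃ p < a, s.bank 6 p < E.κ 11 ∧ c = p * E.κ 11 + s.bank 6 p))
    ⟨by simp [eval], fun i => by simp [eval]⟩ (by
      rintro a ha s' hf hb ⟨h1, h2⟩
      rw [eval_seq]
      obtain ⟨s1, hs1⟩ : ∃ s1, s1 = (load1 6 3 45).eval E (s'.setReg 45 a) := ⟨_, rfl⟩
      have q3 : s1.reg 3 = s.bank 6 a := by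
        rw [hs1]
        have := hb 6 (by simp [wb])
        simp [eval, this]
      have qb : s1.bank = s'.bank := by rw [hs1]; simp [eval]
      have q42 : s1.reg 42 = a * E.κ 11 := by rw [hs1]; simp [eval, h1]
      have q : ∀ r ∈ [40, 41, 51], s1.reg r = s.reg r := by
        intro r hr
        have h' := hf r (by simp at hr; simp [wr]; omega)
        simp only [List.mem_cons, List.not_mem_nil, or_false] at hr
        rcases hr with rfl | rfl | rfl <;> simpa [hs1, eval] using h'
      rw [← hs1]
      have inner := eval_loop_frame (E := E) (i := 46) (j := 11) (s := s1)
        (p := ifEq 46 3 (store 0 40 12 42 51 ;; store 0 41 12 42 51) ;; addl 42 42 1)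
        (fun g s' => s'.reg 42 = a * E.κ 11 + g ∧ Marked E s s'
          (fun c => (∃ p < a, s.bank 6 p < E.κ 11 ∧ c = p * E.κ 11 + s.bank 6 p) ∨
            s.bank 6 a < g ∧ c = a * E.κ 11 + s.bank 6 a)
          (fun c => (∃ p < a, s.bank 6 p < E.κ 11 ∧ c = p * E.κ 11 + s.bank 6 p) ∨
            s.bank 6 a < g ∧ c = a * E.κ 11 + s.bank 6 a))
        ⟨by simpa using q42, h2.congr (by simp) (by simp) (by rw [qb])⟩ (by
          rintro g hg s2 hf2 hb2 ⟨h3, h4⟩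
          have w3 : s2.reg 3 = s.bank 6 a := (hf2 3 (by simp [wr])).trans q3
          have w40 : s2.reg 40 = s.reg 40 := (hf2 40 (by simp [wr])).trans (q 40 (by simp))
          have w41 : s2.reg 41 = s.reg 41 := (hf2 41 (by simp [wr])).trans (q 41 (by simp))
          have w51 : s2.reg 51 = s.reg 51 := (hf2 51 (by simp [wr])).trans (q 51 (by simp))
          rw [eval_seq, eval_ifEq]
          by_cases hgJ : g = s.bank 6 a
          · rw [if_pos (by simp [w3, hgJ])]
            refine ⟨by simp [eval, h3, add_assoc], ?_⟩
            refine ((h4.storeA (s'' := s2.setCell 0 (s.reg 40 * E.κ 12 + (a * E.κ 11 + g))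
              (s.reg 51)) (a * E.κ 11 + g) (by simp)).storeB
              (s'' := (s2.setCell 0 (s.reg 40 * E.κ 12 + (a * E.κ 11 + g))
              (s.reg 51)).setCell 0 (s.reg 41 * E.κ 12 + (a * E.κ 11 + g))
              (s.reg 51)) (a * E.κ 11 + g) (by simp)).congr ?_ ?_ ?_
            · intro c
              simp [hgJ]
            · intro c
              simp [hgJ]
            · funext i
              simp [eval, w40, w41, w51, h3]
          · rw [if_neg (by simpa [w3] using hgJ)]
            refine ⟨by simp [eval, h3, add_assoc], h4.congr (fun c => ?_) (fun c => ?_) ?_⟩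
            · have : s.bank 6 a < g + 1 ↔ s.bank 6 a < g := by omega
              simp only [this]
            · have : s.bank 6 a < g + 1 ↔ s.bank 6 a < g := by omega
              simp only [this]
            · simp [eval])
      refine ⟨by rw [inner.1, add_mul, one_mul], inner.2.congr (fun c => ?_) (fun c => ?_) rfl⟩
      all_goals
        simp only [Nat.lt_succ_iff_lt_or_eq, or_and_right, exists_or, exists_eq_left])
  exact key

lemma Marked.trans {E : Env} {s s' s'' : NState} {SA SB SA' SB' : ℕ → Prop}
    (h : Marked E s s' SA SB) (h' : Marked E s' s'' SA' SB') (hr : ∀ r ∈ [40, 41, 51],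
    s'.reg r = s.reg r) : Marked E s s'' (fun c => SA c ∨ SA' c) (fun c => SB c ∨ SB' c) := by
  intro i
  have h1 := h i
  have h2 := h' i
  rw [hr 40 (by simp), hr 41 (by simp), hr 51 (by simp)] at h2
  clear h h' hr
  simp only [or_and_right, exists_or]
  generalize (∃ c, SA c ∧ i = s.reg 40 * E.κ 12 + c) = a at *
  generalize (∃ c, SB c ∧ i = s.reg 41 * E.κ 12 + c) = b at *
  generalize (∃ c, SA' c ∧ i = s.reg 40 * E.κ 12 + c) = a' at *
  generalize (∃ c, SB' c ∧ i = s.reg 41 * E.κ 12 + c) = b' at *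
  constructor
  · intro h3
    by_cases h4 : a' ∨ b'
    · exact h2.1 h4
    · rw [h2.2 h4]
      exact h1.1 (by tauto)
  · intro h3
    rw [h2.2 (by tauto), h1.2 (by tauto)]

lemma wr_clausesP : clausesP.wr ⊆ [47, 7, 48, 49, 50, 52, 3, 4, 5, 42] := by
  have h0 := wr_satHalf 0
  have h1 := wr_satHalf 1
  simp only [clausesP, wr, List.append_nil, List.nil_append, List.cons_append]
  simp only [List.cons_subset, List.append_subset, List.nil_subset]
  refine ⟨by simp, by simp, List.Subset.trans h0 (by simp), List.Subset.trans h1 (by simp), by simp⟩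
lemma wb_clausesP : clausesP.wb = [0, 0, 0, 0] := by simp [clausesP, wb, wb_satHalf]

lemma HalfSat.congr {E : Env} {s s' : NState} (h2 : s'.bank 2 = s.bank 2)
    (h7 : s'.bank 7 = s.bank 7) (o t : ℕ) : HalfSat E s' o t ↔ HalfSat E s o t := by
  rw [HalfSat, HalfSat, h2, h7]

lemma eval_clausesP {E : Env} {s : NState} {o : ℕ} (h42 : s.reg 42 = o) :
    Marked E s (clausesP.eval E s)
      (fun c => ∃ t < E.κ 2, 0 < s.bank 3 t ∧
        c = o + 2 * rank s t + if HalfSat E s 0 t then 0 else 1)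
      (fun c => ∃ t < E.κ 2, 0 < s.bank 3 t ∧
        (c = o + 2 * rank s t ∨ HalfSat E s (E.κ 8) t ∧ c = o + 2 * rank s t + 1)) := by
  have hwr : ∀ r ∈ [40, 41, 51], r ∉ clausesP.wr := fun r hr h => by
    have := wr_clausesP h
    simp at hr this
    omega
  have key := eval_loop_frame (E := E) (i := 47) (j := 2) (s := s)
    (p := load1 3 7 47 ;; ifPos 7 (satHalf 0 ;; satHalf 1 ;;
    ifPos 48 (store 0 40 12 42 51) skip ;; store 0 41 12 42 51 ;; addl 42 42 1 ;;
    ifPos 48 skip (store 0 40 12 42 51) ;; ifPos 49 (store 0 41 12 42 51) skip ;;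
    addl 42 42 1) skip)
    (fun a s' => s'.reg 42 = o + 2 * rank s a ∧ Marked E s s'
      (fun c => ∃ t < a, 0 < s.bank 3 t ∧
        c = o + 2 * rank s t + if HalfSat E s 0 t then 0 else 1)
      (fun c => ∃ t < a, 0 < s.bank 3 t ∧
        (c = o + 2 * rank s t ∨ HalfSat E s (E.κ 8) t ∧ c = o + 2 * rank s t + 1)))
    ⟨by simp [rank, h42], fun i => by simp⟩ (by
      rintro a ha s' hf hb ⟨h1, h2⟩
      have hbk : ∀ b ≠ 0, s'.bank b = s.bank b := fun b hb0 =>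
        hb b (by simp [wb, wb_satHalf, hb0])
      have hrk : ∀ r ∈ [40, 41, 51], s'.reg r = s.reg r := fun r hr => hf r (hwr r hr)
      rw [eval_seq]
      obtain ⟨s1, hs1⟩ : ∃ s1, s1 = (load1 3 7 47).eval E (s'.setReg 47 a) := ⟨_, rfl⟩
      have a7 : s1.reg 7 = s.bank 3 a := by
        rw [hs1]
        simp [eval, hbk]
      have ab : s1.bank = s'.bank := by rw [hs1]; simp [eval]
      have ar : ∀ r, r ∉ [47, 7] → s1.reg r = s'.reg r := fun r hr => by
        simp at hr
        rw [hs1]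
        simp [eval, hr]
      have a47 : s1.reg 47 = a := by rw [hs1]; simp [eval]
      have hex : ∀ P : ℕ → Prop, (∃ v < a + 1, P v) ↔ (∃ v < a, P v) ∨ P a := fun P => by
        simp only [Nat.lt_succ_iff_lt_or_eq, or_and_right, exists_or, exists_eq_left]
      rw [← hs1, eval, a7, rank_succ]
      simp only [hex]
      by_cases hl : 0 < s.bank 3 a
      swap
      · simp only [hl, if_false, false_and, or_false]
        exact ⟨by rw [eval, ar 42 (by simp)]; simpa using h1, h2.congr (fun _ => Iff.rfl)
          (fun _ => Iff.rfl) (by rw [eval, ab])⟩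
      simp only [hl, if_true, true_and]
      rw [eval_seq, eval_seq]
      have b48 := eval_satHalf (E := E) (s := s1) (side := 0) (by simp)
      obtain ⟨s2, hs2⟩ : ∃ s2, s2 = (satHalf 0).eval E s1 := ⟨_, rfl⟩
      have bb : s2.bank = s'.bank := by
        rw [hs2, ← ab]
        exact funext fun b => eval_bank (by simp [wb_satHalf]) _
      have br : ∀ r, r ∉ [48, 50, 52, 3, 4, 5] → s2.reg r = s1.reg r := fun r hr => by
        rw [hs2]
        exact eval_reg (fun h => hr (wr_satHalf 0 h)) _
      have c49 := eval_satHalf (E := E) (s := s2) (side := 1) (by simp)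
      rw [← hs2] at b48 ⊢
      obtain ⟨s3, hs3⟩ : ∃ s3, s3 = (satHalf 1).eval E s2 := ⟨_, rfl⟩
      have cb : s3.bank = s'.bank := by
        rw [hs3, ← bb]
        exact funext fun b => eval_bank (by simp [wb_satHalf]) _
      have cr : ∀ r, r ∉ [49, 50, 52, 3, 4, 5] → s3.reg r = s2.reg r := fun r hr => by
        rw [hs3]
        exact eval_reg (fun h => hr (wr_satHalf 1 h)) _
      rw [← hs3] at c49 ⊢
      simp only [Nat.reduceAdd, zero_mul, one_mul] at b48 c49
      simp only [a47, HalfSat.congr (s := s) (s' := s1) (by rw [ab]; exact hbk 2 (by simp))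
        (by rw [ab]; exact hbk 7 (by simp))] at b48
      simp only [br 47 (by simp), a47, HalfSat.congr (s := s) (s' := s2)
        (by rw [bb]; exact hbk 2 (by simp)) (by rw [bb]; exact hbk 7 (by simp))] at c49
      have d48 := (cr 48 (by simp)).trans b48
      have d : ∀ r ∈ [40, 41, 51], s3.reg r = s.reg r := fun r hr => by
        rw [cr r (by simp at hr ⊢; omega), br r (by simp at hr ⊢; omega),
          ar r (by simp at hr ⊢; omega), hrk r hr]
      have d40 := d 40 (by simp)
      have d41 := d 41 (by simp)
      have d51 := d 51 (by simp)
      have d42 : s3.reg 42 = o + 2 * rank s a := by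
        rw [cr 42 (by simp), br 42 (by simp), ar 42 (by simp), h1]
      have hA : Marked E s (s3.setCell 0 (s.reg 40 * E.κ 12 + (o + 2 * rank s a +
          if HalfSat E s 0 a then 0 else 1)) (s.reg 51)) _ _ :=
        h2.storeA (o + 2 * rank s a + if HalfSat E s 0 a then 0 else 1) (by simp [cb])
      have hB := hA.storeB (s'' := (s3.setCell 0 (s.reg 40 * E.κ 12 + (o + 2 * rank s a +
          if HalfSat E s 0 a then 0 else 1)) (s.reg 51)).setCell 0
          (s.reg 41 * E.κ 12 + (o + 2 * rank s a)) (s.reg 51)) (o + 2 * rank s a) (by simp)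
      by_cases hu : HalfSat E s 0 a <;> by_cases hw : HalfSat E s (E.κ 8) a
      · refine ⟨by simp [eval, d48, c49, hu, hw, d42]; ring, (hB.storeB (s'' := (((s3.setCell 0
          (s.reg 40 * E.κ 12 + (o + 2 * rank s a + if HalfSat E s 0 a then 0 else 1))
          (s.reg 51)).setCell 0 (s.reg 41 * E.κ 12 + (o + 2 * rank s a)) (s.reg 51)).setCell 0
          (s.reg 41 * E.κ 12 + (o + 2 * rank s a + 1)) (s.reg 51))) (o + 2 * rank s a + 1)
          (by simp)).congr (fun c => ?_) (fun c => ?_) ?_⟩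
        · rfl
        · simp only [hw, true_and, or_assoc]
        · funext i
          simp [eval, d48, c49, hu, hw, d42, d40, d41, d51, add_assoc]
      · refine ⟨by simp [eval, d48, c49, hu, hw, d42]; ring, hB.congr (fun c => ?_)
          (fun c => ?_) ?_⟩
        · rfl
        · simp only [hw, false_and, or_false]
        · funext i
          simp [eval, d48, c49, hu, hw, d42, d40, d41, d51, add_assoc]
      · refine ⟨by simp [eval, d48, c49, hu, hw, d42]; ring, (hB.storeB (s'' := (((s3.setCell 0
          (s.reg 40 * E.κ 12 + (o + 2 * rank s a + if HalfSat E s 0 a then 0 else 1))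
          (s.reg 51)).setCell 0 (s.reg 41 * E.κ 12 + (o + 2 * rank s a)) (s.reg 51)).setCell 0
          (s.reg 41 * E.κ 12 + (o + 2 * rank s a + 1)) (s.reg 51))) (o + 2 * rank s a + 1)
          (by simp)).congr (fun c => ?_) (fun c => ?_) ?_⟩
        · rfl
        · simp only [hw, true_and, or_assoc]
        · funext i
          simp [eval, d48, c49, hu, hw, d42, d40, d41, d51, add_assoc]
          split_ifs <;> rfl
      · refine ⟨by simp [eval, d48, c49, hu, hw, d42]; ring, hB.congr (fun c => ?_)
          (fun c => ?_) ?_⟩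
        · rfl
        · simp only [hw, false_and, or_false]
        · funext i
          simp [eval, d48, c49, hu, hw, d42, d40, d41, d51, add_assoc]
          split_ifs <;> rfl)
  exact key.2

lemma wr_writeP : writeP.wr ⊆ [42, 45, 3, 46, 47, 7, 48, 49, 50, 52, 4, 5, 40, 41] := by
  have := wr_clausesP
  simp only [writeP, wr, wr_digitsP, List.append_subset]
  refine ⟨by simp, List.Subset.trans this (by simp), by simp, by simp, by simp, by simp⟩
lemma wb_writeP : writeP.wb = [0, 0, 0, 0, 0, 0, 1] := by
  simp [writeP, wb, wb_digitsP, wb_clausesP]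

lemma DigCol.congr {E : Env} {s s' : NState} (h6 : s'.bank 6 = s.bank 6) (c : ℕ) :
    DigCol E s' c ↔ DigCol E s c := by
  rw [DigCol, DigCol, h6]

lemma rank_congr {s s' : NState} (h3 : s'.bank 3 = s.bank 3) (t : ℕ) : rank s' t = rank s t := by
  rw [rank, rank, h3]

lemma InA.congr {E : Env} {s s' : NState} (h2 : s'.bank 2 = s.bank 2) (h3 : s'.bank 3 = s.bank 3)
    (h6 : s'.bank 6 = s.bank 6) (h7 : s'.bank 7 = s.bank 7) (c : ℕ) : InA E s' c ↔ InA E s c := by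
  simp only [InA, DigCol.congr h6, HalfSat.congr h2 h7, rank_congr h3, h3]

lemma InB.congr {E : Env} {s s' : NState} (h2 : s'.bank 2 = s.bank 2) (h3 : s'.bank 3 = s.bank 3)
    (h6 : s'.bank 6 = s.bank 6) (h7 : s'.bank 7 = s.bank 7) (c : ℕ) : InB E s' c ↔ InB E s c := by
  simp only [InB, DigCol.congr h6, HalfSat.congr h2 h7, rank_congr h3, h3]

lemma eval_writeP {E : Env} {s : NState} (h0 : s.reg 0 = 0) :
    Marked E s (writeP.eval E s) (InA E s) (InB E s) ∧
    (∀ i, (writeP.eval E s).bank 1 i = if i = s.reg 41 * E.κ 13 then 1 else s.bank 1 i) ∧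
    (writeP.eval E s).reg 40 = s.reg 40 + 1 ∧ (writeP.eval E s).reg 41 = s.reg 41 + 1 := by
  rw [writeP, eval_seq, eval_seq]
  obtain ⟨h1, h2⟩ := eval_digitsP E s
  obtain ⟨s1, hs1⟩ : ∃ s1, s1 = digitsP.eval E s := ⟨_, rfl⟩
  have b1 : ∀ b ≠ 0, s1.bank b = s.bank b := fun b hb => by
    rw [hs1, eval_bank (by simp [wb_digitsP, hb])]
  have r1 : ∀ r, r ∉ [42, 45, 3, 46] → s1.reg r = s.reg r := fun r hr => by
    rw [hs1, eval_reg (by simp at hr; simp [wr_digitsP, hr])]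
  rw [← hs1] at h1 h2 ⊢
  have h3 := eval_clausesP (E := E) h1
  obtain ⟨s2, hs2⟩ : ∃ s2, s2 = clausesP.eval E s1 := ⟨_, rfl⟩
  have b2 : ∀ b ≠ 0, s2.bank b = s.bank b := fun b hb => by
    rw [hs2, eval_bank (by simp [wb_clausesP, hb]), b1 b hb]
  have r2 : ∀ r, r ∉ [47, 7, 48, 49, 50, 52, 3, 4, 5, 42, 45, 46] → s2.reg r = s.reg r :=
    fun r hr => by
      rw [hs2, eval_reg (fun h => hr (by have := wr_clausesP h; simp at this ⊢; omega)),
        r1 r (fun h => hr (by simp at h ⊢; omega))]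
  rw [← hs2] at h3 ⊢
  have e0 := r2 0 (by simp)
  have e40 := r2 40 (by simp)
  have e41 := r2 41 (by simp)
  refine ⟨(h2.trans h3 fun r hr => r1 r (by simp at hr ⊢; omega)).congr (fun c => ?_) (fun c => ?_)
    ?_, fun i => ?_, ?_, ?_⟩
  · simp only [InA, HalfSat.congr (b1 2 (by simp)) (b1 7 (by simp)), b1 3 (by simp),
      rank_congr (b1 3 (by simp))]
  · simp only [InB, HalfSat.congr (b1 2 (by simp)) (b1 7 (by simp)), b1 3 (by simp),
      rank_congr (b1 3 (by simp))]
  · funext i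
    simp [eval]
  · simp [eval, e0, h0, e41, b2 1 (by simp)]
  · simp [eval, e40]
  · simp [eval, e41]

end FP

/-! ### All rows -/

namespace FP

/-- The state in which a row is written: the family at leaf number `j`, and half-assignment
number `x`. -/
def rowState (E : Env) (α k G j x : ℕ) : NState :=
  ((leafP α k G).eval E (NState.setBank ⟨fun _ => 0, fun _ _ => 0⟩ 6 (digs G (E.κ 7) j))).setBank 7
    (digs 2 (E.κ 8) x)

/-- The support of row `r` of the first kind. The row belongs to leaf number `r / κ 9` and
half-assignment number `r % κ 9`. -/
def RowA (E : Env) (α k G r c : ℕ) : Prop := InA E (rowState E α k G (r / E.κ 9) (r % E.κ 9)) c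

/-- The support of row `r` of the second kind, numbered in the same way. -/
def RowB (E : Env) (α k G r c : ℕ) : Prop := InB E (rowState E α k G (r / E.κ 9) (r % E.κ 9)) c

/-- The cell `i` of the matrix `Q` is in the support of one of the first `N` rows of either kind. -/
def Cell (E : Env) (α k G N i : ℕ) : Prop :=
  (∃ r < N, ∃ c, RowA E α k G r c ∧ i = r * E.κ 12 + c) ∨
    ∃ r < N, ∃ c, RowB E α k G r c ∧ i = (E.κ 15 + r) * E.κ 12 + c

/-- The first `N` rows of either kind have been written. -/
structure Written (E : Env) (α k G N : ℕ) (s : NState) : Prop where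
  r40 : s.reg 40 = N
  r41 : s.reg 41 = E.κ 15 + N
  r51 : s.reg 51 = E.κ 14
  on : ∀ i, Cell E α k G N i → s.bank 0 i = E.κ 14
  off : ∀ i, ¬ Cell E α k G N i → s.bank 0 i = 0
  one : ∀ i, (∃ r < N, i = (E.κ 15 + r) * E.κ 13) → s.bank 1 i = 1
  zero : ∀ i, (¬ ∃ r < N, i = (E.κ 15 + r) * E.κ 13) → s.bank 1 i = 0

lemma Written.congr {E : Env} {α k G N : ℕ} {s s' : NState} (h : Written E α k G N s)
    (hr : ∀ r ∈ [40, 41, 51], s'.reg r = s.reg r) (h0 : s'.bank 0 = s.bank 0)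
    (h1 : s'.bank 1 = s.bank 1) : Written E α k G N s' := by
  refine ⟨(hr 40 (by simp)).trans h.r40, (hr 41 (by simp)).trans h.r41,
    (hr 51 (by simp)).trans h.r51, ?_, ?_, ?_, ?_⟩
  · rw [h0]; exact h.on
  · rw [h0]; exact h.off
  · rw [h1]; exact h.one
  · rw [h1]; exact h.zero

/-- Fill the matrices `Q` and `V`. -/
def mainP (α k G : ℕ) : FP :=
  const 40 0 ;; setc 41 15 ;; setc 51 14 ;;
  loop 43 10 (leafP α k G ;; loop 44 9 (writeP ;; odo 7 8 2) ;; odo 6 7 G)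

lemma wr_subset_regs (p : FP) : p.wr ⊆ p.regs := by
  induction p with
  | seq p q ihp ihq | ite _ _ p q ihp ihq | ifPos _ p q ihp ihq =>
    intro r hr
    simp only [wr, List.mem_append] at hr
    simp only [regs, List.mem_cons, List.mem_append]
    have := @ihp r
    have := @ihq r
    tauto
  | loop i j p ih =>
    intro r hr
    simp only [wr, List.mem_cons] at hr
    simp only [regs, List.mem_cons]
    exact hr.imp id (@ih r)
  | _ => simp [wr, regs]

lemma wr_zeroR (L : List ℕ) : (zeroR L).wr = L := by
  induction L with
  | nil => rfl
  | cons r L ih => simp [zeroR, wr, ih]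

lemma wb_zeroR (L : List ℕ) : (zeroR L).wb = [] := by
  induction L with
  | nil => rfl
  | cons r L ih => simp [zeroR, wb, ih]

lemma wr_leafP (α k G : ℕ) {r : ℕ} (hr : r ∈ (leafP α k G).wr) : r < 39 := by
  have h1 := regs_stepP α k G r
  have h2 := @wr_subset_regs (stepP α k G) r
  simp only [leafP, clearP, wr, wr_zeroR, wr_readP, wr_clearV, List.mem_append, List.mem_cons,
    List.mem_range, List.not_mem_nil, or_false] at hr
  by_contra h
  have h3 : r ∉ (stepP α k G).wr := fun h3 => h (h1 (h2 h3))
  simp only [h3, or_false] at hr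
  omega

lemma wb_leafP (α k G : ℕ) : (leafP α k G).wb ⊆ [2, 3, 4, 5] := by
  have := wb_find α k
  simp only [leafP, clearP, stepP, wb, wb_zeroR, wb_readP, wb_clearV, wb_heartP, wb_petalP]
  simp
  exact List.Subset.trans this (by simp)

section

variable {E : Env} {α k G : ℕ}

lemma Written.writeP {N j x : ℕ} (hx : x < E.κ 9) (hN : N = j * E.κ 9 + x) {s : NState}
    (h : Written E α k G N s) (h0 : s.reg 0 = 0) (h2 : s.bank 2 = (rowState E α k G j x).bank 2)
    (h3 : s.bank 3 = (rowState E α k G j x).bank 3) (h6 : s.bank 6 = (rowState E α k G j x).bank 6)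
    (h7 : s.bank 7 = (rowState E α k G j x).bank 7) :
    Written E α k G (N + 1) (writeP.eval E s) := by
  obtain ⟨k1, k2, k3, k4⟩ := eval_writeP (E := E) h0
  have hj : N / E.κ 9 = j := by
    rw [hN, mul_comm, Nat.mul_add_div (by omega), Nat.div_eq_of_lt hx, add_zero]
  have hx' : N % E.κ 9 = x := by
    rw [hN, mul_comm, Nat.mul_add_mod, Nat.mod_eq_of_lt hx]
  have hA : ∀ c, InA E s c ↔ RowA E α k G N c := fun c => by
    rw [RowA, hj, hx', InA.congr h2 h3 h6 h7]
  have hB : ∀ c, InB E s c ↔ RowB E α k G N c := fun c => by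
    rw [RowB, hj, hx', InB.congr h2 h3 h6 h7]
  have hex : ∀ P : ℕ → Prop, (∃ v < N + 1, P v) ↔ (∃ v < N, P v) ∨ P N := fun P => by
    simp only [Nat.lt_succ_iff_lt_or_eq, or_and_right, exists_or, exists_eq_left]
  have hC : ∀ i, Cell E α k G (N + 1) i ↔ Cell E α k G N i ∨
      ((∃ c, InA E s c ∧ i = s.reg 40 * E.κ 12 + c) ∨
        ∃ c, InB E s c ∧ i = s.reg 41 * E.κ 12 + c) := fun i => by
    simp only [Cell, hex, hA, hB, h.r40, h.r41]
    exact or_or_or_comm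
  have r51 : (FP.writeP.eval E s).reg 51 = s.reg 51 := eval_reg (fun hm => by
    have := wr_writeP hm
    simp at this) s
  refine ⟨by rw [k3, h.r40], by rw [k4, h.r41, add_assoc], r51.trans h.r51, fun i hi => ?_,
    fun i hi => ?_, fun i hi => ?_, fun i hi => ?_⟩
  · rw [hC] at hi
    by_cases hi' : (∃ c, InA E s c ∧ i = s.reg 40 * E.κ 12 + c) ∨
        ∃ c, InB E s c ∧ i = s.reg 41 * E.κ 12 + c
    · rw [(k1 i).1 hi', h.r51]
    · rw [(k1 i).2 hi', h.on i (hi.resolve_right hi')]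
  · rw [hC, not_or] at hi
    rw [(k1 i).2 hi.2, h.off i hi.1]
  · rw [k2, h.r41]
    rw [hex] at hi
    split_ifs with hi'
    · rfl
    · exact h.one i (hi.resolve_right hi')
  · rw [k2, h.r41]
    rw [hex, not_or] at hi
    rw [if_neg hi.2]
    exact h.zero i hi.1

/-- The whole program fills both matrices as intended. -/
lemma eval_mainP (hG : 0 < G) (h9 : E.κ 9 = 2 ^ E.κ 8) {s : NState} (hs : ∀ b i, s.bank b i = 0) :
    Written E α k G (E.κ 10 * E.κ 9) ((mainP α k G).eval E s) := by
  rw [mainP, eval_seq, eval_seq, eval_seq]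
  have hz : ∀ b, s.bank b = fun _ => 0 := fun b => funext (hs b)
  have d0 : ∀ B n, digs B n 0 = fun _ => 0 := fun B n => by funext p; simp [digs]
  have hcl : Clean E s := by constructor <;> simp [hs]
  have hz' : Clean E (⟨fun _ => 0, fun _ _ => 0⟩ : NState) := by constructor <;> simp
  refine (eval_loop (i := 43) (j := 10) (p := leafP α k G ;; loop 44 9 (FP.writeP ;; odo 7 8 2) ;;
      odo 6 7 G)
    (fun a s' => Written E α k G (a * E.κ 9) s' ∧ Clean E s' ∧ s'.bank 6 = digs G (E.κ 7) a ∧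
      s'.bank 7 = digs 2 (E.κ 8) 0) ⟨⟨?_, ?_, ?_, ?_, ?_, ?_, ?_⟩, ?_, ?_, ?_⟩ ?_).1
  · simp [eval]
  · simp [eval]
  · simp [eval]
  · simp [Cell]
  · simp [eval, hs]
  · simp
  · simp [eval, hs]
  · exact hcl.congr fun _ _ => rfl
  · simp [eval, hz, d0]
  · simp [eval, hz, d0]
  rintro a ha s' ⟨h1, h2, h6, h7⟩
  obtain ⟨s1, hs1⟩ : ∃ s1, s1 = s'.setReg 43 a := ⟨_, rfl⟩
  rw [← hs1]
  have w1 : Written E α k G (a * E.κ 9) s1 := h1.congr (fun r hr => by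
    rw [hs1, NState.setReg_reg, if_neg (by simp at hr; omega)]) (by rw [hs1]; rfl)
      (by rw [hs1]; rfl)
  have c1 : Clean E s1 := h2.congr fun b _ => by rw [hs1]; rfl
  have b6 : s1.bank 6 = digs G (E.κ 7) a := by rw [hs1]; exact h6
  have b7 : s1.bank 7 = digs 2 (E.κ 8) 0 := by rw [hs1]; exact h7
  rw [eval_seq, eval_seq]
  obtain ⟨s2, hs2⟩ : ∃ s2, s2 = (leafP α k G).eval E s1 := ⟨_, rfl⟩
  rw [← hs2]
  have hbk : ∀ b, b ∉ [2, 3, 4, 5] → s2.bank b = s1.bank b := fun b hb => by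
    rw [hs2, eval_bank fun h => hb (wb_leafP _ _ _ h)]
  have w2 : Written E α k G (a * E.κ 9) s2 := w1.congr (fun r hr => by
    rw [hs2, eval_reg fun h => by have := wr_leafP _ _ _ h; simp at hr; omega])
    (hbk 0 (by simp)) (hbk 1 (by simp))
  have c2 : Clean E s2 := by rw [hs2]; exact keepsClean_leafP c1
  have z2 : s2.reg 0 = 0 := by
    rw [hs2]
    exact reg_zero_leafP c1
  have d6 : s2.bank 6 = digs G (E.κ 7) a := by rw [hbk 6 (by simp), b6]
  have d7 : s2.bank 7 = digs 2 (E.κ 8) 0 := by rw [hbk 7 (by simp), b7]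
  have d23 : ∀ x b, b = 2 ∨ b = 3 → s2.bank b = (rowState E α k G a x).bank b := fun x b hb => by
    rw [rowState, NState.setBank_bank, if_neg (by omega), hs2]
    refine bank_leafP_congr c1 (hz'.congr fun b' hb' => ?_) ?_ hb
    · rw [NState.setBank_bank, if_neg (by simp at hb'; omega)]
    · rw [NState.setBank_bank, if_pos rfl, b6]
  have r6 : ∀ x, (rowState E α k G a x).bank 6 = digs G (E.κ 7) a := fun x => by
    rw [rowState, NState.setBank_bank, if_neg (by omega),
      eval_bank fun h => by have := wb_leafP _ _ _ h; simp at this, NState.setBank_bank, if_pos rfl]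
  have r7 : ∀ x, (rowState E α k G a x).bank 7 = digs 2 (E.κ 8) x := fun x => by
    rw [rowState, NState.setBank_bank, if_pos rfl]
  have inner := eval_loop_frame (E := E) (i := 44) (j := 9) (s := s2) (p := FP.writeP ;; odo 7 8 2)
    (fun x s' => Written E α k G (a * E.κ 9 + x) s' ∧ s'.bank 7 = digs 2 (E.κ 8) x) ⟨w2, d7⟩ (by
      rintro x hx s3 hf hb ⟨h4, h5⟩
      have h0 : (s3.setReg 44 x).reg 0 = 0 := by
        rw [NState.setReg_reg, if_neg (by simp), hf 0, z2]
        intro h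
        simp only [wr, wr_odo, List.mem_cons, List.mem_append] at h
        have : 0 ∉ FP.writeP.wr := fun h' => by have := wr_writeP h'; simp at this
        simp [this] at h
      have hb' : ∀ b, b ≠ 0 → b ≠ 1 → b ≠ 7 → (s3.setReg 44 x).bank b = s2.bank b :=
        fun b g0 g1 g7 => hb b (by simp [wb, wb_writeP, g0, g1, g7])
      have h6 := Written.writeP hx rfl (h4.congr (s' := s3.setReg 44 x) (fun r hr => by
        rw [NState.setReg_reg, if_neg (by simp at hr; omega)]) rfl rfl) h0
        (by rw [hb' 2 (by simp) (by simp) (by simp), d23 x 2 (.inl rfl)])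
        (by rw [hb' 3 (by simp) (by simp) (by simp), d23 x 3 (.inr rfl)])
        (by rw [hb' 6 (by simp) (by simp) (by simp), r6, d6])
        (by rw [r7]; exact h5)
      rw [eval_seq]
      constructor
      · refine h6.congr (fun r hr => ?_) ?_ ?_
        · rw [eval_reg]
          rw [wr_odo]
          simp at hr ⊢
          omega
        · rw [eval_bank (by simp)]
        · rw [eval_bank (by simp)]
      · refine eval_odo ?_ (by simp) ?_
        · rw [eval_reg (fun h' => by have := wr_writeP h'; simp at this)]
          exact h0
        · rw [eval_bank (by simp [wb_writeP])]
          exact h5)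
  obtain ⟨s4, hs4⟩ : ∃ s4, s4 = (loop 44 9 (FP.writeP ;; odo 7 8 2)).eval E s2 := ⟨_, rfl⟩
  rw [← hs4] at inner ⊢
  have e4 : ∀ b, b ≠ 0 → b ≠ 1 → b ≠ 7 → s4.bank b = s2.bank b :=
    fun b g0 g1 g7 => by rw [hs4, eval_bank (by simp [wb, wb_writeP, g0, g1, g7])]
  have z4 : s4.reg 0 = 0 := by
    rw [hs4, eval_reg, z2]
    intro h
    simp only [wr, wr_odo, List.mem_cons, List.mem_append] at h
    have : 0 ∉ FP.writeP.wr := fun h' => by have := wr_writeP h'; simp at this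
    simp [this] at h
  refine ⟨?_, ?_, ?_, ?_⟩
  · rw [add_mul, one_mul]
    refine inner.1.congr (fun r hr => ?_) ?_ ?_
    · rw [eval_reg]
      rw [wr_odo]
      simp at hr ⊢
      omega
    · rw [eval_bank (by simp)]
    · rw [eval_bank (by simp)]
  · refine c2.congr fun b hb => ?_
    rw [eval_bank (by simp at hb ⊢; omega)]
    simp at hb
    exact e4 b (by omega) (by omega) (by omega)
  · refine eval_odo z4 hG ?_
    rw [e4 6 (by simp) (by simp) (by simp), d6]
  · rw [eval_bank (by simp), inner.2, h9, digs_pow 2 _ (by simp)]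

end

end FP

/-! ### Pairs of rows and assignments -/

namespace FP

open Sparsify

/-- The set of literals that an assignment makes true. -/
def trueLits (E : Env) (β : ℕ → Bool) : Finset ℕ :=
  (Finset.range (E.κ 6)).image fun v => if β v then v + 1 else v + 1 + E.κ 6

/-- The assignment satisfies all clauses of the input. -/
def Solves (E : Env) (β : ℕ → Bool) : Prop := ∀ i < E.κ 4, ∃ l ∈ clauseSet E i, l ∈ trueLits E β

section

variable {E : Env} {s s' : NState}

lemma halfSat_or (h6 : E.κ 6 = 2 * E.κ 8) (h1 : E.κ 1 = 2 * E.κ 6 + 1)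
    (h2 : s'.bank 2 = s.bank 2) {β : ℕ → Bool}
    (hβ : ∀ v < E.κ 8, (β v = true ↔ 0 < s.bank 7 v))
    (hβ' : ∀ v < E.κ 8, (β (v + E.κ 8) = true ↔ 0 < s'.bank 7 v)) (t : ℕ) :
    (HalfSat E s 0 t ∨ HalfSat E s' (E.κ 8) t) ↔ ∃ l ∈ vec E s 2 t, l ∈ trueLits E β := by
  simp only [HalfSat, h2, mem_vec, trueLits, Finset.mem_image, Finset.mem_range]
  constructor
  · rintro (⟨v, hv, h⟩ | ⟨v, hv, h⟩)
    · rcases h with ⟨h, h'⟩ | ⟨h, h'⟩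
      · exact ⟨v + 1 + 0, ⟨by omega, h'⟩, v, by omega, by rw [if_pos ((hβ v hv).2 h)]⟩
      · exact ⟨v + 1 + 0 + E.κ 6, ⟨by omega, h'⟩, v, by omega, by
          rw [if_neg (by rw [hβ v hv]; omega)]⟩
    · rcases h with ⟨h, h'⟩ | ⟨h, h'⟩
      · exact ⟨v + 1 + E.κ 8, ⟨by omega, h'⟩, v + E.κ 8, by omega, by
          rw [if_pos ((hβ' v hv).2 h)]; omega⟩
      · exact ⟨v + 1 + E.κ 8 + E.κ 6, ⟨by omega, h'⟩, v + E.κ 8, by omega, by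
          rw [if_neg (by rw [hβ' v hv]; omega)]; omega⟩
  · rintro ⟨l, ⟨hl, hl'⟩, v, hv, rfl⟩
    by_cases hv8 : v < E.κ 8
    · refine .inl ⟨v, hv8, ?_⟩
      by_cases hb : β v = true
      · rw [if_pos hb] at hl'
        exact .inl ⟨(hβ v hv8).1 hb, hl'⟩
      · rw [if_neg hb] at hl'
        exact .inr ⟨by have := (hβ v hv8).not.1 hb; omega, hl'⟩
    · obtain ⟨u, rfl⟩ := Nat.exists_eq_add_of_le' (not_lt.1 hv8)
      have hu : u < E.κ 8 := by omega
      have e : u + 1 + E.κ 8 = u + E.κ 8 + 1 := by omega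
      refine .inr ⟨u, hu, ?_⟩
      rw [e]
      by_cases hb : β (u + E.κ 8) = true
      · rw [if_pos hb] at hl'
        exact .inl ⟨(hβ' u hu).1 hb, hl'⟩
      · rw [if_neg hb] at hl'
        exact .inr ⟨by have := (hβ' u hu).not.1 hb; omega, hl'⟩

lemma rank_lt {t t' : ℕ} (h : t < t') (ht : 0 < s.bank 3 t) : rank s t < rank s t' := by
  rw [rank, rank]
  refine Finset.card_lt_card ⟨fun a ha => ?_, fun hsub => ?_⟩
  · simp only [Finset.mem_filter, Finset.mem_range] at ha ⊢
    exact ⟨by omega, ha.2⟩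
  · have := hsub (Finset.mem_filter.2 ⟨Finset.mem_range.2 h, ht⟩)
    simp at this

lemma rank_inj {t t' : ℕ} (ht : 0 < s.bank 3 t) (ht' : 0 < s.bank 3 t')
    (h : rank s t = rank s t') : t = t' := by
  rcases lt_trichotomy t t' with hlt | rfl | hlt
  · have := rank_lt hlt ht
    omega
  · rfl
  · have := rank_lt hlt ht'
    omega

lemma rank_lt_card {t : ℕ} (ht : t < E.κ 2) (h : 0 < s.bank 3 t) : rank s t < (live E s).card :=
  rank_lt (s := s) ht h

lemma DigCol.lt {c : ℕ} (h : DigCol E s c) : c < E.κ 7 * E.κ 11 := by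
  obtain ⟨p, hp, h1, rfl⟩ := h
  calc p * E.κ 11 + s.bank 6 p < (p + 1) * E.κ 11 := by rw [add_mul, one_mul]; omega
    _ ≤ _ := Nat.mul_le_mul_right _ hp

lemma InA.lt {c : ℕ} (h : InA E s c) : c < E.κ 7 * E.κ 11 + 2 * (live E s).card := by
  rcases h with h | ⟨t, ht, h1, rfl⟩
  · have := h.lt
    omega
  · have := rank_lt_card ht h1
    split_ifs <;> omega

lemma InB.lt {c : ℕ} (h : InB E s c) : c < E.κ 7 * E.κ 11 + 2 * (live E s).card := by
  rcases h with h | ⟨t, ht, h1, rfl | ⟨-, rfl⟩⟩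
  · have := h.lt
    omega
  all_goals
    have := rank_lt_card ht h1
    omega

/-- If a row of the first kind is contained in a row of the second kind, then they belong to the
same leaf. -/
lemma digits_eq_of_subset (hs : ∀ p < E.κ 7, s.bank 6 p < E.κ 11)
    (h : ∀ c, InA E s c → InB E s' c) : ∀ p < E.κ 7, s.bank 6 p = s'.bank 6 p := by
  intro p hp
  have hc : DigCol E s (p * E.κ 11 + s.bank 6 p) := ⟨p, hp, hs p hp, rfl⟩
  have h1 := hc.lt
  rcases h _ (.inl hc) with ⟨p', -, h2, h3⟩ | ⟨t, -, -, h3 | ⟨-, h3⟩⟩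
  · obtain rfl := row_unique (hs p hp) h2 h3
    omega
  all_goals omega

/-- Within a leaf, containment of rows means that the two half-assignments together satisfy all
clauses. -/
lemma subset_iff (h3 : s'.bank 3 = s.bank 3)
    (h6 : s'.bank 6 = s.bank 6) : (∀ c, InA E s c → InB E s' c) ↔
      ∀ t ∈ live E s, HalfSat E s 0 t ∨ HalfSat E s' (E.κ 8) t := by
  constructor
  · intro h t ht
    obtain ⟨ht, h1⟩ := mem_live.1 ht
    by_contra hn
    rw [not_or] at hn
    have := h _ (.inr ⟨t, ht, h1, rfl⟩)
    rw [if_neg hn.1] at this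
    rcases this with h4 | ⟨t', -, h5, h4 | ⟨h6, h4⟩⟩
    · have := h4.lt
      omega
    · rw [rank_congr h3] at h4
      omega
    · rw [rank_congr h3] at h4
      rw [h3] at h5
      obtain rfl := rank_inj h1 h5 (by omega)
      exact hn.2 h6
  · rintro h c (hc | ⟨t, ht, h1, rfl⟩)
    · exact .inl ((DigCol.congr h6 c).2 hc)
    · refine .inr ⟨t, ht, by rwa [h3], ?_⟩
      rw [rank_congr h3]
      rcases h t (mem_live.2 ⟨ht, h1⟩) with h4 | h4
      · rw [if_pos h4]
        exact .inl rfl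
      · split_ifs
        · exact .inl rfl
        · exact .inr ⟨h4, rfl⟩

end

section

variable {E : Env} {α k G m e : ℕ}

/-- Some row of the first kind is contained in some row of the second kind if and only if the input
has a solution. -/
lemma exists_subset_iff (hp : Params E α k G m e) (hm : E.κ 4 = m) (hk : E.κ 5 = k)
    (he : E.κ 7 = e) (h11 : E.κ 11 = G) (hL : E.κ 1 * α ^ (3 * k) < E.κ 3)
    (h6 : E.κ 6 = 2 * E.κ 8) (h1 : E.κ 1 = 2 * E.κ 6 + 1) (h9 : E.κ 9 = 2 ^ E.κ 8)
    (h10 : E.κ 10 = G ^ e) :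
    (∃ a < E.κ 10 * E.κ 9, ∃ r < E.κ 10 * E.κ 9, ∀ c, RowA E α k G a c → RowB E α k G r c) ↔
      ∃ β, Solves E β := by
  have hG := hp.hG
  have hz : ∀ J, Clean E (NState.setBank ⟨fun _ => 0, fun _ _ => 0⟩ 6 J) := fun J => by
    constructor <;> simp [NState.setBank_bank]
  have b6 : ∀ j x, (rowState E α k G j x).bank 6 = digs G e j := fun j x => by
    rw [rowState, NState.setBank_bank, if_neg (by omega),
      eval_bank fun h => by have := wb_leafP _ _ _ h; simp at this, NState.setBank_bank, if_pos rfl,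
      he]
  have b7 : ∀ j x, (rowState E α k G j x).bank 7 = digs 2 (E.κ 8) x := fun j x => by
    rw [rowState, NState.setBank_bank, if_pos rfl]
  have b23 : ∀ j j' x y, digs G e j = digs G e j' → ∀ b, b = 2 ∨ b = 3 →
      (rowState E α k G j x).bank b = (rowState E α k G j' y).bank b := fun j j' x y hj b hb => by
    rw [rowState, rowState, he, hj, NState.setBank_bank, NState.setBank_bank, if_neg (by omega),
      if_neg (by omega)]
  have hfam : ∀ j x, fam E (rowState E α k G j x) = fam E ((leafP α k G).eval E
      (NState.setBank ⟨fun _ => 0, fun _ _ => 0⟩ 6 (digs G e j))) := fun j x => by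
    rw [rowState, he]
    exact fam_congr (by rw [NState.setBank_bank, if_neg (by omega)])
      (by rw [NState.setBank_bank, if_neg (by omega)])
  have key : ∀ j x y β, (∀ v < E.κ 8, (β v = true ↔ 0 < digs 2 (E.κ 8) x v)) →
      (∀ v < E.κ 8, (β (v + E.κ 8) = true ↔ 0 < digs 2 (E.κ 8) y v)) →
      ((∀ t ∈ live E (rowState E α k G j x), HalfSat E (rowState E α k G j x) 0 t ∨
        HalfSat E (rowState E α k G j y) (E.κ 8) t) ↔
            Hits (trueLits E β) (fam E ((leafP α k G).eval E
      (NState.setBank ⟨fun _ => 0, fun _ _ => 0⟩ 6 (digs G e j))))) := by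
    intro j x y β hβ hβ'
    rw [← hfam j x, Hits, fam, Finset.forall_mem_image]
    refine forall₂_congr fun t _ => ?_
    exact halfSat_or h6 h1 (b23 j j y x rfl 2 (.inl rfl)) (by simpa only [b7] using hβ)
      (by simpa only [b7] using hβ') t
  constructor
  · rintro ⟨a, -, r, -, h⟩
    have hd : digs G e (a / E.κ 9) = digs G e (r / E.κ 9) := by
      have := digits_eq_of_subset (by rw [b6, h11]; exact fun p _ => digs_lt (by omega)) h
      rw [b6, b6, he] at this
      funext p
      by_cases hpe : p < e
      · exact this p hpe
      · simp [digs, hpe]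
    let β : ℕ → Bool := fun v => if v < E.κ 8 then decide (0 < digs 2 (E.κ 8) (a % E.κ 9) v)
      else decide (0 < digs 2 (E.κ 8) (r % E.κ 9) (v - E.κ 8))
    have hb : ∀ c, RowB E α k G r c ↔ InB E (rowState E α k G (a / E.κ 9) (r % E.κ 9)) c :=
      fun c => InB.congr (b23 _ _ _ _ hd.symm 2 (.inl rfl)) (b23 _ _ _ _ hd.symm 3 (.inr rfl))
        (by rw [b6, b6, hd]) (by rw [b7, b7]) c
    have h' := (subset_iff (b23 _ _ _ _ rfl 3 (.inr rfl))
      (by rw [b6, b6])).1 (fun c hc => (hb c).1 (h c hc))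
    rw [key _ _ _ β (fun v hv => by simp [β, hv]) (fun v hv => by simp [β])] at h'
    exact ⟨β, (eval_leafP hp hm hk hL (hz _)).2.2 _ h'⟩
  · rintro ⟨β, hβ⟩
    obtain ⟨J, k1, k2, k3⟩ := exists_leaf hp hm hk hβ
    obtain ⟨j, hj, rfl⟩ := exists_digs k1 k2
    obtain ⟨x, hx, hx'⟩ := exists_digs (G := 2) (n := E.κ 8)
      (J := fun v => if v < E.κ 8 ∧ β v = true then 1 else 0)
      (fun p => by split_ifs <;> omega) (fun p hpe => by rw [if_neg (by omega)])
    obtain ⟨y, hy, hy'⟩ := exists_digs (G := 2) (n := E.κ 8)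
      (J := fun v => if v < E.κ 8 ∧ β (v + E.κ 8) = true then 1 else 0)
      (fun p => by split_ifs <;> omega) (fun p hpe => by rw [if_neg (by omega)])
    rw [← h9] at hx hy
    have hlt : ∀ z < E.κ 9, j * E.κ 9 + z < E.κ 10 * E.κ 9 := fun z hz' => by
      calc j * E.κ 9 + z < (j + 1) * E.κ 9 := by rw [add_mul, one_mul]; omega
        _ ≤ _ := Nat.mul_le_mul_right _ (by omega)
    have hdiv : ∀ z < E.κ 9, (j * E.κ 9 + z) / E.κ 9 = j := fun z hz' => by
      rw [mul_comm, Nat.mul_add_div (by omega), Nat.div_eq_of_lt hz', add_zero]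
    have hmod : ∀ z < E.κ 9, (j * E.κ 9 + z) % E.κ 9 = z := fun z hz' => by
      rw [mul_comm, Nat.mul_add_mod, Nat.mod_eq_of_lt hz']
    refine ⟨j * E.κ 9 + x, hlt x hx, j * E.κ 9 + y, hlt y hy, ?_⟩
    simp only [RowA, RowB, hdiv x hx, hmod x hx, hdiv y hy, hmod y hy]
    rw [subset_iff (b23 _ _ _ _ rfl 3 (.inr rfl)) (by rw [b6, b6]),
      key _ _ _ β (fun v hv => by cases h : β v <;> simp [hx', hv, h])
      (fun v hv => by cases h : β (v + E.κ 8) <;> simp [hy', hv, h])]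
    exact k3 _ (hz _) (by rw [NState.setBank_bank, if_pos rfl])

/-- The columns of a row are bounded. -/
lemma row_lt (hp : Params E α k G m e) (hm : E.κ 4 = m) (hk : E.κ 5 = k)
    (hL : E.κ 1 * α ^ (3 * k) < E.κ 3)
    (h12 : E.κ 7 * E.κ 11 + 2 * (1 + k * (E.κ 1 * α ^ (3 * k))) ≤ E.κ 12) {r c : ℕ}
    (h : RowA E α k G r c ∨ RowB E α k G r c) : c < E.κ 12 := by
  have hz : ∀ J, Clean E (NState.setBank ⟨fun _ => 0, fun _ _ => 0⟩ 6 J) := fun J => by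
    constructor <;> simp [NState.setBank_bank]
  obtain ⟨g1, g2, -⟩ := eval_leafP hp hm hk hL (hz (digs G (E.κ 7) (r / E.κ 9)))
  have h1 : (live E (rowState E α k G (r / E.κ 9) (r % E.κ 9))).card ≤
      1 + k * (E.κ 1 * α ^ (3 * k)) := by
    rw [fam, Finset.card_image_of_injOn g1.inj] at g2
    rw [rowState, live_congr (s := (leafP α k G).eval E
      (NState.setBank ⟨fun _ => 0, fun _ _ => 0⟩ 6 (digs G (E.κ 7) (r / E.κ 9))))]
    · exact g2
    · rw [NState.setBank_bank, if_neg (by omega)]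
  rcases h with h | h
  · have := InA.lt h
    omega
  · have := InB.lt h
    omega

/-- The matrices that the program `mainP` writes: row `r` of `Q` is `κ 14` times the indicator of a
set `S r`, the first column of `V` is the indicator of the second half of the rows, and there are
rows `a` and `r` in the first and second half with `S a ⊆ S r` if and only if the input has a
solution. -/
theorem exists_matrices (hp : Params E α k G m e) (hm : E.κ 4 = m) (hk : E.κ 5 = k)
    (he : E.κ 7 = e) (h11 : E.κ 11 = G) (hL : E.κ 1 * α ^ (3 * k) < E.κ 3)
    (h6 : E.κ 6 = 2 * E.κ 8) (h1 : E.κ 1 = 2 * E.κ 6 + 1) (h9 : E.κ 9 = 2 ^ E.κ 8)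
    (h10 : E.κ 10 = G ^ e) (h15 : E.κ 15 = E.κ 10 * E.κ 9)
    (h12 : E.κ 7 * E.κ 11 + 2 * (1 + k * (E.κ 1 * α ^ (3 * k))) ≤ E.κ 12)
    {s : NState} (hs : ∀ b i, s.bank b i = 0) :
    ∃ S : ℕ → Finset ℕ, (∀ r, S r ⊆ Finset.range (E.κ 12)) ∧
      (∀ r < 2 * E.κ 15, ∀ c < E.κ 12, ((mainP α k G).eval E s).bank 0 (r * E.κ 12 + c) =
        if c ∈ S r then E.κ 14 else 0) ∧
      (∀ i, 2 * E.κ 15 * E.κ 12 ≤ i → ((mainP α k G).eval E s).bank 0 i = 0) ∧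
      (∀ i, (∃ r < E.κ 15, i = (E.κ 15 + r) * E.κ 13) → ((mainP α k G).eval E s).bank 1 i = 1) ∧
      (∀ i, (¬ ∃ r < E.κ 15, i = (E.κ 15 + r) * E.κ 13) →
        ((mainP α k G).eval E s).bank 1 i = 0) ∧
      ((∃ a < E.κ 15, ∃ r < E.κ 15, S a ⊆ S (E.κ 15 + r)) ↔ ∃ β, Solves E β) := by
  classical
  have hG := hp.hG
  have hW := eval_mainP (k := k) (α := α) (by omega : 0 < G) h9 hs
  rw [← h15] at hW
  have hlt : ∀ {r c}, RowA E α k G r c ∨ RowB E α k G r c → c < E.κ 12 :=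
    row_lt hp hm hk hL h12
  have hS : ∀ r c, c < E.κ 12 → ∀ N, N = E.κ 15 → (Cell E α k G N (r * E.κ 12 + c) ↔
      if r < N then RowA E α k G r c else r < 2 * N ∧ RowB E α k G (r - N) c) := by
    intro r c hc N hN
    constructor
    · rintro (⟨r', hr', c', h, e⟩ | ⟨r', hr', c', h, e⟩)
      · obtain rfl := row_unique hc (hlt (.inl h)) e
        obtain rfl : c = c' := by omega
        rwa [if_pos hr']
      · obtain rfl := row_unique hc (hlt (.inr h)) e
        obtain rfl : c = c' := by omega
        rw [if_neg (by omega), hN, Nat.add_sub_cancel_left]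
        exact ⟨by omega, h⟩
    · intro h
      split_ifs at h with hr
      · exact .inl ⟨r, hr, c, h, rfl⟩
      · exact .inr ⟨r - N, by omega, c, h.2, by rw [← hN]; congr 2; omega⟩
  refine ⟨fun r => (Finset.range (E.κ 12)).filter fun c => if r < E.κ 15 then RowA E α k G r c else
    r < 2 * E.κ 15 ∧ RowB E α k G (r - E.κ 15) c, fun r => Finset.filter_subset _ _, ?_, ?_, hW.one,
    hW.zero, ?_⟩
  · intro r hr c hc
    simp only [Finset.mem_filter, Finset.mem_range, hc, true_and]
    simp only [← hS r c hc _ rfl]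
    split_ifs with h
    exacts [hW.on _ h, hW.off _ h]
  · intro i hi
    refine hW.off i ?_
    rintro (⟨r', hr', c', h, e⟩ | ⟨r', hr', c', h, e⟩)
    · have h3 := hlt (.inl h)
      have : r' * E.κ 12 + c' < (2 * E.κ 15) * E.κ 12 := by
        calc r' * E.κ 12 + c' < (r' + 1) * E.κ 12 := by rw [add_mul, one_mul]; omega
          _ ≤ _ := Nat.mul_le_mul_right _ (by omega)
      omega
    · have h3 := hlt (.inr h)
      have : (E.κ 15 + r') * E.κ 12 + c' < (2 * E.κ 15) * E.κ 12 := by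
        calc (E.κ 15 + r') * E.κ 12 + c' < (E.κ 15 + r' + 1) * E.κ 12 := by
              rw [add_mul _ 1, one_mul]; omega
          _ ≤ _ := Nat.mul_le_mul_right _ (by omega)
      omega
  · rw [← exists_subset_iff hp hm hk he h11 hL h6 h1 h9 h10, ← h15]
    refine exists_congr fun a => and_congr_right fun ha => exists_congr fun r =>
      and_congr_right fun hr => ?_
    rw [Finset.subset_iff]
    refine forall_congr' fun c => ?_
    simp only [Finset.mem_filter, Finset.mem_range, ha, if_true]
    rw [if_neg (by omega), Nat.add_sub_cancel_left]
    constructor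
    · exact fun h hA => (h ⟨hlt (.inl hA), hA⟩).2.2
    · exact fun h hA => ⟨hA.1, by omega, h hA.2⟩

end

end FP

/-! ### Attention detects containment of sets -/

section

variable {n d e half B : ℕ} {S : ℕ → Finset ℕ} {Q : Matrix (Fin n) (Fin d) ℝ}
  {V : Matrix (Fin n) (Fin e) ℝ}

lemma dotProduct_of_indicator (hS : ∀ r, S r ⊆ Finset.range d)
    (hQ : ∀ i j, Q i j = if (j : ℕ) ∈ S i then (B : ℝ) else 0) (i k : Fin n) :
    Q i ⬝ᵥ Q k = (B : ℝ) ^ 2 * (S i ∩ S k).card := by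
  have h1 : ∀ j : Fin d, Q i j * Q k j = (fun l : ℕ => if l ∈ S i ∩ S k then (B : ℝ) ^ 2 else 0)
      j := by
    intro j
    rw [hQ, hQ]
    by_cases h1 : (j : ℕ) ∈ S i <;> by_cases h2 : (j : ℕ) ∈ S k <;> simp [h1, h2, sq]
  rw [dotProduct, Finset.sum_congr rfl fun j _ => h1 j, Fin.sum_univ_eq_sum_range (fun l : ℕ =>
    if l ∈ S i ∩ S k then (B : ℝ) ^ 2 else 0) d, ← Finset.sum_filter, Finset.filter_mem_eq_inter,
    Finset.inter_eq_right.2 (Finset.inter_subset_left.trans (hS i)), Finset.sum_const, nsmul_eq_mul,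
    mul_comm]

/-- If `S a` is contained in some `S r` with `r` in the second half of the rows, then the weight of
the second half in row `a` is at least `1 / n`, and otherwise it is at most `n * exp (-B ^ 2)`. An
approximation of it can tell these cases apart. -/
lemma le_approx_iff (hn : n = 2 * half) (he : 0 < e) (hS : ∀ r, S r ⊆ Finset.range d)
    (hQ : ∀ i j, Q i j = if (j : ℕ) ∈ S i then (B : ℝ) else 0)
    (hV : ∀ i, V i ⟨0, he⟩ = if half ≤ (i : ℕ) then 1 else 0) {μ : ℝ} (h1 : μ < 1)
    {C : ℕ} (hC : 1 ≤ C * (1 - μ)) (hB : 2 * C * (n : ℝ) ^ 2 < Real.exp ((B : ℝ) ^ 2))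
    {a : ℕ} (ha : a < half) {y : ℝ}
    (hy : |y - selfAttention Q V ⟨a, by omega⟩ ⟨0, he⟩| ≤
      μ * |selfAttention Q V ⟨a, by omega⟩ ⟨0, he⟩|) :
    1 / ((n : ℝ) * C) ≤ y ↔ ∃ r < half, S a ⊆ S (half + r) := by
  obtain ⟨i, hi⟩ : ∃ i : Fin n, i = ⟨a, by omega⟩ := ⟨_, rfl⟩
  rw [← hi] at hy
  have hia : (i : ℕ) = a := by rw [hi]
  obtain ⟨w, hw⟩ : ∃ w : Fin n → ℝ, w = fun k : Fin n =>
      Real.exp ((B : ℝ) ^ 2 * (S a ∩ S (k : ℕ)).card) :=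
    ⟨_, rfl⟩
  have hwpos : ∀ k, 0 < w k := fun k => by rw [hw]; exact Real.exp_pos _
  have hY : selfAttention Q V i ⟨0, he⟩ =
      (∑ k : Fin n, if half ≤ (k : ℕ) then w k else 0) / ∑ k, w k := by
    have hs : ∀ k, expScore Q i k = w k := fun k => by
      rw [expScore, Matrix.of_apply, dotProduct_of_indicator hS hQ, hw, hia]
    rw [selfAttention, Matrix.mul_apply, Finset.sum_div]
    refine Finset.sum_congr rfl fun k _ => ?_
    simp only [rowNormalize, Matrix.of_apply, hs, hV]
    split_ifs <;> simp
  have hmax : ∀ k, w k ≤ w i := fun k => by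
    rw [hw]
    simp only [hia, Finset.inter_self]
    gcongr
    exact Finset.inter_subset_left
  have hsum : 0 < ∑ k, w k := lt_of_lt_of_le (hwpos i)
    (Finset.single_le_sum (fun k _ => (hwpos k).le) (Finset.mem_univ i))
  have hnpos : (0 : ℝ) < n := by
    have : 0 < n := by omega
    exact_mod_cast this
  have hCpos : (0 : ℝ) < C := by
    by_contra h
    have : (C : ℝ) = 0 := le_antisymm (not_lt.1 h) (by positivity)
    rw [this] at hC
    linarith
  have hYnn : 0 ≤ selfAttention Q V i ⟨0, he⟩ := by
    rw [hY]
    refine div_nonneg (Finset.sum_nonneg fun k _ => ?_) hsum.le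
    split_ifs
    exacts [(hwpos k).le, le_rfl]
  rw [abs_of_nonneg hYnn, abs_le] at hy
  obtain ⟨Y, hYe⟩ : ∃ Y, Y = selfAttention Q V i ⟨0, he⟩ := ⟨_, rfl⟩
  rw [← hYe] at hy hY hYnn
  constructor
  · intro hle
    by_contra hno
    push Not at hno
    have hsmall : Y ≤ n * Real.exp (-(B : ℝ) ^ 2) := by
      rw [hY, div_le_iff₀ hsum]
      calc (∑ k : Fin n, if half ≤ (k : ℕ) then w k else 0)
          ≤ ∑ k : Fin n, Real.exp (-(B : ℝ) ^ 2) * w i := by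
            refine Finset.sum_le_sum fun k _ => ?_
            split_ifs with hk
            · have hlt : (S a ∩ S k).card < (S a).card := by
                refine Finset.card_lt_card ⟨Finset.inter_subset_left, fun hsub => ?_⟩
                refine hno (k - half) (by omega) ?_
                rw [show half + (k - half) = (k : ℕ) by omega]
                exact hsub.trans Finset.inter_subset_right
              rw [hw]
              simp only [hia, Finset.inter_self]
              rw [← Real.exp_add]
              refine Real.exp_le_exp.2 ?_
              have : ((S a ∩ S k).card : ℝ) + 1 ≤ (S a).card := by exact_mod_cast hlt
              nlinarith [sq_nonneg (B : ℝ)]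
            · have := hwpos i
              positivity
        _ = n * (Real.exp (-(B : ℝ) ^ 2) * w i) := by simp
        _ ≤ n * Real.exp (-(B : ℝ) ^ 2) * ∑ k, w k := by
            rw [← mul_assoc]
            gcongr
            exact Finset.single_le_sum (fun k _ => (hwpos k).le) (Finset.mem_univ i)
    have h2 : y ≤ 2 * (n * Real.exp (-(B : ℝ) ^ 2)) := by nlinarith [hy.2]
    have h3 : 1 / ((n : ℝ) * C) ≤ 2 * (n * Real.exp (-(B : ℝ) ^ 2)) := hle.trans h2
    rw [div_le_iff₀ (by positivity)] at h3
    have h4 : Real.exp (-(B : ℝ) ^ 2) * Real.exp ((B : ℝ) ^ 2) = 1 := by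
      rw [← Real.exp_add]; simp
    have h5 : Real.exp (-(B : ℝ) ^ 2) * (2 * C * (n : ℝ) ^ 2) < 1 := by
      rw [← h4]
      exact mul_lt_mul_of_pos_left hB (Real.exp_pos _)
    nlinarith
  · rintro ⟨r, hr, hsub⟩
    have hbig : 1 ≤ n * Y := by
      rw [hY, ← mul_div_assoc, le_div_iff₀ hsum, one_mul]
      have hk : w ⟨half + r, by omega⟩ = w i := by
        rw [hw]
        simp only [hia, Finset.inter_self, Finset.inter_eq_left.2 hsub]
      calc ∑ k, w k ≤ ∑ k : Fin n, w i := Finset.sum_le_sum fun k _ => hmax k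
        _ = n * w i := by simp
        _ ≤ _ := by
          gcongr
          rw [← hk]
          have h6 := Finset.single_le_sum (f := fun k : Fin n => if half ≤ (k : ℕ) then w k else 0)
            (fun k _ => by split_ifs; exacts [(hwpos k).le, le_rfl])
            (Finset.mem_univ (⟨half + r, by omega⟩ : Fin n))
          simpa using h6
    rw [div_le_iff₀ (by positivity)]
    have h7 : (1 - μ) * Y ≤ y := by linarith [hy.1]
    calc (1 : ℝ) ≤ C * (1 - μ) * (n * Y) := by nlinarith
      _ = (1 - μ) * Y * (n * C) := by ring
      _ ≤ y * (n * C) := by gcongr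

end

/-! ### Bounds on the number of steps -/

namespace FP

/-- All loop bounds of the program are constants with numbers in `L`. -/
def LoopsIn (L : List ℕ) : FP → Prop
  | seq p q | ite _ _ p q | ifPos _ p q => p.LoopsIn L ∧ q.LoopsIn L
  | loop _ j p => j ∈ L ∧ p.LoopsIn L
  | _ => True

/-- The program does not add two variables. -/
def NoAddv : FP → Prop
  | addv _ _ _ => False
  | seq p q | ite _ _ p q | ifPos _ p q => p.NoAddv ∧ q.NoAddv
  | loop _ _ p => p.NoAddv
  | _ => True

lemma NoAddv.adds_eq {p : FP} (h : p.NoAddv) (E : Env) : p.adds E = 0 := by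
  induction p with
  | seq p q ihp ihq | ite _ _ p q ihp ihq | ifPos _ p q ihp ihq =>
    rw [adds, ihp h.1, ihq h.2]
  | loop i j p ih => rw [adds, ih h, mul_zero]
  | addv => exact h.elim
  | _ => rfl

lemma LoopsIn.adds_eq {p : FP} (h : p.LoopsIn []) (E E' : Env) : p.adds E = p.adds E' := by
  induction p with
  | seq p q ihp ihq | ite _ _ p q ihp ihq | ifPos _ p q ihp ihq =>
    rw [adds, adds, ihp h.1, ihq h.2]
  | loop i j p ih => simp [LoopsIn] at h
  | _ => rfl

/-- The number of steps is polynomial in the loop bounds. -/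
lemma LoopsIn.exists_steps_le {p : FP} {L : List ℕ} (h : p.LoopsIn L) :
    ∃ a, ∀ (E : Env) (P : ℕ), 2 ≤ P → (∀ j ∈ L, E.κ j ≤ P) → p.steps E ≤ P ^ a := by
  have two : ∀ {u v a b P : ℕ}, 2 ≤ P → u ≤ P ^ a → v ≤ P ^ b → 1 + u + v ≤ P ^ (a + b + 2) := by
    intro u v a b P hP hu hv
    have h1 : P ^ a ≤ P ^ (a + b) := Nat.pow_le_pow_right (by omega) (by omega)
    have h2 : P ^ b ≤ P ^ (a + b) := Nat.pow_le_pow_right (by omega) (by omega)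
    have h3 : 1 ≤ P ^ (a + b) := Nat.one_le_pow _ _ (by omega)
    have h4 : 4 ≤ P ^ 2 := by nlinarith
    calc 1 + u + v ≤ P ^ (a + b) * 4 := by omega
      _ ≤ P ^ (a + b) * P ^ 2 := Nat.mul_le_mul_left _ h4
      _ = _ := (pow_add P (a + b) 2).symm
  induction p with
  | seq p q ihp ihq | ite _ _ p q ihp ihq | ifPos _ p q ihp ihq =>
    obtain ⟨a, ha⟩ := ihp h.1
    obtain ⟨b, hb⟩ := ihq h.2
    refine ⟨a + b + 2, fun E P hP hE => ?_⟩
    have := two hP (ha E P hP hE) (hb E P hP hE)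
    rw [steps]
    omega
  | loop i j p ih =>
    obtain ⟨a, ha⟩ := ih h.2
    refine ⟨a + 3, fun E P hP hE => ?_⟩
    rw [steps]
    have h1 := ha E P hP hE
    have h2 : 1 ≤ P ^ a := Nat.one_le_pow _ _ (by omega)
    have h3 : E.κ j ≤ P := hE j h.1
    calc 1 + E.κ j * (1 + p.steps E) ≤ P ^ a + P * (P ^ a + P ^ a) := by gcongr
      _ = P ^ a * (1 + 2 * P) := by ring
      _ ≤ P ^ a * P ^ 3 := by
        gcongr
        nlinarith [Nat.mul_le_mul hP hP]
      _ = _ := (pow_add P a 3).symm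
  | _ => exact ⟨0, fun E P _ _ => by simp [steps]⟩

lemma loopsIn_seqs {L : List ℕ} {p : ℕ → FP} (h : ∀ a, (p a).LoopsIn L) (n : ℕ) :
    (seqs p n).LoopsIn L := by
  induction n with
  | zero => trivial
  | succ n ih => exact ⟨ih, h n⟩

lemma noAddv_seqs {p : ℕ → FP} (h : ∀ a, (p a).NoAddv) (n : ℕ) : (seqs p n).NoAddv := by
  induction n with
  | zero => trivial
  | succ n ih => exact ⟨ih, h n⟩

/-- The constants that bound the inner loops. They are small. -/
def innerLoops : List ℕ := [1, 2, 3, 4, 5, 7, 8, 11]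

lemma loopsIn_interV (neg : Bool) (b₁ r₁ b₂ r₂ b r : ℕ) :
    (interV neg b₁ r₁ b₂ r₂ b r).LoopsIn innerLoops ∧ (interV neg b₁ r₁ b₂ r₂ b r).NoAddv := by
  cases neg <;> simp [interV, LoopsIn, NoAddv, innerLoops]

lemma loopsIn_ins : ins.LoopsIn innerLoops ∧ ins.NoAddv := by
  have := loopsIn_interV false 4 0 4 0 2 9
  simp [ins, insTest, insKill, subV, LoopsIn, NoAddv, this]
  simp [innerLoops]

lemma loopsIn_find (α k : ℕ) : (find α k).LoopsIn innerLoops ∧ (find α k).NoAddv := by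
  have h : ∀ i a c, (findV c i a).LoopsIn innerLoops ∧ (findV c i a).NoAddv := fun i a c => by
    have h1 := loopsIn_interV false 2 1 2 14 5 0
    simp [findV, tryV, countV, isLive, cardV, subV, ifEq, LoopsIn, NoAddv, h1]
    simp [innerLoops]
  have h' : ∀ i a c, (ifPos 11 skip (findV c i a)).LoopsIn innerLoops ∧
      (ifPos 11 skip (findV c i a)).NoAddv := fun i a c =>
    ⟨⟨trivial, (h i a c).1⟩, trivial, (h i a c).2⟩
  exact ⟨⟨trivial, loopsIn_seqs (fun c => loopsIn_seqs (fun i => (h' _ _ c).1) _) _⟩,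
    ⟨trivial, noAddv_seqs (fun c => noAddv_seqs (fun i => (h' _ _ c).2) _) _⟩⟩

lemma loopsIn_zeroR (M : List ℕ) (L : List ℕ) : (zeroR M).LoopsIn L ∧ (zeroR M).NoAddv := by
  induction M with
  | nil => exact ⟨trivial, trivial⟩
  | cons r M ih => exact ⟨⟨trivial, ih.1⟩, trivial, ih.2⟩

lemma loopsIn_leafP (α k G : ℕ) :
    (leafP α k G).LoopsIn innerLoops ∧ (leafP α k G).NoAddv := by
  have h1 := loopsIn_find α k
  have h2 := loopsIn_ins
  have h3 := loopsIn_zeroR (List.range 39) innerLoops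
  have h4 := fun neg b₁ r₁ b₂ r₂ b r => loopsIn_interV neg b₁ r₁ b₂ r₂ b r
  simp [leafP, clearP, clearV, readP, readClause, markV, stepP, heartP, petalP, isLive, cardV, subV,
    ifEq, LoopsIn, NoAddv, h1, h2, h3, h4]
  simp [innerLoops]

lemma loopsIn_writeP : writeP.LoopsIn innerLoops ∧ writeP.NoAddv := by
  simp [writeP, digitsP, clausesP, satHalf, ifEq, LoopsIn, NoAddv]
  simp [innerLoops]

lemma loopsIn_odo {n : ℕ} (hn : n ∈ innerLoops) (b G : ℕ) :
    (odo b n G).LoopsIn innerLoops ∧ (odo b n G).NoAddv := by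
  simp [odo, LoopsIn, NoAddv, hn]

lemma adds_mainP (α k G : ℕ) (E : Env) : (mainP α k G).adds E = 0 :=
  NoAddv.adds_eq (p := mainP α k G) ⟨trivial, trivial, trivial, (loopsIn_leafP α k G).2,
    ⟨loopsIn_writeP.2, (loopsIn_odo (by simp [innerLoops]) 7 2).2⟩,
    (loopsIn_odo (by simp [innerLoops]) 6 G).2⟩ E

/-- Up to polynomial factors, the running time is the number of rows. -/
lemma exists_steps_mainP_le (α k G : ℕ) : ∃ a, ∀ (E : Env) (P : ℕ), 2 ≤ P →
    (∀ j ∈ innerLoops, E.κ j ≤ P) → 1 ≤ E.κ 9 → 1 ≤ E.κ 10 →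
    (mainP α k G).steps E ≤ E.κ 10 * E.κ 9 * P ^ a := by
  obtain ⟨a1, h1⟩ := (loopsIn_leafP α k G).1.exists_steps_le
  obtain ⟨a2, h2⟩ := loopsIn_writeP.1.exists_steps_le
  obtain ⟨a3, h3⟩ := (loopsIn_odo (n := 8) (by simp [innerLoops]) 7 2).1.exists_steps_le
  obtain ⟨a4, h4⟩ := (loopsIn_odo (n := 7) (by simp [innerLoops]) 6 G).1.exists_steps_le
  refine ⟨a1 + a2 + a3 + a4 + 4, fun E P hP hE h9 h10 => ?_⟩
  obtain ⟨y, hy⟩ : ∃ y, y = P ^ (a1 + a2 + a3 + a4) := ⟨_, rfl⟩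
  have hle : ∀ i ≤ a1 + a2 + a3 + a4, P ^ i ≤ y := fun i hi => by
    rw [hy]; exact Nat.pow_le_pow_right (by omega) hi
  have g1 := (h1 E P hP hE).trans (hle a1 (by omega))
  have g2 := (h2 E P hP hE).trans (hle a2 (by omega))
  have g3 := (h3 E P hP hE).trans (hle a3 (by omega))
  have g4 := (h4 E P hP hE).trans (hle a4 (by omega))
  have g0 : 1 ≤ y := by rw [hy]; exact Nat.one_le_pow _ _ (by omega)
  have g5 : 16 ≤ P ^ 4 := by
    calc 16 = 2 ^ 4 := by norm_num
      _ ≤ _ := Nat.pow_le_pow_left hP 4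
  simp only [mainP, steps]
  rw [pow_add, ← hy]
  have e1 : 1 + E.κ 9 * (1 + (writeP.steps E + (odo 7 8 2).steps E)) ≤ E.κ 9 * (4 * y) := by
    calc 1 + E.κ 9 * (1 + (writeP.steps E + (odo 7 8 2).steps E)) ≤
        E.κ 9 * y + E.κ 9 * (y + (y + y)) := by
          gcongr
          exact Nat.mul_pos h9 g0
      _ = _ := by ring
  have e2 : y ≤ E.κ 9 * y := Nat.le_mul_of_pos_left _ h9
  calc _ ≤ 4 + E.κ 10 * (1 + (y + (E.κ 9 * (4 * y) + y))) := by
        rw [show ∀ u, 1 + (1 + (1 + (1 + u))) = 4 + u from fun u => by ring]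
        gcongr
    _ ≤ E.κ 10 * (4 * (E.κ 9 * y)) + E.κ 10 * (E.κ 9 * y + (E.κ 9 * y + (E.κ 9 * (4 * y) +
        E.κ 9 * y))) := by
        have : 1 ≤ E.κ 9 * y := Nat.mul_pos h9 g0
        have : 1 ≤ E.κ 10 * (E.κ 9 * y) := Nat.mul_pos h10 this
        gcongr
        · calc 4 = 4 * 1 := rfl
            _ ≤ 4 * (E.κ 10 * (E.κ 9 * y)) := by gcongr
            _ = _ := by ring
    _ = E.κ 10 * E.κ 9 * (y * 11) := by ring
    _ ≤ _ := by gcongr; omega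

end FP

/-- The function is bounded by a polynomial. -/
def PolyBdd (f : ℕ → ℕ → ℕ) : Prop := ∃ a, ∀ N m, f N m ≤ (N + m + 2) ^ a

namespace PolyBdd

variable {f g : ℕ → ℕ → ℕ}

lemma mono (hg : PolyBdd g) (h : ∀ N m, f N m ≤ g N m) : PolyBdd f := by
  obtain ⟨a, ha⟩ := hg
  exact ⟨a, fun N m => (h N m).trans (ha N m)⟩

lemma const (c : ℕ) : PolyBdd fun _ _ => c :=
  ⟨c, fun N m => Nat.lt_two_pow_self.le.trans (Nat.pow_le_pow_left (by omega) c)⟩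

lemma fst : PolyBdd fun N _ => N := ⟨1, fun N m => by rw [pow_one]; dsimp only; omega⟩

lemma snd : PolyBdd fun _ m => m := ⟨1, fun N m => by rw [pow_one]; dsimp only; omega⟩

lemma mul (hf : PolyBdd f) (hg : PolyBdd g) : PolyBdd fun N m => f N m * g N m := by
  obtain ⟨a, ha⟩ := hf
  obtain ⟨b, hb⟩ := hg
  exact ⟨a + b, fun N m => by rw [pow_add]; exact Nat.mul_le_mul (ha N m) (hb N m)⟩

lemma add (hf : PolyBdd f) (hg : PolyBdd g) : PolyBdd fun N m => f N m + g N m := by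
  obtain ⟨a, ha⟩ := hf
  obtain ⟨b, hb⟩ := hg
  refine ⟨a + b + 1, fun N m => ?_⟩
  have h1 : (N + m + 2) ^ a ≤ (N + m + 2) ^ (a + b) := Nat.pow_le_pow_right (by omega) (by omega)
  have h2 : (N + m + 2) ^ b ≤ (N + m + 2) ^ (a + b) := Nat.pow_le_pow_right (by omega) (by omega)
  calc f N m + g N m ≤ (N + m + 2) ^ (a + b) * 2 := by have := ha N m; have := hb N m; omega
    _ ≤ (N + m + 2) ^ (a + b) * (N + m + 2) := by gcongr; omega
    _ = _ := (pow_succ _ _).symm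

lemma pow (hf : PolyBdd f) (t : ℕ) : PolyBdd fun N m => f N m ^ t := by
  induction t with
  | zero => simpa using const 1
  | succ t ih => simpa only [pow_succ] using ih.mul hf

end PolyBdd

/-! ### Computing the constants -/

/-- The parameters of the reduction, which depend only on the number `k` of literals in a clause and
on the exponents. The number of digits `e` (in base `2 ^ b`) of a leaf grows by one whenever the
number of variables grows by `2 * q * b`, starting from `e₀`. The nonzero entries of `Q` are
`B₁ * e`. -/
structure Par where
  (q b α k e₀ B₁ : ℕ)

namespace Par

/-- The number of digits for `N` variables. -/
def digits (P : Par) (N : ℕ) : ℕ := P.e₀ + N / (2 * P.q * P.b)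

/-- The number of rows in each half of the matrices. -/
def half (P : Par) (e : ℕ) : ℕ := 2 ^ ((P.q + 1) * P.b * e)

/-- The constants of the environment of the program `FP.mainP`; the number `16` is the number of
rows. The numbers `12` and `13` (the dimensions) are not determined here. The number `2 * q * b * e`
of variables (constant `6`) may exceed the given one: additional variables are irrelevant. -/
def kap (P : Par) (m e : ℕ) : ℕ → ℕ
  | 1 => 4 * P.q * P.b * e + 1
  | 2 => (4 * P.q * P.b * e + 1) * P.α ^ (3 * P.k) + m
  | 3 => (4 * P.q * P.b * e + 1) * P.α ^ (3 * P.k) + 1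
  | 4 => m
  | 5 => P.k
  | 6 => 2 * P.q * P.b * e
  | 7 => e
  | 8 => P.q * P.b * e
  | 9 => 2 ^ (P.q * P.b * e)
  | 10 => 2 ^ (P.b * e)
  | 11 => 2 ^ P.b
  | 14 => P.B₁ * e
  | 15 => P.half e
  | 16 => 2 * P.half e
  | _ => 0

/-- The numbers of the constants that are computed. -/
def computed : List ℕ := [1, 2, 3, 4, 5, 6, 7, 8, 9, 10, 11, 14, 15, 16]

end Par

namespace FP

/-- `v := 2 ^ t * v` -/
def dbl (v t : ℕ) : FP := seqs (fun _ => addv v v v) t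

lemma eval_dbl (E : Env) (v t : ℕ) (s : NState) :
    (dbl v t).eval E s = s.setReg v (2 ^ t * s.reg v) := by
  induction t with
  | zero => ext <;> simp +contextual [dbl, seqs, eval]
  | succ t ih =>
    rw [dbl, seqs, eval_seq, ← dbl, ih]
    ext r
    · simp only [eval, NState.setReg_reg]
      split_ifs
      · ring
      · rfl
    · simp [eval]

/-- The initial values of the constants. -/
def prepInit (P : Par) : FP :=
  const 1 (P.kap 0 P.e₀ 1) ;; const 2 (P.kap 0 P.e₀ 2) ;; addc 2 2 4 ;; const 3 (P.kap 0 P.e₀ 3) ;;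
  setc 4 4 ;; const 5 P.k ;; const 6 (P.kap 0 P.e₀ 6) ;; const 7 P.e₀ ;; const 8 (P.kap 0 P.e₀ 8) ;;
  const 9 (P.kap 0 P.e₀ 9) ;; const 10 (P.kap 0 P.e₀ 10) ;; const 11 (2 ^ P.b) ;;
  const 14 (P.kap 0 P.e₀ 14) ;; const 15 (P.half P.e₀) ;; const 16 (2 * P.half P.e₀) ;; const 31 0

/-- Increase the number of digits by one. -/
def prepTick (P : Par) : FP :=
  addl 1 1 (4 * P.q * P.b) ;; addl 2 2 (4 * P.q * P.b * P.α ^ (3 * P.k)) ;;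
  addl 3 3 (4 * P.q * P.b * P.α ^ (3 * P.k)) ;; addl 6 6 (2 * P.q * P.b) ;; addl 7 7 1 ;;
  addl 8 8 (P.q * P.b) ;; dbl 9 (P.q * P.b) ;; dbl 10 P.b ;; addl 14 14 P.B₁ ;;
  dbl 15 ((P.q + 1) * P.b) ;; dbl 16 ((P.q + 1) * P.b)

/-- Count the variables modulo `2 * q * b`, with one more digit at each overflow. -/
def prepStep (P : Par) : FP :=
  addl 31 31 1 ;; const 32 (2 * P.q * P.b) ;; ite 31 32 skip (const 31 0 ;; prepTick P)

/-- Compute the constants from the number of variables (constant `0`) and the number of clauses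
(constant `4`), in a single loop over the variables. -/
def prepP (P : Par) : FP := prepInit P ;; loop 30 0 (prepStep P)

lemma loopsIn_prepInit (P : Par) : (prepInit P).LoopsIn [] := by simp [prepInit, LoopsIn]

lemma loopsIn_dbl (L : List ℕ) (v t : ℕ) : (dbl v t).LoopsIn L :=
  loopsIn_seqs (p := fun _ => addv v v v)
  (fun _ => trivial) t

lemma loopsIn_prepStep (P : Par) (L : List ℕ) : (prepStep P).LoopsIn L := by
  simp [prepStep, prepTick, LoopsIn, loopsIn_dbl]

lemma wb_dbl (v t : ℕ) : (dbl v t).wb = [] :=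
  List.subset_nil.1 (wb_seqs fun _ => by simp [wb])

lemma wb_prepP (P : Par) : (prepP P).wb = [] := by
  simp [prepP, prepInit, prepStep, prepTick, wb, wb_dbl]

lemma eval_prepTick {P : Par} {E : Env} {s : NState} {m e : ℕ}
    (h : ∀ j ∈ Par.computed, s.reg j = P.kap m e j) :
    (∀ j ∈ Par.computed, ((prepTick P).eval E s).reg j = P.kap m (e + 1) j) ∧
      ((prepTick P).eval E s).reg 31 = s.reg 31 := by
  simp only [Par.computed, List.mem_cons, List.not_mem_nil, or_false, forall_eq_or_imp, forall_eq,
    Par.kap, Par.half] at h ⊢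
  obtain ⟨h1, h2, h3, h4, h5, h6, h7, h8, h9, h10, h11, h14, h15, h16⟩ := h
  simp only [prepTick, eval_seq, eval_dbl]
  simp only [eval, NState.setReg_reg, Nat.reduceEqDiff, if_true, if_false, OfNat.ofNat_ne_one,
    OfNat.one_ne_ofNat, h1, h2, h3, h4, h5, h6, h7, h8, h9, h10, h11, h14, h15, h16, and_true,
    true_and]
  constructorm* _ ∧ _ <;> first | trivial | ring

lemma eval_prepP {P : Par} (hqb : 1 ≤ P.q * P.b) {E : Env} {s : NState} :
    ∀ j ∈ Par.computed, ((prepP P).eval E s).reg j = P.kap (E.κ 4) (P.digits (E.κ 0)) j := by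
  rw [prepP, eval_seq, Par.digits]
  have hpos : 1 ≤ 2 * P.q * P.b := by rw [mul_assoc]; omega
  refine (eval_loop (fun a s' => (∀ j ∈ Par.computed, s'.reg j =
    P.kap (E.κ 4) (P.e₀ + a / (2 * P.q * P.b)) j) ∧ s'.reg 31 = a % (2 * P.q * P.b)) ?_ ?_).1
  · rw [Nat.zero_div, Nat.zero_mod, add_zero]
    refine ⟨?_, by simp [prepInit, eval]⟩
    simp [Par.computed, Par.kap, prepInit, eval]
  · rintro a ha s' ⟨h1, h2⟩
    have h1' : ∀ j ∈ Par.computed, j ≠ 30 ∧ j ≠ 31 ∧ j ≠ 32 := by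
      intro j hj
      simp [Par.computed] at hj
      omega
    by_cases hlt : a % (2 * P.q * P.b) + 1 < 2 * P.q * P.b
    · have e1 : (a + 1) / (2 * P.q * P.b) = a / (2 * P.q * P.b) := by
        rw [Nat.succ_div, if_neg, add_zero]
        intro hd
        have := Nat.mod_eq_zero_of_dvd hd
        rw [Nat.add_mod, Nat.mod_eq_of_lt (a := 1) (by omega), Nat.mod_eq_of_lt hlt] at this
        omega
      have e2 : (a + 1) % (2 * P.q * P.b) = a % (2 * P.q * P.b) + 1 := by
        rw [Nat.add_mod, Nat.mod_eq_of_lt (a := 1) (by omega), Nat.mod_eq_of_lt hlt]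
      rw [e1, e2]
      refine ⟨fun j hj => ?_, by simp [prepStep, eval, h2, hlt]⟩
      obtain ⟨g1, g2, g3⟩ := h1' j hj
      rw [← h1 j hj]
      simp [prepStep, eval, h2, hlt, g1, g2, g3]
    · have h3 : a % (2 * P.q * P.b) + 1 = 2 * P.q * P.b := by
        have := Nat.mod_lt a hpos
        omega
      have hd : 2 * P.q * P.b ∣ a + 1 := by
        rw [Nat.dvd_iff_mod_eq_zero, Nat.add_mod]
        rcases Nat.lt_or_ge 1 (2 * P.q * P.b) with h | h
        · rw [Nat.mod_eq_of_lt h, h3, Nat.mod_self]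
        · rw [show 2 * P.q * P.b = 1 by omega, Nat.mod_one]
      have e1 : (a + 1) / (2 * P.q * P.b) = a / (2 * P.q * P.b) + 1 := by
        rw [Nat.succ_div, if_pos hd]
      rw [e1, Nat.mod_eq_zero_of_dvd hd, ← add_assoc]
      have key := eval_prepTick (P := P) (E := E) (m := E.κ 4) (e := P.e₀ + a / (2 * P.q * P.b))
        (s := (((s'.setReg 30 a).setReg 31 (2 * P.q * P.b)).setReg 32 (2 * P.q * P.b)).setReg 31 0)
        (fun j hj => by
          obtain ⟨g1, g2, g3⟩ := h1' j hj
          rw [← h1 j hj]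
          simp [g1, g2, g3])
      have e3 : (prepStep P).eval E (s'.setReg 30 a) = (prepTick P).eval E
          ((((s'.setReg 30 a).setReg 31 (2 * P.q * P.b)).setReg 32
            (2 * P.q * P.b)).setReg 31 0) := by
        simp [prepStep, eval, h2, h3]
      rw [e3]
      exact ⟨key.1, by rw [key.2]; simp⟩

end FP

/-! ### Copying, and the search for a large entry -/

/-- Copy registers, as a list of pairs of a target and a source. -/
def copies {F : Set (ℝ → ℝ)} : List (ℕ × ℕ) → Prog F
  | [] => .skip
  | (r, s) :: L => .seq (.seq (.const tmpReg 0) (.arith .plus r s tmpReg)) (copies L)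

lemma exec_copies {M : Model} {W : ℕ} {L : List (ℕ × ℕ)}
    (hL : ∀ x ∈ L, x.1 ≠ tmpReg ∧ x.2 ≠ tmpReg ∧ ∀ y ∈ L, x.1 ≠ y.2)
    (hd : (L.map Prod.fst).Nodup) {σ : State} (hσ : ∀ x ∈ L, ∃ v : ℕ, σ.reg x.2 = v ∧ v ≤ W) :
    ∃ τ, ExecN M W (copies L) σ τ (2 * L.length + 1) ∧ τ.bank = σ.bank ∧
      (∀ x ∈ L, τ.reg x.1 = σ.reg x.2) ∧
      ∀ r, r ≠ tmpReg → r ∉ L.map Prod.fst → τ.reg r = σ.reg r := by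
  induction L generalizing σ with
  | nil => exact ⟨σ, .skip, rfl, by simp, fun _ _ _ => rfl⟩
  | cons x L ih =>
    obtain ⟨r, s⟩ := x
    obtain ⟨h1, h2, h3⟩ := hL (r, s) (by simp)
    obtain ⟨v, hv, hvW⟩ := hσ (r, s) (by simp)
    simp only [List.map_cons, List.nodup_cons] at hd
    dsimp only at h1 h2 h3 hv
    have g1 := ExecN.const (M := M) (W := W) (σ := σ) tmpReg 0 (Nat.zero_le W)
    have g2 := ExecN.plus (M := M) (W := W) (σ := σ.setReg tmpReg ((0 : ℕ) : ℝ)) r s tmpReg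
      (x := v) (y := 0) (by simp [h2, hv]) (by simp) (by omega)
    obtain ⟨σ', hσ'⟩ : ∃ σ', σ' = (σ.setReg tmpReg ((0 : ℕ) : ℝ)).setReg r ((v + 0 : ℕ) : ℝ) :=
      ⟨_, rfl⟩
    have e1 : ∀ t, t ≠ tmpReg → t ≠ r → σ'.reg t = σ.reg t := fun t ht htr => by
      rw [hσ', State.setReg_reg, if_neg htr, State.setReg_reg, if_neg ht]
    have e2 : ∀ y ∈ L, σ'.reg y.2 = σ.reg y.2 := fun y hy =>
      e1 _ (hL y (by simp [hy])).2.1 (h3 y (by simp [hy])).symm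
    obtain ⟨τ, g3, b3, k3, f3⟩ := ih (σ := σ')
      (fun y hy => ⟨(hL y (by simp [hy])).1, (hL y (by simp [hy])).2.1, fun z hz =>
        (hL y (by simp [hy])).2.2 z (by simp [hz])⟩) hd.2
      (fun y hy => by rw [e2 y hy]; exact hσ y (by simp [hy]))
    rw [← hσ'] at g2
    refine ⟨τ, ((g1.seq g2).seq g3).mono (by simp; omega), ?_, ?_, ?_⟩
    · rw [b3, hσ']; rfl
    · intro y hy
      rcases List.mem_cons.1 hy with rfl | hy
      · rw [f3 _ h1 hd.1, hσ']
        simp [hv]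
      · rw [k3 y hy, e2 y hy]
    · intro t ht htL
      simp only [List.map_cons, List.mem_cons, not_or] at htL
      rw [f3 t ht htL.2, e1 t ht htL.1]

/-- A loop with a counter, whose rounds may have different costs. -/
lemma exec_loop {M : Model} {r s N : ℕ} {p : Prog M.ops} (P : ℕ → State → Prop) (cost : ℕ → ℕ)
    (hP : ∀ a σ, P a σ → σ.reg r = (a : ℕ) ∧ σ.reg s = (N : ℕ))
    (hs : ∀ a < N, ∀ σ, P a σ → ∃ τ c, Exec M p σ τ c ∧ c ≤ cost a ∧ P (a + 1) τ) (j : ℕ) :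
    ∀ a, a + j = N → ∀ σ, P a σ → ∃ τ c, Exec M (.loop r s p) σ τ c ∧
      c ≤ ∑ i ∈ Finset.Ico a N, (1 + 2 * M.bits N + cost i) + (1 + 2 * M.bits N) ∧ P N τ := by
  induction j with
  | zero =>
    rintro a rfl σ h
    obtain ⟨h1, h2⟩ := hP _ _ h
    refine ⟨σ, _, .loopFalse (by rw [h1, h2]; simp), ?_, h⟩
    rw [h1, h2]
    simp only [Model.size_natCast, add_zero, Finset.Ico_self, Finset.sum_empty]
    omega
  | succ j ih =>
    intro a ha σ h
    obtain ⟨h1, h2⟩ := hP _ _ h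
    obtain ⟨τ, c, h3, h4, h5⟩ := hs a (by omega) σ h
    obtain ⟨υ, c', h6, h7, h8⟩ := ih (a + 1) (by omega) τ h5
    refine ⟨υ, _, .loopTrue (by rw [h1, h2]; exact_mod_cast (by omega : a < N)) h3 h6, ?_, h8⟩
    rw [Finset.sum_eq_sum_Ico_succ_bot (by omega : a < N), h1, h2]
    simp only [Model.size_natCast]
    have := M.bits_mono (by omega : a ≤ N)
    omega

/-- Search the first column of a matrix, in the first half of its rows, for an entry that is not
below the threshold in register `41`. -/
def scanBody {F : Set (ℝ → ℝ)} : Prog F :=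
  .seq (.load 40 57 25) <| .seq (.branch 57 41 .skip (.const 0 1)) <|
  .seq (.arith .plus 9 9 73) (.arith .plus 25 25 (cstReg 13))

/-- Is some entry at least `1 / (C * n)`? -/
def scanP {F : Set (ℝ → ℝ)} (C : ℕ) : Prog F :=
  .seq (.const 73 (1 : ℕ)) <| .seq (.const 41 C) <| .seq (.arith .times 41 41 (cstReg 16)) <|
  .seq (.arith .divide 41 73 41) <| .seq (.const 9 (0 : ℕ)) <| .seq (.const 25 (0 : ℕ)) <|
  .seq (.const 0 (0 : ℕ)) (.loop 9 (cstReg 15) scanBody)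

lemma exec_scanP {M : Model} {C half w n W : ℕ} {σ : State} (h15 : σ.reg (cstReg 15) = half)
    (h13 : σ.reg (cstReg 13) = w) (h16 : σ.reg (cstReg 16) = n) (hn : 1 ≤ n) (hC : 1 ≤ C)
    (hW1 : half + 1 ≤ W) (hW2 : half * w + w ≤ W) (hW3 : n * C ≤ W) :
    ∃ τ c, Exec M (scanP C) σ τ c ∧
      c ≤ (6 * half + 8) * (1 + 3 * M.bits W) +
        2 * ∑ i ∈ Finset.range half, M.size (σ.bank 40 (i * w)) ∧
      ((∃ i < half, 1 / ((n : ℝ) * C) ≤ σ.bank 40 (i * w)) → τ.reg 0 = 1) ∧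
      ((¬ ∃ i < half, 1 / ((n : ℝ) * C) ≤ σ.bank 40 (i * w)) → τ.reg 0 = 0) := by
  simp only [cstReg, Nat.reduceMul, Nat.reduceAdd] at h15 h13 h16
  have hCn : C * n ≤ W := by rw [mul_comm]; exact hW3
  have hnC : n ≤ n * C := Nat.le_mul_of_pos_right _ hC
  have hCC : C ≤ n * C := Nat.le_mul_of_pos_left _ hn
  have hpos : 1 ≤ C * n := Nat.mul_pos hC hn
  -- the initialization
  have g1 := ExecN.const (M := M) (W := W) (σ := σ) 73 1 (by omega)
  obtain ⟨σ1, e1⟩ : ∃ σ1, σ1 = σ.setReg 73 ((1 : ℕ) : ℝ) := ⟨_, rfl⟩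
  have g2 := ExecN.const (M := M) (W := W) (σ := σ1) 41 C (by omega)
  obtain ⟨σ2, e2⟩ : ∃ σ2, σ2 = σ1.setReg 41 (C : ℝ) := ⟨_, rfl⟩
  have g3 := ExecN.times (M := M) (W := W) (σ := σ2) 41 41 (cstReg 16) (x := C) (y := n)
    (by simp [e2]) (by simp [cstReg, e1, e2, h16]) (by omega) (by omega) hCn
  obtain ⟨σ3, e3⟩ : ∃ σ3, σ3 = σ2.setReg 41 ((C * n : ℕ) : ℝ) := ⟨_, rfl⟩
  have hx3 : σ3.reg 41 = ((C * n : ℕ) : ℝ) := by simp [e3]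
  have hx3' : σ3.reg 73 = ((1 : ℕ) : ℝ) := by simp [e3, e2, e1]
  have g4 : ExecN M W (.arith .divide 41 73 41) σ3 (σ3.setReg 41 (1 / ((C * n : ℕ) : ℝ))) 1 := by
    refine ⟨_, .arith σ3 .divide 41 73 41 _ (fun _ => ?_) ?_, ?_⟩
    · rw [hx3]
      exact_mod_cast (by omega : C * n ≠ 0)
    · rw [hx3, hx3', Arith.eval, Nat.cast_one]
    · rw [hx3, hx3', Model.size_one_div _ _ hpos, Model.size_natCast, Model.size_natCast]
      have := M.bits_mono hCn
      have := M.bits_mono (by omega : 1 ≤ W)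
      omega
  obtain ⟨σ4, e4⟩ : ∃ σ4, σ4 = σ3.setReg 41 (1 / ((C * n : ℕ) : ℝ)) := ⟨_, rfl⟩
  have g5 := ExecN.const (M := M) (W := W) (σ := σ4) 9 0 (by omega)
  obtain ⟨σ5, e5⟩ : ∃ σ5, σ5 = σ4.setReg 9 ((0 : ℕ) : ℝ) := ⟨_, rfl⟩
  have g6 := ExecN.const (M := M) (W := W) (σ := σ5) 25 0 (by omega)
  obtain ⟨σ6, e6⟩ : ∃ σ6, σ6 = σ5.setReg 25 ((0 : ℕ) : ℝ) := ⟨_, rfl⟩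
  have g7 := ExecN.const (M := M) (W := W) (σ := σ6) 0 0 (by omega)
  obtain ⟨σ7, e7⟩ : ∃ σ7, σ7 = σ6.setReg 0 ((0 : ℕ) : ℝ) := ⟨_, rfl⟩
  rw [← e1] at g1; rw [← e2] at g2; rw [← e3] at g3; rw [← e4] at g4; rw [← e5] at g5
  rw [← e6] at g6; rw [← e7] at g7
  -- the loop
  obtain ⟨y, hy⟩ : ∃ y : ℕ → ℝ, y = fun i => σ.bank 40 (i * w) := ⟨_, rfl⟩
  have key := exec_loop (M := M) (r := 9) (s := cstReg 15) (N := half) (p := scanBody)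
    (fun a σ' => σ'.reg 9 = a ∧ σ'.reg (cstReg 15) = half ∧ σ'.bank = σ.bank ∧
      σ'.reg 25 = (a * w : ℕ) ∧ σ'.reg 73 = (1 : ℕ) ∧ σ'.reg (cstReg 13) = w ∧
      σ'.reg 41 = 1 / ((C * n : ℕ) : ℝ) ∧
      ((∃ i < a, 1 / ((n : ℝ) * C) ≤ y i) → σ'.reg 0 = 1) ∧
      ((¬ ∃ i < a, 1 / ((n : ℝ) * C) ≤ y i) → σ'.reg 0 = 0))
    (fun a => 5 + 9 * M.bits W + 2 * M.size (y a)) (fun a σ' h => ⟨h.1, h.2.1⟩) (by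
      rintro a ha υ ⟨k1, k2, k3, k4, k5, k6, k7, k8, k9⟩
      simp only [cstReg, Nat.reduceMul, Nat.reduceAdd] at k2 k6
      have haw : a * w + w ≤ W := by
        have : a * w ≤ half * w := Nat.mul_le_mul_right _ ha.le
        omega
      have f1 := Exec.load (M := M) υ 40 57 25 (a * w) k4
      have hya : υ.bank 40 (a * w) = y a := by rw [k3, hy]
      rw [hya, k4] at f1
      obtain ⟨υ1, d1⟩ : ∃ υ1, υ1 = υ.setReg 57 (y a) := ⟨_, rfl⟩
      rw [← d1] at f1
      have w1 := M.bits_mono (by omega : a * w ≤ W)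
      have w2 := M.bits_mono (by omega : 1 ≤ W)
      have w3 := M.bits_mono hCn
      have hθ : (1 : ℝ) / ((C * n : ℕ) : ℝ) = 1 / ((n : ℝ) * C) := by push_cast; rw [mul_comm]
      have hex : (∃ i < a + 1, 1 / ((n : ℝ) * C) ≤ y i) ↔
          (∃ i < a, 1 / ((n : ℝ) * C) ≤ y i) ∨ 1 / ((n : ℝ) * C) ≤ y a := by
        simp only [Nat.lt_succ_iff_lt_or_eq, or_and_right, exists_or, exists_eq_left]
      obtain ⟨υ2, c2, f2, hc2, b2, r2, v2, v2'⟩ : ∃ υ2 c2, Exec M (.branch 57 41 .skip (.const 0 1))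
          υ1 υ2 c2 ∧ c2 ≤ 2 + M.size (y a) + 2 * M.bits W ∧ υ2.bank = υ.bank ∧
          (∀ r, r ≠ 0 → υ2.reg r = υ1.reg r) ∧
          ((∃ i < a + 1, 1 / ((n : ℝ) * C) ≤ y i) → υ2.reg 0 = 1) ∧
          ((¬ ∃ i < a + 1, 1 / ((n : ℝ) * C) ≤ y i) → υ2.reg 0 = 0) := by
        have h57 : υ1.reg 57 = y a := by simp [d1]
        have h41 : υ1.reg 41 = 1 / ((C * n : ℕ) : ℝ) := by simp [d1, k7]
        have h0 : υ1.reg 0 = υ.reg 0 := by simp [d1]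
        simp only [hex]
        by_cases hlt : y a < 1 / ((n : ℝ) * C)
        · have := Exec.branchTrue (M := M) (r := 57) (s := 41) (σ := υ1) (q := .const 0 1)
            (by rw [h57, h41, hθ]; exact hlt) (.skip υ1)
          rw [h57, h41, Model.size_one_div _ _ hpos] at this
          refine ⟨_, _, this, by omega, by rw [d1]; rfl, fun _ _ => rfl, ?_, ?_⟩
          · rw [or_iff_left (not_le.2 hlt), h0]; exact k8
          · rw [or_iff_left (not_le.2 hlt), h0]; exact k9
        · have := Exec.branchFalse (M := M) (r := 57) (s := 41) (σ := υ1) (p := .skip)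
            (by rw [h57, h41, hθ]; exact hlt) (.const υ1 0 1)
          rw [h57, h41, Model.size_one_div _ _ hpos, Model.size_intCast, Int.natAbs_one] at this
          refine ⟨_, _, this, by omega, by rw [d1]; rfl, fun r hr => by simp [hr], ?_, ?_⟩
          · intro _; simp
          · intro h; exact absurd (Or.inr (not_lt.1 hlt)) h
      have r2' : ∀ r, r ≠ 0 → r ≠ 57 → υ2.reg r = υ.reg r := fun r h0 h1 => by
        rw [r2 r h0, d1, State.setReg_reg, if_neg h1]
      obtain ⟨c3, f3, hc3⟩ := ExecN.plus (M := M) (W := W) (σ := υ2) 9 9 73 (x := a) (y := 1)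
        (by rw [r2' 9 (by simp) (by simp), k1]) (by rw [r2' 73 (by simp) (by simp), k5]) (by omega)
      obtain ⟨υ3, d3⟩ : ∃ υ3, υ3 = υ2.setReg 9 ((a + 1 : ℕ) : ℝ) := ⟨_, rfl⟩
      rw [← d3] at f3
      obtain ⟨c4, f4, hc4⟩ := ExecN.plus (M := M) (W := W) (σ := υ3) 25 25 (cstReg 13)
        (x := a * w) (y := w) (by rw [d3]; simp [r2' 25, k4])
        (by rw [d3]; simp [cstReg, r2' 212, k6]) haw
      refine ⟨_, _, f1.seq (f2.seq (f3.seq f4)), ?_, ?_⟩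
      · simp only [Model.size_natCast]
        omega
      · simp only [cstReg, Nat.reduceMul, Nat.reduceAdd]
        refine ⟨by simp [d3], by simp [d3, r2' 244, k2], ?_, by simp [add_mul],
          by simp [d3, r2' 73, k5], by simp [d3, r2' 212, k6], by simp [d3, r2' 41, k7], ?_, ?_⟩
        · rw [State.setReg_bank, d3, State.setReg_bank, b2, k3]
        · intro h; simpa [d3] using v2 h
        · intro h; simpa [d3] using v2' h) half 0 (by omega) σ7
    ⟨by simp [e7, e6, e5], by simp [cstReg, e7, e6, e5, e4, e3, e2, e1, h15],
      by rw [e7, e6, e5, e4, e3, e2, e1]; rfl, by simp [e7, e6],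
      by simp [e7, e6, e5, e4, e3, e2, e1], by simp [cstReg, e7, e6, e5, e4, e3, e2, e1, h13],
      by simp [e7, e6, e5, e4], by simp, by simp [e7]⟩
  obtain ⟨τ, c, hc, hle, -, -, -, -, -, -, -, hτ⟩ := key
  obtain ⟨c1, f1, hc1⟩ := g1
  obtain ⟨c2, f2, hc2⟩ := g2
  obtain ⟨c3, f3, hc3⟩ := g3
  obtain ⟨c4, f4, hc4⟩ := g4
  obtain ⟨c5, f5, hc5⟩ := g5
  obtain ⟨c6, f6, hc6⟩ := g6
  obtain ⟨c7, f7, hc7⟩ := g7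
  refine ⟨τ, _, f1.seq (f2.seq (f3.seq (f4.seq (f5.seq (f6.seq (f7.seq hc)))))), ?_, ?_⟩
  · have hw := M.bits_mono (by omega : half ≤ W)
    have hsum : ∑ i ∈ Finset.Ico 0 half, (1 + 2 * M.bits half + (5 + 9 * M.bits W +
        2 * M.size (y i)))
        ≤ half * (6 * (1 + 3 * M.bits W)) + 2 * ∑ i ∈ Finset.range half, M.size (y i) := by
      rw [← Finset.range_eq_Ico, Finset.mul_sum]
      calc _ ≤ ∑ i ∈ Finset.range half, (6 * (1 + 3 * M.bits W) + 2 * M.size (y i)) :=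
            Finset.sum_le_sum fun i _ => by omega
        _ = _ := by rw [Finset.sum_add_distrib]; simp
    rw [hy] at hsum
    rw [hy] at hle
    have e : (6 * half + 8) * (1 + 3 * M.bits W) =
      half * (6 * (1 + 3 * M.bits W)) + 8 * (1 + 3 * M.bits W) := by ring
    rw [e]
    dsimp only at hle hsum
    omega
  · rwa [hy] at hτ

/-! ### Inputs in memory -/

lemma flatten_apply {n d : ℕ} (A : Matrix (Fin n) (Fin d) ℝ) (i : Fin n) (j : Fin d) :
    flatten A (i * d + j) = A i j := by
  have h := (finProdFinEquiv (i, j)).2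
  have e : ((finProdFinEquiv (i, j) : Fin (n * d)) : ℕ) = i * d + j := by
    rw [finProdFinEquiv_apply_val]; ring
  rw [e] at h
  have e' : (⟨i * d + j, h⟩ : Fin (n * d)) = finProdFinEquiv (i, j) := Fin.ext e.symm
  rw [flatten, dif_pos h, e', Equiv.symm_apply_apply]

lemma flatten_eq {n d : ℕ} {A : Matrix (Fin n) (Fin d) ℝ} {f : ℕ → ℝ}
    (h : ∀ (i : Fin n) (j : Fin d), f (i * d + j) = A i j) (h' : ∀ a, n * d ≤ a → f a = 0) :
    flatten A = f := by
  funext a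
  by_cases ha : a < n * d
  · obtain ⟨⟨i, j⟩, hij⟩ := finProdFinEquiv.surjective (⟨a, ha⟩ : Fin (n * d))
    have e : a = i * d + j := by
      have := congrArg Fin.val hij
      rw [finProdFinEquiv_apply_val] at this
      exact (by rw [← show (j : ℕ) + d * i = a from this]; ring)
    rw [e, flatten_apply, h]
  · rw [flatten, dif_neg ha, h' a (not_lt.1 ha)]

/-- The code of a literal, as an integer. -/
def litInt {n : ℕ} : Option (Fin n × Bool) → ℤ
  | none => 0
  | some (v, true) => (v : ℕ) + 1
  | some (v, false) => -((v : ℕ) + 1)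

lemma litCode_eq {n : ℕ} (l : Option (Fin n × Bool)) : litCode l = litInt l := by
  rcases l with _ | ⟨v, _ | _⟩ <;> simp [litCode, litInt]

/-- The cells of bank `0` of the input for a formula. -/
def satCode {k n m : ℕ} (φ : KCNF k n m) (a : ℕ) : ℤ :=
  if h : a < m * k then litInt (φ (finProdFinEquiv.symm ⟨a, h⟩).1 (finProdFinEquiv.symm ⟨a, h⟩).2)
  else 0

lemma satInput_bank_zero {k n m : ℕ} (φ : KCNF k n m) (a : ℕ) :
    (satInput φ).bank 0 a = satCode φ a := by
  simp only [satInput, flatten, satCode, Matrix.of_apply]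
  split_ifs
  · exact litCode_eq _
  · simp

lemma satCode_apply {k n m : ℕ} (φ : KCNF k n m) (i : Fin m) (j : Fin k) :
    satCode φ (i * k + j) = litInt (φ i j) := by
  have h := flatten_apply (Matrix.of fun i j => litCode (φ i j)) i j
  have h' : ((satCode φ (i * k + j) : ℤ) : ℝ) = litInt (φ i j) := by
    rw [← satInput_bank_zero, ← litCode_eq]
    exact h
  exact_mod_cast h'

lemma natAbs_satCode_le {k n m : ℕ} (φ : KCNF k n m) (a : ℕ) : (satCode φ a).natAbs ≤ n := by
  rw [satCode]
  split_ifs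
  · rcases φ (finProdFinEquiv.symm ⟨a, _⟩).1 (finProdFinEquiv.symm ⟨a, _⟩).2 with _ | ⟨v, _ | _⟩ <;>
      simp only [litInt] <;> omega
  · simp

/-- An environment with the formula as input is solvable if and only if the formula is
satisfiable. -/
lemma exists_solves_iff {k N m : ℕ} (φ : KCNF k N m) {E : Env} (hm : E.κ 4 = m) (hk : E.κ 5 = k)
    (h1 : E.κ 1 = 2 * E.κ 6 + 1) (h6 : N ≤ E.κ 6) (hι : E.ι = satCode φ) :
    (∃ β, FP.Solves E β) ↔ φ.Satisfiable := by
  constructor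
  · rintro ⟨β, hβ⟩
    refine ⟨fun v => β v, fun i => ?_⟩
    obtain ⟨l, hl, hl'⟩ := hβ i (by omega)
    simp only [FP.clauseSet, Finset.mem_filter, hι, hk] at hl
    obtain ⟨-, j, hj, hl⟩ := hl
    simp only [FP.trueLits, Finset.mem_image, Finset.mem_range] at hl'
    obtain ⟨v', hv', hl'⟩ := hl'
    rw [show j = ((⟨j, hj⟩ : Fin k) : ℕ) from rfl, satCode_apply] at hl
    refine ⟨⟨j, hj⟩, ?_⟩
    rcases h : φ i ⟨j, hj⟩ with _ | ⟨v, b⟩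
    · simp [h, litInt] at hl
    · refine ⟨(v, b), rfl, ?_⟩
      have hv := v.2
      rw [h] at hl
      cases b <;> simp only [litInt] at hl
      · obtain rfl : v' = v := by split_ifs at hl' <;> omega
        by_contra hb
        rw [if_pos (by simpa using hb)] at hl'
        omega
      · obtain rfl : v' = v := by split_ifs at hl' <;> omega
        by_contra hb
        rw [if_neg hb] at hl'
        omega
  · rintro ⟨a, ha⟩
    refine ⟨fun v => if h : v < N then a ⟨v, h⟩ else false, fun i hi => ?_⟩
    obtain ⟨j, ⟨v, b⟩, h, hab⟩ := ha ⟨i, by omega⟩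
    have hv := v.2
    have hc := satCode_apply φ ⟨i, by omega⟩ j
    rw [h] at hc
    dsimp only at hc hab
    refine ⟨if b then v + 1 else v + 1 + E.κ 6, ?_, ?_⟩
    · simp only [FP.clauseSet, Finset.mem_filter, hι, hk, Finset.mem_range]
      refine ⟨by split_ifs <;> omega, j, j.2, ?_⟩
      rw [hc]
      cases b <;> simp only [litInt]
      · exact .inr ⟨by omega, by simp⟩
      · exact .inl ⟨by omega, by simp⟩
    · simp only [FP.trueLits, Finset.mem_image, Finset.mem_range]
      exact ⟨v, by omega, by simp [hab]⟩

/-! ### Composition of the programs -/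

lemma Keeps.reg {σ τ : State} (h : Keeps 0 σ τ) {r : ℕ} (hr : r % 16 ≠ 2 ∧ r % 16 ≠ 3 ∧
    r % 16 ≠ 5) :
    τ.reg r = σ.reg r :=
  h.1 r ⟨fun v => by unfold varReg; omega, fun δ _ => by unfold ctrReg; omega,
    by unfold tmpReg; omega, by unfold tmpReg'; omega⟩

lemma Keeps.bank' {σ τ : State} (h : Keeps 0 σ τ) {b : ℕ} (hb : b % 16 ≠ 2 ∧ b ≠ 8 ∧ b ≠ 24) :
    τ.bank b = σ.bank b :=
  h.2 b fun b' => by unfold bankOf; split_ifs <;> omega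

/-- The environment in which the constants are computed. -/
def prepEnv {k N m : ℕ} (φ : KCNF k N m) : Env :=
  ⟨fun j => if j = 0 then N else if j = 4 then m else 0, satCode φ⟩

/-- Compute the constants, and copy the number of rows to where the programs for the dimensions
expect it. -/
def frontP {F : Set (ℝ → ℝ)} (P : Par) : Prog F :=
  .seq (copies [(cstReg 0, 0), (cstReg 4, 1)]) <| .seq ((FP.prepP P).compile 0) <|
    copies [(6, varReg 16), (7, varReg 16)]

/-- The state after the computation of the constants. -/
structure Front (P : Par) {N m : ℕ} (φ : KCNF P.k N m) (s : NState) (σ : State) : Prop where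
  computed : ∀ j ∈ Par.computed, s.reg j = P.kap m (P.digits N) j
  zero : ∀ b i, s.bank b i = 0
  var : ∀ v, σ.reg (varReg v) = s.reg v
  c0 : σ.reg 4 = N
  r6 : σ.reg 6 = s.reg 16
  r7 : σ.reg 7 = s.reg 16
  reg : ∀ r, r % 16 ≠ 2 ∧ r % 16 ≠ 3 ∧ r % 16 ≠ 5 ∧ r ≠ 0 ∧ r ≠ 1 ∧ r ≠ 4 ∧ r ≠ 68 ∧ r ≠ 6 ∧ r ≠ 7 →
    σ.reg r = 0
  bank0 : ∀ i, σ.bank 0 i = satCode φ i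
  bank : ∀ b, b ≠ 0 → σ.bank b = fun _ => 0

/-- The constants are computed in polynomial time. -/
lemma exec_frontP (M : Model) (P : Par) (hqb : 1 ≤ P.q * P.b) : ∃ f, PolyBdd f ∧
    ∀ {N m : ℕ} (φ : KCNF P.k N m), ∃ s σ c X, Exec M (frontP P) (satInput φ) σ c ∧
      Front P φ s σ ∧ c ≤ f N m ∧ s.BddBy X ∧ M.bits X ≤ f N m := by
  obtain ⟨a, ha⟩ := FP.LoopsIn.exists_steps_le (p := FP.prepP P) (L := [0])
    ⟨by simp [FP.prepInit, FP.LoopsIn], by simp, FP.loopsIn_prepStep P _⟩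
  obtain ⟨A0, hA0⟩ : ∃ A0, ∀ E, (FP.prepInit P).adds E = A0 :=
    ⟨_, fun E => (FP.loopsIn_prepInit P).adds_eq E ⟨fun _ => 0, fun _ => 0⟩⟩
  obtain ⟨A1, hA1⟩ : ∃ A1, ∀ E, (FP.prepStep P).adds E = A1 :=
    ⟨_, fun E => (FP.loopsIn_prepStep P []).adds_eq E ⟨fun _ => 0, fun _ => 0⟩⟩
  let D : ℕ → ℕ → ℕ := fun N m => (FP.prepP P).maxLit + N + m + 1
  let B : ℕ → ℕ → ℕ := fun N m => (A0 + N * A1 + 2) + (D N m * (N + 2) ^ a + 2) + (D N m + 2)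
  have hD : PolyBdd D := (((PolyBdd.const _).add .fst).add .snd).add (.const 1)
  have hB : PolyBdd B := ((((PolyBdd.const _).add (PolyBdd.fst.mul (.const _))).add (.const 2)).add
    ((hD.mul ((PolyBdd.fst.add (.const 2)).pow a)).add (.const 2))).add (hD.add (.const 2))
  refine ⟨fun N m => 5 * (1 + 3 * (N + m + 2)) + 6 * (N + 2) ^ a * (1 + 3 * (3 * B N m)) +
    5 * (1 + 3 * B N m) + B N m, ?_, fun {N m} φ => ?_⟩
  · exact ((((PolyBdd.const 5).mul ((PolyBdd.const 1).add ((PolyBdd.const 3).mul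
      ((PolyBdd.fst.add .snd).add (.const 2))))).add
      (((PolyBdd.const 6).mul ((PolyBdd.fst.add (.const 2)).pow a)).mul
      ((PolyBdd.const 1).add ((PolyBdd.const 3).mul ((PolyBdd.const 3).mul hB))))).add
      ((PolyBdd.const 5).mul ((PolyBdd.const 1).add ((PolyBdd.const 3).mul hB)))).add hB
  obtain ⟨σ1, ⟨c1, x1, hc1⟩, b1, k1, f1⟩ := exec_copies (M := M) (W := N + m)
    (L := [(cstReg 0, 0), (cstReg 4, 1)]) (by decide) (by decide) (σ := satInput φ)
    (by
      intro x hx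
      simp only [List.mem_cons, List.not_mem_nil, or_false] at hx
      rcases hx with rfl | rfl
      exacts [⟨N, rfl, by omega⟩, ⟨m, rfl, by omega⟩])
  have z : ∀ r, r ≠ 0 → r ≠ 1 → (satInput φ).reg r = 0 := by
    rintro (_ | _ | r) h0 h1
    exacts [absurd rfl h0, absurd rfl h1, rfl]
  have q0 : σ1.reg 4 = N := k1 (cstReg 0, 0) (by simp)
  have q4 : σ1.reg 68 = m := k1 (cstReg 4, 1) (by simp)
  have q : ∀ r, r ≠ 0 → r ≠ 1 → r ≠ 4 → r ≠ 5 → r ≠ 68 → σ1.reg r = 0 := fun r g0 g1 g4 g5 g68 => by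
    rw [f1 r g5 (by simp [cstReg]; omega), z r g0 g1]
  have hrep : Represents (prepEnv φ) σ1 ⟨fun _ => 0, fun _ _ => 0⟩ := by
    refine ⟨fun v => ?_, fun j => ?_, fun b i => ?_, fun i => ?_⟩
    · rw [q] <;> first | (unfold varReg; omega) | simp
    · by_cases h0 : j = 0
      · subst h0; simp [prepEnv, cstReg, q0]
      · by_cases h4 : j = 4
        · subst h4; simp [prepEnv, cstReg, q4]
        · rw [q] <;> first | (unfold cstReg; omega) | simp [prepEnv, h0, h4]
    · rw [b1]
      have : bankOf b ≠ 0 := by unfold bankOf; split_ifs <;> omega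
      obtain ⟨b', hb'⟩ := Nat.exists_eq_succ_of_ne_zero this
      rw [hb']
      simp [satInput]
    · rw [b1, satInput_bank_zero]; rfl
  have hE : (prepEnv φ).BddBy (D N m) := by
    refine ⟨fun j => ?_, fun i => ?_⟩
    · simp only [prepEnv, D]
      split_ifs <;> omega
    · have := natAbs_satCode_le φ i
      simp only [prepEnv, D]
      omega
  have hst : (FP.prepP P).steps (prepEnv φ) ≤ (N + 2) ^ a :=
    ha _ (N + 2) (by omega) (by simp [prepEnv])
  have had : (FP.prepP P).adds (prepEnv φ) = A0 + N * A1 := by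
    rw [FP.prepP, FP.adds, FP.adds, hA0, hA1]; rfl
  obtain ⟨Z, hZ⟩ : ∃ Z, Z = 2 ^ (A0 + N * A1) * (D N m * (N + 2) ^ a) + D N m := ⟨_, rfl⟩
  have hD1 : 1 ≤ D N m := by simp [D]
  have hle : 2 ^ (FP.prepP P).adds (prepEnv φ) *
      (0 + D N m * (FP.prepP P).steps (prepEnv φ)) ≤ Z := by
    rw [had, zero_add, hZ]
    exact (Nat.mul_le_mul_left _ (Nat.mul_le_mul_left _ hst)).trans (Nat.le_add_right _ _)
  have hlit : (FP.prepP P).LitLe (D N m) := FP.litLe_of_maxLit_le (by simp only [D]; omega)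
  have h0 : NState.BddBy ⟨fun _ => 0, fun _ _ => 0⟩ 0 := ⟨fun _ => le_rfl, fun _ _ => le_rfl⟩
  obtain ⟨σ2, ⟨c2, x2, hc2⟩, r2, k2⟩ := FP.exec_compile (M := M) hE
    (by omega) (by omega : D N m ≤ Z)
    hlit 0 h0 hle hrep
  obtain ⟨s, hs⟩ : ∃ s, s = (FP.prepP P).eval (prepEnv φ) ⟨fun _ => 0, fun _ _ => 0⟩ := ⟨_, rfl⟩
  have hbd : s.BddBy Z := by rw [hs]; exact (FP.bddBy_eval hE hlit h0).mono hle
  rw [← hs] at r2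
  obtain ⟨σ3, ⟨c3, x3, hc3⟩, b3, k3, f3⟩ := exec_copies (M := M) (W := Z)
    (L := [(6, varReg 16), (7, varReg 16)]) (by decide) (by decide) (σ := σ2)
    (by
      intro x hx
      have : ∃ v : ℕ, σ2.reg (varReg 16) = v ∧ v ≤ Z := ⟨_, r2.var 16, hbd.1 16⟩
      simp only [List.mem_cons, List.not_mem_nil, or_false] at hx
      rcases hx with rfl | rfl <;> exact this)
  have f3' : ∀ r, r ≠ 5 → r ≠ 6 → r ≠ 7 → σ3.reg r = σ2.reg r := fun r g5 g6 g7 =>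
    f3 r g5 (by simp [g6, g7])
  have hbZ : M.bits Z ≤ B N m := by
    rw [hZ]
    have e1 := M.bits_add (2 ^ (A0 + N * A1) * (D N m * (N + 2) ^ a)) (D N m)
    have e2 := M.bits_mul (2 ^ (A0 + N * A1)) (D N m * (N + 2) ^ a)
    have e3 := M.bits_two_pow (A0 + N * A1)
    have e4 := M.bits_le (D N m * (N + 2) ^ a)
    have e5 := M.bits_le (D N m)
    simp only [B]
    omega
  have hbank : ∀ b i, s.bank b i = 0 := fun b i => by
    rw [hs, FP.eval_bank (by simp [FP.wb_prepP])]
  refine ⟨s, σ3, _, Z, x1.seq (x2.seq x3), ?_, ?_, hbd, ?_⟩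
  · refine ⟨?_, hbank, fun v => ?_, ?_, ?_, ?_, fun r hr => ?_, fun i => ?_, fun b hb => ?_⟩
    · intro j hj
      rw [hs, FP.eval_prepP hqb j hj]
      rfl
    · rw [f3' _ (by unfold varReg; omega) (by unfold varReg; omega) (by unfold varReg; omega),
      r2.var]
    · rw [f3' 4 (by simp) (by simp) (by simp), k2.reg (by simp), q0]
    · rw [k3 (6, varReg 16) (by simp), r2.var]
    · rw [k3 (7, varReg 16) (by simp), r2.var]
    · rw [f3' r (by omega) (by omega) (by omega), k2.reg (by omega), q] <;> omega
    · rw [b3, r2.inp]; rfl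
    · rw [b3]
      by_cases hb2 : ∃ b', b = bankOf b'
      · obtain ⟨b', rfl⟩ := hb2
        funext i
        rw [r2.bank, hbank, Nat.cast_zero]
      · rw [k2.2 b (not_exists.1 hb2), b1]
        obtain ⟨b', rfl⟩ := Nat.exists_eq_succ_of_ne_zero hb
        rfl
  · have e1 := M.bits_le (N + m)
    have e2 : M.bits (Z * Z + Z) ≤ 3 * B N m := by
      have := M.bits_add (Z * Z) Z
      have := M.bits_mul Z Z
      omega
    have e3 : c2 ≤ 6 * (N + 2) ^ a * (1 + 3 * (3 * B N m)) := by
      refine hc2.trans (Nat.mul_le_mul (Nat.mul_le_mul_left _ hst) (by omega))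
    simp only [List.length_cons, List.length_nil] at hc1 hc3
    have e4 : c1 ≤ 5 * (1 + 3 * (N + m + 2)) := hc1.trans (Nat.mul_le_mul_left _ (by omega))
    have e5 : c3 ≤ 5 * (1 + 3 * B N m) := hc3.trans (Nat.mul_le_mul_left _ (by omega))
    dsimp only
    omega
  · dsimp only
    omega

/-! ### The parameters and the matrices -/

/-- Class `i` of registers or banks. -/
def cls (i r : ℕ) : ℕ := 16 * r + i

lemma cls_injective (i : ℕ) : (cls i).Injective := fun a b h => by unfold cls at h; omega

lemma AgreeOff.reg {i : ℕ} (hi : i < 16) {σ τ : State} (h : AgreeOff (cls i) (cls i) σ τ) {r : ℕ}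
    (hr : r % 16 ≠ i) : τ.reg r = σ.reg r :=
  h.1 r fun ⟨x, hx⟩ => hr (by rw [← hx, cls]; omega)

lemma AgreeOff.bank {i : ℕ} (hi : i < 16) {σ τ : State} (h : AgreeOff (cls i) (cls i) σ τ) {b : ℕ}
    (hb : b % 16 ≠ i) : τ.bank b = σ.bank b :=
  h.2 b fun ⟨x, hx⟩ => hb (by rw [← hx, cls]; omega)

namespace Par

/-- What the parameters have to satisfy for the reduction to be correct. -/
structure Good (P : Par) : Prop where
  hq : 1 ≤ P.q
  hb : 1 ≤ P.b
  he₀ : 1 ≤ P.e₀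
  hα : 2 ^ P.k + 2 ≤ P.α
  hk : 2 * P.k ≤ P.α
  hdig : (4 * P.q * P.b + 1) * (P.α ^ (3 * P.k) * P.α + (2 ^ P.b - 1) * P.k) < (2 ^ P.b - 1) * P.α

/-- A bound on the small constants of the environment and on the logarithms of the others. -/
def small (P : Par) (m e : ℕ) : ℕ :=
  (4 * P.q * P.b * e + 1) * P.α ^ (3 * P.k) + 4 * P.q * P.b * e + m + P.k + 2 ^ P.b + P.B₁ * e +
    (P.q + 1) * P.b * e + e + 5

lemma digits_le (P : Par) (N : ℕ) : P.digits N ≤ P.e₀ + N :=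
  Nat.add_le_add_left (Nat.div_le_self _ _) _

lemma polyBdd_digits (P : Par) : PolyBdd fun N _ => P.digits N :=
  ((PolyBdd.const P.e₀).add .fst).mono fun N _ => P.digits_le N

lemma polyBdd_small (P : Par) : PolyBdd fun N m => P.small m (P.digits N) := by
  have h := P.polyBdd_digits
  have h1 := (PolyBdd.const (4 * P.q * P.b)).mul h
  exact (((((((((h1.add (.const 1)).mul (.const (P.α ^ (3 * P.k)))).add h1).add .snd).add
    (.const P.k)).add (.const (2 ^ P.b))).add ((PolyBdd.const P.B₁).mul h)).add
    ((PolyBdd.const ((P.q + 1) * P.b)).mul h)).add h).add (.const 5)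

lemma kap_eq_zero (P : Par) (m e : ℕ) {j : ℕ} (hj : j ∉ computed) : P.kap m e j = 0 := by
  by_cases h : j < 17
  · interval_cases j <;> first | rfl | exact absurd (by decide) hj
  · obtain ⟨i, rfl⟩ := Nat.exists_eq_add_of_le' (not_lt.1 h)
    rfl

lemma five_le_small (P : Par) (m e : ℕ) : 5 ≤ P.small m e := Nat.le_add_left _ _

lemma kap_le_small (P : Par) (m e : ℕ) {j : ℕ} (hj : j ∈ FP.innerLoops) :
    P.kap m e j ≤ P.small m e := by
  have h : 4 * P.q * P.b * e = 4 * (P.q * P.b * e) := by ring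
  have h2 := Nat.two_pow_pos P.b
  simp only [FP.innerLoops, List.mem_cons, List.not_mem_nil, or_false] at hj
  rcases hj with rfl | rfl | rfl | rfl | rfl | rfl | rfl | rfl <;> simp only [kap, small] <;> omega

lemma bits_kap_le (M : Model) (P : Par) (m e : ℕ) (j : ℕ) :
    M.bits (P.kap m e j) ≤ P.small m e := by
  have h : 4 * P.q * P.b * e = 4 * (P.q * P.b * e) := by ring
  have h2 : (P.q + 1) * P.b * e = P.q * P.b * e + P.b * e := by ring
  by_cases hj : j ∈ computed
  · simp only [computed, List.mem_cons, List.not_mem_nil, or_false] at hj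
    have b1 := M.bits_two_pow (P.q * P.b * e)
    have b2 := M.bits_two_pow (P.b * e)
    have b3 := M.bits_two_pow ((P.q + 1) * P.b * e)
    have b4 := M.bits_mul 2 (2 ^ ((P.q + 1) * P.b * e))
    have b5 := M.bits_two_pow 1
    rw [pow_one] at b5
    have b6 := M.bits_le
    have h3 := b6 ((4 * P.q * P.b * e + 1) * P.α ^ (3 * P.k) + m)
    have h4 := b6 ((4 * P.q * P.b * e + 1) * P.α ^ (3 * P.k) + 1)
    have h5 := b6 (4 * P.q * P.b * e + 1)
    have h6 := b6 (2 * P.q * P.b * e)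
    have h7 : 2 * P.q * P.b * e = 2 * (P.q * P.b * e) := by ring
    have h8 := b6 (P.q * P.b * e)
    have h9 := b6 (P.B₁ * e)
    have b7 := M.bits_two_pow P.b
    have b8 : P.b < 2 ^ P.b := Nat.lt_two_pow_self
    have b9 := b6 m
    have b10 := b6 P.k
    have b11 := b6 e
    rcases hj with rfl | rfl | rfl | rfl | rfl | rfl | rfl | rfl | rfl | rfl | rfl | rfl | rfl |
      rfl <;>
      simp only [kap, small, half] <;> omega
  · rw [kap_eq_zero P m e hj]
    have := M.bits_le 0
    have := P.five_le_small m e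
    omega

end Par

/-- The environment of the program `FP.mainP`, with the dimensions `D` and `w`. -/
def mainEnv (P : Par) {N m : ℕ} (φ : KCNF P.k N m) (D w : ℕ) : Env :=
  ⟨fun j => if j = 0 then N else if j = 12 then D else if j = 13 then w else
    P.kap m (P.digits N) j, satCode φ⟩

/-- The registers that are copied between the computation of the constants and the dimensions and
their use. -/
def mainCopies : List (ℕ × ℕ) :=
  Par.computed.map (fun j => (cstReg j, varReg j)) ++
    [(cstReg 12, 6), (cstReg 13, 7), (8, varReg 16), (24, 6), (40, 7)]

/-- Compute the dimensions and the matrices. -/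
def middleP {M : Model} (P : Par) (pd pv : Prog M.ops) : Prog M.ops :=
  .seq (pd.rename (cls 6) (cls 6)) <| .seq (pv.rename (cls 7) (cls 7)) <|
  .seq (copies mainCopies) ((FP.mainP P.α P.k (2 ^ P.b)).compile 0)

/-- The state before the call of the program for attention. -/
structure Middle (P : Par) {N m : ℕ} (φ : KCNF P.k N m) (D w : ℕ) (s : NState) (σ : State) :
    Prop where
  rep : Represents (mainEnv P φ D w) σ
    ((FP.mainP P.α P.k (2 ^ P.b)).eval (mainEnv P φ D w) s)
  r8 : σ.reg 8 = (2 * P.half (P.digits N) : ℕ)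
  r24 : σ.reg 24 = D
  r40 : σ.reg 40 = w
  reg : ∀ r, 2 < r → σ.reg (cls 8 r) = 0
  bank : ∀ b, 1 < b → σ.bank (cls 8 b) = fun _ => 0

lemma Embeds.numInput {P : Par} {N m : ℕ} {φ : KCNF P.k N m} {s : NState} {σ σ' : State}
    (h : Front P φ s σ) {i n : ℕ} (hi : i = 6 ∨ i = 7) (h0 : σ'.reg i = n)
    (hr : ∀ r, r % 16 = i → σ'.reg r = σ.reg r) (hb : ∀ b, b % 16 = i → σ'.bank b = σ.bank b) :
    Embeds (cls i) (cls i) (numInput n) σ' := by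
  constructor
  · rintro (_ | r)
    · rw [show cls i 0 = i by unfold cls; omega]; exact h0
    · rw [hr _ (by unfold cls; omega), h.reg _ (by unfold cls; omega)]
      rfl
  · intro b
    rw [hb _ (by unfold cls; omega), h.bank _ (by unfold cls; omega)]
    rfl

/-- The dimensions and the matrices are computed in time linear in the number of rows, up to
polynomial factors and the costs `cd` and `cv` of the dimensions. The latter enter as factors, since
they bound the lengths of the dimensions. -/
lemma exec_middleP (M : Model) (P : Par) : ∃ f, PolyBdd f ∧ ∀ {N m : ℕ} (φ : KCNF P.k N m)
    {s : NState} {σ : State} {X : ℕ} (_ : Front P φ s σ) (_ : s.BddBy X)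
    {pd pv : Prog M.ops} {τd τv : State} {cd cv D w : ℕ}
    (_ : Exec M pd (numInput (2 * P.half (P.digits N))) τd cd) (_ : τd.reg 0 = D)
    (_ : Exec M pv (numInput (2 * P.half (P.digits N))) τv cv) (_ : τv.reg 0 = w),
    ∃ τ c, Exec M (middleP P pd pv) σ τ c ∧ Middle P φ D w s τ ∧
      M.bits D ≤ P.small m (P.digits N) + cd ∧ M.bits w ≤ P.small m (P.digits N) + cv ∧
      c ≤ f N m * P.half (P.digits N) * (1 + cd + cv + M.bits X) := by
  obtain ⟨a, ha⟩ := FP.exists_steps_mainP_le P.α P.k (2 ^ P.b)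
  let L := (FP.mainP P.α P.k (2 ^ P.b)).maxLit
  let U : ℕ → ℕ → ℕ := fun N m => P.small m (P.digits N)
  -- a bound on the sizes of all numbers, up to the sizes of the dimensions and of `X`
  let g : ℕ → ℕ → ℕ := fun N m => (L + N + m + 3) + 18 * U N m + 2 * U N m +
      2 * (U N m + U N m ^ a + 2) + 2
  have hU : PolyBdd U := P.polyBdd_small
  have hg : PolyBdd g := (((((((PolyBdd.const L).add .fst).add .snd).add (.const 3)).add
    ((PolyBdd.const 18).mul hU)).add ((PolyBdd.const 2).mul hU)).add ((PolyBdd.const 2).mul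
    ((hU.add (hU.pow a)).add (.const 2)))).add (.const 2)
  refine ⟨fun N m => 2 + 39 * (1 + 9 * (2 * g N m)) + 6 * U N m ^ a * (1 + 9 * (4 * g N m)), ?_, ?_⟩
  · exact ((PolyBdd.const 2).add ((PolyBdd.const 39).mul ((PolyBdd.const 1).add
      ((PolyBdd.const 9).mul ((PolyBdd.const 2).mul hg))))).add
      (((PolyBdd.const 6).mul (hU.pow a)).mul ((PolyBdd.const 1).add ((PolyBdd.const 9).mul
      ((PolyBdd.const 4).mul hg))))
  intro N m φ s σ X hF hX pd pv τd τv cd cv D w hd hD hv hw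
  obtain ⟨e, he⟩ : ∃ e, e = P.digits N := ⟨_, rfl⟩
  rw [← he] at hd hv ⊢
  have hcomp := hF.computed
  rw [← he] at hcomp
  have h16 : s.reg 16 = 2 * P.half e := hcomp 16 (by decide)
  have hhalf : 1 ≤ P.half e := Nat.one_le_two_pow
  -- the dimensions
  have hn : M.bits (2 * P.half e) ≤ P.small m e := P.bits_kap_le M m e 16
  have hbD : M.bits D ≤ P.small m e + cd := by
    have := hd.size_reg_le 0
    rw [hD, Model.size_natCast] at this
    exact this.trans (Nat.add_le_add_right hn _)
  have hbw : M.bits w ≤ P.small m e + cv := by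
    have := hv.size_reg_le 0
    rw [hw, Model.size_natCast] at this
    exact this.trans (Nat.add_le_add_right hn _)
  obtain ⟨σ1, x1, m1, a1⟩ := hd.rename (cls_injective 6) (cls_injective 6)
    (Embeds.numInput hF (.inl rfl) (by rw [hF.r6, h16]) (fun _ _ => rfl) fun _ _ => rfl)
  have r1 : ∀ r, r % 16 ≠ 6 → σ1.reg r = σ.reg r := fun r hr => a1.reg (by simp) hr
  have k1 : ∀ b, b % 16 ≠ 6 → σ1.bank b = σ.bank b := fun b hb => a1.bank (by simp) hb
  obtain ⟨σ2, x2, m2, a2⟩ := hv.rename (cls_injective 7) (cls_injective 7)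
    (Embeds.numInput (σ' := σ1) hF (.inr rfl) (by rw [r1 7 (by simp), hF.r7, h16])
      (fun r hr => r1 r (by omega)) fun b hb => k1 b (by omega))
  have r2 : ∀ r, r % 16 ≠ 6 → r % 16 ≠ 7 → σ2.reg r = σ.reg r := fun r h6 h7 => by
    rw [a2.reg (by simp) h7, r1 r h6]
  have k2 : ∀ b, b % 16 ≠ 6 → b % 16 ≠ 7 → σ2.bank b = σ.bank b := fun b h6 h7 => by
    rw [a2.bank (by simp) h7, k1 b h6]
  have v6 : σ2.reg 6 = D := by
    rw [a2.reg (by simp) (by simp)]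
    exact (m1.1 0).trans hD
  have v7 : σ2.reg 7 = w := (m2.1 0).trans hw
  have vv : ∀ v, σ2.reg (varReg v) = s.reg v := fun v => by
    rw [r2 _ (by unfold varReg; omega) (by unfold varReg; omega), hF.var]
  -- the copies
  obtain ⟨σ3, ⟨c3, x3, hc3⟩, k3, q3, f3⟩ := exec_copies (M := M) (W := X + (D + w))
    (L := mainCopies)
    (by decide) (by decide) (σ := σ2) (by
      intro x hx
      simp only [mainCopies, List.mem_append, List.mem_map, List.mem_cons, List.not_mem_nil,
        or_false] at hx
      rcases hx with ⟨j, -, rfl⟩ | rfl | rfl | rfl | rfl | rfl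
      · exact ⟨s.reg j, vv j, (hX.1 j).trans (Nat.le_add_right _ _)⟩
      · exact ⟨D, v6, by omega⟩
      · exact ⟨w, v7, by omega⟩
      · exact ⟨s.reg 16, vv 16, (hX.1 16).trans (Nat.le_add_right _ _)⟩
      · exact ⟨D, v6, by omega⟩
      · exact ⟨w, v7, by omega⟩)
  have hdst : ∀ r ∈ mainCopies.map Prod.fst, r % 16 = 4 ∨ r % 16 = 8 := by decide
  have f3' : ∀ r, r % 16 ≠ 4 → r % 16 ≠ 8 → r ≠ 5 → σ3.reg r = σ2.reg r := fun r h4 h8 h5 =>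
    f3 r h5 fun hm => by have := hdst r hm; omega
  have hrep : Represents (mainEnv P φ D w) σ3 s := by
    refine ⟨fun v => ?_, fun j => ?_, fun b i => ?_, fun i => ?_⟩
    · rw [f3' _ (by unfold varReg; omega) (by unfold varReg; omega) (by unfold varReg; omega), vv]
    · simp only [mainEnv, ← he]
      by_cases hj : j ∈ Par.computed
      · have hj' : j ≠ 0 ∧ j ≠ 12 ∧ j ≠ 13 := by
          refine ⟨?_, ?_, ?_⟩ <;> rintro rfl <;> exact absurd hj (by decide)
        rw [if_neg hj'.1, if_neg hj'.2.1, if_neg hj'.2.2, q3 (cstReg j, varReg j)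
          (List.mem_append_left _ (List.mem_map.2 ⟨j, hj, rfl⟩)), vv, hcomp j hj]
      · by_cases h12 : j = 12
        · subst h12
          rw [q3 (cstReg 12, 6) (by decide), v6]; rfl
        · by_cases h13 : j = 13
          · subst h13
            rw [q3 (cstReg 13, 7) (by decide), v7]; rfl
          · have hnd : cstReg j ∉ mainCopies.map Prod.fst := by
              intro hm
              simp only [mainCopies, List.map_append, List.map_map, List.mem_append, List.mem_map,
                List.map_cons, List.map_nil, List.mem_cons, List.not_mem_nil, or_false,
                Function.comp] at hm
              rcases hm with ⟨i, hi, hij⟩ | hm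
              · obtain rfl : i = j := by unfold cstReg at hij; omega
                exact hj hi
              · unfold cstReg at hm; omega
            rw [if_neg h12, if_neg h13, f3 _ (by unfold cstReg tmpReg; omega) hnd,
              r2 _ (by unfold cstReg; omega) (by unfold cstReg; omega)]
            by_cases h0 : j = 0
            · subst h0
              exact hF.c0
            · have h4 : j ≠ 4 := by rintro rfl; exact hj (by decide)
              rw [if_neg h0, P.kap_eq_zero _ _ hj, hF.reg _ (by unfold cstReg; omega),
                  Nat.cast_zero]
    · have h8 : bankOf b % 16 = 8 ∨ bankOf b % 16 = 2 := by unfold bankOf; split_ifs <;> omega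
      rw [k3, k2 _ (by omega) (by omega), hF.bank _ (by omega), hF.zero, Nat.cast_zero]
    · rw [k3, k2 0 (by simp) (by simp), hF.bank0]; rfl
  -- the matrices
  obtain ⟨E, hE⟩ : ∃ E, E = mainEnv P φ D w := ⟨_, rfl⟩
  rw [← hE] at hrep
  have hκ : ∀ j, j ≠ 0 → j ≠ 12 → j ≠ 13 → E.κ j = P.kap m e j := fun j g0 g12 g13 => by
    rw [hE, he]; simp [mainEnv, g0, g12, g13]
  have h109 : E.κ 10 * E.κ 9 = P.half e := by
    rw [hκ 10 (by simp) (by simp) (by simp), hκ 9 (by simp) (by simp) (by simp), Par.kap, Par.kap,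
      Par.half, ← pow_add]
    congr 1; ring
  have hsmall5 : 2 ≤ P.small m e := le_trans (by simp) (P.five_le_small m e)
  have hst : (FP.mainP P.α P.k (2 ^ P.b)).steps E ≤ P.half e * P.small m e ^ a := by
    rw [← h109]
    refine ha E _ hsmall5 (fun j hj => ?_) ?_ ?_
    · have hj' : j ≠ 0 ∧ j ≠ 12 ∧ j ≠ 13 := by
        refine ⟨?_, ?_, ?_⟩ <;> rintro rfl <;> exact absurd hj (by decide)
      rw [hκ j hj'.1 hj'.2.1 hj'.2.2]
      exact P.kap_le_small m e hj
    · rw [hκ 9 (by simp) (by simp) (by simp)]; exact Nat.one_le_two_pow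
    · rw [hκ 10 (by simp) (by simp) (by simp)]; exact Nat.one_le_two_pow
  obtain ⟨Δ, hΔ⟩ : ∃ Δ, Δ = (L + N + m + 1) + ((∑ j ∈ Finset.range 17, P.kap m e j) + (D + w)) :=
    ⟨_, rfl⟩
  have hEΔ : E.BddBy Δ := by
    rw [hE]
    refine ⟨fun j => ?_, fun i => ?_⟩
    · have hk : P.kap m e j ≤ ∑ j ∈ Finset.range 17, P.kap m e j := by
        by_cases hj : j < 17
        · exact Finset.single_le_sum (f := P.kap m e) (fun _ _ => Nat.zero_le _)
            (Finset.mem_range.2 hj)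
        · rw [P.kap_eq_zero m e fun h => hj ((by decide : ∀ j ∈ Par.computed, j < 17) j h)]
          exact Nat.zero_le _
      simp only [mainEnv, ← he]
      split_ifs <;> omega
    · have := natAbs_satCode_le φ i
      simp only [mainEnv]
      omega
  obtain ⟨Z, hZ⟩ : ∃ Z, Z = X + (Δ * (P.half e * P.small m e ^ a) + Δ) := ⟨_, rfl⟩
  have hZle : 2 ^ (FP.mainP P.α P.k (2 ^ P.b)).adds E *
      (X + Δ * (FP.mainP P.α P.k (2 ^ P.b)).steps E) ≤ Z := by
    rw [FP.adds_mainP, pow_zero, one_mul, hZ]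
    have := Nat.mul_le_mul_left Δ hst
    omega
  obtain ⟨σ4, ⟨c4, x4, hc4⟩, m4, k4⟩ := FP.exec_compile (M := M) hEΔ (by omega) (by omega : Δ ≤ Z)
    (FP.litLe_of_maxLit_le (by omega)) 0 hX hZle hrep
  rw [hE] at m4
  have r4 : ∀ r, r % 16 = 8 → σ4.reg r = σ3.reg r := fun r hr => k4.reg (by omega)
  refine ⟨σ4, _, x1.seq (x2.seq (x3.seq x4)), ⟨m4, ?_, ?_, ?_, fun r hr => ?_, fun b hb => ?_⟩, hbD,
    hbw, ?_⟩
  · rw [r4 8 (by simp), q3 (8, varReg 16) (by decide), vv, h16, he]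
  · rw [r4 24 (by simp), q3 (24, 6) (by decide), v6]
  · rw [r4 40 (by simp), q3 (40, 7) (by decide), v7]
  · have hnd : cls 8 r ∉ mainCopies.map Prod.fst := fun hm => by
      have : ∀ x ∈ mainCopies.map Prod.fst, x % 16 = 8 → x < 41 := by decide
      have := this _ hm (by unfold cls; omega)
      unfold cls at this; omega
    rw [r4 _ (by unfold cls; omega), f3 _ (by unfold cls tmpReg; omega) hnd,
      r2 _ (by unfold cls; omega) (by unfold cls; omega), hF.reg _ (by unfold cls; omega)]
  · rw [k4.bank' (by unfold cls; omega), k3, k2 _ (by unfold cls; omega) (by unfold cls; omega),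
      hF.bank _ (by unfold cls; omega)]
  -- the costs
  · have hbsum : ∀ n, M.bits (∑ j ∈ Finset.range n, P.kap m e j) ≤ n * P.small m e + 2 := by
      intro n
      induction n with
      | zero => simpa using M.bits_le 0
      | succ n ih =>
        rw [Finset.sum_range_succ]
        have := M.bits_add (∑ j ∈ Finset.range n, P.kap m e j) (P.kap m e n)
        have := P.bits_kap_le M m e n
        rw [add_mul, one_mul]
        omega
    have hUe : U N m = P.small m e := by rw [he]
    have b1 := hbsum 17
    have b2 := M.bits_add (L + N + m + 1) ((∑ j ∈ Finset.range 17, P.kap m e j) + (D + w))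
    have b3 := M.bits_add (∑ j ∈ Finset.range 17, P.kap m e j) (D + w)
    have b4 := M.bits_add D w
    have b5 := M.bits_le (L + N + m + 1)
    rw [← hΔ] at b2
    have b6 := M.bits_add X (Δ * (P.half e * P.small m e ^ a) + Δ)
    have b7 := M.bits_add (Δ * (P.half e * P.small m e ^ a)) Δ
    have b8 := M.bits_mul Δ (P.half e * P.small m e ^ a)
    have b9 := M.bits_mul (P.half e) (P.small m e ^ a)
    have b10 := M.bits_le (P.small m e ^ a)
    have b11 := P.bits_kap_le M m e 15
    rw [show P.kap m e 15 = P.half e from rfl] at b11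
    rw [← hZ] at b6
    have b12 := M.bits_add (Z * Z) Z
    have b13 := M.bits_mul Z Z
    have b14 := M.bits_add X (D + w)
    obtain ⟨y, hy⟩ : ∃ y, y = 1 + cd + cv + M.bits X := ⟨_, rfl⟩
    have hgy : g N m = (L + N + m + 3) + 18 * P.small m e + 2 * P.small m e +
        2 * (P.small m e + P.small m e ^ a + 2) + 2 := by simp only [g, hUe]
    obtain ⟨G, hG⟩ : ∃ G, G = g N m := ⟨_, rfl⟩
    rw [← hG] at hgy
    have hΔG : M.bits Δ ≤ G + y := by omega
    have hZG : M.bits Z ≤ 3 * (G + y) := by omega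
    have hGy : G + y ≤ 2 * (G * y) := by
      have h1 := Nat.le_mul_of_pos_right G (by omega : 0 < y)
      have h2 := Nat.le_mul_of_pos_left y (by omega : 0 < G)
      omega
    have hy1 : 1 ≤ y := by omega
    rw [show mainCopies.length = 19 from rfl] at hc3
    have e3 : c3 ≤ 39 * (1 + 9 * (2 * G)) * (P.half e * y) := by
      calc c3 ≤ 39 * (1 + 3 * M.bits (X + (D + w))) := hc3
        _ ≤ 39 * (y + 9 * (2 * (G * y))) := Nat.mul_le_mul_left _ (by omega)
        _ = 39 * (1 + 9 * (2 * G)) * (1 * y) := by ring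
        _ ≤ _ := by gcongr
    have e4 : c4 ≤ 6 * P.small m e ^ a * (1 + 9 * (4 * G)) * (P.half e * y) := by
      calc c4 ≤ 6 * (P.half e * P.small m e ^ a) * (1 + 3 * M.bits (Z * Z + Z)) :=
            hc4.trans (Nat.mul_le_mul_right _ (Nat.mul_le_mul_left _ hst))
        _ ≤ 6 * (P.half e * P.small m e ^ a) * (y + 9 * (4 * (G * y))) :=
            Nat.mul_le_mul_left _ (by omega)
        _ = _ := by ring
    have e1 : cd + cv ≤ 2 * (P.half e * y) := by
      have : 1 * y ≤ P.half e * y := Nat.mul_le_mul_right _ hhalf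
      omega
    dsimp only
    rw [hUe, ← hG, ← hy]
    calc cd + (cv + (c3 + c4)) ≤ 2 * (P.half e * y) + 39 * (1 + 9 * (2 * G)) * (P.half e * y) +
          6 * P.small m e ^ a * (1 + 9 * (4 * G)) * (P.half e * y) := by omega
      _ = _ := by ring

lemma Model.entry_natCast (M : Model) {d x : ℕ} (h : x ≤ d) : M.Entry d (x : ℝ) := by
  cases M with
  | realRAM F => trivial
  | logRAM => exact ⟨x, h, rfl⟩

namespace Par

/-- The dimension of the rows that is needed for one digit. -/
def dim (P : Par) : ℕ := 2 ^ P.b + 2 + 2 * P.k * ((4 * P.q * P.b + 1) * P.α ^ (3 * P.k)) + P.B₁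

lemma dim_spec (P : Par) {e D : ℕ} (he : 1 ≤ e) (h : P.dim * e ≤ D) : P.B₁ * e ≤ D ∧ 1 ≤ D ∧
    e * 2 ^ P.b + 2 * (1 + P.k * ((4 * P.q * P.b * e + 1) * P.α ^ (3 * P.k))) ≤ D := by
  have e1 : P.dim * e = (e * 2 ^ P.b + 2 * e) + (2 * P.k * ((4 * P.q * P.b * e + e) *
    P.α ^ (3 * P.k))) + P.B₁ * e := by rw [dim]; ring
  have e2 : 2 * P.k * ((4 * P.q * P.b * e + 1) * P.α ^ (3 * P.k)) ≤
      2 * P.k * ((4 * P.q * P.b * e + e) * P.α ^ (3 * P.k)) := by gcongr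
  have e3 : 2 * (1 + P.k * ((4 * P.q * P.b * e + 1) * P.α ^ (3 * P.k))) =
    2 + 2 * P.k * ((4 * P.q * P.b * e + 1) * P.α ^ (3 * P.k)) := by ring
  refine ⟨by omega, by omega, by omega⟩

lemma lt_two_mul_digits (P : Par) (hP : P.Good) (N : ℕ) : N < 2 * P.q * P.b * P.digits N := by
  have hpos : 0 < 2 * P.q * P.b := Nat.mul_pos (Nat.mul_pos (by simp) hP.hq) hP.hb
  have h1 := Nat.lt_mul_div_succ N hpos
  have h2 := hP.he₀
  exact h1.trans_le (Nat.mul_le_mul_left _ (by rw [digits]; omega))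

/-- Entries of size `B₁ * e` separate the two cases of `le_approx_iff`. -/
lemma two_mul_lt_exp (P : Par) {C : ℕ} (hB : 2 * (P.q + 1) * P.b + 4 + C ≤ P.B₁) {e : ℕ}
    (he : 1 ≤ e) :
    2 * C * ((2 * P.half e : ℕ) : ℝ) ^ 2 < Real.exp (((P.B₁ * e : ℕ) : ℝ) ^ 2) := by
  obtain ⟨x, hx⟩ : ∃ x, x = (P.q + 1) * P.b * e := ⟨_, rfl⟩
  have h1 : 2 * x + 4 + C ≤ P.B₁ * e := by
    calc 2 * x + 4 + C ≤ 2 * x + 4 * e + C * e := by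
          have := Nat.le_mul_of_pos_right C he
          omega
      _ = (2 * (P.q + 1) * P.b + 4 + C) * e := by rw [hx]; ring
      _ ≤ _ := Nat.mul_le_mul_right _ hB
  have h2 : 2 * C * (2 * P.half e) ^ 2 < 2 ^ (P.B₁ * e) := by
    have h3 : C < 2 ^ C := Nat.lt_two_pow_self
    calc 2 * C * (2 * P.half e) ^ 2 = C * 2 ^ (2 * x + 3) := by
          rw [half, ← hx, pow_add, pow_mul']; ring
      _ < 2 ^ C * 2 ^ (2 * x + 3) := Nat.mul_lt_mul_of_pos_right h3 (by positivity)
      _ = 2 ^ (2 * x + 3 + C) := by ring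
      _ ≤ _ := Nat.pow_le_pow_right (by simp) (by omega)
  have h4 : (2 : ℝ) ≤ Real.exp 1 := by linarith [Real.add_one_le_exp 1]
  calc 2 * C * ((2 * P.half e : ℕ) : ℝ) ^ 2 < (2 : ℝ) ^ (P.B₁ * e) := by exact_mod_cast h2
    _ ≤ Real.exp 1 ^ (P.B₁ * e) := pow_le_pow_left₀ (by norm_num) h4 _
    _ = Real.exp ((P.B₁ * e : ℕ) : ℝ) := by rw [← Real.exp_nat_mul, mul_one]
    _ ≤ _ := by
      refine Real.exp_le_exp.2 ?_
      have : (1 : ℝ) ≤ (P.B₁ * e : ℕ) := by exact_mod_cast (by omega : 1 ≤ P.B₁ * e)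
      nlinarith

/-- The parameters are as the branching process requires. -/
lemma Good.params {P : Par} (hP : P.Good) {N m : ℕ} (φ : KCNF P.k N m) (D w : ℕ) :
    FP.Params (mainEnv P φ D w) P.α P.k (2 ^ P.b) m (P.digits N) := by
  obtain ⟨e, he⟩ : ∃ e, e = P.digits N := ⟨_, rfl⟩
  have he1 : 1 ≤ e := by rw [he]; exact hP.he₀.trans (Nat.le_add_right _ _)
  have h1 : (mainEnv P φ D w).κ 1 = 4 * P.q * P.b * e + 1 := by rw [he]; rfl
  have hle : 4 * P.q * P.b * e + 1 ≤ (4 * P.q * P.b + 1) * e := by rw [add_mul, one_mul]; omega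
  refine ⟨hP.hα, hP.hk, ?_, ?_, ?_⟩
  · calc 2 = 2 ^ 1 := rfl
      _ ≤ _ := Nat.pow_le_pow_right (by simp) hP.hb
  · rw [add_comm]; exact le_rfl
  · rw [h1, ← he]
    calc (4 * P.q * P.b * e + 1) * P.α ^ (3 * P.k) * P.α +
        (2 ^ P.b - 1) * (P.k * (4 * P.q * P.b * e + 1))
        = (4 * P.q * P.b * e + 1) * (P.α ^ (3 * P.k) * P.α + (2 ^ P.b - 1) * P.k) := by ring
      _ ≤ (4 * P.q * P.b + 1) * e * (P.α ^ (3 * P.k) * P.α + (2 ^ P.b - 1) * P.k) :=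
        Nat.mul_le_mul_right _ hle
      _ = e * ((4 * P.q * P.b + 1) * (P.α ^ (3 * P.k) * P.α + (2 ^ P.b - 1) * P.k)) := by ring
      _ < _ := Nat.mul_lt_mul_of_pos_left hP.hdig he1

end Par

/-! ### The program for satisfiability -/

/-- The program for satisfiability that makes a single call of the program `p` for attention. -/
def solver {M : Model} (P : Par) (C : ℕ) (pd pv p : Prog M.ops) : Prog M.ops :=
  .seq (frontP P) <| .seq (middleP P pd pv) <| .seq (p.rename (cls 8) (cls 8)) (scanP C)

/-- The program `solver` decides satisfiability. Apart from the call of `p`, it takes time linear in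
the number of rows, up to polynomial factors and the costs of the dimensions. -/
theorem exec_solver (M : Model) {P : Par} (hP : P.Good) {C : ℕ} (hC1 : 1 ≤ C)
    (hB : 2 * (P.q + 1) * P.b + 4 + C ≤ P.B₁) {d dv : ℕ → ℕ} (hdv : ∀ n, 1 ≤ dv n) {μ : ℝ}
    (hμ : μ < 1) (hC : 1 ≤ C * (1 - μ)) {p : Prog M.ops} {T : ℕ → ℝ}
    (hp : ComputesAttention M d dv (MulApprox μ) p T) :
    ∃ f, PolyBdd f ∧ ∀ {N m : ℕ} (φ : KCNF P.k N m) {pd pv : Prog M.ops} {τd τv : State}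
      {cd cv n : ℕ} (_ : n = 2 * P.half (P.digits N)) (_ : Exec M pd (numInput n) τd cd)
      (_ : τd.reg 0 = d n) (_ : Exec M pv (numInput n) τv cv) (_ : τv.reg 0 = dv n)
      (_ : P.dim * P.digits N ≤ d n),
    ∃ τ c, Exec M (solver P C pd pv p) (satInput φ) τ c ∧
      (c : ℝ) ≤ (f N m : ℕ) * P.half (P.digits N) * (1 + cd + cv) + 3 * T n ∧
      (φ.Satisfiable → τ.reg 0 = 1) ∧ (¬ φ.Satisfiable → τ.reg 0 = 0) := by
  obtain ⟨f1, hf1, H1⟩ := exec_frontP M P (Nat.mul_pos hP.hq hP.hb)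
  obtain ⟨f2, hf2, H2⟩ := exec_middleP M P
  let g : ℕ → ℕ → ℕ := fun N m => 2 * P.small m (P.digits N) + C + 7
  have hg : PolyBdd g := (((PolyBdd.const 2).mul P.polyBdd_small).add (.const C)).add (.const 7)
  refine ⟨fun N m => f1 N m + f2 N m * (1 + f1 N m) + 14 * (1 + 3 * g N m) + 4, ((hf1.add (hf2.mul
    ((PolyBdd.const 1).add hf1))).add ((PolyBdd.const 14).mul ((PolyBdd.const 1).add
    ((PolyBdd.const 3).mul hg)))).add (.const 4), ?_⟩
  intro N m φ pd pv τd τv cd cv n hn hd hdn hv hvn hdim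
  obtain ⟨e, he⟩ : ∃ e, e = P.digits N := ⟨_, rfl⟩
  have he1 : 1 ≤ e := by rw [he]; exact hP.he₀.trans (Nat.le_add_right _ _)
  obtain ⟨half, hhalf⟩ : ∃ half, half = P.half e := ⟨_, rfl⟩
  have hhalf1 : 1 ≤ half := by rw [hhalf]; exact Nat.one_le_two_pow
  rw [← he] at hdim
  obtain ⟨hBd, hd1, hcols⟩ := P.dim_spec he1 hdim
  have hw := hdv n
  obtain ⟨D, hD⟩ : ∃ D, D = d n := ⟨_, rfl⟩
  obtain ⟨w, hwe⟩ : ∃ w, w = dv n := ⟨_, rfl⟩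
  rw [← hwe] at hw
  rw [← hD] at hBd hd1 hcols
  obtain ⟨s, σ1, c1, X, x1, F1, hc1, hX, hbX⟩ := H1 φ
  obtain ⟨σ2, c2, x2, F2, hbD, hbw, hc2⟩ := H2 φ F1 hX (D := D) (w := w)
    (hn ▸ hd) (hdn.trans (by rw [hD])) (hn ▸ hv) (hvn.trans (by rw [hwe]))
  obtain ⟨E, hE⟩ : ∃ E, E = mainEnv P φ D w := ⟨_, rfl⟩
  have hκ : ∀ j, j ≠ 0 → j ≠ 12 → j ≠ 13 → E.κ j = P.kap m e j := fun j g0 g12 g13 => by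
    rw [hE, he]; simp [mainEnv, g0, g12, g13]
  have k1 : E.κ 1 = 4 * P.q * P.b * e + 1 := hκ 1 (by simp) (by simp) (by simp)
  have k3 : E.κ 3 = (4 * P.q * P.b * e + 1) * P.α ^ (3 * P.k) + 1 :=
      hκ 3 (by simp) (by simp) (by simp)
  have k4 : E.κ 4 = m := hκ 4 (by simp) (by simp) (by simp)
  have k5 : E.κ 5 = P.k := hκ 5 (by simp) (by simp) (by simp)
  have k6 : E.κ 6 = 2 * P.q * P.b * e := hκ 6 (by simp) (by simp) (by simp)
  have k7 : E.κ 7 = e := hκ 7 (by simp) (by simp) (by simp)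
  have k8 : E.κ 8 = P.q * P.b * e := hκ 8 (by simp) (by simp) (by simp)
  have k9 : E.κ 9 = 2 ^ (P.q * P.b * e) := hκ 9 (by simp) (by simp) (by simp)
  have k10 : E.κ 10 = 2 ^ (P.b * e) := hκ 10 (by simp) (by simp) (by simp)
  have k11 : E.κ 11 = 2 ^ P.b := hκ 11 (by simp) (by simp) (by simp)
  have k12 : E.κ 12 = D := by rw [hE]; rfl
  have k13 : E.κ 13 = w := by rw [hE]; rfl
  have k14 : E.κ 14 = P.B₁ * e := hκ 14 (by simp) (by simp) (by simp)
  have k15 : E.κ 15 = half := by rw [hκ 15 (by simp) (by simp) (by simp), hhalf]; rfl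
  have k16 : E.κ 16 = 2 * half := by rw [hκ 16 (by simp) (by simp) (by simp), hhalf]; rfl
  have hpar := hP.params φ D w
  rw [← hE, ← he] at hpar
  have h1 : E.κ 1 = 2 * E.κ 6 + 1 := by rw [k1, k6]; ring
  obtain ⟨S, hS1, hS2, hS3, hS4, hS5, hS6⟩ := FP.exists_matrices hpar k4 k5 k7 k11
    (by rw [k1, k3]; omega)
    (by rw [k6, k8]; ring) h1 (by rw [k9, k8])
    (by rw [k10, ← pow_mul]) (by rw [k15, k10, k9, hhalf, Par.half, ← pow_add]; congr 1; ring)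
    (by rw [k7, k11, k1, k12]; exact hcols) (fun b i => F1.zero b i)
  rw [exists_solves_iff φ k4 k5 h1 (by rw [k6, he]; exact (P.lt_two_mul_digits hP N).le)
    (by rw [hE]; rfl)] at hS6
  have hrep := F2.rep
  rw [← hE] at hrep
  rw [k12] at hS1 hS2 hS3
  rw [k13] at hS4 hS5
  rw [k14] at hS2
  rw [k15] at hS2 hS3 hS4 hS5 hS6
  rw [← he, ← hhalf] at hn
  -- the input for the attention program
  let Q : Matrix (Fin n) (Fin D) ℝ := fun i j => if (j : ℕ) ∈ S i then ((P.B₁ * e : ℕ) : ℝ) else 0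
  let V : Matrix (Fin n) (Fin w) ℝ := fun i j => if half ≤ (i : ℕ) ∧ (j : ℕ) = 0 then 1 else 0
  have hQ : flatten Q = σ2.bank 8 := by
    refine flatten_eq (fun i j => ?_) fun a ha => ?_
    · rw [show (8 : ℕ) = bankOf 0 from rfl, hrep.bank, hS2 i (by omega) j j.2]
      simp only [Q]
      split_ifs <;> simp
    · rw [show (8 : ℕ) = bankOf 0 from rfl, hrep.bank, hS3 a (by rwa [hn] at ha), Nat.cast_zero]
  have hV : flatten V = σ2.bank 24 := by
    refine flatten_eq (fun i j => ?_) fun a ha => ?_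
    · rw [show (24 : ℕ) = bankOf 1 from rfl, hrep.bank]
      by_cases h : half ≤ (i : ℕ) ∧ (j : ℕ) = 0
      · rw [hS4 _ ⟨i - half, by omega, by rw [h.2, add_zero]; congr 1; omega⟩]
        simp [V, h]
      · rw [hS5]
        · simp only [V, if_neg h, Nat.cast_zero]
        · rintro ⟨r, hr, hir⟩
          have := FP.row_unique (l' := 0) j.2 (by omega) (hir.trans (add_zero _).symm)
          rw [this] at hir
          exact h ⟨by omega, by omega⟩
    · rw [show (24 : ℕ) = bankOf 1 from rfl, hrep.bank, hS5, Nat.cast_zero]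
      rintro ⟨r, hr, rfl⟩
      have : (half + r + 1) * w ≤ n * w := Nat.mul_le_mul_right _ (by omega)
      rw [add_mul _ 1, one_mul] at this
      omega
  have hemb : Embeds (cls 8) (cls 8) (attnInput Q V) σ2 := by
    constructor
    · rintro (_ | _ | _ | r)
      · refine F2.r8.trans ?_
        rw [← he, ← hhalf, ← hn]; rfl
      · exact F2.r24
      · exact F2.r40
      · exact F2.reg (r + 3) (by omega)
    · rintro (_ | _ | b)
      · exact hQ.symm
      · exact hV.symm
      · exact F2.bank (b + 2) (by omega)
  obtain ⟨τp, cp, xp, hcp, hok⟩ : RunsWithin M p (attnInput Q V) (T n) fun τ =>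
      MulApprox μ n w (attnOutput n w τ) (selfAttention Q V) := by
    subst hD hwe
    refine hp n (by omega) Q V (fun i j => ?_) fun i j => ?_
    · simp only [Q]
      split_ifs
      · exact M.entry_natCast hBd
      · simpa using M.entry_natCast (Nat.zero_le (d n))
    · simp only [V]
      split_ifs
      · simpa using M.entry_natCast hd1
      · simpa using M.entry_natCast (Nat.zero_le (d n))
  obtain ⟨σ3, x3, m3, a3⟩ := xp.rename (cls_injective 8) (cls_injective 8) hemb
  -- the decision
  have h40 : σ3.bank 40 = τp.bank 2 := m3.2 2
  have hcst : ∀ j, σ3.reg (cstReg j) = E.κ j := fun j => by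
    rw [a3.reg (by simp) (by unfold cstReg; omega), hrep.cst]
  obtain ⟨W, hW⟩ : ∃ W, W = 2 * half * (w + C + 1) := ⟨_, rfl⟩
  have hWe : W = 2 * (half * w) + 2 * half * C + 2 * half := by rw [hW]; ring
  have hhw : w ≤ half * w := Nat.le_mul_of_pos_left _ hhalf1
  have hW3 : n * C ≤ W := by rw [hn, hWe]; omega
  obtain ⟨τ, c4, x4, hc4, ans1, ans0⟩ := exec_scanP (M := M) (C := C) (half := half) (w := w)
    (n := n) (W := W) (σ := σ3) (by rw [hcst, k15]) (by rw [hcst, k13]) (by rw [hcst, k16, hn])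
    (by omega) hC1 (by omega) (by omega) hW3
  have hiff : (∃ i < half, 1 / ((n : ℝ) * C) ≤ σ3.bank 40 (i * w)) ↔ φ.Satisfiable := by
    rw [← hS6]
    refine exists_congr fun a => and_congr_right fun ha => ?_
    have h := le_approx_iff (Q := Q) (V := V) (S := S) (B := P.B₁ * e) (μ := μ) (C := C)
      (y := attnOutput n w τp ⟨a, by omega⟩ ⟨0, hw⟩) hn hw hS1 (fun i j => rfl)
      (fun i => by simp [V]) hμ hC (by rw [hn, hhalf]; exact P.two_mul_lt_exp hB he1) ha (hok _ _)
    rw [← h, h40]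
    simp [attnOutput]
  rw [hiff] at ans1 ans0
  refine ⟨τ, _, x1.seq (x2.seq (x3.seq x4)), ?_, ans1, ans0⟩
  -- the cost
  have hsum : ∑ i ∈ Finset.range half, M.size (σ3.bank 40 (i * w)) ≤ half * 2 + cp := by
    have hinj : Set.InjOn (fun i => i * w) (Finset.range half : Finset ℕ) := fun i _ j _ h =>
      Nat.eq_of_mul_eq_mul_right hw h
    have h := xp.sum_size_bank_le 2 ((Finset.range half).image fun i => i * w)
    rw [Finset.sum_image hinj, Finset.sum_image hinj] at h
    rw [h40]
    refine h.trans (Nat.add_le_add_right ?_ _)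
    have h0 : ∀ i ∈ Finset.range half, M.size ((attnInput Q V).bank 2 (i * w)) ≤ 2 := fun i _ => by
      have := M.bits_le 0
      rw [Model.bits, Nat.cast_zero] at this
      exact this
    exact (Finset.sum_le_card_nsmul _ _ _ h0).trans (by simp)
  have hbW : M.bits W ≤ g N m + cv := by
    have b1 := M.bits_mul (2 * half) (w + C + 1)
    have b2 := M.bits_add (w + C) 1
    have b3 := M.bits_add w C
    have b4 := M.bits_le C
    have b5 := M.bits_le 1
    have b6 := P.bits_kap_le M m e 16
    rw [show P.kap m e 16 = 2 * P.half e from rfl, ← hhalf] at b6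
    rw [← he] at hbw
    simp only [g, ← he]
    rw [← hW] at b1
    omega
  have hnat : c1 + (c2 + (cp + c4)) ≤ (f1 N m + f2 N m * (1 + f1 N m) + 14 * (1 + 3 * g N m) + 4) *
      half * (1 + cd + cv) + 3 * cp := by
    obtain ⟨y, hy⟩ : ∃ y, y = 1 + cd + cv := ⟨_, rfl⟩
    have hy1 : 1 ≤ y := by omega
    rw [← he, ← hhalf, ← hy] at hc2
    rw [← hy]
    have e1 : c1 ≤ f1 N m * half * y := by
      rw [mul_assoc]
      exact hc1.trans (Nat.le_mul_of_pos_right _ (Nat.mul_pos hhalf1 hy1))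
    have e2 : c2 ≤ f2 N m * (1 + f1 N m) * half * y := by
      have : y + M.bits X ≤ (1 + f1 N m) * y := by
        rw [add_mul, one_mul]
        have := Nat.le_mul_of_pos_right (f1 N m) hy1
        omega
      calc c2 ≤ f2 N m * half * ((1 + f1 N m) * y) := hc2.trans (Nat.mul_le_mul_left _ this)
        _ = _ := by ring
    have e4 : (6 * half + 8) * (1 + 3 * M.bits W) ≤ 14 * (1 + 3 * g N m) * half * y := by
      have h5 : 1 + 3 * M.bits W ≤ (1 + 3 * g N m) * y := by
        have := Nat.mul_le_mul_left (1 + 3 * g N m) hy1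
        calc 1 + 3 * M.bits W ≤ (1 + 3 * g N m) * 1 + 3 * cv := by omega
          _ ≤ (1 + 3 * g N m) * 1 + (1 + 3 * g N m) * (cd + cv) := by
            have : 3 ≤ 1 + 3 * g N m := by simp only [g]; omega
            exact Nat.add_le_add_left (Nat.mul_le_mul this (by omega)) _
          _ = _ := by rw [hy]; ring
      calc (6 * half + 8) * (1 + 3 * M.bits W) ≤ (14 * half) * ((1 + 3 * g N m) * y) :=
            Nat.mul_le_mul (by omega) h5
        _ = _ := by ring
    have e5 : half * 4 ≤ 4 * half * y := by
      rw [mul_comm half]; exact Nat.le_mul_of_pos_right _ hy1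
    rw [add_mul, add_mul, add_mul, add_mul, add_mul, add_mul]
    omega
  have hreal : ((c1 + (c2 + (cp + c4)) : ℕ) : ℝ) ≤ (((f1 N m + f2 N m * (1 + f1 N m) +
      14 * (1 + 3 * g N m) + 4) * half * (1 + cd + cv) + 3 * cp : ℕ) : ℝ) := Nat.cast_le.2 hnat
  refine hreal.trans ?_
  rw [← he, ← hhalf]
  push_cast at hcp ⊢
  linarith

/-! ### The choice of the parameters -/

/-- The base `2 ^ b` of the digits outgrows the bound `α ^ (3 * k)` of sparsification, although `α`
has to grow with `b`: the heart branches cost few digits since the base is large, and the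
petal branches cost few digits since `α` is large. -/
lemma exists_good_params (q k : ℕ) (hq : 1 ≤ q) : ∃ b α, 1 ≤ b ∧ 2 ^ k + 2 ≤ α ∧ 2 * k ≤ α ∧
    (4 * q * b + 1) * (α ^ (3 * k) * α + (2 ^ b - 1) * k) < (2 ^ b - 1) * α := by
  obtain ⟨A, hA⟩ : ∃ A, A = 10 * q * (k + 1) * (2 ^ k + 2) := ⟨_, rfl⟩
  obtain ⟨c, hc⟩ : ∃ c, c = 10 * q * A ^ (3 * k) + 1 := ⟨_, rfl⟩
  have hA1 : 10 * q * k + 2 * k ≤ A ∧ 2 ^ k + 2 ≤ A := by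
    have h1 : 10 * q * (k + 1) * 2 ≤ A := by
      rw [hA]; exact Nat.mul_le_mul_left _ (Nat.le_add_left 2 _)
    have h2 : 1 * (2 ^ k + 2) ≤ A := by
      rw [hA]; exact Nat.mul_le_mul_right _ (Nat.mul_pos (by omega) (Nat.succ_pos k))
    have h3 : k ≤ q * k := Nat.le_mul_of_pos_left _ hq
    have h4 : 10 * q * (k + 1) * 2 = 20 * (q * k) + 20 * q := by ring
    have h5 : 10 * q * k = 10 * (q * k) := by ring
    omega
  -- powers of two outgrow polynomials
  obtain ⟨b, hb1, hb⟩ : ∃ b : ℕ, 1 ≤ b ∧ c * b ^ (3 * k + 1) < 2 ^ b := by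
    have ht := tendsto_pow_const_div_const_pow_of_one_lt (3 * k + 1) (r := (2 : ℝ)) (by norm_num)
    have hc0 : (0 : ℝ) < 1 / c := by rw [hc]; positivity
    obtain ⟨b, hb, hb1⟩ := ((ht.eventually_lt_const hc0).and (Filter.eventually_ge_atTop 1)).exists
    refine ⟨b, hb1, ?_⟩
    rw [div_lt_div_iff₀ (by positivity) (by rw [hc]; positivity), one_mul, mul_comm] at hb
    exact_mod_cast hb
  have hAb : A ≤ A * b := Nat.le_mul_of_pos_right _ hb1
  refine ⟨b, A * b, hb1, by omega, by omega, ?_⟩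
  obtain ⟨g, hg⟩ : ∃ g, g = 2 ^ b - 1 := ⟨_, rfl⟩
  obtain ⟨y, hy⟩ : ∃ y, y = (A * b) ^ (3 * k) := ⟨_, rfl⟩
  have h4 : 4 * q * b + 1 ≤ 5 * q * b := by
    have := Nat.mul_pos hq hb1
    have e4 : 4 * q * b = 4 * (q * b) := by ring
    have e5 : 5 * q * b = 5 * (q * b) := by ring
    omega
  have hyg : 2 * ((5 * q * b) * y) < g := by
    have e1 : c * b ^ (3 * k + 1) = 2 * ((5 * q * b) * y) + b ^ (3 * k + 1) := by
      rw [hc, hy, mul_pow]; ring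
    have := Nat.one_le_pow (3 * k + 1) b hb1
    omega
  have hk : 2 * ((5 * q * b) * k) ≤ A * b := by
    calc 2 * ((5 * q * b) * k) = 10 * q * k * b := by ring
      _ ≤ _ := Nat.mul_le_mul_right _ (by omega)
  have hpos : 0 < A * b := Nat.mul_pos ((Nat.succ_pos _).trans_le hA1.2) hb1
  rw [← hg, ← hy]
  have e1 := Nat.mul_lt_mul_of_pos_right hyg hpos
  have e2 := Nat.mul_le_mul_left g hk
  have e3 := Nat.mul_le_mul_right (y * (A * b) + g * k) h4
  have e4 : (5 * q * b) * (y * (A * b) + g * k) =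
    (5 * q * b) * y * (A * b) + g * ((5 * q * b) * k) := by ring
  have e5 : 2 * ((5 * q * b) * y) * (A * b) = 2 * ((5 * q * b) * y * (A * b)) := by ring
  have e6 : g * (2 * ((5 * q * b) * k)) = 2 * (g * ((5 * q * b) * k)) := by ring
  omega

/-- A dimension in `ω(log n)` eventually exceeds any multiple of `log n`. -/
lemma exists_forall_mul_le_dim {d : ℕ → ℕ}
    (hd : (fun n : ℕ => Real.log n) =o[Filter.atTop] fun n : ℕ => (d n : ℝ)) (D x : ℕ)
    (hx : 1 ≤ x) : ∃ e₀, 1 ≤ e₀ ∧ ∀ e, e₀ ≤ e → D * e ≤ d (2 * 2 ^ (x * e)) := by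
  have hl2 := Real.log_pos (by norm_num : (1 : ℝ) < 2)
  have hxr : (1 : ℝ) ≤ x := by exact_mod_cast hx
  have hc : 0 < x * Real.log 2 / (D + 1) := by positivity
  obtain ⟨n₀, h⟩ := Filter.eventually_atTop.1 (hd.def hc)
  refine ⟨n₀ + 1, by omega, fun e he => ?_⟩
  have h1 : e < 2 ^ (x * e) :=
    (Nat.lt_two_pow_self).trans_le (Nat.pow_le_pow_right (by simp) (Nat.le_mul_of_pos_left _ hx))
  have h2 := h (2 * 2 ^ (x * e)) (by omega)
  obtain ⟨y, hy⟩ : ∃ y, y = d (2 * 2 ^ (x * e)) := ⟨_, rfl⟩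
  rw [← hy] at h2 ⊢
  have h3 : x * e * Real.log 2 ≤ Real.log ((2 * 2 ^ (x * e) : ℕ) : ℝ) := by
    have : x * e * Real.log 2 = Real.log ((2 ^ (x * e) : ℕ) : ℝ) := by
      push_cast; rw [Real.log_pow]; push_cast; ring
    rw [this]
    exact Real.log_le_log (by positivity) (by exact_mod_cast Nat.le_mul_of_pos_left _ (by simp))
  have h4 := (h3.trans (le_abs_self _)).trans h2
  rw [Real.norm_natCast, div_mul_eq_mul_div, le_div_iff₀ (by positivity)] at h4
  have h5 : (e : ℝ) * (D + 1) ≤ y := by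
    refine le_of_mul_le_mul_left ?_ (by positivity : 0 < x * Real.log 2)
    linarith
  have h6 : e * (D + 1) ≤ y := by exact_mod_cast h5
  calc D * e ≤ e * (D + 1) := by rw [mul_comm]; exact Nat.mul_le_mul_left _ (by omega)
    _ ≤ y := h6

/-! ### The running time -/

lemma exists_pow_le_two_rpow (a : ℕ) {δ : ℝ} (hδ : 0 < δ) :
    ∃ K : ℝ, 0 ≤ K ∧ ∀ N : ℕ, ((N : ℝ) + 2) ^ a ≤ K * (2 : ℝ) ^ (δ * N) := by
  have hr : 1 < (2 : ℝ) ^ δ := Real.one_lt_rpow (by norm_num) hδ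
  obtain ⟨B, hB⟩ := (tendsto_pow_const_div_const_pow_of_one_lt a hr).bddAbove_range
  have hB' : ∀ n : ℕ, (n : ℝ) ^ a / ((2 : ℝ) ^ δ) ^ n ≤ B := fun n => hB ⟨n, rfl⟩
  have hB0 : 0 ≤ B := le_trans (by positivity) (hB' 0)
  refine ⟨B * ((2 : ℝ) ^ δ) ^ 2, by positivity, fun N => ?_⟩
  have h := hB' (N + 2)
  rw [div_le_iff₀ (by positivity)] at h
  rw [Real.rpow_mul (by norm_num), Real.rpow_natCast]
  calc ((N : ℝ) + 2) ^ a = ((N + 2 : ℕ) : ℝ) ^ a := by push_cast; rfl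
    _ ≤ _ := h
    _ = _ := by ring

/-- The number of rows is `2 ^ ((1 + 1 / q) * N / 2)`, up to a constant factor. -/
lemma Par.rows_rpow_le (P : Par) (hq : 1 ≤ P.q) (hb : 1 ≤ P.b) {γ : ℝ} (hγ0 : 0 < γ) (hγ1 : γ ≤ 1)
    (hqγ : 4 ≤ P.q * γ) (N : ℕ) : ((2 * P.half (P.digits N) : ℕ) : ℝ) ^ (2 - γ) ≤
    (2 : ℝ) ^ (2 * (1 + (P.q + 1) * P.b * P.e₀ : ℝ)) * (2 : ℝ) ^ ((1 - γ / 4) * N) := by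
  have hq' : (1 : ℝ) ≤ P.q := by exact_mod_cast hq
  have hb' : (1 : ℝ) ≤ P.b := by exact_mod_cast hb
  obtain ⟨u, hu⟩ : ∃ u : ℕ, u = N / (2 * P.q * P.b) := ⟨_, rfl⟩
  have hu1 : 2 * (P.q : ℝ) * P.b * u ≤ N := by
    have := Nat.mul_div_le N (2 * P.q * P.b)
    rw [← hu] at this
    exact_mod_cast this
  have hn : ((2 * P.half (P.digits N) : ℕ) : ℝ) =
      (2 : ℝ) ^ (1 + (P.q + 1) * P.b * (P.e₀ + u) : ℝ) := by
    rw [half, digits, ← hu, ← pow_succ', Nat.cast_pow, ← Real.rpow_natCast]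
    push_cast
    congr 1
    ring
  rw [hn, ← Real.rpow_mul (by norm_num), ← Real.rpow_add (by norm_num)]
  refine Real.rpow_le_rpow_of_exponent_le (by norm_num) ?_
  have h1 : 0 ≤ γ * (1 + (P.q + 1) * P.b * P.e₀ : ℝ) := by positivity
  -- `(2 - γ) * (q + 1) ≤ (1 - γ / 4) * 2 * q`
  have h2 : (2 - γ) * (P.q + 1) ≤ (1 - γ / 4) * (2 * P.q) := by nlinarith
  have h3 : (2 - γ) * (P.q + 1) * (P.b * u) ≤ (1 - γ / 4) * (2 * P.q) * (P.b * u) :=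
    mul_le_mul_of_nonneg_right h2 (by positivity)
  have h4 : (1 - γ / 4) * (2 * P.q * P.b * u) ≤ (1 - γ / 4) * N :=
    mul_le_mul_of_nonneg_left hu1 (by linarith)
  linarith

/-- The costs of the program `solver` are `poly (N, m) * n ^ (2 - γ)` with
`n = O (2 ^ ((1 + 1 / q) * N / 2))`, and `1 / q ≤ γ / 4`; this is below `2 ^ ((1 - γ / 8) * N)`. -/
theorem not_computesAttention_mulApprox (M : Model) (hSETH : SETH M) (d dv : ℕ → ℕ)
    (hd : (fun n : ℕ => Real.log n) =o[Filter.atTop] fun n : ℕ => (d n : ℝ))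
    (hdv : ∀ n, 1 ≤ dv n) (hdc : SublinearTime M d) (hdvc : SublinearTime M dv) (ε : ℝ)
    (hε : 0 < ε) (μ : ℝ) (hμ : μ < 1) (p : Prog M.ops) (K : ℝ) :
    ¬ ComputesAttention M d dv (MulApprox μ) p fun n => K * (n : ℝ) ^ (2 - ε) := by
  intro hp
  obtain ⟨pd, γd, Kd, hγd, hpd⟩ := hdc
  obtain ⟨pv, γv, Kv, hγv, hpv⟩ := hdvc
  -- a common exponent and a common constant for the three running times
  obtain ⟨γ, hγ0, hγ1, hγd', hγv', hγε⟩ : ∃ γ : ℝ, 0 < γ ∧ γ ≤ 1 ∧ γ ≤ γd ∧ γ ≤ γv ∧ γ ≤ ε :=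
    ⟨min (min 1 γd) (min γv ε), by positivity, by simp, by simp, by simp, by simp⟩
  obtain ⟨K', hK0, hKd, hKv, hK⟩ : ∃ K' : ℝ, 0 ≤ K' ∧ Kd ≤ K' ∧ Kv ≤ K' ∧ K ≤ K' :=
    ⟨max (max 0 Kd) (max Kv K), by simp, by simp, by simp, by simp⟩
  have hmono : ∀ {x y L : ℝ} {n : ℕ}, L ≤ K' → x ≤ y → 1 ≤ n →
      L * (n : ℝ) ^ x ≤ K' * (n : ℝ) ^ y := fun hL hxy hn =>
    mul_le_mul hL (Real.rpow_le_rpow_of_exponent_le (by exact_mod_cast hn) hxy) (by positivity) hK0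
  obtain ⟨q, hq⟩ := exists_nat_ge (4 / γ)
  rw [div_le_iff₀ hγ0] at hq
  have hq1 : 1 ≤ q := by
    rcases Nat.eq_zero_or_pos q with h | h
    · rw [h, Nat.cast_zero, zero_mul] at hq
      norm_num at hq
    · exact h
  obtain ⟨k, hk⟩ := hSETH (γ / 8) (by positivity)
  obtain ⟨b, α, hb, hα, hkα, hdig⟩ := exists_good_params q k hq1
  obtain ⟨C, hC⟩ := exists_nat_ge (1 / (1 - μ))
  have hμ' : 0 < 1 - μ := by linarith
  rw [div_le_iff₀ hμ'] at hC
  have hC1 : 1 ≤ C := by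
    rcases Nat.eq_zero_or_pos C with h | h
    · rw [h, Nat.cast_zero, zero_mul] at hC
      norm_num at hC
    · exact h
  -- the needed dimension per digit does not depend on `e₀`
  let P₀ : Par := ⟨q, b, α, k, 1, 2 * (q + 1) * b + 4 + C⟩
  obtain ⟨e₀, he₀, hdim⟩ := exists_forall_mul_le_dim hd P₀.dim ((q + 1) * b)
    (Nat.mul_pos (Nat.succ_pos q) hb)
  let P : Par := ⟨q, b, α, k, e₀, 2 * (q + 1) * b + 4 + C⟩
  have hP : P.Good := ⟨hq1, hb, he₀, hα, hkα, hdig⟩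
  obtain ⟨f, ⟨a, hf⟩, hsolve⟩ := exec_solver M hP hC1 le_rfl hdv hμ hC hp
  obtain ⟨K₂, hK₂, hpoly⟩ := exists_pow_le_two_rpow a (by positivity : 0 < γ / 8)
  refine hk ⟨solver P C pd pv p,
    K₂ * ((1 + 5 * K') * (2 : ℝ) ^ (2 * (1 + (q + 1) * b * e₀ : ℝ))), a, fun N m φ => ?_⟩
  obtain ⟨n, hn⟩ : ∃ n, n = 2 * P.half (P.digits N) := ⟨_, rfl⟩
  have hhalf : 1 ≤ P.half (P.digits N) := Nat.one_le_two_pow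
  have hn1 : 1 ≤ n := by omega
  obtain ⟨τd, cd, xd, hcd, hτd⟩ := hpd n hn1
  obtain ⟨τv, cv, xv, hcv, hτv⟩ := hpv n hn1
  obtain ⟨τ, c, x, hc, hsat⟩ := hsolve φ hn xd hτd xv hτv
    (by rw [hn]; exact hdim _ (Nat.le_add_right _ _))
  refine ⟨τ, c, x, ?_, hsat⟩
  obtain ⟨z, hz⟩ : ∃ z : ℝ, z = (n : ℝ) ^ (1 - γ) := ⟨_, rfl⟩
  have hn1' : (1 : ℝ) ≤ n := by exact_mod_cast hn1
  have hz1 : 1 ≤ z := by rw [hz]; exact Real.one_le_rpow hn1' (by linarith)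
  have hnz : (n : ℝ) ^ (2 - γ) = n * z := by
    rw [hz, show 2 - γ = 1 + (1 - γ) by ring, Real.rpow_add (by linarith), Real.rpow_one]
  have hcd' : (cd : ℝ) ≤ K' * z := by rw [hz]; exact hcd.trans (hmono hKd (by linarith) hn1)
  have hcv' : (cv : ℝ) ≤ K' * z := by rw [hz]; exact hcv.trans (hmono hKv (by linarith) hn1)
  have hT : K * (n : ℝ) ^ (2 - ε) ≤ K' * (n * z) := by
    rw [← hnz]; exact hmono hK (by linarith) hn1
  obtain ⟨w, hw⟩ : ∃ w : ℝ, w = ((N : ℝ) + 2) ^ a * ((m : ℝ) + 1) ^ a := ⟨_, rfl⟩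
  have hw1 : 1 ≤ w := by
    rw [hw, ← mul_pow]
    exact one_le_pow₀ (by nlinarith [Nat.cast_nonneg (α := ℝ) N, Nat.cast_nonneg (α := ℝ) m])
  have hfw : (f N m : ℝ) ≤ w := by
    have h1 : (N + m + 2) ^ a ≤ ((N + 2) * (m + 1)) ^ a :=
      Nat.pow_le_pow_left (by ring_nf; omega) a
    rw [hw, ← mul_pow]
    exact_mod_cast (hf N m).trans h1
  have hhn : (P.half (P.digits N) : ℝ) ≤ n := by exact_mod_cast (by omega)
  have h1 : (c : ℝ) ≤ w * ((1 + 5 * K') * (n * z)) := by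
    have e1 : (f N m : ℝ) * P.half (P.digits N) * (1 + cd + cv) ≤ w * n * ((1 + 2 * K') * z) := by
      refine mul_le_mul (mul_le_mul hfw hhn (by positivity) (by positivity)) ?_ (by positivity)
        (by positivity)
      linarith
    have e2 : 1 * (3 * (K' * (n * z))) ≤ w * (3 * (K' * (n * z))) :=
      mul_le_mul_of_nonneg_right hw1 (by positivity)
    have e3 : w * n * ((1 + 2 * K') * z) + w * (3 * (K' * (n * z))) =
      w * ((1 + 5 * K') * (n * z)) := by ring
    linarith
  have h2 := P.rows_rpow_le hq1 hb hγ0 hγ1 hq N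
  rw [← hn, hnz] at h2
  have h3 : (2 : ℝ) ^ ((1 - γ / 8) * N) = (2 : ℝ) ^ (γ / 8 * N) * (2 : ℝ) ^ ((1 - γ / 4) * N) := by
    rw [← Real.rpow_add (by norm_num)]; congr 1; ring
  calc (c : ℝ) ≤ w * ((1 + 5 * K') * (n * z)) := h1
    _ ≤ (K₂ * (2 : ℝ) ^ (γ / 8 * N) * ((m : ℝ) + 1) ^ a) * ((1 + 5 * K') *
        ((2 : ℝ) ^ (2 * (1 + (q + 1) * b * e₀ : ℝ)) * (2 : ℝ) ^ ((1 - γ / 4) * N))) := by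
      refine mul_le_mul ?_ (mul_le_mul_of_nonneg_left h2 (by positivity)) (by positivity)
        (by positivity)
      rw [hw]
      exact mul_le_mul_of_nonneg_right (hpoly N) (by positivity)
    _ = _ := by simp only [h3]; ring

theorem mainTheorem2 (M : Model) (hSETH : SETH M) (d dv : ℕ → ℕ)
    (hd : (fun n : ℕ => Real.log n) =o[Filter.atTop] fun n : ℕ => (d n : ℝ))
    (hdv : ∀ n, 1 ≤ dv n)
    (hdc : SublinearTime M d) (hdvc : SublinearTime M dv) (ε : ℝ) (hε : 0 < ε) :
    (¬ ∃ (p : Prog M.ops) (K : ℝ),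
      ComputesAttention M d dv Exact p fun n => K * (n : ℝ) ^ (2 - ε)) ∧
    (∀ μ : ℝ, 0 ≤ μ → μ < 1 → ¬ ∃ (p : Prog M.ops) (K : ℝ),
      ComputesAttention M d dv (MulApprox μ) p fun n => K * (n : ℝ) ^ (2 - ε)) := by
  have h := not_computesAttention_mulApprox M hSETH d dv hd hdv hdc hdvc ε hε
  refine ⟨fun ⟨p, K, hp⟩ => h 0 one_pos p K fun n hn Q V hQ hV => ?_,
    fun μ _ hμ ⟨p, K, hp⟩ => h μ hμ p K hp⟩
  obtain ⟨τ, c, hx, hc, hτ⟩ := hp n hn Q V hQ hV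
  refine ⟨τ, c, hx, hc, fun i j => ?_⟩
  rw [show attnOutput n (dv n) τ = _ from hτ]
  simp
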